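/- **Setting.** Finitely many asynchronous processes $P=\{1,\dots,n\}$ share a memory of registers with read, write, compare-and-swap (CAS) and one fetch-and-add register; a *step* of a process is the execution of one instruction with at most one access to a mutable shared register. The memory holds a concurrent set of keys from a linear order with operations $\mathrm{insert}(k)$, $\mathrm{remove}(k)$, $\mathrm{contains}(k)$, $\mathrm{count}(lo,hi)$, stored, initially empty, as an external binary search tree below a fictive root. Each inner node $v$ has an immutable separating key and initial size $\mathrm{Init\_Sz}$, two child pointers, a pointer to an immutable state (augmentation value, number of modifications $\mathrm{Mod\_Cnt}$, timestamp $\mathrm{Ts\_Mod}$ of the last modification) and a Michael–Scott queue of operation descriptors. An operation $Op$ of a process $p$ is executed by *hand-over-hand helping*: 1. $p$ creates a descriptor without timestamp, whose queue $\mathrm{Traverse}$ contains the fictive root, and announces it in its cell of an array of size $n$ (this is the first step of $Op$). It obtains a timestamp by fetch-and-add and CAS, scans the array, gives timestamps to the descriptors that have none, and inserts all announced descriptors with smaller timestamps, and then its own, in timestamp order into the queue of the fictive root by $\mathrm{push\_if}$ (which does nothing if the last cell has a timestamp at least as large). 2. While $Op.\mathrm{Traverse}$ is non-empty, $p$ takes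 its first node $v$, executes in $v$ the operations at the head of $v$'s queue until the queue is empty or its head has a timestamp larger than that of $Op$, and removes $v$ from $Op.\mathrm{Traverse}$. Finally $p$ returns the parts of the answer collected in $Op.\mathrm{Processed}$. 3. Executing $X$ in $v$ means: for each child of $v$ in which $X$ has to continue, if it is an empty node or a leaf with a timestamp smaller than that of $X$, it is replaced by CAS as $X$ demands; if it is an inner node $c$, then $c$ is added to $X.\mathrm{Traverse}$, the state of $c$ is modified by CAS if its $\mathrm{Ts\_Mod}$ is smaller than the timestamp of $X$, and $X$ is inserted into the queue of $c$ by $\mathrm{push\_if}$; then the part of the answer for $v$ is added to $X.\mathrm{Processed}$, and $X$ is removed from the head of $v$'s queue if it is still there. 4. Before this, if $c$ has not yet been modified by $X$ or a later operation, and if $\mathrm{Mod\_Cnt}$ of $c$ would exceed $K\cdot\mathrm{Init\_Sz}$ by applying $X$, the subtree of $c$ is rebuilt: the process executes all operations in the queues of that subtree (those with timestamps smaller than that of $X$), collects the keys, builds a perfectly balanced tree of them marked with the timestamp of $X$ minus one, tries to put it in the place of $c$ by CAS, and reads the child pointer again. Here $K$ is a real constant with $K\ge\frac12$ (so that a newly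 built inner node, which has at least two keys, need not be rebuilt at once). The augmentation values, the way in which an operation changes them, and the parts of the answer that it extracts in a node are arbitrary; subtree sizes are an example. **Theorem 2 (wait-freedom).** There is a function $B:\mathbb N\times\mathbb N\to\mathbb N$ such that for every number $n=|P|$ of processes, every execution with an arbitrary schedule of the processes and arbitrary operations invoked by them, and every operation $Op$ (insert, remove, contains or count) of a process $p$ in it, the following holds: if the tree has $N$ inner nodes (with the fictive root) when $Op$ begins, then $Op$ finishes within at most $B(n,N)$ steps of $p$, all steps for timestamps, for helping other operations and for rebuilding subtrees included, no matter how many steps the other processes take or whether they are suspended. Moreover, at every moment of every execution each operations queue contains at most $|P|$ descriptors. -/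

import Mathlib

namespace WaitFreeTree

/-! Shared memory of the concurrent search tree.  Heap objects are referred to by addresses. -/

abbrev NodeId := ℕ
abbrev OpId := ℕ
abbrev CellId := ℕ

/-- The operations offered to the clients of the tree. -/
inductive Operation (κ : Type*) where
  | insert (k : κ)
  | remove (k : κ)
  | contains (k : κ)
  | count (lo hi : κ)

/-- What a descriptor asks of one subtree.  In `count lo hi` a bound `none` is one that all keys of
the subtree are known to satisfy, so that `count (some lo) (some hi)`, `count (some lo) none` and
`count none (some hi)` are the procedures counting with both borders, with the left border and with
the right border. -/
inductive Query (κ : Type*) where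
  | insert (k : κ)
  | remove (k : κ)
  | contains (k : κ)
  | count (lo hi : Option κ)

def Operation.query {κ : Type*} : Operation κ → Query κ
  | .insert k => .insert k
  | .remove k => .remove k
  | .contains k => .contains k
  | .count lo hi => .count (some lo) (some hi)

/-- The number of modifications that an operation adds to `Mod_Cnt`. -/
def Query.weight {κ : Type*} : Query κ → ℕ
  | .insert _ => 1
  | .remove _ => 1
  | _ => 0

/-- All keys of the subtree are counted: only its augmentation value is needed. -/
def Query.isWhole {κ : Type*} : Query κ → Bool
  | .count none none => true
  | _ => false

inductive Side where
  | left
  | right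
deriving DecidableEq

/-- Content of a child pointer.  Empty nodes and leaves are immutable and carry the timestamp of the
operation that created them; an inner node is given by its address. -/
inductive Ref (κ : Type*) where
  | empty (ts : ℕ)
  | leaf (key : κ) (ts : ℕ)
  | inner (v : NodeId)
deriving DecidableEq

/-- The immutable state to which the state pointer of an inner node points.  A new state always has
a new `tsMod`, so comparing states by value is the same as comparing the pointers. -/
structure State (σ : Type*) where
  aug : σ
  modCnt : ℕ
  tsMod : ℕ
deriving DecidableEq

/-- The two registers of a Michael–Scott queue; `head` is the dummy cell before the first one. -/
structure Queue where
  head : CellId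
  tail : CellId

/-- An inner node.  `sep` (the minimal key that may be in the right subtree), `initSz` and `born`
are immutable; `sep = none` marks the fictive root, whose only child is the left one. -/
structure Node (κ σ : Type*) where
  sep : Option κ
  initSz : ℕ
  born : ℕ
  left : Ref κ
  right : Ref κ
  state : State σ
  queue : Queue

/-- The shared record of an operation. -/
structure OpRecord (κ : Type*) where
  query : Query κ
  ts : Option ℕ
  traverse : Queue
  processed : Queue

/-- A descriptor as it is stored in a queue: the operation, its timestamp, and what it has to do in
the subtree with that queue. -/
structure Desc (κ : Type*) where
  op : OpId
  ts : ℕ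
  query : Query κ

/-- Contents of queue cells: nothing (the first dummy cell of a queue), descriptors (in operations
queues), nodes (in `Traverse`), and parts of the answer (in `Processed`). -/
inductive Item (κ ρ : Type*) where
  | dummy
  | desc (d : Desc κ)
  | node (v : NodeId)
  | part (v : NodeId) (r : ρ)

/-- A queue cell; only `next` is ever modified. -/
structure Cell (κ ρ : Type*) where
  item : Item κ ρ
  ts : ℕ
  next : Option CellId

/-- The shared memory for `n` processes.  The counters give fresh addresses; `version` is the
fetch-and-add register of the timestamps; `announce` is the array of current descriptors; `ret p`
is the answer of the latest finished operation of process `p`. -/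
structure Mem (κ σ ρ : Type*) (n : ℕ) where
  node : NodeId → Node κ σ
  nodeCount : ℕ
  op : OpId → OpRecord κ
  opCount : ℕ
  cell : CellId → Cell κ ρ
  cellCount : ℕ
  version : ℕ
  announce : Fin n → Option OpId
  ret : Fin n → List (NodeId × ρ)

/-- Addresses of the queues. -/
inductive QRef where
  | node (v : NodeId)
  | traverse (o : OpId)
  | processed (o : OpId)

/-- What a process sees of one child of a node while it executes an operation there. -/
inductive View (κ σ : Type*) where
  | empty (ts : ℕ)
  | leaf (key : κ) (ts : ℕ)
  | below (born : ℕ)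
  | whole (a : σ)

/-- The choices that the construction leaves open: the threshold constant `K` of the rebuilding, the
augmentation values (the initial one of a subtree with given keys, and how an operation with a given
timestamp changes it), and the part of the answer that an operation with a given timestamp obtains
in a node from what it sees there. -/
structure Spec (κ σ ρ : Type*) where
  K : ℝ
  ofKeys : List κ → σ
  modify : Query κ → ℕ → σ → σ
  value : Query κ → ℕ → List (View κ σ) → ρ

section Memory

variable {κ σ ρ : Type*} {n : ℕ}

def Node.child (x : Node κ σ) : Side → Ref κ
  | .left => x.left
  | .right => x.right

def Node.setChild (x : Node κ σ) (r : Ref κ) : Side → Node κ σ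
  | .left => { x with left := r }
  | .right => { x with right := r }

def Mem.setNode (m : Mem κ σ ρ n) (v : NodeId) (x : Node κ σ) : Mem κ σ ρ n :=
  { m with node := Function.update m.node v x }

def Mem.setOp (m : Mem κ σ ρ n) (o : OpId) (x : OpRecord κ) : Mem κ σ ρ n :=
  { m with op := Function.update m.op o x }

def Mem.setCell (m : Mem κ σ ρ n) (c : CellId) (x : Cell κ ρ) : Mem κ σ ρ n :=
  { m with cell := Function.update m.cell c x }

/-- Allocates a cell, at the address `m.cellCount`. -/
def Mem.newCell (m : Mem κ σ ρ n) (x : Cell κ ρ) : Mem κ σ ρ n :=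
  { m.setCell m.cellCount x with cellCount := m.cellCount + 1 }

def Mem.queue (m : Mem κ σ ρ n) : QRef → Queue
  | .node v => (m.node v).queue
  | .traverse o => (m.op o).traverse
  | .processed o => (m.op o).processed

def Mem.setQueue (m : Mem κ σ ρ n) (q : Queue) : QRef → Mem κ σ ρ n
  | .node v => m.setNode v { m.node v with queue := q }
  | .traverse o => m.setOp o { m.op o with traverse := q }
  | .processed o => m.setOp o { m.op o with processed := q }

/-- Allocates, at the address `m.nodeCount`, an inner node with an empty queue.  Everything in it is
marked with the timestamp `ts`, so that only operations with later timestamps affect it. -/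
def Mem.newNode (m : Mem κ σ ρ n) (sep : κ) (initSz ts : ℕ) (l r : Ref κ) (a : σ) : Mem κ σ ρ n :=
  let m' := m.newCell ⟨.dummy, ts, none⟩
  { m'.setNode m'.nodeCount
      ⟨some sep, initSz, ts, l, r, ⟨a, 0, ts⟩, ⟨m.cellCount, m.cellCount⟩⟩ with
    nodeCount := m'.nodeCount + 1 }

/-- Builds in fresh memory a perfectly balanced external tree with the given (sorted) keys. -/
def build (A : Spec κ σ ρ) (ts : ℕ) : List κ → Mem κ σ ρ n → Ref κ × Mem κ σ ρ n
  | [], m => (.empty ts, m)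
  | [k], m => (.leaf k ts, m)
  | k :: k' :: l, m =>
    let keys := k :: k' :: l
    let h := keys.length / 2
    let L := build A ts (keys.take h) m
    let R := build A ts (keys.drop h) L.2
    (.inner R.2.nodeCount,
      R.2.newNode (keys.getD h k) keys.length ts L.1 R.1 (A.ofKeys keys))
termination_by l => l.length
decreasing_by all_goals simp; omega

end Memory

section Counting

variable {κ : Type*} [LinearOrder κ]

/-- What an operation with timestamp `ts` learns for its answer from one child: for an update `1` if
it is successful there, for `contains` `1` if the key is found, for `count` the number of keys in
the range, as far as they are not counted further below. -/
def countView : Query κ → ℕ → View κ ℤ → ℤ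
  | .insert _, ts, .empty t => if t < ts then 1 else 0
  | .insert k, ts, .leaf k' t => if k' ≠ k ∨ t = ts then 1 else 0
  | .insert _, ts, .below b => if b = ts then 1 else 0
  | .remove _, ts, .empty t => if t = ts then 1 else 0
  | .remove k, ts, .leaf k' t => if k' = k ∧ t < ts then 1 else 0
  | .contains k, _, .leaf k' _ => if k' = k then 1 else 0
  | .count lo hi, _, .leaf k' _ => if lo.all (· ≤ k') && hi.all (k' ≤ ·) then 1 else 0
  | .count _ _, _, .whole a => a
  | _, _, _ => 0

/-- The instance for `insert`, `remove`, `contains` and `count`: the augmentation values are the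
subtree sizes.  `eff t` tells whether the update with timestamp `t` changes the set of keys.  The
answer of an operation is the sum of its parts. -/
def countSpec (K : ℝ) (eff : ℕ → Bool) : Spec κ ℤ ℤ where
  K := K
  ofKeys l := l.length
  modify q ts a :=
    match q with
    | .insert _ => if eff ts then a + 1 else a
    | .remove _ => if eff ts then a - 1 else a
    | _ => a
  value q ts views := (views.map (countView q ts)).sum

end Counting

/-! The code of the processes.  The local state of a process is a stack of frames; one step executes
the top frame, which accesses at most one shared register that is not immutable. -/

inductive Frame (κ σ ρ : Type*) (n : ℕ) where
  -- getting a timestamp for the own operation, and collecting the earlier operations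
  | fetch (o : OpId)
  | stamp (o : OpId) (ts : ℕ)
  | stamped (o : OpId)
  | scan (o : OpId) (ts : ℕ) (todo : List (Fin n)) (saved : List (Desc κ))
  | scanTs (o : OpId) (ts : ℕ) (o' : OpId) (todo : List (Fin n)) (saved : List (Desc κ))
  | scanFetch (o : OpId) (ts : ℕ) (o' : OpId) (todo : List (Fin n)) (saved : List (Desc κ))
  | scanStamp (o : OpId) (ts : ℕ) (o' : OpId) (ts' : ℕ) (todo : List (Fin n))
      (saved : List (Desc κ))
  | enqueue (l : List (Desc κ))
  -- insertion into a queue; with `guarded = true` it is `push_if`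
  | push (q : QRef) (x : Item κ ρ) (ts : ℕ) (guarded : Bool)
  | pushNext (q : QRef) (x : Item κ ρ) (ts : ℕ) (guarded : Bool) (tail : CellId)
  | pushLink (q : QRef) (x : Item κ ρ) (ts : ℕ) (guarded : Bool) (tail : CellId)
  | pushSwing (q : QRef) (tail new : CellId)
  -- `pop_if`
  | pop (ts : ℕ) (v : NodeId)
  | popNext (ts : ℕ) (v : NodeId) (head : CellId)
  | popSwing (v : NodeId) (head new : CellId)
  -- `execute_until_timestamp`
  | untilTs (ts : ℕ) (v : NodeId)
  | untilNext (ts : ℕ) (v : NodeId) (head : CellId)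
  -- `execute_in_node`, with the children still to be treated
  | exec (d : Desc κ) (v : NodeId) (todo : List (Side × Query κ)) (views : List (View κ σ))
      (rebuilt : Bool)
  | execState (d : Desc κ) (v : NodeId) (s : Side) (q : Query κ) (todo : List (Side × Query κ))
      (views : List (View κ σ)) (rebuilt : Bool) (c : NodeId)
  | modify (d : Desc κ) (c : NodeId) (st : State σ)
  | replace (v : NodeId) (s : Side) (old : Ref κ) (ts : ℕ) (keys : List κ)
  -- rebuilding: finishing all operations of a subtree, then collecting its keys
  | drain (ts : ℕ) (todo : List NodeId)
  | drainLeft (ts : ℕ) (u : NodeId) (todo : List NodeId)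
  | drainRight (ts : ℕ) (u : NodeId) (l : Ref κ) (todo : List NodeId)
  | gather (ts : ℕ) (v : NodeId) (s : Side) (c : NodeId) (todo : List (Ref κ)) (keys : List κ)
  | gatherLeft (ts : ℕ) (v : NodeId) (s : Side) (c u : NodeId) (todo : List (Ref κ))
      (keys : List κ)
  | gatherRight (ts : ℕ) (v : NodeId) (s : Side) (c u : NodeId) (l : Ref κ)
      (todo : List (Ref κ)) (keys : List κ)
  -- the traversal of the tree by the initiator, and the assembly of the answer
  | main (o : OpId) (ts : ℕ)
  | mainNext (o : OpId) (ts : ℕ) (head : CellId)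
  | mainPop (o : OpId) (new : CellId)
  | result (o : OpId)
  | resultNext (c : CellId) (parts : List (NodeId × ρ))

section Code

variable {κ σ ρ : Type*} {n : ℕ} [LinearOrder κ]

/-- The children of a node with the given `sep` that matter for a query, with what the query asks
of them.  The execution continues in those whose query is not `isWhole`. -/
def route (q : Query κ) : Option κ → List (Side × Query κ)
  | none => [(.left, q)]
  | some r =>
    match q with
    | .insert k => [(if k < r then .left else .right, q)]
    | .remove k => [(if k < r then .left else .right, q)]
    | .contains k => [(if k < r then .left else .right, q)]
    | .count lo hi =>
      if lo.any (fun a => r ≤ a) then [(.right, q)]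
      else if hi.any (fun b => b < r) then [(.left, q)]
      else [(.left, .count lo none), (.right, .count none hi)]

/-- The timestamp of an empty node or a leaf. -/
def Ref.ts : Ref κ → ℕ
  | .empty t => t
  | .leaf _ t => t
  | .inner _ => 0

/-- The keys of the tree by which a query replaces an empty node or a leaf, if it changes it. -/
def leafUpdate : Query κ → Ref κ → Option (List κ)
  | .insert k, .empty _ => some [k]
  | .insert k, .leaf k' _ => if k < k' then some [k, k'] else if k' < k then some [k', k] else none
  | .remove k, .leaf k' _ => if k = k' then some [] else none
  | _, _ => none

def Ref.nodes : Ref κ → List NodeId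
  | .inner v => [v]
  | _ => []

/-- The modified state; every operation leaves its timestamp. -/
def newState (A : Spec κ σ ρ) (d : Desc κ) (st : State σ) : State σ :=
  ⟨A.modify d.query d.ts st.aug, st.modCnt + d.query.weight, d.ts⟩

open Classical in
/-- The number of modifications will exceed the threshold once the operation has been applied. -/
noncomputable def mustRebuild (A : Spec κ σ ρ) (d : Desc κ) (initSz : ℕ) (st : State σ) : Bool :=
  decide (A.K * initSz < ((st.modCnt + d.query.weight : ℕ) : ℝ))

variable [DecidableEq σ]

/-- One step of process `p` whose top frame is given: the new memory, and the frames that replace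
the top frame. -/
noncomputable def step (A : Spec κ σ ρ) (p : Fin n) (m : Mem κ σ ρ n) :
    Frame κ σ ρ n → Mem κ σ ρ n × List (Frame κ σ ρ n)
  -- timestamps
  | .fetch o => ({ m with version := m.version + 1 }, [.stamp o m.version])
  | .stamp o t =>
    (if (m.op o).ts = none then m.setOp o { m.op o with ts := some t } else m, [.stamped o])
  | .stamped o =>
    match (m.op o).ts with
    | none => (m, [.fetch o])
    | some t => (m, [.scan o t (List.finRange n) [], .main o t])
  | .scan o t [] saved =>
    (m, [.enqueue ((⟨o, t, (m.op o).query⟩ :: saved).insertionSort (fun a b => a.ts ≤ b.ts))])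
  | .scan o t (i :: todo) saved =>
    match m.announce i with
    | none => (m, [.scan o t todo saved])
    | some o' => (m, [.scanTs o t o' todo saved])
  | .scanTs o t o' todo saved =>
    match (m.op o').ts with
    | none => (m, [.scanFetch o t o' todo saved])
    | some t' =>
      (m, [.scan o t todo (if t' < t then ⟨o', t', (m.op o').query⟩ :: saved else saved)])
  | .scanFetch o t o' todo saved =>
    ({ m with version := m.version + 1 }, [.scanStamp o t o' m.version todo saved])
  | .scanStamp o t o' t' todo saved =>
    (if (m.op o').ts = none then m.setOp o' { m.op o' with ts := some t' } else m,
      [.scanTs o t o' todo saved])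
  | .enqueue [] => (m, [])
  | .enqueue (d :: l) => (m, [.push (.node 0) (.desc d) d.ts true, .enqueue l])
  -- insertion into a queue
  | .push q x t g =>
    let tail := (m.queue q).tail
    if g = true ∧ t ≤ (m.cell tail).ts then (m, []) else (m, [.pushNext q x t g tail])
  | .pushNext q x t g tail =>
    match (m.cell tail).next with
    | some new => (m, [.pushSwing q tail new, .push q x t g])
    | none => (m, [.pushLink q x t g tail])
  | .pushLink q x t g tail =>
    if (m.cell tail).next = none then
      let new := m.cellCount
      let m' := m.newCell ⟨x, t, none⟩
      (m'.setCell tail { m'.cell tail with next := some new }, [.pushSwing q tail new])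
    else (m, if g then [] else [.push q x t g])
  | .pushSwing q tail new =>
    (if (m.queue q).tail = tail then m.setQueue { m.queue q with tail := new } q else m, [])
  -- removal from an operations queue
  | .pop t v => (m, [.popNext t v (m.queue (.node v)).head])
  | .popNext t v head =>
    match (m.cell head).next with
    | none => (m, [])
    | some new => (m, if (m.cell new).ts = t then [.popSwing v head new] else [])
  | .popSwing v head new =>
    (if (m.queue (.node v)).head = head then
        m.setQueue { m.queue (.node v) with head := new } (.node v) else m, [])
  -- executing the operations of a node up to a timestamp
  | .untilTs t v => (m, [.untilNext t v (m.queue (.node v)).head])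
  | .untilNext t v head =>
    match (m.cell head).next with
    | none => (m, [])
    | some c =>
      match (m.cell c).item with
      | .desc d =>
        if t < d.ts then (m, [])
        else (m, [.exec d v (route d.query (m.node v).sep) [] false, .untilTs t v])
      | _ => (m, [])
  -- executing an operation in a node
  | .exec d v [] views _ =>
    (m, [.push (.processed d.op) (.part v (A.value d.query d.ts views)) 0 false, .pop d.ts v])
  | .exec d v ((s, q) :: todo) views rebuilt =>
    match (m.node v).child s with
    | .inner c => (m, [.execState d v s q todo views rebuilt c])
    | .empty t =>
      (m, (if t < d.ts then (leafUpdate q (.empty t)).toList.map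
              (fun keys => .replace v s (.empty t) d.ts keys) else []) ++
          [.exec d v todo (views ++ [.empty t]) false])
    | .leaf k t =>
      (m, (if t < d.ts then (leafUpdate q (.leaf k t)).toList.map
              (fun keys => .replace v s (.leaf k t) d.ts keys) else []) ++
          [.exec d v todo (views ++ [.leaf k t]) false])
  | .execState d v s q todo views rebuilt c =>
    let st := (m.node c).state
    if q.isWhole then (m, [.exec d v todo (views ++ [.whole st.aug]) false])
    else if st.tsMod < d.ts ∧ rebuilt = false ∧ mustRebuild A d (m.node c).initSz st = true then
      (m, [.drain (d.ts - 1) [c], .gather (d.ts - 1) v s c [.inner c] [],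
           .exec d v ((s, q) :: todo) views true])
    else
      (m, [.push (.traverse d.op) (.node c) 0 false, .modify { d with query := q } c st,
           .push (.node c) (.desc { d with query := q }) d.ts true,
           .exec d v todo (views ++ [.below (m.node c).born]) false])
  | .modify d c st =>
    (if st.tsMod < d.ts ∧ (m.node c).state = st then
        m.setNode c { m.node c with state := newState A d st } else m, [])
  | .replace v s old t keys =>
    (if (m.node v).child s = old then
        let b := build A t keys m
        b.2.setNode v ((b.2.node v).setChild b.1 s) else m, [])
  -- rebuilding
  | .drain _ [] => (m, [])
  | .drain t (u :: todo) => (m, [.untilTs t u, .drainLeft t u todo])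
  | .drainLeft t u todo => (m, [.drainRight t u (m.node u).left todo])
  | .drainRight t u l todo => (m, [.drain t (l.nodes ++ (m.node u).right.nodes ++ todo)])
  | .gather t v s c [] keys => (m, [.replace v s (.inner c) t keys])
  | .gather t v s c (.empty _ :: todo) keys => (m, [.gather t v s c todo keys])
  | .gather t v s c (.leaf k _ :: todo) keys => (m, [.gather t v s c todo (keys ++ [k])])
  | .gather t v s c (.inner u :: todo) keys => (m, [.gatherLeft t v s c u todo keys])
  | .gatherLeft t v s c u todo keys => (m, [.gatherRight t v s c u (m.node u).left todo keys])
  | .gatherRight t v s c u l todo keys =>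
    (m, [.gather t v s c (l :: (m.node u).right :: todo) keys])
  -- the initiator's traversal
  | .main o t => (m, [.mainNext o t (m.queue (.traverse o)).head])
  | .mainNext o t head =>
    match (m.cell head).next with
    | none => (m, [.result o])
    | some c =>
      match (m.cell c).item with
      | .node v => (m, [.untilTs t v, .mainPop o c, .main o t])
      | _ => (m, [.mainPop o c, .main o t])
  | .mainPop o new =>
    (m.setQueue { m.queue (.traverse o) with head := new } (.traverse o), [])
  | .result o => (m, [.resultNext (m.queue (.processed o)).head []])
  | .resultNext c parts =>
    match (m.cell c).next with
    | none => ({ m with ret := Function.update m.ret p parts }, [])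
    | some c' =>
      match (m.cell c').item with
      | .part v r =>
        (m, [.resultNext c' (if v ∈ parts.map Prod.fst then parts else parts ++ [(v, r)])])
      | _ => (m, [.resultNext c' parts])

/-- The first step of an operation of process `p`: its descriptor is created, with no timestamp, with
the fictive root in `Traverse` and nothing in `Processed`, and put into the array. -/
def announceOp (m : Mem κ σ ρ n) (p : Fin n) (q : Query κ) : Mem κ σ ρ n :=
  let c := m.cellCount
  let m₁ := m.newCell ⟨.dummy, 0, some (c + 1)⟩
  let m₂ := m₁.newCell ⟨.node 0, 0, none⟩
  let m₃ := m₂.newCell ⟨.dummy, 0, none⟩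
  { m₃.setOp m₃.opCount ⟨q, none, ⟨c, c + 1⟩, ⟨c + 2, c + 2⟩⟩ with
    opCount := m₃.opCount + 1
    announce := Function.update m₃.announce p (some m₃.opCount) }

/-- The initial memory: the fictive root (node `0`, with the root queue) above an empty tree. -/
def initMem (A : Spec κ σ ρ) (n : ℕ) : Mem κ σ ρ n where
  node := fun _ => ⟨none, 0, 0, .empty 0, .empty 0, ⟨A.ofKeys [], 0, 0⟩, ⟨0, 0⟩⟩
  nodeCount := 1
  op := fun _ => ⟨.count none none, none, ⟨0, 0⟩, ⟨0, 0⟩⟩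
  opCount := 0
  cell := fun _ => ⟨.dummy, 0, none⟩
  cellCount := 1
  version := 1
  announce := fun _ => none
  ret := fun _ => []

end Code

/-- A configuration: the shared memory and the local states of the processes. -/
structure Config (κ σ ρ : Type*) (n : ℕ) where
  mem : Mem κ σ ρ n
  stack : Fin n → List (Frame κ σ ρ n)

section Executions

variable {κ σ ρ : Type*} {n : ℕ}

/-- Process `p` is not executing any operation. -/
def Config.Idle (c : Config κ σ ρ n) (p : Fin n) : Prop := c.stack p = []

/-- The inner nodes of the current tree. -/
inductive InTree (m : Mem κ σ ρ n) : NodeId → Prop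
  | root : InTree m 0
  | child (v c : NodeId) (s : Side) (hv : InTree m v) (hc : (m.node v).child s = .inner c) :
      InTree m c

open Classical in
/-- The size of the current tree: the number of its inner nodes, the fictive root included. -/
noncomputable def treeSize (m : Mem κ σ ρ n) : ℕ :=
  ((Finset.range m.nodeCount).filter (fun v => InTree m v)).card

/-- The cells `l` follow one another, the first of them following the cell `c`. -/
def Follow (m : Mem κ σ ρ n) : CellId → List CellId → Prop
  | _, [] => True
  | c, c' :: l => (m.cell c).next = some c' ∧ Follow m c' l

variable [LinearOrder κ] [DecidableEq σ]

/-- Process `p` takes a step: if it is idle, it invokes an arbitrary operation, and otherwise it goes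
on with its current one. -/
inductive Step (A : Spec κ σ ρ) (p : Fin n) : Config κ σ ρ n → Config κ σ ρ n → Prop
  | invoke (c : Config κ σ ρ n) (a : Operation κ) (h : c.Idle p) :
      Step A p c ⟨announceOp c.mem p a.query, Function.update c.stack p [.fetch c.mem.opCount]⟩
  | run (c : Config κ σ ρ n) (f : Frame κ σ ρ n) (rest : List (Frame κ σ ρ n))
      (h : c.stack p = f :: rest) :
      Step A p c ⟨(step A p c.mem f).1,
        Function.update c.stack p ((step A p c.mem f).2 ++ rest)⟩

/-- `c 0, …, c T` is an execution from the initial configuration, with an arbitrary schedule: the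
process `sched t` takes the step from `c t` to `c (t + 1)`. -/
def IsExecution (A : Spec κ σ ρ) (T : ℕ) (c : ℕ → Config κ σ ρ n) (sched : ℕ → Fin n) : Prop :=
  c 0 = ⟨initMem A n, fun _ => []⟩ ∧ ∀ t < T, Step A (sched t) (c t) (c (t + 1))

end Executions

end WaitFreeTree

open WaitFreeTree

/-! History information and the invariant of the shared memory. -/

namespace WaitFreeTree

set_option linter.unusedSectionVars false

/-! The difficulty of helping is that helpers act on stale information. The proof is a
rely-guarantee argument about the shared memory, followed by an amortised count of steps.

Safety. The memory is enriched by history information. Every step satisfies a relation `Guar`, which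
preserves the invariant `Inv` (`Guar.inv`) and all assertions about pending frames of the processes
(`Guar.pre`); `stepOK` checks each kind of step, and `exists_history` puts this together for a whole
execution. The decisive fact is that helpers cannot disagree. Once all earlier operations that come
to a node `c` are in its queue, the state of `c` is settled for the next operation `d`, so `d`
either rebuilds `c` (`Doomed`) or enters it (`Accepted`), whoever helps; see `accepted_not_doomed`,
`Guar.doomed` and `Guar.accepted`. Below a doomed node the queues run empty, and then nothing
changes there any more (`Frz`, `Clr`), so that all helpers collect keys from the same subtree.

Queues. A pending descriptor belongs to an announced operation, every process announces one at a
time, and the timestamps in a queue are distinct; hence at most `n` descriptors (`queue_length`).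

Few competitors. Let `τ` be the timestamp of the operation considered. Each process contributes at
most two operations with timestamps up to `τ`: the one announced at the beginning, and the first one
that it starts later. When it starts a further one, the operation considered has been stamped
already (`Inv.rel`, `relTs_card`).

Small trees. Each child pointer carries as a mark the timestamp with which its content was created.
Marks increase strictly, and at most `4 * n + 1` values up to `τ` are available. A slot is given the
weight `4 ^ k`, where `k` values are still to come. The replacement of a leaf turns one slot into at
most three of a quarter of the weight, and a rebuilding creates no more nodes than it discards, with
slots that are not heavier. So the weight of the tree falls with each change within the horizon
(`treeWeight_step`), which bounds the number of nodes that matter, their depth, and the number of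
descriptors that can be met (`window_card`, `window_dep`, `live_card`).

Counting. A process begins to treat each descriptor cell at most once (`inact_run`), because nested
executions have decreasing timestamps (`StackOK`). One treatment costs a bounded number of steps: a
traversal of a subtree is bounded through its depth, and an insertion is retried only after another
cell has been appended. The number of such cells is bounded in operations queues by the number of
relevant timestamps, and in the records of operations by a potential that counts the insertions
still possible (`History.contention`, `tail_bound`). Finally, the charge of the stack together with
a fixed amount for every cell not yet begun falls with each own step and is not raised by foreign
ones (`charged_step`, `cost_env`, `steps_le`). -/

noncomputable instance : DecidableEq QRef := Classical.decEq _

/-- Auxiliary history information: the queue of each cell, the place at which a node was put into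
the tree and its depth, the operation for which a timestamp was fetched, and the owner of an
operation. -/
structure Ghost (n : ℕ) where
  own : ℕ → QRef
  par : ℕ → ℕ × Side
  dep : ℕ → ℕ
  ticket : ℕ → ℕ
  proc : ℕ → Fin n

/-- The shared memory together with the history information. -/
@[ext]
structure St (κ σ ρ : Type*) (n : ℕ) where
  nodeCount : ℕ
  opCount : ℕ
  cellCount : ℕ
  version : ℕ
  own : ℕ → QRef
  item : ℕ → Item κ ρ
  cts : ℕ → ℕ
  nxt : ℕ → Option ℕ
  hd : QRef → ℕ
  tl : QRef → ℕ
  sep : ℕ → Option κ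
  initSz : ℕ → ℕ
  born : ℕ → ℕ
  state : ℕ → State σ
  child : ℕ → Side → Ref κ
  par : ℕ → ℕ × Side
  dep : ℕ → ℕ
  oquery : ℕ → Query κ
  ots : ℕ → Option ℕ
  announce : Fin n → Option ℕ
  ticket : ℕ → ℕ
  proc : ℕ → Fin n

variable {κ σ ρ : Type*} {n : ℕ}

def view (m : Mem κ σ ρ n) (g : Ghost n) : St κ σ ρ n where
  nodeCount := m.nodeCount
  opCount := m.opCount
  cellCount := m.cellCount
  version := m.version
  own := g.own
  item x := (m.cell x).item
  cts x := (m.cell x).ts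
  nxt x := (m.cell x).next
  hd q := (m.queue q).head
  tl q := (m.queue q).tail
  sep v := (m.node v).sep
  initSz v := (m.node v).initSz
  born v := (m.node v).born
  state v := (m.node v).state
  child v := (m.node v).child
  par := g.par
  dep := g.dep
  oquery o := (m.op o).query
  ots o := (m.op o).ts
  announce := m.announce
  ticket := g.ticket
  proc := g.proc

namespace St

variable (S S' : St κ σ ρ n)

/-! ### Queues, subtrees and the progress of operations -/

def InQ (x : ℕ) (q : QRef) : Prop := x < S.cellCount ∧ S.own x = q

def VQ : QRef → Prop
  | .node v => v < S.nodeCount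
  | .traverse o => o < S.opCount
  | .processed o => o < S.opCount

/-- An operation with timestamp at least `t` has been inserted into the queue of `v`. -/
def Ins (v : ℕ) (t : ℕ) : Prop := ∃ x, S.InQ x (.node v) ∧ t ≤ S.cts x

/-- All operations with timestamps up to `t` have been removed from the queue of `v`. -/
def Passed (v : ℕ) (t : ℕ) : Prop := ∀ x, S.InQ x (.node v) → S.cts x ≤ t → x ≤ S.hd (.node v)

def NoPend (v : ℕ) : Prop := ∀ x, S.InQ x (.node v) → x ≤ S.hd (.node v)

/-- The operation has come to the head of the queue of `v`. -/
def Reached (v : ℕ) (d : Desc κ) : Prop :=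
  (∃ x, S.InQ x (.node v) ∧ S.item x = .desc d ∧ S.cts x = d.ts) ∧
    ∀ x, S.InQ x (.node v) → S.cts x < d.ts → x ≤ S.hd (.node v)

/-- Cells keep their owner after they have been popped, so this is permanent. -/
def InTrav (o : ℕ) (v : ℕ) : Prop := ∃ y, S.InQ y (.traverse o) ∧ S.item y = .node v

/-- The mark of a child pointer: the timestamp with which its present content was created. After a
rebuilding it is one less than the timestamp of the rebuilding operation. -/
def rts : Ref κ → ℕ
  | .empty t => t
  | .leaf _ t => t
  | .inner c => S.born c

/-- The nodes below `u`. -/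
inductive Below (u : ℕ) : ℕ → Prop
  | refl : Below u u
  | child (v c : ℕ) (s : Side) (hv : Below u v) (hc : S.child v s = .inner c) : Below u c

open Classical in
noncomputable def below (u : ℕ) : Finset ℕ :=
  (Finset.range S.nodeCount).filter (S.Below u)

noncomputable def size : Ref κ → ℕ
  | .inner u => (S.below u).card
  | _ => 0

/-- No operation is pending in the subtree of `u`. -/
inductive Clr : ℕ → Prop
  | mk (u : ℕ) (hp : S.NoPend u) (hc : ∀ s c, S.child u s = .inner c → Clr c) : Clr u

/-- The operation is over and does not occur in any queue. -/
def Finished (o : ℕ) : Prop :=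
  ∃ t, S.ots o = some t ∧ S.Ins 0 t ∧ (∀ o' ≤ o, S.ots o' ≠ none) ∧
    ∀ v x d, S.InQ x (.node v) → S.item x = .desc d → d.op = o → x ≤ S.hd (.node v)

/-- All timestamps before `t` are known, and their operations are in the root queue. -/
def RootPred (t : ℕ) : Prop :=
  t ≤ S.version ∧ ∀ t', 1 ≤ t' → t' < t →
    ∃ t'', S.ots (S.ticket t') = some t'' ∧ (t'' = t' → S.Ins 0 t')

/-! ### The arrival of an operation at a child, and the decision whether to rebuild it -/

section

variable [LinearOrder κ]

/-- The operation comes from the parent of `c` to `c` and has to continue there. -/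
def ComesBy (c : ℕ) (d : Desc κ) (q : Query κ) : Prop :=
  c < S.nodeCount ∧ c ≠ 0 ∧ S.Reached (S.par c).1 d ∧
    ((S.par c).2, q) ∈ route d.query (S.sep (S.par c).1) ∧ q.isWhole = false

def Comes (c : ℕ) (t : ℕ) : Prop := ∃ d q, S.ComesBy c d q ∧ d.ts = t

/-- An inserted operation has been applied to the state before. So with all earlier arrivals
inserted, the state of `c` is the one by which the operation with timestamp `t` has to be judged. -/
def PredDone (c : ℕ) (t : ℕ) : Prop := ∀ t' < t, S.Comes c t' → S.Ins c t'

/-- What the operation with timestamp `t` has to do for the child at `s` is done. -/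
def SideDone (v : ℕ) (s : Side) (q : Query κ) (t : ℕ) : Prop :=
  (∀ c, S.child v s = .inner c → q.isWhole = false → S.Ins c t) ∧
    ((∀ c, S.child v s ≠ .inner c) → t ≤ (S.child v s).ts ∨ leafUpdate q (S.child v s) = none)

def AllDone (v : ℕ) (d : Desc κ) : Prop :=
  ∀ s q, (s, q) ∈ route d.query (S.sep v) → S.SideDone v s q d.ts

/-- The second case is that of a late helper: `c` has been replaced, but the operation is in its
queue, and the pointer has a mark of at least `t`. -/
def Att (c : ℕ) (t : ℕ) : Prop :=
  S.child (S.par c).1 (S.par c).2 = .inner c ∨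
    (S.Ins c t ∧ t ≤ S.rts (S.child (S.par c).1 (S.par c).2))

/-- The operation finds `c` in a state in which it has to be rebuilt. -/
def Doomed (A : Spec κ σ ρ) (c : ℕ) (d : Desc κ) : Prop :=
  (∃ q, S.ComesBy c d q) ∧ S.PredDone c d.ts ∧ (S.state c).tsMod < d.ts ∧
    mustRebuild A d (S.initSz c) (S.state c) = true

/-- The operation may be inserted in `c`. -/
def Accepted (A : Spec κ σ ρ) (c : ℕ) (d : Desc κ) : Prop :=
  (∃ q, S.ComesBy c d q) ∧ S.PredDone c d.ts ∧ S.Att c d.ts ∧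
    (d.ts ≤ (S.state c).tsMod ∨ mustRebuild A d (S.initSz c) (S.state c) = false)

/-- What a helper knows after reading the child pointer and before reading the state, when both
verdicts are still possible. -/
def Seen (A : Spec κ σ ρ) (c : ℕ) (d : Desc κ) : Prop :=
  (∃ q, S.ComesBy c d q) ∧ S.PredDone c d.ts ∧ (S.Att c d.ts ∨ S.Doomed A c d)

/-- Nothing can change in `u` any more once its queue is empty, because the operation with
timestamp `X` rebuilds the tree above. -/
inductive Frz (A : Spec κ σ ρ) (X : ℕ) : ℕ → Prop
  | base (c : ℕ) (d : Desc κ) (h : S.Doomed A c d) (hX : d.ts = X) : Frz A X c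
  | step (w u : ℕ) (s : Side) (h : Frz A X w) (hp : S.NoPend w)
      (hc : S.child w s = .inner u) : Frz A X u

/-- The descriptor for `v` has the query for that child, so it shares only its timestamp with the
accepted descriptor `d'` of the parent. The bound on `tsMod` reflects that the state is modified
before the insertion. -/
def Admits (A : Spec κ σ ρ) (v : ℕ) (d : Desc κ) : Prop :=
  v < S.nodeCount ∧ d.op < S.opCount ∧ S.ots d.op = some d.ts ∧ S.InTrav d.op v ∧
    ((v = 0 ∧ S.RootPred d.ts) ∨
      (v ≠ 0 ∧ (∃ d', S.Accepted A v d' ∧ d'.ts = d.ts) ∧ d.ts ≤ (S.state v).tsMod))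

def TravAdmits (A : Spec κ σ ρ) (o : ℕ) (c : ℕ) (d : Desc κ) : Prop :=
  o < S.opCount ∧ d.op = o ∧ S.ots o = some d.ts ∧ S.Accepted A c d ∧ S.InTrav o (S.par c).1

/-- A cell is allocated when it is linked behind the last one (or with its record), so the order in
a queue is that of the addresses. `lag` says that the tail register is at most one cell behind. -/
structure QInv : Prop where
  ends : ∀ q, S.VQ q → S.InQ (S.hd q) q ∧ S.InQ (S.tl q) q
  vq : ∀ x < S.cellCount, S.VQ (S.own x)
  next : ∀ x < S.cellCount, ∀ y, S.nxt x = some y →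
    S.InQ y (S.own x) ∧ x < y ∧ ∀ z, S.InQ z (S.own x) → x < z → y ≤ z
  last : ∀ q x y, S.InQ x q → S.InQ y q → x < y → S.nxt x ≠ none
  lag : ∀ q y, S.VQ q → S.nxt (S.tl q) = some y → S.nxt y = none

/-- `trav` and `passed` tie the operations queues to the `Traverse` lists, in which a parent
precedes its children. `child` makes the recorded parent unique, which keeps subtrees disjoint while
pointers change. `rtsIns` bounds the marks of child pointers by timestamps that have arrived at the
parent. `tree` says that work is pending only in nodes of the current tree. `rel` is the source of
the bound on competing operations: when a process starts an operation, everything not younger than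
its previous one has a timestamp already. -/
structure Inv (A : Spec κ σ ρ) : Prop where
  queues : S.QInv
  sorted : ∀ v x y, S.InQ x (.node v) → S.InQ y (.node v) → x < y → S.cts x < S.cts y
  bornCell : ∀ v < S.nodeCount, ∃ x, S.InQ x (.node v) ∧ S.cts x = S.born v
  bornLe : ∀ v x, S.InQ x (.node v) → S.born v ≤ S.cts x
  desc : ∀ v x, S.InQ x (.node v) → (S.item x = .dummy ∧ S.cts x = S.born v) ∨
    ∃ d, S.item x = .desc d ∧ S.cts x = d.ts ∧ d.op < S.opCount ∧ S.ots d.op = some d.ts ∧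
      S.InTrav d.op v ∧ (v ≠ 0 → S.Comes v d.ts)
  tsMod : ∀ v x, v ≠ 0 → S.InQ x (.node v) → S.cts x ≤ (S.state v).tsMod
  trav : ∀ o y, S.InQ y (.traverse o) → S.item y = .dummy ∨ S.item y = .node 0 ∨
    ∃ c d, S.item y = .node c ∧ d.op = o ∧ S.ots o = some d.ts ∧ S.Accepted A c d ∧
      ∃ y' < y, S.InQ y' (.traverse o) ∧ S.item y' = .node (S.par c).1
  travRoot : ∀ o < S.opCount, S.InTrav o 0
  passed : ∀ o y v, S.InQ y (.traverse o) → y ≤ S.hd (.traverse o) → S.item y = .node v →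
    ∃ t, S.ots o = some t ∧ S.Ins v t ∧ S.Passed v t
  nodePos : 0 < S.nodeCount
  fresh : ∀ v < S.nodeCount, v ≠ 0 → 2 ≤ S.initSz v ∧
    ((S.state v).tsMod = S.born v → (S.state v).modCnt = 0)
  child : ∀ v < S.nodeCount, ∀ s c, S.child v s = .inner c →
    c < S.nodeCount ∧ c ≠ 0 ∧ S.par c = (v, s) ∧ S.dep c = S.dep v + 1
  rtsIns : ∀ v < S.nodeCount, ∀ s, S.Ins v (S.rts (S.child v s)) ∧ S.born v ≤ S.rts (S.child v s)
  done : ∀ v x d, S.InQ x (.node v) → x ≤ S.hd (.node v) → S.item x = .desc d → S.AllDone v d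
  tree : ∀ v x, S.InQ x (.node v) → S.hd (.node v) < x → S.Below 0 v
  stamp : ∀ o < S.opCount, ∀ t, S.ots o = some t → 1 ≤ t ∧ t < S.version ∧ S.ticket t = o
  ticketLt : ∀ t, 1 ≤ t → t < S.version → S.ticket t < S.opCount
  ann : ∀ i o, S.announce i = some o → o < S.opCount ∧ S.proc o = i
  fin : ∀ o < S.opCount, S.Finished o ∨ ∃ i, S.announce i = some o
  rel : ∀ o₁ o₂, o₁ < o₂ → o₂ < S.opCount → S.proc o₁ = S.proc o₂ → ∀ o' ≤ o₁,
    ∃ t', S.ots o' = some t' ∧ ∀ t, 1 ≤ t → t < S.version → S.ticket t = o₂ → t' < t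
  depRoot : S.dep 0 = 0
  versionPos : 1 ≤ S.version

/-- The change of the child pointer of `v` at `s`. -/
structure Slot (A : Spec κ σ ρ) (v : ℕ) (s : Side) : Prop where
  cause : (∃ d q, S.Reached v d ∧ (s, q) ∈ route d.query (S.sep v) ∧
      (∀ c, S.child v s ≠ .inner c) ∧ (S.child v s).ts < d.ts ∧
      leafUpdate q (S.child v s) ≠ none ∧ S'.rts (S'.child v s) = d.ts ∧
      S'.nodeCount ≤ S.nodeCount + 1) ∨
    (∃ c d, S.child v s = .inner c ∧ S.Doomed A c d ∧ S.Clr c ∧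
      S'.rts (S'.child v s) + 1 = d.ts ∧ S'.nodeCount ≤ S.nodeCount + (S.below c).card)
  inner : ∀ c, S'.child v s = .inner c → S.nodeCount ≤ c ∧ c < S'.nodeCount ∧
    S'.par c = (v, s) ∧ S'.dep c = S.dep v + 1
  depth : ∀ w, S.nodeCount ≤ w → w < S'.nodeCount →
    S'.dep w < S.dep v + 1 + (S'.nodeCount - S.nodeCount) ∧
    S'.born w = S'.rts (S'.child v s)

/-- What one step of a process may change. -/
structure Guar (A : Spec κ σ ρ) : Prop where
  nodeCount_le : S.nodeCount ≤ S'.nodeCount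
  opCount_le : S.opCount ≤ S'.opCount
  cellCount_le : S.cellCount ≤ S'.cellCount
  version_le : S.version ≤ S'.version
  own_eq : ∀ x < S.cellCount, S'.own x = S.own x
  item_eq : ∀ x < S.cellCount, S'.item x = S.item x
  cts_eq : ∀ x < S.cellCount, S'.cts x = S.cts x
  nxt_eq : ∀ x < S.cellCount, ∀ y, S.nxt x = some y → S'.nxt x = some y
  queues : S'.QInv
  sep_eq : ∀ v < S.nodeCount, S'.sep v = S.sep v
  initSz_eq : ∀ v < S.nodeCount, S'.initSz v = S.initSz v
  born_eq : ∀ v < S.nodeCount, S'.born v = S.born v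
  par_eq : ∀ v < S.nodeCount, S'.par v = S.par v
  dep_eq : ∀ v < S.nodeCount, S'.dep v = S.dep v
  oquery_eq : ∀ o < S.opCount, S'.oquery o = S.oquery o
  ots_eq : ∀ o < S.opCount, ∀ t, S.ots o = some t → S'.ots o = some t
  ticket_eq : ∀ t < S.version, S'.ticket t = S.ticket t
  proc_eq : ∀ o < S.opCount, S'.proc o = S.proc o
  hd_le : ∀ v < S.nodeCount, S.hd (.node v) ≤ S'.hd (.node v)
  hd_lt : ∀ v < S.nodeCount, S'.hd (.node v) < S.cellCount
  tl_le : ∀ q, S.VQ q → S.tl q ≤ S'.tl q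
  hd_new : ∀ v < S.nodeCount, ∀ x, S.InQ x (.node v) → S.hd (.node v) < x →
    x ≤ S'.hd (.node v) → ∃ d, S.item x = .desc d ∧ S.Reached v d ∧ S.AllDone v d
  hd_trav : ∀ o < S.opCount, ∀ y v, S'.InQ y (.traverse o) → y ≤ S'.hd (.traverse o) →
    S'.item y = .node v → S.InQ y (.traverse o) ∧ (y ≤ S.hd (.traverse o) ∨
      v < S.nodeCount ∧ ∃ t, S.ots o = some t ∧ S.Ins v t ∧ S.Passed v t)
  state : ∀ c < S.nodeCount, S'.state c = S.state c ∨
    ∃ d, S.Accepted A c d ∧ (S.state c).tsMod < d.ts ∧ (S'.state c).tsMod = d.ts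
  slot : ∀ v < S.nodeCount, ∀ s, S'.child v s = S.child v s ∨ Slot S S' A v s
  slot_unique : ∀ v < S.nodeCount, ∀ s, S'.child v s ≠ S.child v s →
    ∀ w < S.nodeCount, ∀ r, S'.child w r ≠ S.child w r → w = v ∧ r = s
  slot_of_new : S'.nodeCount ≠ S.nodeCount →
    ∃ v < S.nodeCount, ∃ s, S'.child v s ≠ S.child v s
  cell_node : ∀ x, S.cellCount ≤ x → ∀ v < S.nodeCount, S'.InQ x (.node v) →
    ∃ d, S'.item x = .desc d ∧ S'.cts x = d.ts ∧ S.Admits A v d ∧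
      (∀ y, S.InQ y (.node v) → S.cts y < d.ts) ∧ (∀ y, S'.InQ y (.node v) → y ≤ x)
  cell_trav : ∀ y, S.cellCount ≤ y → ∀ o < S.opCount, S'.InQ y (.traverse o) →
    ∃ c d, S'.item y = .node c ∧ S.TravAdmits A o c d
  node_new : ∀ v, S.nodeCount ≤ v → v < S'.nodeCount →
    (∃ x, S.cellCount ≤ x ∧ S'.InQ x (.node v) ∧ S'.cts x = S'.born v ∧ S'.item x = .dummy ∧
      S'.hd (.node v) = x ∧ ∀ y, S'.InQ y (.node v) → y = x) ∧
    (S'.state v).tsMod = S'.born v ∧ (S'.state v).modCnt = 0 ∧ 2 ≤ S'.initSz v ∧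
    ∀ s, S'.rts (S'.child v s) = S'.born v ∧ ∀ c, S'.child v s = .inner c →
      S.nodeCount ≤ c ∧ c < S'.nodeCount ∧ S'.par c = (v, s) ∧ S'.dep c = S'.dep v + 1
  op_new : ∀ o, S.opCount ≤ o → o < S'.opCount → S'.ots o = none ∧
    (∃ y, S'.InQ y (.traverse o) ∧ S'.item y = .node 0) ∧
    (∀ y, S'.InQ y (.traverse o) → S'.item y = .dummy ∨
      (S'.item y = .node 0 ∧ S'.hd (.traverse o) < y)) ∧
    o = S.opCount ∧ ∃ i, S'.announce i = some o
  ots_new : ∀ o < S.opCount, ∀ t, S'.ots o = some t → S.ots o = some t ∨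
    (1 ≤ t ∧ t < S.version ∧ S.ticket t = o)
  ticket_new : ∀ t, S.version ≤ t → t < S'.version → S'.ticket t < S.opCount
  announce_new : ∀ i, S'.announce i = S.announce i ∨
    ((∀ o, S.announce i = some o → S.Finished o) ∧ S'.announce i = some S.opCount ∧
      S.opCount < S'.opCount ∧ S'.proc S.opCount = i ∧ S'.version = S.version)

end

end St

end WaitFreeTree

/-! Consequences of the invariant, and what a step leaves in force. -/

namespace WaitFreeTree

set_option linter.unusedSectionVars false

variable {κ σ ρ : Type*} {n : ℕ} [LinearOrder κ]

theorem route_unique {Q : Query κ} {r : Option κ} {s : Side} {q q' : Query κ}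
    (h : (s, q) ∈ route Q r) (h' : (s, q') ∈ route Q r) : q = q' := by
  cases r with
  | none => simp [route] at h h'; rw [h.2, h'.2]
  | some r =>
    cases Q with
    | insert k => simp [route] at h h'; rw [h.2, h'.2]
    | remove k => simp [route] at h h'; rw [h.2, h'.2]
    | contains k => simp [route] at h h'; rw [h.2, h'.2]
    | count lo hi =>
      simp only [route] at h h'
      split_ifs at h h'
      · simp at h h'; rw [h.2, h'.2]
      · simp at h h'; rw [h.2, h'.2]
      · simp at h h'
        rcases h with ⟨rfl, rfl⟩ | ⟨rfl, rfl⟩ <;> simp at h' <;> exact h'.symm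

omit [LinearOrder κ] in
theorem Ref.ts_eq_rts (S : St κ σ ρ n) {r : Ref κ} (h : ∀ c, r ≠ .inner c) : r.ts = S.rts r := by
  cases r with
  | inner c => exact absurd rfl (h c)
  | _ => rfl

namespace St

variable {S S' : St κ σ ρ n} {A : Spec κ σ ρ}

/-! ### Consequences of the invariant in a single state -/

namespace Inv

variable (I : S.Inv A)
include I

theorem node_lt {x v} (h : S.InQ x (.node v)) : v < S.nodeCount := by
  have := I.queues.vq x h.1
  rw [h.2] at this
  exact this

theorem trav_lt {x o} (h : S.InQ x (.traverse o)) : o < S.opCount := by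
  have := I.queues.vq x h.1
  rw [h.2] at this
  exact this

theorem cell_unique {x y v} (hx : S.InQ x (.node v)) (hy : S.InQ y (.node v))
    (h : S.cts x = S.cts y) : x = y := by
  rcases lt_trichotomy x y with h1 | h1 | h1
  · have := I.sorted v x y hx hy h1; omega
  · exact h1
  · have := I.sorted v y x hy hx h1; omega

theorem lt_of_cts {x y v} (hx : S.InQ x (.node v)) (hy : S.InQ y (.node v))
    (h : S.cts x < S.cts y) : x < y := by
  rcases lt_trichotomy x y with h1 | h1 | h1
  · exact h1
  · subst h1; omega
  · have := I.sorted v y x hy hx h1; omega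

theorem cts_le {x y v} (hx : S.InQ x (.node v)) (hy : S.InQ y (.node v))
    (h : x ≤ y) : S.cts x ≤ S.cts y := by
  rcases h.lt_or_eq with h | rfl
  · exact (I.sorted v x y hx hy h).le
  · exact le_rfl

theorem ins_tsMod {v t} (hv : v ≠ 0) (h : S.Ins v t) : t ≤ (S.state v).tsMod := by
  obtain ⟨x, hx, ht⟩ := h
  exact ht.trans (I.tsMod v x hv hx)

theorem born_tsMod {v} (h0 : v ≠ 0) (hv : v < S.nodeCount) : S.born v ≤ (S.state v).tsMod := by
  obtain ⟨x, hx, ht⟩ := I.bornCell v hv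
  exact ht ▸ I.tsMod v x h0 hx

theorem ins_born {v} (hv : v < S.nodeCount) : S.Ins v (S.born v) := by
  obtain ⟨x, hx, ht⟩ := I.bornCell v hv
  exact ⟨x, hx, ht.ge⟩

omit I in
theorem _root_.WaitFreeTree.St.Reached.lt (I : S.Inv A) {v d} (h : S.Reached v d) : v < S.nodeCount := by
  obtain ⟨⟨x, hx, _⟩, _⟩ := h
  exact I.node_lt hx

theorem reached_unique {v d d'} (h : S.Reached v d) (h' : S.Reached v d') (e : d.ts = d'.ts) :
    d = d' := by
  obtain ⟨⟨x, hx, hi, ht⟩, _⟩ := h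
  obtain ⟨⟨y, hy, hi', ht'⟩, _⟩ := h'
  have : x = y := I.cell_unique hx hy (by omega)
  subst this
  rw [hi] at hi'
  exact Item.desc.inj hi'

/-- What precedes a descriptor that has come to the head was popped, and only completed descriptors
are popped. -/
theorem allDone_of_lt {v d d'} (h : S.Reached v d) (h' : S.Reached v d') (e : d'.ts < d.ts) :
    S.AllDone v d' := by
  obtain ⟨_, hr⟩ := h
  obtain ⟨⟨y, hy, hi', ht'⟩, _⟩ := h'
  exact I.done v y d' hy (hr y hy (by omega)) hi'

/-- The descriptor in a queue cell. -/
theorem desc_cell {v x d} (hx : S.InQ x (.node v)) (hi : S.item x = .desc d) :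
    S.cts x = d.ts ∧ d.op < S.opCount ∧ S.ots d.op = some d.ts ∧
      S.InTrav d.op v ∧ (v ≠ 0 → S.Comes v d.ts) := by
  rcases I.desc v x hx with h | ⟨d', h, h'⟩
  · rw [hi] at h; cases h.1
  · rw [hi] at h; cases h; exact h'

theorem reached_desc {v d} (h : S.Reached v d) :
    d.op < S.opCount ∧ S.ots d.op = some d.ts ∧ S.InTrav d.op v ∧ (v ≠ 0 → S.Comes v d.ts) := by
  obtain ⟨⟨x, hx, hi, _⟩, _⟩ := h
  exact (I.desc_cell hx hi).2

/-- The history function `ticket` inverts the assignment of timestamps. -/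
theorem op_unique {o o' t} (ho : o < S.opCount) (ho' : o' < S.opCount) (h : S.ots o = some t)
    (h' : S.ots o' = some t) : o = o' := by
  rw [← (I.stamp o ho t h).2.2, (I.stamp o' ho' t h').2.2]

/-- The state is modified before an insertion, whereas a doomed node has not been modified by `d` or
a later operation. -/
theorem doomed_not_ins {c d t} (h : S.Doomed A c d) (ht : d.ts ≤ t) : ¬ S.Ins c t := by
  intro hi
  obtain ⟨⟨q, hq⟩, _, h2, _⟩ := h
  have := I.ins_tsMod hq.2.1 hi
  omega

/-- A timestamp determines the descriptor at the parent, and both verdicts are about the same state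
of `c`. This is why helpers agree on whether to rebuild. -/
theorem accepted_not_doomed {c d d'} (h : S.Accepted A c d) (h' : S.Doomed A c d')
    (e : d.ts = d'.ts) : False := by
  obtain ⟨⟨q, hq⟩, _, _, h2⟩ := h
  obtain ⟨⟨q', hq'⟩, _, h3, h4⟩ := h'
  have := I.reached_unique hq.2.2.1 hq'.2.2.1 e
  subst this
  rcases h2 with h2 | h2
  · omega
  · rw [h2] at h4; cases h4

omit I in
theorem ins_of_doomed_lt {c d d' q} (hq : S.ComesBy c d q) (h' : S.Doomed A c d')
    (h : d.ts < d'.ts) : S.Ins c d.ts := h'.2.1 _ h ⟨d, q, hq, rfl⟩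

/-- Two operations that may be inserted in the same node, the earlier one is there first. -/
theorem pred_of_admits {v d d'} (h : S.Admits A v d) (h' : S.Admits A v d') (hlt : d'.ts < d.ts) :
    S.Ins v d'.ts := by
  obtain ⟨_, h1, h2, _, h3⟩ := h
  obtain ⟨_, h1', h2', _, h3'⟩ := h'
  rcases h3 with ⟨rfl, hr⟩ | ⟨hv, ⟨e, he, ht⟩, _⟩
  · have hs := I.stamp _ h1' _ h2'
    obtain ⟨t'', ht, hi⟩ := hr.2 d'.ts hs.1 hlt
    rw [hs.2.2, h2'] at ht
    cases ht
    exact hi rfl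
  · rcases h3' with ⟨rfl, _⟩ | ⟨_, ⟨e', he', ht'⟩, _⟩
    · exact absurd rfl hv
    · obtain ⟨q', hq'⟩ := he'.1
      exact he.2.1 _ (by omega) ⟨e', q', hq', ht'⟩

omit [LinearOrder κ] I in
theorem not_ins_of_all_lt {v t} (h : ∀ y, S.InQ y (.node v) → S.cts y < t) : ¬ S.Ins v t := by
  rintro ⟨x, hx, ht⟩
  have := h x hx
  omega

/-- An operation that has left the parent has been inserted in an accepted child. -/
theorem accepted_ins {c d} (h : S.Accepted A c d)
    (hd : ∃ x, S.InQ x (.node (S.par c).1) ∧ S.item x = .desc d ∧ x ≤ S.hd (.node (S.par c).1)) :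
    S.Ins c d.ts := by
  obtain ⟨x, hx, hi, hle⟩ := hd
  obtain ⟨⟨q, hq⟩, _, ha, _⟩ := h
  rcases ha with ha | ha
  · exact (I.done _ x d hx hle hi _ _ hq.2.2.2.1).1 c ha hq.2.2.2.2
  · exact ha.1

/-- A node in which an operation may still be inserted is in the tree. -/
theorem below_of_admits {v d} (h : S.Admits A v d) (hn : ¬ S.Ins v d.ts) : S.Below 0 v := by
  obtain ⟨_, _, _, _, ⟨rfl, _⟩ | ⟨_, ⟨d', ha, ht⟩, _⟩⟩ := h
  · exact .refl
  · obtain ⟨q, hq⟩ := ha.1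
    obtain ⟨⟨x, hx, hi, hc⟩, _⟩ := id hq.2.2.1
    have h1 : S.hd (.node (S.par v).1) < x := by
      by_contra hle
      push Not at hle
      exact hn (ht ▸ I.accepted_ins ha ⟨x, hx, hi, hle⟩)
    rcases ha.2.2.1 with h2 | h2
    · exact .child _ _ _ (I.tree _ x hx h1) h2
    · exact absurd (ht ▸ h2.1) hn

/-- A doomed node has not been modified by `X`, which bounds its cells. The bound is inherited
downwards: a descriptor in a child has been in the queue of the parent, and the birth of the child
does not exceed the timestamp of some cell of the parent. -/
theorem frz_cells {X u} (h : S.Frz A X u) :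
    (∀ x, S.InQ x (.node u) → S.cts x < X) ∧ u < S.nodeCount := by
  induction h with
  | base c d h hX =>
    obtain ⟨⟨q, hq⟩, _, h2, _⟩ := h
    refine ⟨fun x hx => ?_, hq.1⟩
    have := I.tsMod c x hq.2.1 hx
    omega
  | step w u s hw hp hc ih =>
    have hch := I.child w ih.2 s u hc
    refine ⟨fun x hx => ?_, hch.1⟩
    rcases I.desc u x hx with ⟨_, h⟩ | ⟨d, hi, hd, _, _, _, hcm⟩
    · obtain ⟨y, hy, hle⟩ := (I.rtsIns w ih.2 s).1
      rw [hc] at hle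
      have := ih.1 y hy
      simp only [rts] at hle
      omega
    · obtain ⟨d', q, hq, ht⟩ := hcm hch.2.1
      have hq' := hq.2.2.1
      rw [hch.2.2.1] at hq'
      obtain ⟨⟨y, hy, _, hyt⟩, _⟩ := hq'
      have := ih.1 y hy
      omega

/-- Nothing can be inserted below a node that is to be rebuilt. -/
theorem frz_no_insert {X u} (h : S.Frz A X u) {d} (hd : S.Admits A u d)
    (hc : ∀ y, S.InQ y (.node u) → S.cts y < d.ts) : False := by
  have hn : ¬ S.Ins u d.ts := not_ins_of_all_lt hc
  cases h with
  | base c e h hX =>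
    obtain ⟨q, hq⟩ := id h.1
    rcases hd.2.2.2.2 with ⟨h0, _⟩ | ⟨_, ⟨d', ha, ht⟩, hle⟩
    · exact hq.2.1 h0
    · obtain ⟨q', hq'⟩ := id ha.1
      have := h.2.2.1
      exact hn (ht ▸ ins_of_doomed_lt hq' h (by omega))
  | step w u s hw hnp hch =>
    have hcc := I.child w (I.frz_cells hw).2 s u hch
    rcases hd.2.2.2.2 with ⟨h0, _⟩ | ⟨_, ⟨d', ha, ht⟩, hle⟩
    · exact hcc.2.1 h0
    · obtain ⟨q', hq'⟩ := id ha.1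
      obtain ⟨⟨x, hx, hi, _⟩, _⟩ := id hq'.2.2.1
      refine hn (ht ▸ I.accepted_ins ha ⟨x, hx, hi, ?_⟩)
      rw [hcc.2.2.1] at hx ⊢
      exact hnp x hx

omit [LinearOrder κ] I in
theorem clr_below {c u} (h : S.Clr c) (hb : S.Below c u) : S.Clr u := by
  induction hb with
  | refl => exact h
  | child v w s _ hc ih =>
    cases ih with
    | mk _ hp hcl => exact hcl s w hc

omit I in
-- `Clr` supplies the empty queues that `Frz.step` needs on the way down.
theorem frz_below {X c u} (hf : S.Frz A X c) (h : S.Clr c) (hb : S.Below c u) : S.Frz A X u := by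
  induction hb with
  | refl => exact hf
  | child v w s hv hc ih =>
    cases clr_below h hv with
    | mk _ hp hcl => exact .step v w s ih hp hc

theorem below_lt {u v} (hu : u < S.nodeCount) (h : S.Below u v) : v < S.nodeCount := by
  induction h with
  | refl => exact hu
  | child v c s hv hc ih => exact (I.child v ih s c hc).1

end Inv

/-! ### Properties of operations and nodes that survive a step -/

namespace Guar

variable (I : S.Inv A) (G : Guar S S' A)

section basic
include G

theorem inQ {x q} (h : S.InQ x q) : S'.InQ x q :=
  ⟨h.1.trans_le G.cellCount_le, (G.own_eq x h.1).trans h.2⟩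

theorem inQ_old {x q} (h : S'.InQ x q) (hx : x < S.cellCount) : S.InQ x q :=
  ⟨hx, (G.own_eq x hx).symm.trans h.2⟩

theorem ins {v t} (h : S.Ins v t) : S'.Ins v t := by
  obtain ⟨x, hx, ht⟩ := h
  exact ⟨x, G.inQ hx, by rwa [G.cts_eq x hx.1]⟩

theorem inTrav {o v} (h : S.InTrav o v) : S'.InTrav o v := by
  obtain ⟨x, hx, ht⟩ := h
  exact ⟨x, G.inQ hx, by rwa [G.item_eq x hx.1]⟩

end basic

include I G

/-- A new cell has a timestamp above all those in the queue, one of which is at least `t`. Without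
`hi` the property could be lost. -/
theorem passed {v t} (hi : S.Ins v t) (h : S.Passed v t) : S'.Passed v t := by
  intro x hx ht
  obtain ⟨y, hy, hyt⟩ := hi
  have hv := I.node_lt hy
  by_cases hxc : x < S.cellCount
  · rw [G.cts_eq x hxc] at ht
    exact (h x (G.inQ_old hx hxc) ht).trans (G.hd_le v hv)
  · obtain ⟨d, _, hd, _, hall, _⟩ := G.cell_node x (not_lt.mp hxc) v hv hx
    have := hall y hy
    omega

theorem reached {v d} (h : S.Reached v d) : S'.Reached v d := by
  have hv := h.lt I
  obtain ⟨⟨y, hy, hi, ht⟩, hp⟩ := h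
  refine ⟨⟨y, G.inQ hy, by rw [G.item_eq y hy.1, hi], by rw [G.cts_eq y hy.1, ht]⟩, fun x hx hlt => ?_⟩
  by_cases hxc : x < S.cellCount
  · rw [G.cts_eq x hxc] at hlt
    exact (hp x (G.inQ_old hx hxc) hlt).trans (G.hd_le v hv)
  · obtain ⟨d', _, hd, _, hall, _⟩ := G.cell_node x (not_lt.mp hxc) v hv hx
    have := hall y hy
    omega

/-- A descriptor earlier than one that is present cannot be added afterwards. -/
theorem reached_back {v d d'} (h : S.Reached v d) (h' : S'.Reached v d') (hlt : d'.ts < d.ts) :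
    S.Reached v d' := by
  have hv := h.lt I
  obtain ⟨⟨y, hy, hi, ht⟩, hp⟩ := h
  obtain ⟨⟨x, hx, hxi, hxt⟩, _⟩ := h'
  by_cases hxc : x < S.cellCount
  · rw [G.cts_eq x hxc] at hxt
    rw [G.item_eq x hxc] at hxi
    exact ⟨⟨x, G.inQ_old hx hxc, hxi, hxt⟩, fun z hz hzt => hp z hz (by omega)⟩
  · obtain ⟨e, _, hd, _, hall, _⟩ := G.cell_node x (not_lt.mp hxc) v hv hx
    have := hall y hy
    omega

theorem comesBy {c d q} (h : S.ComesBy c d q) : S'.ComesBy c d q := by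
  obtain ⟨h1, h2, h3, h4, h5⟩ := h
  have hp := G.par_eq c h1
  refine ⟨h1.trans_le G.nodeCount_le, h2, ?_, ?_, h5⟩
  · rw [hp]; exact G.reached I h3
  · rw [hp, G.sep_eq _ (h3.lt I)]; exact h4

theorem comes {c t} (h : S.Comes c t) : S'.Comes c t := by
  obtain ⟨d, q, h, ht⟩ := h
  exact ⟨d, q, G.comesBy I h, ht⟩

theorem comes_back {c d q t} (h : S.ComesBy c d q) (h' : S'.Comes c t) (hlt : t < d.ts) :
    S.Comes c t := by
  obtain ⟨d', q', h', rfl⟩ := h'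
  obtain ⟨h1, h2, h3, h4, h5⟩ := h
  obtain ⟨_, _, h3', h4', h5'⟩ := h'
  rw [G.par_eq c h1] at h3' h4'
  rw [G.sep_eq _ (h3.lt I)] at h4'
  exact ⟨d', q', ⟨h1, h2, G.reached_back I h3 h3' hlt, h4', h5'⟩, rfl⟩

theorem predDone {c d q} (h : S.ComesBy c d q) (hp : S.PredDone c d.ts) : S'.PredDone c d.ts :=
  fun t ht hc => G.ins (hp t ht (G.comes_back I h hc ht))

omit I in
theorem tsMod_le {c} (hc : c < S.nodeCount) : (S.state c).tsMod ≤ (S'.state c).tsMod := by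
  rcases G.state c hc with h | ⟨d, _, h1, h2⟩
  · rw [h]
  · omega

/-- A change of the state by an operation that finds all earlier ones there. -/
theorem tsMod_ge {c d q} (h : S.ComesBy c d q) (hp : S.PredDone c d.ts) :
    S'.state c = S.state c ∨ d.ts ≤ (S'.state c).tsMod := by
  rcases G.state c h.1 with h' | ⟨e, ha, h1, h2⟩
  · exact .inl h'
  · right
    by_contra hlt
    obtain ⟨q', hq'⟩ := ha.1
    have := I.ins_tsMod h.2.1 (hp e.ts (by omega) ⟨e, q', hq', rfl⟩)
    omega

/-- Only an accepted operation changes a state. An earlier one is already in the queue, so the state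
is not older than it; `d` itself cannot be accepted; a later one would need `d` in the queue of `c`,
which is impossible for a doomed node. -/
theorem doomed {c d} (h : S.Doomed A c d) : S'.Doomed A c d := by
  obtain ⟨⟨q, hq⟩, h1, h2, h3⟩ := id h
  have hs : S'.state c = S.state c := by
    rcases G.state c hq.1 with h' | ⟨e, ha, h4, h5⟩
    · exact h'
    · exfalso
      obtain ⟨q', hq'⟩ := id ha.1
      rcases lt_trichotomy e.ts d.ts with hlt | heq | hlt
      · have := I.ins_tsMod hq.2.1 (h1 e.ts hlt ⟨e, q', hq', rfl⟩)
        omega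
      · exact I.accepted_not_doomed ha h heq
      · exact I.doomed_not_ins h le_rfl (ha.2.1 d.ts hlt ⟨d, q, hq, rfl⟩)
  exact ⟨⟨q, G.comesBy I hq⟩, G.predDone I hq h1, by rwa [hs],
    by rwa [hs, G.initSz_eq c hq.1]⟩

theorem ins_born {v} (hv : v < S'.nodeCount) : S'.Ins v (S'.born v) := by
  by_cases h : v < S.nodeCount
  · rw [G.born_eq v h]; exact G.ins (I.ins_born h)
  · obtain ⟨⟨x, _, hx, ht, _⟩, _⟩ := G.node_new v (by omega) hv
    exact ⟨x, hx, ht.ge⟩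

theorem rts_eq {v s} (hv : v < S.nodeCount) : S'.rts (S.child v s) = S.rts (S.child v s) := by
  cases h : S.child v s with
  | inner c => exact G.born_eq c (I.child v hv s c h).1
  | _ => rfl

/-- A rebuilding by `d` marks with `d.ts - 1`. That is not below the birth of the old child, since
`d` finds its state older than `d.ts`. -/
theorem rts_le {v s} (hv : v < S.nodeCount) : S.rts (S.child v s) ≤ S'.rts (S'.child v s) := by
  rcases G.slot v hv s with h | ⟨⟨d, q, _, _, h3, h4, _, h5, _⟩ | ⟨c, d, h1, h2, _, h4, _⟩, _⟩
  · rw [h, G.rts_eq I hv]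
  · rw [Ref.ts_eq_rts S h3] at h4
    omega
  · obtain ⟨q, hq⟩ := h2.1
    have := I.born_tsMod hq.2.1 hq.1
    have := h2.2.2.1
    rw [h1]
    simp only [rts] at *
    omega

theorem child_lt {v s c} (hv : v < S.nodeCount) (h : S'.child v s = .inner c) :
    c < S'.nodeCount := by
  rcases G.slot v hv s with h' | h'
  · rw [h'] at h
    exact (I.child v hv s c h).1.trans_le G.nodeCount_le
  · exact (h'.inner c h).2.1

/-- An inner node born at `t` or later has a first cell with this birth as timestamp, and that
counts as an insertion. -/
theorem sideDone_of_le {v s q t} (hv : v < S.nodeCount) (h : t ≤ S'.rts (S'.child v s)) :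
    S'.SideDone v s q t := by
  refine ⟨fun c hc _ => ?_, fun hc => .inl (by rwa [Ref.ts_eq_rts S' hc])⟩
  rw [hc] at h
  obtain ⟨x, hx, ht⟩ := G.ins_born I (G.child_lt I hv hc)
  exact ⟨x, hx, h.trans ht⟩

/-- Once an operation has come to a node, only the operation itself and later ones can change the
child pointers. -/
theorem slot_ge {v s d} (hr : S.Reached v d) (hne : S'.child v s ≠ S.child v s) :
    d.ts ≤ S'.rts (S'.child v s) ∨
      ∃ c, S.child v s = .inner c ∧ S.Doomed A c d ∧ S'.rts (S'.child v s) + 1 = d.ts := by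
  rcases (G.slot v (hr.lt I) s).resolve_left hne with
    ⟨⟨e, q, h1, h2, h3, h4, h5, h6, _⟩ | ⟨c, e, h1, h2, _, h4, _⟩, _⟩
  · rcases lt_or_ge e.ts d.ts with hlt | hge
    · exfalso
      rcases (I.allDone_of_lt hr h1 hlt s q h2).2 h3 with h | h
      · omega
      · exact h5 h
    · left; omega
  · obtain ⟨q, hq⟩ := id h2.1
    have hp := (I.child v (hr.lt I) s c h1).2.2.1
    obtain ⟨_, _, hq3, hq4, hq5⟩ := id hq
    rw [hp] at hq3 hq4
    rcases lt_trichotomy e.ts d.ts with hlt | heq | hlt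
    · exfalso
      exact I.doomed_not_ins h2 le_rfl ((I.allDone_of_lt hr hq3 hlt s q hq4).1 c h1 hq5)
    · right
      have := I.reached_unique hq3 hr heq
      subst this
      exact ⟨c, h1, h2, h4⟩
    · left; omega

/-- The only change that leaves a mark below `d.ts` is the rebuilding by `d`, and then `d` is not in
the queue of the old child. -/
theorem sideDone {v s q d} (hr : S.Reached v d) (hq : (s, q) ∈ route d.query (S.sep v))
    (h : S.SideDone v s q d.ts) : S'.SideDone v s q d.ts := by
  have hv := hr.lt I
  by_cases hne : S'.child v s = S.child v s
  · refine ⟨fun c hc hw => ?_, fun hc => ?_⟩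
    · rw [hne] at hc; exact G.ins (h.1 c hc hw)
    · rw [hne] at hc ⊢; exact h.2 hc
  · rcases G.slot_ge I hr hne with h' | ⟨c, h1, h2, h3⟩
    · exact G.sideDone_of_le I hv h'
    · exfalso
      obtain ⟨q', hq'⟩ := id h2.1
      obtain ⟨_, _, hq3, hq4, hq5⟩ := id hq'
      rw [(I.child v hv s c h1).2.2.1] at hq4
      rw [← route_unique hq hq4] at hq5
      exact I.doomed_not_ins h2 le_rfl (h.1 c h1 hq5)

theorem allDone {v d} (hr : S.Reached v d) (h : S.AllDone v d) : S'.AllDone v d := by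
  intro s q hq
  rw [G.sep_eq v (hr.lt I)] at hq
  exact G.sideDone I hr hq (h s q hq)

/-- If an operation later than `d` replaces `c`, then `d` is in the queue of `c`, being one of its
predecessors; if `d` itself does, then `c` was doomed. -/
theorem att_or {c d q} (hq : S.ComesBy c d q) (h : S.Att c d.ts) :
    S'.Att c d.ts ∨ S.Doomed A c d := by
  have hv := hq.2.2.1.lt I
  rw [Att, G.par_eq c hq.1]
  rcases h with h | h
  · by_cases hne : S'.child (S.par c).1 (S.par c).2 = S.child (S.par c).1 (S.par c).2
    · exact .inl (.inl (hne.trans h))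
    · rcases G.slot_ge I hq.2.2.1 hne with h' | ⟨c', h1, h2, h3⟩
      · rcases (G.slot _ hv _).resolve_left hne with
          ⟨⟨e, _, _, _, h3, _⟩ | ⟨c', e, h1, h2, _, h4, _⟩, _⟩
        · exact absurd h (h3 c)
        · rw [h] at h1
          cases h1
          exact .inl (.inr ⟨G.ins (Inv.ins_of_doomed_lt hq h2 (by omega)), h'⟩)
      · rw [h] at h1
        cases h1
        exact .inr h2
  · exact .inl (.inr ⟨G.ins h.1, h.2.trans (G.rts_le I hv)⟩)

theorem accepted {c d} (h : S.Accepted A c d) : S'.Accepted A c d := by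
  obtain ⟨⟨q, hq⟩, hp, ha, hn⟩ := id h
  refine ⟨⟨q, G.comesBy I hq⟩, G.predDone I hq hp, ?_, ?_⟩
  · rcases G.att_or I hq ha with h' | h'
    · exact h'
    · exact (I.accepted_not_doomed h h' rfl).elim
  · rcases G.tsMod_ge I hq hp with hs | hs
    · rw [hs, G.initSz_eq c hq.1]; exact hn
    · exact .inl hs

theorem seen {c d} (h : S.Seen A c d) : S'.Seen A c d := by
  obtain ⟨⟨q, hq⟩, hp, ha⟩ := id h
  refine ⟨⟨q, G.comesBy I hq⟩, G.predDone I hq hp, ?_⟩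
  rcases ha with ha | ha
  · rcases G.att_or I hq ha with h' | h'
    · exact .inl h'
    · exact .inr (G.doomed I h')
  · exact .inr (G.doomed I ha)

theorem rootPred {t} (h : S.RootPred t) : S'.RootPred t := by
  refine ⟨h.1.trans G.version_le, fun t' h1 h2 => ?_⟩
  obtain ⟨t'', h3, h4⟩ := h.2 t' h1 h2
  have hlt : t' < S.version := h2.trans_le h.1
  rw [G.ticket_eq t' hlt]
  exact ⟨t'', G.ots_eq _ (I.ticketLt t' h1 hlt) _ h3, fun h => G.ins (h4 h)⟩

theorem admits {v d} (h : S.Admits A v d) : S'.Admits A v d := by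
  obtain ⟨h0, h1, h2, h3, h4⟩ := h
  refine ⟨h0.trans_le G.nodeCount_le, h1.trans_le G.opCount_le, G.ots_eq _ h1 _ h2, G.inTrav h3, ?_⟩
  rcases h4 with ⟨hv, hr⟩ | ⟨hv, ⟨d', ha, ht⟩, hle⟩
  · exact .inl ⟨hv, G.rootPred I hr⟩
  · exact .inr ⟨hv, ⟨d', G.accepted I ha, ht⟩, hle.trans (G.tsMod_le h0)⟩

theorem travAdmits {o c d} (h : S.TravAdmits A o c d) : S'.TravAdmits A o c d := by
  obtain ⟨h0, h1, h2, h3, h4⟩ := h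
  obtain ⟨q, hq⟩ := id h3.1
  refine ⟨h0.trans_le G.opCount_le, h1, G.ots_eq _ h0 _ h2, G.accepted I h3, ?_⟩
  rw [G.par_eq c hq.1]
  exact G.inTrav h4

theorem frz_noPend {X u} (h : S.Frz A X u) (hp : S.NoPend u) : S'.NoPend u := by
  intro x hx
  have hu := (I.frz_cells h).2
  by_cases hxc : x < S.cellCount
  · exact (hp x (G.inQ_old hx hxc)).trans (G.hd_le u hu)
  · obtain ⟨d, _, hd, ha, hall, _⟩ := G.cell_node x (not_lt.mp hxc) u hu hx
    exact (I.frz_no_insert h ha hall).elim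

/-- A child pointer is changed for an operation not yet completed at the node. With an empty queue
all operations have been popped there, hence completed. -/
theorem frz_child {X u} (h : S.Frz A X u) (hp : S.NoPend u) (s : Side) :
    S'.child u s = S.child u s := by
  have hu := (I.frz_cells h).2
  rcases G.slot u hu s with h' | ⟨⟨e, q, h1, h2, h3, h4, h5, h6, _⟩ | ⟨c, e, h1, h2, _, h4, _⟩, _⟩
  · exact h'
  · exfalso
    obtain ⟨⟨x, hx, hi, _⟩, _⟩ := h1
    rcases (I.done u x e hx (hp x hx) hi s q h2).2 h3 with h | h
    · omega
    · exact h5 h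
  · exfalso
    obtain ⟨q, hq⟩ := id h2.1
    obtain ⟨_, _, hq3, hq4, hq5⟩ := hq
    rw [(I.child u hu s c h1).2.2.1] at hq3 hq4
    obtain ⟨⟨x, hx, hi, _⟩, _⟩ := hq3
    exact I.doomed_not_ins h2 le_rfl ((I.done u x e hx (hp x hx) hi s q hq4).1 c h1 hq5)

theorem frz {X u} (h : S.Frz A X u) : S'.Frz A X u := by
  induction h with
  | base c d h hX => exact .base c d (G.doomed I h) hX
  | step w u s hw hp hc ih =>
    exact .step w u s ih (G.frz_noPend I hw hp) ((G.frz_child I hw hp s).trans hc)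

theorem clr {X u} (h : S.Frz A X u) (hc : S.Clr u) : S'.Clr u := by
  induction hc with
  | mk u hp hc ih =>
    refine .mk u (G.frz_noPend I h hp) fun s c h' => ?_
    rw [G.frz_child I h hp s] at h'
    exact ih s c h' (.step u c s h hp h')

theorem below_clr {X u v} (h : S.Frz A X u) (hc : S.Clr u) : S'.Below u v ↔ S.Below u v := by
  constructor
  · intro hb
    induction hb with
    | refl => exact .refl
    | child v c s hv hcc ih =>
      cases Inv.clr_below hc ih with
      | mk _ hp _ =>
        rw [G.frz_child I (Inv.frz_below h hc ih) hp s] at hcc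
        exact .child v c s ih hcc
  · intro hb
    induction hb with
    | refl => exact .refl
    | child v c s hv hcc ih =>
      cases Inv.clr_below hc hv with
      | mk _ hp _ =>
        exact .child v c s ih ((G.frz_child I (Inv.frz_below h hc hv) hp s).trans hcc)

theorem below_eq {X u} (h : S.Frz A X u) (hc : S.Clr u) : S'.below u = S.below u := by
  have hu := (I.frz_cells h).2
  ext v
  simp only [below, Finset.mem_filter, Finset.mem_range, G.below_clr I h hc]
  exact ⟨fun hv => ⟨I.below_lt hu hv.2, hv.2⟩, fun hv => ⟨hv.1.trans_le G.nodeCount_le, hv.2⟩⟩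

/-- A node leaves the tree only when its queue is empty for ever. -/
theorem below_root {v} (h : S.Below 0 v) :
    S'.Below 0 v ∨ ∃ X, S.Frz A X v ∧ S.Clr v := by
  induction h with
  | refl => exact .inl .refl
  | child v c s hv hc ih =>
    have hlt := I.below_lt I.nodePos hv
    rcases ih with ih | ⟨X, hf, hcl⟩
    · by_cases hne : S'.child v s = S.child v s
      · exact .inl (.child v c s ih (hne.trans hc))
      · rcases (G.slot v hlt s).resolve_left hne with
          ⟨⟨e, _, _, _, h3, _⟩ | ⟨c', e, h1, h2, h3, h4, _⟩, _⟩
        · exact absurd hc (h3 c)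
        · rw [hc] at h1
          cases h1
          exact .inr ⟨_, .base c e h2 rfl, h3⟩
    · cases hcl with
      | mk _ hp hcl => exact .inr ⟨X, .step v c s hf hp hc, hcl s c hc⟩

/-- A new cell for `o` would lie in a child of a node from which `o` has been popped. An accepted
operation is then in the queue of the child already, and queues grow only by later timestamps. At
the root the timestamp of `o` is present. -/
theorem finished {o} (ho : o < S.opCount) (h : S.Finished o) : S'.Finished o := by
  obtain ⟨t, h1, h2, h3, h4⟩ := h
  refine ⟨t, G.ots_eq o ho t h1, G.ins h2, fun o' ho' => ?_, fun v x d hx hi hd => ?_⟩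
  · obtain ⟨t', ht'⟩ := Option.ne_none_iff_exists'.mp (h3 o' ho')
    rw [G.ots_eq o' (ho'.trans_lt ho) t' ht']
    simp
  · by_cases hxc : x < S.cellCount
    · rw [G.item_eq x hxc] at hi
      have hx' := G.inQ_old hx hxc
      exact (h4 v x d hx' hi hd).trans (G.hd_le v (I.node_lt hx'))
    · by_cases hv : v < S.nodeCount
      · exfalso
        obtain ⟨e, hie, hte, ha, hall, _⟩ := G.cell_node x (not_lt.mp hxc) v hv hx
        rw [hi] at hie
        cases hie
        have hn := Inv.not_ins_of_all_lt hall
        obtain ⟨_, _, ho1, _, ha⟩ := ha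
        rw [hd, h1] at ho1
        cases ho1
        rcases ha with ⟨rfl, _⟩ | ⟨_, ⟨e, ha, ht⟩, _⟩
        · exact hn h2
        · obtain ⟨q, hq⟩ := id ha.1
          obtain ⟨⟨y, hy, hyi, _⟩, _⟩ := id hq.2.2.1
          have he := I.reached_desc hq.2.2.1
          rw [ht] at he
          have := I.op_unique he.1 ho he.2.1 h1
          exact hn (ht ▸ I.accepted_ins ha ⟨y, hy, hyi, h4 _ y e hy hyi this⟩)
      · have hv' : v < S'.nodeCount := by
          have := G.queues.vq x hx.1
          rw [hx.2] at this
          exact this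
        obtain ⟨⟨y, _, _, _, _, hyh, hall⟩, _⟩ := G.node_new v (not_lt.mp hv) hv'
        rw [hall x hx, hyh]

end Guar

end St

end WaitFreeTree

/-! Preservation of the order of the operations queues. -/

namespace WaitFreeTree

set_option linter.unusedSectionVars false

variable {κ σ ρ : Type*} {n : ℕ} [LinearOrder κ]

namespace St

variable {S S' : St κ σ ρ n} {A : Spec κ σ ρ}

theorem Inv.reached_of_popped (I : S.Inv A) {v x d} (hx : S.InQ x (.node v))
    (h : x ≤ S.hd (.node v)) (hi : S.item x = .desc d) : S.Reached v d := by
  have ht := (I.desc_cell hx hi).1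
  exact ⟨⟨x, hx, hi, ht⟩, fun y hy hlt => (I.lt_of_cts hy hx (by omega)).le.trans h⟩

theorem Guar.node_lt (G : Guar S S' A) {x v} (h : S'.InQ x (.node v)) : v < S'.nodeCount := by
  have := G.queues.vq x h.1
  rw [h.2] at this
  exact this

theorem Guar.trav_lt (G : Guar S S' A) {x o} (h : S'.InQ x (.traverse o)) : o < S'.opCount := by
  have := G.queues.vq x h.1
  rw [h.2] at this
  exact this

/-- A cell of an operations queue is an old one, a new one in an old queue, or the first one of a
new queue. -/
theorem Guar.cell_cases (G : Guar S S' A) {x v} (h : S'.InQ x (.node v)) :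
    (v < S.nodeCount ∧ S.InQ x (.node v) ∧ S'.cts x = S.cts x ∧ S'.item x = S.item x) ∨
    (v < S.nodeCount ∧ S.cellCount ≤ x ∧ ∃ d, S'.item x = .desc d ∧ S'.cts x = d.ts ∧
      S.Admits A v d ∧ (∀ y, S.InQ y (.node v) → S.cts y < d.ts) ∧ ∀ y, S'.InQ y (.node v) → y ≤ x) ∨
    (S.nodeCount ≤ v ∧ v < S'.nodeCount ∧ S'.cts x = S'.born v ∧ S'.item x = .dummy ∧
      S'.hd (.node v) = x ∧ ∀ y, S'.InQ y (.node v) → y = x) := by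
  by_cases hv : v < S.nodeCount
  · by_cases hx : x < S.cellCount
    · exact .inl ⟨hv, G.inQ_old h hx, G.cts_eq x hx, G.item_eq x hx⟩
    · exact .inr (.inl ⟨hv, not_lt.mp hx, G.cell_node x (not_lt.mp hx) v hv h⟩)
  · obtain ⟨⟨y, _, hy, h1, h2, h3, h4⟩, _⟩ := G.node_new v (not_lt.mp hv) (G.node_lt h)
    have := h4 x h
    subst this
    exact .inr (.inr ⟨not_lt.mp hv, G.node_lt h, h1, h2, h3, h4⟩)

theorem Guar.inv (I : S.Inv A) (G : Guar S S' A) : S'.Inv A where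
  queues := G.queues
  sorted v x y hx hy hlt := by
    rcases G.cell_cases hx with ⟨hv, hx', hc, _⟩ | ⟨hv, hxc, d, _, _, _, _, hall⟩ | ⟨hv, _, _, _, _, hall⟩
    · rcases G.cell_cases hy with ⟨_, hy', hc', _⟩ | ⟨_, _, d, _, hd, _, hall, _⟩ | ⟨hv', _⟩
      · rw [hc, hc']; exact I.sorted v x y hx' hy' hlt
      · rw [hc, hd]; exact hall x hx'
      · exact absurd hv (not_lt.mpr hv')
    · exact absurd (hall y hy) (not_le.mpr hlt)
    · exact absurd (hall y hy) hlt.ne'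
  bornCell v hv := by
    by_cases h : v < S.nodeCount
    · obtain ⟨x, hx, ht⟩ := I.bornCell v h
      exact ⟨x, G.inQ hx, by rw [G.cts_eq x hx.1, ht, G.born_eq v h]⟩
    · obtain ⟨⟨x, _, hx, ht, _⟩, _⟩ := G.node_new v (not_lt.mp h) hv
      exact ⟨x, hx, ht⟩
  bornLe v x hx := by
    rcases G.cell_cases hx with ⟨hv, hx', hc, _⟩ | ⟨hv, hxc, d, _, hd, _, hall, _⟩ | ⟨hv, _, h, _⟩
    · rw [hc, G.born_eq v hv]; exact I.bornLe v x hx'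
    · obtain ⟨y, hy, ht⟩ := I.bornCell v hv
      rw [hd, G.born_eq v hv, ← ht]
      exact (hall y hy).le
    · exact h.ge
  desc v x hx := by
    rcases G.cell_cases hx with ⟨hv, hx', hc, hi⟩ | ⟨hv, hxc, d, hi, hd, ha, hall, _⟩ | ⟨hv, _, h, hi, _⟩
    · rw [hc, hi, G.born_eq v hv]
      rcases I.desc v x hx' with h | ⟨d, h1, h2, h3, h4, h5, h6⟩
      · exact .inl h
      · exact .inr ⟨d, h1, h2, h3.trans_le G.opCount_le, G.ots_eq _ h3 _ h4, G.inTrav h5,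
          fun h0 => G.comes I (h6 h0)⟩
    · obtain ⟨h0, h1, h2, h3, h4⟩ := ha
      refine .inr ⟨d, hi, hd, h1.trans_le G.opCount_le, G.ots_eq _ h1 _ h2, G.inTrav h3, fun hv0 => ?_⟩
      rcases h4 with ⟨h4, _⟩ | ⟨_, ⟨d', ha, ht⟩, _⟩
      · exact absurd h4 hv0
      · obtain ⟨q, hq⟩ := ha.1
        exact G.comes I ⟨d', q, hq, ht⟩
    · exact .inl ⟨hi, h⟩
  tsMod v x h0 hx := by
    rcases G.cell_cases hx with ⟨hv, hx', hc, hi⟩ | ⟨hv, hxc, d, hi, hd, ha, hall, _⟩ | ⟨hv, hv', h, hi, _⟩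
    · rw [hc]; exact (I.tsMod v x h0 hx').trans (G.tsMod_le hv)
    · rcases ha.2.2.2.2 with ⟨h4, _⟩ | ⟨_, _, h⟩
      · exact absurd h4 h0
      · rw [hd]; exact h.trans (G.tsMod_le hv)
    · rw [h, (G.node_new v hv hv').2.1]
  trav o y hy := by
    by_cases ho : o < S.opCount
    · by_cases hyc : y < S.cellCount
      · rw [G.item_eq y hyc]
        rcases I.trav o y (G.inQ_old hy hyc) with h | h | ⟨c, d, h1, h2, h3, h4, y', h5, h6, h7⟩
        · exact .inl h
        · exact .inr (.inl h)
        · obtain ⟨q, hq⟩ := id h4.1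
          refine .inr (.inr ⟨c, d, h1, h2, G.ots_eq o ho _ h3, G.accepted I h4, y', h5, G.inQ h6, ?_⟩)
          rw [G.item_eq y' h6.1, G.par_eq c hq.1, h7]
      · obtain ⟨c, d, hi, _, h2, h3, h4, y', h5, h6⟩ := G.cell_trav y (not_lt.mp hyc) o ho hy
        obtain ⟨q, hq⟩ := id h4.1
        refine .inr (.inr ⟨c, d, hi, h2, G.ots_eq o ho _ h3, G.accepted I h4, y',
          h5.1.trans_le (not_lt.mp hyc), G.inQ h5, ?_⟩)
        rw [G.item_eq y' h5.1, G.par_eq c hq.1, h6]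
    · rcases (G.op_new o (not_lt.mp ho) (G.trav_lt hy)).2.2.1 y hy with h | h
      · exact .inl h
      · exact .inr (.inl h.1)
  travRoot o ho := by
    by_cases h : o < S.opCount
    · exact G.inTrav (I.travRoot o h)
    · exact (G.op_new o (not_lt.mp h) ho).2.1
  passed o y v hy hle hi := by
    by_cases ho : o < S.opCount
    · obtain ⟨hy', h | ⟨_, t, h1, h2, h3⟩⟩ := G.hd_trav o ho y v hy hle hi
      · rw [G.item_eq y hy'.1] at hi
        obtain ⟨t, h1, h2, h3⟩ := I.passed o y v hy' h hi
        exact ⟨t, G.ots_eq o ho t h1, G.ins h2, G.passed I h2 h3⟩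
      · exact ⟨t, G.ots_eq o ho t h1, G.ins h2, G.passed I h2 h3⟩
    · rcases (G.op_new o (not_lt.mp ho) (G.trav_lt hy)).2.2.1 y hy with h | h
      · rw [hi] at h; cases h
      · exact absurd hle (not_le.mpr h.2)
  nodePos := I.nodePos.trans_le G.nodeCount_le
  fresh v hv h0 := by
    by_cases h : v < S.nodeCount
    · rw [G.initSz_eq v h, G.born_eq v h]
      refine ⟨(I.fresh v h h0).1, fun he => ?_⟩
      rcases G.state v h with hs | ⟨d, _, h1, h2⟩
      · rw [hs] at he ⊢; exact (I.fresh v h h0).2 he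
      · have := I.born_tsMod h0 h
        omega
    · obtain ⟨_, h1, h2, h3, _⟩ := G.node_new v (not_lt.mp h) hv
      exact ⟨h3, fun _ => h2⟩
  child v hv s c hc := by
    by_cases h : v < S.nodeCount
    · rcases G.slot v h s with h' | h'
      · rw [h'] at hc
        obtain ⟨h1, h2, h3, h4⟩ := I.child v h s c hc
        exact ⟨h1.trans_le G.nodeCount_le, h2, (G.par_eq c h1).trans h3,
          by rw [G.dep_eq c h1, G.dep_eq v h, h4]⟩
      · obtain ⟨h1, h2, h3, h4⟩ := h'.inner c hc
        exact ⟨h2, (I.nodePos.trans_le h1).ne', h3, by rw [h4, G.dep_eq v h]⟩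
    · obtain ⟨h1, h2, h3, h4⟩ := ((G.node_new v (not_lt.mp h) hv).2.2.2.2 s).2 c hc
      exact ⟨h2, (I.nodePos.trans_le h1).ne', h3, h4⟩
  rtsIns v hv s := by
    by_cases h : v < S.nodeCount
    · refine ⟨?_, ?_⟩
      · rcases G.slot v h s with h' | ⟨⟨d, q, h1, _, _, _, _, h5, _⟩ | ⟨c, d, h1, h2, _, h4, _⟩, _⟩
        · rw [h', G.rts_eq I h]; exact G.ins (I.rtsIns v h s).1
        · obtain ⟨⟨x, hx, _, ht⟩, _⟩ := h1
          exact G.ins ⟨x, hx, by omega⟩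
        · obtain ⟨q, hq⟩ := h2.1
          obtain ⟨⟨x, hx, _, ht⟩, _⟩ := hq.2.2.1
          rw [(I.child v h s c h1).2.2.1] at hx
          exact G.ins ⟨x, hx, by omega⟩
      · rw [G.born_eq v h]
        exact (I.rtsIns v h s).2.trans (G.rts_le I h)
    · have := ((G.node_new v (not_lt.mp h) hv).2.2.2.2 s).1
      rw [this]
      exact ⟨G.ins_born I hv, le_rfl⟩
  done v x d hx hle hi := by
    rcases G.cell_cases hx with ⟨hv, hx', hc, hi'⟩ | ⟨hv, hxc, _⟩ | ⟨hv, hv', h, hi', _⟩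
    · rw [hi'] at hi
      by_cases hh : x ≤ S.hd (.node v)
      · exact G.allDone I (I.reached_of_popped hx' hh hi) (I.done v x d hx' hh hi)
      · obtain ⟨e, h1, h2, h3⟩ := G.hd_new v hv x hx' (not_le.mp hh) hle
        rw [hi] at h1
        cases h1
        exact G.allDone I h2 h3
    · exact absurd (hle.trans_lt (G.hd_lt v hv)) (not_lt.mpr hxc)
    · rw [hi] at hi'; cases hi'
  tree v x hx hlt := by
    rcases G.cell_cases hx with ⟨hv, hx', hc, hi'⟩ | ⟨hv, hxc, d, _, _, ha, hall, _⟩ | ⟨_, _, _, _, h, _⟩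
    · have hh := (G.hd_le v hv).trans_lt hlt
      rcases G.below_root I (I.tree v x hx' hh) with h | ⟨X, _, hcl⟩
      · exact h
      · cases hcl with
        | mk _ hp _ => exact absurd (hp x hx') (not_le.mpr hh)
    · rcases G.below_root I (I.below_of_admits ha (Inv.not_ins_of_all_lt hall)) with h | ⟨X, hf, _⟩
      · exact h
      · exact (I.frz_no_insert hf ha hall).elim
    · exact absurd h hlt.ne
  stamp o ho t ht := by
    by_cases h : o < S.opCount
    · have : 1 ≤ t ∧ t < S.version ∧ S.ticket t = o := by
        rcases G.ots_new o h t ht with h' | h'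
        · exact I.stamp o h t h'
        · exact h'
      exact ⟨this.1, this.2.1.trans_le G.version_le, by rw [G.ticket_eq t this.2.1, this.2.2]⟩
    · rw [(G.op_new o (not_lt.mp h) ho).1] at ht
      cases ht
  ticketLt t h1 h2 := by
    by_cases h : t < S.version
    · rw [G.ticket_eq t h]; exact (I.ticketLt t h1 h).trans_le G.opCount_le
    · exact (G.ticket_new t (not_lt.mp h) h2).trans_le G.opCount_le
  ann i o h := by
    rcases G.announce_new i with h' | ⟨_, h2, h3, h4, _⟩
    · rw [h'] at h
      obtain ⟨h1, h2⟩ := I.ann i o h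
      exact ⟨h1.trans_le G.opCount_le, (G.proc_eq o h1).trans h2⟩
    · rw [h2] at h
      cases h
      exact ⟨h3, h4⟩
  fin o ho := by
    by_cases h : o < S.opCount
    · rcases I.fin o h with h' | ⟨i, hi⟩
      · exact .inl (G.finished I h h')
      · rcases G.announce_new i with h' | ⟨h1, _⟩
        · exact .inr ⟨i, h'.trans hi⟩
        · exact .inl (G.finished I h (h1 o hi))
    · exact .inr (G.op_new o (not_lt.mp h) ho).2.2.2.2
  rel o₁ o₂ hlt ho hp o' ho' := by
    by_cases h : o₂ < S.opCount
    · have h1 : o₁ < S.opCount := hlt.trans h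
      rw [G.proc_eq _ h, G.proc_eq _ h1] at hp
      obtain ⟨t', ht', hall⟩ := I.rel o₁ o₂ hlt h hp o' ho'
      have ho'' : o' < S.opCount := ho'.trans_lt h1
      refine ⟨t', G.ots_eq o' ho'' t' ht', fun t ht1 ht2 htk => ?_⟩
      by_cases hv : t < S.version
      · rw [G.ticket_eq t hv] at htk
        exact hall t ht1 hv htk
      · exact (I.stamp o' ho'' t' ht').2.1.trans_le (not_lt.mp hv)
    -- A process announces `o₂` only after its announced operation is finished. Then everything up
    -- to `o₁` has a timestamp, while none has been fetched for `o₂`.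
    · obtain ⟨_, _, _, rfl, i, hi⟩ := G.op_new o₂ (not_lt.mp h) ho
      have h1 : o₁ < S.opCount := hlt
      have hf : S.Finished o₁ := by
        rcases I.fin o₁ h1 with h' | ⟨j, hj⟩
        · exact h'
        · rcases G.announce_new i with h' | ⟨h2, _, _, h3, _⟩
          · rw [h'] at hi
            exact absurd (I.ann i _ hi).1 (lt_irrefl _)
          · refine h2 o₁ ?_
            rw [G.proc_eq _ h1, (I.ann j o₁ hj).2, h3] at hp
            rw [← hp, hj]
      have hv : S'.version = S.version := by
        rcases G.announce_new i with h' | ⟨_, _, _, _, h3⟩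
        · rw [h'] at hi
          exact absurd (I.ann i _ hi).1 (lt_irrefl _)
        · exact h3
      obtain ⟨_, _, _, hst, _⟩ := hf
      obtain ⟨t', ht'⟩ := Option.ne_none_iff_exists'.mp (hst o' ho')
      refine ⟨t', G.ots_eq o' (ho'.trans_lt h1) t' ht', fun t ht1 ht2 htk => ?_⟩
      rw [hv] at ht2
      rw [G.ticket_eq t ht2] at htk
      exact absurd (I.ticketLt t ht1 ht2) (by rw [htk]; exact lt_irrefl _)
  depRoot := by rw [G.dep_eq 0 I.nodePos, I.depRoot]
  versionPos := I.versionPos.trans G.version_le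

end St

end WaitFreeTree

/-! The steps that do not allocate nodes. -/

namespace WaitFreeTree

set_option linter.unusedSectionVars false

variable {κ σ ρ : Type*} {n : ℕ} [LinearOrder κ]

namespace St

variable {S S' : St κ σ ρ n} {A : Spec κ σ ρ}

theorem Guar.refl (I : S.Inv A) : Guar S S A where
  nodeCount_le := le_rfl
  opCount_le := le_rfl
  cellCount_le := le_rfl
  version_le := le_rfl
  own_eq _ _ := rfl
  item_eq _ _ := rfl
  cts_eq _ _ := rfl
  nxt_eq _ _ _ h := h
  queues := I.queues
  sep_eq _ _ := rfl
  initSz_eq _ _ := rfl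
  born_eq _ _ := rfl
  par_eq _ _ := rfl
  dep_eq _ _ := rfl
  oquery_eq _ _ := rfl
  ots_eq _ _ _ h := h
  ticket_eq _ _ := rfl
  proc_eq _ _ := rfl
  hd_le _ _ := le_rfl
  hd_lt v hv := (I.queues.ends (.node v) hv).1.1
  tl_le _ _ := le_rfl
  hd_new _ _ _ _ h h' := absurd h' (not_le.mpr h)
  hd_trav _ _ _ _ h h' _ := ⟨h, .inl h'⟩
  state _ _ := .inl rfl
  slot _ _ _ := .inl rfl
  slot_unique _ _ _ h := absurd rfl h
  slot_of_new h := absurd rfl h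
  cell_node _ hx _ _ h := absurd h.1 (not_lt.mpr hx)
  cell_trav _ hx _ _ h := absurd h.1 (not_lt.mpr hx)
  node_new _ h h' := absurd h' (not_lt.mpr h)
  op_new _ h h' := absurd h' (not_lt.mpr h)
  ots_new _ _ _ h := .inl h
  ticket_new _ h h' := absurd h' (not_lt.mpr h)
  announce_new _ := .inl rfl

/-! The effects of the steps. -/

def fetchSt (S : St κ σ ρ n) (o : OpId) : St κ σ ρ n :=
  { S with version := S.version + 1, ticket := Function.update S.ticket S.version o }

def stampSt (S : St κ σ ρ n) (o : OpId) (t : ℕ) : St κ σ ρ n :=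
  { S with ots := Function.update S.ots o (some t) }

def linkSt (S : St κ σ ρ n) (q : QRef) (y : CellId) (x : Item κ ρ) (t : ℕ) : St κ σ ρ n :=
  { S with
    cellCount := S.cellCount + 1
    own := Function.update S.own S.cellCount q
    item := Function.update S.item S.cellCount x
    cts := Function.update S.cts S.cellCount t
    nxt := Function.update (Function.update S.nxt S.cellCount none) y (some S.cellCount) }

noncomputable def tailSt (S : St κ σ ρ n) (q : QRef) (y : CellId) : St κ σ ρ n :=
  { S with tl := Function.update S.tl q y }

noncomputable def headSt (S : St κ σ ρ n) (q : QRef) (y : CellId) : St κ σ ρ n :=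
  { S with hd := Function.update S.hd q y }

def stateSt (S : St κ σ ρ n) (c : NodeId) (st : State σ) : St κ σ ρ n :=
  { S with state := Function.update S.state c st }

noncomputable def announceSt (S : St κ σ ρ n) (p : Fin n) (q : Query κ) : St κ σ ρ n :=
  let c := S.cellCount
  let o := S.opCount
  { S with
    opCount := o + 1
    cellCount := c + 3
    own := Function.update (Function.update (Function.update S.own c (.traverse o))
      (c + 1) (.traverse o)) (c + 2) (.processed o)
    item := Function.update (Function.update (Function.update S.item c .dummy)
      (c + 1) (.node 0)) (c + 2) .dummy
    cts := Function.update (Function.update (Function.update S.cts c 0) (c + 1) 0) (c + 2) 0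
    nxt := Function.update (Function.update (Function.update S.nxt c (some (c + 1)))
      (c + 1) none) (c + 2) none
    hd := Function.update (Function.update S.hd (.traverse o) c) (.processed o) (c + 2)
    tl := Function.update (Function.update S.tl (.traverse o) (c + 1)) (.processed o) (c + 2)
    oquery := Function.update S.oquery o q
    ots := Function.update S.ots o none
    announce := Function.update S.announce p (some o)
    proc := Function.update S.proc o p }

/-! ### Single register accesses obey the guarantee -/

theorem guar_fetch (I : S.Inv A) {o} (ho : o < S.opCount) : Guar S (S.fetchSt o) A :=
  { Guar.refl I with
    slot := fun _ _ _ => .inl rfl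
    queues := ⟨I.queues.ends, I.queues.vq, I.queues.next, I.queues.last, I.queues.lag⟩
    version_le := Nat.le_succ _
    ticket_eq := fun t ht => by simp [fetchSt, Function.update_of_ne ht.ne]
    ticket_new := fun t h1 h2 => by
      have : t = S.version := by simp only [fetchSt] at h2; omega
      subst this
      simpa [fetchSt] using ho
    announce_new := fun _ => .inl rfl }

theorem guar_stamp (I : S.Inv A) {o t} (hn : S.ots o = none)
    (ht : 1 ≤ t ∧ t < S.version ∧ S.ticket t = o) : Guar S (S.stampSt o t) A :=
  { Guar.refl I with
    slot := fun _ _ _ => .inl rfl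
    queues := ⟨I.queues.ends, I.queues.vq, I.queues.next, I.queues.last, I.queues.lag⟩
    ots_eq := fun o' _ t' h => by
      by_cases he : o' = o
      · subst he; rw [hn] at h; cases h
      · simpa [stampSt, Function.update_of_ne he] using h
    op_new := fun _ h h' => absurd h' (not_lt.mpr h)
    ots_new := fun o' _ t' h => by
      by_cases he : o' = o
      · subst he
        simp [stampSt] at h
        subst h
        exact .inr ht
      · left
        simpa [stampSt, Function.update_of_ne he] using h }

theorem guar_tail (I : S.Inv A) {q y z} (hq : S.VQ q) (hz : S.tl q = z) (hn : S.nxt z = some y) :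
    Guar S (S.tailSt q y) A :=
  have hz' := (I.queues.ends q hq).2
  have hy := I.queues.next z (hz ▸ hz'.1) y hn
  { Guar.refl I with
    slot := fun _ _ _ => .inl rfl
    queues :=
      { vq := I.queues.vq
        next := I.queues.next
        last := I.queues.last
        ends := fun q' hq' => ⟨(I.queues.ends q' hq').1, by
          by_cases h : q' = q
          · subst h
            rw [hz] at hz'
            simp only [tailSt, Function.update_self]
            rw [← hz'.2]
            exact hy.1
          · show S.InQ (Function.update S.tl q y q') q'
            rw [Function.update_of_ne h]
            exact (I.queues.ends q' hq').2⟩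
        lag := fun q' w hq' hw => by
          by_cases h : q' = q
          · subst h
            simp only [tailSt, Function.update_self] at hw
            rw [I.queues.lag q' y hq (by rw [hz, hn])] at hw
            cases hw
          · simp only [tailSt, Function.update_of_ne h] at hw
            exact I.queues.lag q' w hq' hw }
    tl_le := fun q' _ => by
      by_cases h : q' = q
      · subst h
        simp only [tailSt, Function.update_self]
        rw [hz]
        exact hy.2.1.le
      · simp [tailSt, Function.update_of_ne h] }

theorem QInv.head (Q : S.QInv) {q y} (h : S.InQ y q) : (S.headSt q y).QInv :=
  { vq := Q.vq
    next := Q.next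
    last := Q.last
    lag := Q.lag
    ends := fun q' hq' => ⟨by
      show S.InQ (Function.update S.hd q y q') q'
      by_cases he : q' = q
      · subst he
        rwa [Function.update_self]
      · rw [Function.update_of_ne he]
        exact (Q.ends q' hq').1, (Q.ends q' hq').2⟩ }

/-- The head moves to its direct successor, so only one descriptor is popped, and this one is
completed. -/
theorem guar_pop (I : S.Inv A) {v y d} (hn : S.nxt (S.hd (.node v)) = some y)
    (hi : S.item y = .desc d) (hr : S.Reached v d) (ha : S.AllDone v d) :
    Guar S (S.headSt (.node v) y) A :=
  have hh := (I.queues.ends (.node v) (hr.lt I)).1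
  have hy := I.queues.next _ hh.1 y hn
  have hy1 : S.InQ y (.node v) := hh.2 ▸ hy.1
  { Guar.refl I with
    slot := fun _ _ _ => .inl rfl
    queues := I.queues.head hy1
    hd_le := fun w _ => by
      by_cases h : w = v
      · subst h
        simpa only [headSt, Function.update_self] using hy.2.1.le
      · simp [headSt, h]
    hd_lt := fun w hw => by
      by_cases h : w = v
      · subst h
        simpa only [headSt, Function.update_self] using hy1.1
      · simpa [headSt, h] using (I.queues.ends (.node w) hw).1.1
    hd_new := fun w _ x hx h1 h2 => by
      by_cases h : w = v
      · subst h
        simp only [headSt, Function.update_self] at h2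
        have : x = y := le_antisymm h2 (hy.2.2 x ⟨hx.1, by rw [hx.2, hh.2]⟩ h1)
        subst this
        exact ⟨d, hi, hr, ha⟩
      · simp only [headSt, Function.update_of_ne (fun e => h (QRef.node.inj e))] at h2
        exact absurd h2 (not_le.mpr h1)
    hd_trav := fun o _ z w h1 h2 _ => ⟨h1, .inl (by simpa [headSt] using h2)⟩
    node_new := fun _ h h' => absurd h' (not_lt.mpr h)
    op_new := fun _ h h' => absurd h' (not_lt.mpr h) }

theorem guar_popTrav (I : S.Inv A) {o y t} (hy : S.InQ y (.traverse o)) (ht : S.ots o = some t)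
    (hp : ∀ y' v, S.InQ y' (.traverse o) → y' ≤ y → S.item y' = .node v →
      S.Ins v t ∧ S.Passed v t) :
    Guar S (S.headSt (.traverse o) y) A :=
  { Guar.refl I with
    slot := fun _ _ _ => .inl rfl
    queues := I.queues.head hy
    hd_le := fun w _ => by simp [headSt]
    hd_lt := fun w hw => by simpa [headSt] using (I.queues.ends (.node w) hw).1.1
    hd_new := fun w _ x hx h1 h2 => by
      simp [headSt] at h2
      exact absurd h2 (not_le.mpr h1)
    hd_trav := fun o' _ z w h1 h2 h3 => by
      by_cases h : o' = o
      · subst h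
        simp only [headSt, Function.update_self] at h2
        obtain ⟨h4, h5⟩ := hp z w h1 h2 h3
        obtain ⟨x, hx, _⟩ := id h4
        exact ⟨h1, .inr ⟨I.node_lt hx, t, ht, h4, h5⟩⟩
      · simp only [headSt, Function.update_of_ne (fun e => h (QRef.traverse.inj e))] at h2
        exact ⟨h1, .inl h2⟩
    node_new := fun _ h h' => absurd h' (not_lt.mpr h)
    op_new := fun _ h h' => absurd h' (not_lt.mpr h) }

theorem guar_state (I : S.Inv A) {c d st} (ha : S.Accepted A c d)
    (hlt : (S.state c).tsMod < d.ts) (hst : st.tsMod = d.ts) : Guar S (S.stateSt c st) A :=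
  { Guar.refl I with
    slot := fun _ _ _ => .inl rfl
    queues := ⟨I.queues.ends, I.queues.vq, I.queues.next, I.queues.last, I.queues.lag⟩
    state := fun c' _ => by
      by_cases h : c' = c
      · subst h
        right
        exact ⟨d, ha, hlt, by simpa [stateSt] using hst⟩
      · left
        simp [stateSt, h]
    node_new := fun _ h h' => absurd h' (not_lt.mpr h) }

theorem linkSt_inQ {q y x t z q'} : (S.linkSt q y x t).InQ z q' ↔
    S.InQ z q' ∨ (z = S.cellCount ∧ q' = q) := by
  simp only [InQ, linkSt]
  by_cases h : z = S.cellCount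
  · subst h
    simp [eq_comm]
  · rw [Function.update_of_ne h]
    constructor
    · rintro ⟨h1, h2⟩; exact .inl ⟨lt_of_le_of_ne (Nat.lt_succ_iff.mp h1) h, h2⟩
    · rintro (⟨h1, h2⟩ | ⟨h1, _⟩)
      · exact ⟨h1.trans (Nat.lt_succ_self _), h2⟩
      · exact absurd h1 h

/-- Having no successor, `y` is the last cell, and by `hl` the tail register points to it; so after
the linking the tail lags by exactly one cell. -/
theorem QInv.link (Q : S.QInv) {q y x t} (hy : S.InQ y q) (hn : S.nxt y = none)
    (hl : y ≤ S.tl q) : (S.linkSt q y x t).QInv where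
  ends q' hq' := ⟨linkSt_inQ.mpr (.inl (Q.ends q' (by cases q' <;> exact hq')).1),
    linkSt_inQ.mpr (.inl (Q.ends q' (by cases q' <;> exact hq')).2)⟩
  vq z hz := by
    have hz' : (S.linkSt q y x t).InQ z ((S.linkSt q y x t).own z) := ⟨hz, rfl⟩
    have : S.VQ ((S.linkSt q y x t).own z) := by
      rcases linkSt_inQ.mp hz' with h | ⟨_, h⟩
      · rw [← h.2]; exact Q.vq z h.1
      · rw [h, ← hy.2]; exact Q.vq y hy.1
    revert this
    cases (S.linkSt q y x t).own z <;> exact id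
  next z hz w hw := by
    have hyne : S.cellCount ≠ y := hy.1.ne'
    by_cases h1 : z = y
    · subst h1
      have hw' : w = S.cellCount := by simpa [linkSt, eq_comm] using hw
      subst hw'
      have hown : (S.linkSt q z x t).own z = q := by
        simp only [linkSt, Function.update_of_ne hyne.symm]; exact hy.2
      rw [hown]
      refine ⟨linkSt_inQ.mpr (.inr ⟨rfl, rfl⟩), hy.1, fun u hu hlt => ?_⟩
      rcases linkSt_inQ.mp hu with h | h
      · exact absurd hn (Q.last q z u hy h hlt)
      · exact h.1.ge
    · by_cases h2 : z = S.cellCount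
      · subst h2
        simp [linkSt, Function.update_of_ne hyne] at hw
      · simp only [linkSt, Function.update_of_ne h1, Function.update_of_ne h2] at hw
        have hz' : z < S.cellCount := lt_of_le_of_ne (Nat.lt_succ_iff.mp hz) h2
        obtain ⟨h3, h4, h5⟩ := Q.next z hz' w hw
        have hown : (S.linkSt q y x t).own z = S.own z := by
          simp only [linkSt, Function.update_of_ne h2]
        rw [hown]
        refine ⟨linkSt_inQ.mpr (.inl h3), h4, fun u hu hlt => ?_⟩
        rcases linkSt_inQ.mp hu with h | h
        · exact h5 u h hlt
        · rw [h.1]; exact h3.1.le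
  last q' z w hz hw hlt := by
    by_cases h1 : z = y
    · subst h1; simp [linkSt]
    · rcases linkSt_inQ.mp hz with hz1 | ⟨hz1, _⟩
      · have h2 : z ≠ S.cellCount := hz1.1.ne
        simp only [linkSt, Function.update_of_ne h1, Function.update_of_ne h2]
        rcases linkSt_inQ.mp hw with hw1 | ⟨_, rfl⟩
        · exact Q.last q' z w hz1 hw1 hlt
        · rcases lt_or_gt_of_ne h1 with h | h
          · exact Q.last q' z y hz1 hy h
          · exact absurd hn (Q.last q' y z hy hz1 h)
      · subst hz1
        exact absurd hlt (not_lt.mpr (Nat.lt_succ_iff.mp hw.1))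
  lag q' z hq' hz := by
    have hq'' : S.VQ q' := by cases q' <;> exact hq'
    have hyne : S.cellCount ≠ y := hy.1.ne'
    have ht := (Q.ends q' hq'').2
    by_cases h1 : S.tl q' = y
    · have : z = S.cellCount := by simpa [linkSt, h1, eq_comm] using hz
      subst this
      simp [linkSt, Function.update_of_ne hyne]
    · simp only [linkSt, Function.update_of_ne h1, Function.update_of_ne ht.1.ne] at hz
      obtain ⟨h3, h4, _⟩ := Q.next _ ht.1 z hz
      have h5 : z ≠ y := by
        rintro rfl
        have : q' = q := by rw [← ht.2, ← h3.2, hy.2]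
        subst this
        exact absurd hl (not_le.mpr h4)
      simp only [linkSt, Function.update_of_ne h5, Function.update_of_ne h3.1.ne]
      exact Q.lag q' z hq'' hz

/-- In an operations queue the timestamp has to exceed all present ones, which keeps the queue
sorted. -/
def LinkOK (S : St κ σ ρ n) (A : Spec κ σ ρ) (x : Item κ ρ) (t : ℕ) : QRef → Prop
  | .node v => ∃ d, x = .desc d ∧ t = d.ts ∧ S.Admits A v d ∧ ∀ y, S.InQ y (.node v) → S.cts y < d.ts
  | .traverse o => ∃ c d, x = .node c ∧ S.TravAdmits A o c d
  | .processed _ => True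

theorem guar_link (I : S.Inv A) {q y x t} (hy : S.InQ y q) (hn : S.nxt y = none)
    (hl : y ≤ S.tl q) (h : S.LinkOK A x t q) : Guar S (S.linkSt q y x t) A :=
  { Guar.refl I with
    slot := fun _ _ _ => .inl rfl
    cellCount_le := Nat.le_succ _
    own_eq := fun z hz => by simp [linkSt, Function.update_of_ne hz.ne]
    item_eq := fun z hz => by simp [linkSt, Function.update_of_ne hz.ne]
    cts_eq := fun z hz => by simp [linkSt, Function.update_of_ne hz.ne]
    nxt_eq := fun z hz w hw => by
      have : z ≠ y := by rintro rfl; rw [hn] at hw; cases hw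
      simpa [linkSt, Function.update_of_ne hz.ne, Function.update_of_ne this] using hw
    queues := I.queues.link hy hn hl
    hd_trav := fun o ho z v hz hle hi => by
      have h1 := (I.queues.ends (.traverse o) ho).1.1
      rcases linkSt_inQ.mp hz with h | ⟨h, _⟩
      · exact ⟨h, .inl hle⟩
      · subst h
        exact absurd (hle.trans_lt h1) (lt_irrefl _)
    cell_node := fun z hz v hv hq => by
      rcases linkSt_inQ.mp hq with h' | ⟨h', rfl⟩
      · exact absurd h'.1 (not_lt.mpr hz)
      · subst h'
        obtain ⟨d, h1, h2, h3, h4⟩ := h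
        refine ⟨d, by simpa [linkSt] using h1, by simpa [linkSt] using h2, h3, h4, fun w hw => ?_⟩
        exact Nat.lt_succ_iff.mp hw.1
    cell_trav := fun z hz o _ hq => by
      rcases linkSt_inQ.mp hq with h' | ⟨h', rfl⟩
      · exact absurd h'.1 (not_lt.mpr hz)
      · subst h'
        obtain ⟨c, d, h1, h2⟩ := h
        exact ⟨c, d, by simpa [linkSt] using h1, h2⟩
    node_new := fun _ h h' => absurd h' (not_lt.mpr h)
    op_new := fun _ h h' => absurd h' (not_lt.mpr h) }

theorem announceSt_inQ {p Q z q'} : (S.announceSt p Q).InQ z q' ↔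
    S.InQ z q' ∨ ((z = S.cellCount ∨ z = S.cellCount + 1) ∧ q' = .traverse S.opCount) ∨
      (z = S.cellCount + 2 ∧ q' = .processed S.opCount) := by
  simp only [InQ, announceSt]
  rcases lt_or_ge z S.cellCount with h | h
  · rw [Function.update_of_ne (by omega), Function.update_of_ne (by omega),
      Function.update_of_ne (by omega)]
    constructor
    · rintro ⟨_, h2⟩; exact .inl ⟨h, h2⟩
    · rintro (⟨h1, h2⟩ | ⟨h1, _⟩ | ⟨h1, _⟩)
      · exact ⟨by omega, h2⟩
      all_goals omega
  · by_cases h0 : z = S.cellCount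
    · subst h0
      rw [Function.update_of_ne (by omega), Function.update_of_ne (by omega)]
      simp [eq_comm]
    · by_cases h1 : z = S.cellCount + 1
      · subst h1
        rw [Function.update_of_ne (by omega)]
        simp [eq_comm]
      · by_cases h2 : z = S.cellCount + 2
        · subst h2
          simp [eq_comm]
        · constructor
          · rintro ⟨h3, _⟩; omega
          · rintro (⟨h1, h2⟩ | ⟨h1, _⟩ | ⟨h1, _⟩) <;> omega

theorem announceSt_nxt {p Q z} (hz : z < S.cellCount) : (S.announceSt p Q).nxt z = S.nxt z := by
  simp only [announceSt]
  rw [Function.update_of_ne (by omega), Function.update_of_ne (by omega),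
      Function.update_of_ne (by omega)]

theorem announceSt_nxt0 {p Q} : (S.announceSt p Q).nxt S.cellCount = some (S.cellCount + 1) := by
  simp only [announceSt]
  rw [Function.update_of_ne (by omega), Function.update_of_ne (by omega), Function.update_self]

theorem announceSt_nxt1 {p Q z} (h : S.cellCount < z) (h' : z < S.cellCount + 3) :
    (S.announceSt p Q).nxt z = none := by
  simp only [announceSt]
  by_cases h2 : z = S.cellCount + 2
  · subst h2; simp
  · have : z = S.cellCount + 1 := by omega
    subst this
    rw [Function.update_of_ne (by omega), Function.update_self]

theorem announceSt_vq {p Q q} : (S.announceSt p Q).VQ q ↔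
    S.VQ q ∨ q = .traverse S.opCount ∨ q = .processed S.opCount := by
  cases q <;> simp [VQ, announceSt] <;> exact le_iff_lt_or_eq

theorem announceSt_hd {p Q q} (h : S.VQ q) :
    (S.announceSt p Q).hd q = S.hd q ∧ (S.announceSt p Q).tl q = S.tl q := by
  have h1 : q ≠ .traverse S.opCount := by rintro rfl; exact lt_irrefl _ h
  have h2 : q ≠ .processed S.opCount := by rintro rfl; exact lt_irrefl _ h
  simp [announceSt, Function.update_of_ne h1, Function.update_of_ne h2]

theorem QInv.announce (Q : S.QInv) {p q} : (S.announceSt p q).QInv where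
  ends q' hq' := by
    rcases announceSt_vq.mp hq' with h | rfl | rfl
    · rw [(announceSt_hd h).1, (announceSt_hd h).2]
      exact ⟨announceSt_inQ.mpr (.inl (Q.ends q' h).1), announceSt_inQ.mpr (.inl (Q.ends q' h).2)⟩
    · exact ⟨announceSt_inQ.mpr (by simp [announceSt]), announceSt_inQ.mpr (by simp [announceSt])⟩
    · exact ⟨announceSt_inQ.mpr (by simp [announceSt]), announceSt_inQ.mpr (by simp [announceSt])⟩
  vq z hz := by
    rw [announceSt_vq]
    have hz' : (S.announceSt p q).InQ z ((S.announceSt p q).own z) := ⟨hz, rfl⟩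
    rcases announceSt_inQ.mp hz' with h | ⟨_, h⟩ | ⟨_, h⟩
    · left; rw [← h.2]; exact Q.vq z h.1
    · right; left; exact h
    · right; right; exact h
  next z hz w hw := by
    rcases lt_or_ge z S.cellCount with h | h
    · rw [announceSt_nxt h] at hw
      obtain ⟨h1, h2, h3⟩ := Q.next z h w hw
      have hz' : (S.announceSt p q).InQ z (S.own z) := announceSt_inQ.mpr (.inl ⟨h, rfl⟩)
      rw [hz'.2]
      refine ⟨announceSt_inQ.mpr (.inl h1), h2, fun u hu hlt => ?_⟩
      rcases announceSt_inQ.mp hu with h' | ⟨h', _⟩ | ⟨h', _⟩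
      · exact h3 u h' hlt
      · have := h1.1; omega
      · have := h1.1; omega
    · by_cases h0 : z = S.cellCount
      · subst h0
        rw [announceSt_nxt0] at hw
        cases hw
        have hz' : (S.announceSt p q).InQ S.cellCount (.traverse S.opCount) :=
          announceSt_inQ.mpr (by simp)
        rw [hz'.2]
        exact ⟨announceSt_inQ.mpr (by simp), Nat.lt_succ_self _, fun u _ hlt => hlt⟩
      · rw [announceSt_nxt1 (by omega) hz] at hw
        cases hw
  last q' z w hz hw hlt := by
    rcases announceSt_inQ.mp hz with h | ⟨h, rfl⟩ | ⟨h, rfl⟩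
    · rw [announceSt_nxt h.1]
      rcases announceSt_inQ.mp hw with h' | ⟨h', rfl⟩ | ⟨h', rfl⟩
      · exact Q.last q' z w h h' hlt
      · have := Q.vq z h.1
        rw [h.2] at this
        exact absurd this (lt_irrefl _)
      · have := Q.vq z h.1
        rw [h.2] at this
        exact absurd this (lt_irrefl _)
    · rcases announceSt_inQ.mp hw with h' | ⟨h', _⟩ | ⟨_, h'⟩
      · have := Q.vq w h'.1
        rw [h'.2] at this
        exact absurd this (lt_irrefl _)
      · have : z = S.cellCount := by omega
        subst this
        rw [announceSt_nxt0]
        simp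
      · cases h'
    · rcases announceSt_inQ.mp hw with h' | ⟨_, h'⟩ | ⟨h', _⟩
      · have := Q.vq w h'.1
        rw [h'.2] at this
        exact absurd this (lt_irrefl _)
      · cases h'
      · omega
  lag q' z hq' hz := by
    rcases announceSt_vq.mp hq' with h | rfl | rfl
    · have ht := (Q.ends q' h).2.1
      rw [(announceSt_hd h).2, announceSt_nxt ht] at hz
      rw [announceSt_nxt (Q.next _ ht z hz).1.1]
      exact Q.lag q' z h hz
    · have : (S.announceSt p q).tl (.traverse S.opCount) = S.cellCount + 1 := by simp [announceSt]
      rw [this, announceSt_nxt1 (by omega) (by omega)] at hz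
      cases hz
    · have : (S.announceSt p q).tl (.processed S.opCount) = S.cellCount + 2 := by simp [announceSt]
      rw [this, announceSt_nxt1 (by omega) (by omega)] at hz
      cases hz

theorem guar_announce (I : S.Inv A) {p Q} (hp : ∀ o, S.announce p = some o → S.Finished o) :
    Guar S (S.announceSt p Q) A :=
  { Guar.refl I with
    slot := fun _ _ _ => .inl rfl
    opCount_le := Nat.le_succ _
    cellCount_le := by simp [announceSt]
    own_eq := fun z hz => by
      simp only [announceSt]
      rw [Function.update_of_ne (by omega), Function.update_of_ne (by omega),
        Function.update_of_ne (by omega)]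
    item_eq := fun z hz => by
      simp only [announceSt]
      rw [Function.update_of_ne (by omega), Function.update_of_ne (by omega),
        Function.update_of_ne (by omega)]
    cts_eq := fun z hz => by
      simp only [announceSt]
      rw [Function.update_of_ne (by omega), Function.update_of_ne (by omega),
        Function.update_of_ne (by omega)]
    nxt_eq := fun z hz w hw => by rw [announceSt_nxt hz, hw]
    queues := I.queues.announce
    oquery_eq := fun o ho => by simp [announceSt, Function.update_of_ne ho.ne]
    ots_eq := fun o ho t ht => by simpa [announceSt, Function.update_of_ne ho.ne] using ht
    proc_eq := fun o ho => by simp [announceSt, Function.update_of_ne ho.ne]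
    tl_le := fun q hq => by rw [(announceSt_hd hq).2]
    hd_le := fun v hv => by rw [(announceSt_hd (q := .node v) hv).1]
    hd_lt := fun v hv => by
      rw [(announceSt_hd (q := .node v) hv).1]
      exact (I.queues.ends (.node v) hv).1.1
    hd_new := fun v hv x _ h1 h2 => by
      rw [(announceSt_hd (q := .node v) hv).1] at h2
      exact absurd h2 (not_le.mpr h1)
    hd_trav := fun o ho y v h1 h2 h3 => by
      rw [(announceSt_hd (q := .traverse o) ho).1] at h2
      rcases announceSt_inQ.mp h1 with h' | ⟨_, h'⟩ | ⟨_, h'⟩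
      · exact ⟨h', .inl h2⟩
      · cases h'
        exact absurd ho (lt_irrefl _)
      · cases h'
    cell_node := fun x hx v _ h => by
      rcases announceSt_inQ.mp h with h' | ⟨_, h'⟩ | ⟨_, h'⟩
      · exact absurd h'.1 (not_lt.mpr hx)
      · cases h'
      · cases h'
    cell_trav := fun x hx o ho h => by
      rcases announceSt_inQ.mp h with h' | ⟨_, h'⟩ | ⟨_, h'⟩
      · exact absurd h'.1 (not_lt.mpr hx)
      · cases h'
        exact absurd ho (lt_irrefl _)
      · cases h'
    node_new := fun _ h h' => absurd h' (not_lt.mpr h)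
    op_new := fun o h h' => by
      have : o = S.opCount := le_antisymm (Nat.lt_succ_iff.mp h') h
      subst this
      refine ⟨by simp [announceSt], ⟨S.cellCount + 1, announceSt_inQ.mpr (by simp), ?_⟩, ?_, rfl,
        p, by simp [announceSt]⟩
      · simp only [announceSt]
        rw [Function.update_of_ne (by omega), Function.update_self]
      · intro y hy
        rcases announceSt_inQ.mp hy with h' | ⟨rfl | rfl, _⟩ | ⟨_, h'⟩
        · exact absurd (I.trav_lt h') (lt_irrefl _)
        · left
          simp only [announceSt]
          rw [Function.update_of_ne (by omega), Function.update_of_ne (by omega),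
            Function.update_self]
        · right
          constructor
          · simp only [announceSt]
            rw [Function.update_of_ne (by omega), Function.update_self]
          · simp [announceSt]
        · cases h'
    ots_new := fun o ho t ht => .inl (by simpa [announceSt, Function.update_of_ne ho.ne] using ht)
    announce_new := fun i => by
      by_cases h : i = p
      · subst h
        exact .inr ⟨hp, by simp [announceSt], Nat.lt_succ_self _, by simp [announceSt], rfl⟩
      · exact .inl (by simp [announceSt, Function.update_of_ne h]) }

end St

end WaitFreeTree

/-! The allocation of trees, and the replacement of children. -/

namespace WaitFreeTree

set_option linter.unusedSectionVars false

variable {κ σ ρ : Type*} {n : ℕ} [LinearOrder κ]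

namespace St

variable {S S' S'' : St κ σ ρ n} {A : Spec κ σ ρ}

/-- The allocation of a tree with root `r`, which is going to be put at `tgt`. -/
structure Grow (S S' : St κ σ ρ n) (b : ℕ) (r : Ref κ) (tgt : ℕ × Side) (k len : ℕ) : Prop where
  nodeCount_le : S.nodeCount ≤ S'.nodeCount
  cellCount_le : S.cellCount ≤ S'.cellCount
  opCount_eq : S'.opCount = S.opCount
  version_eq : S'.version = S.version
  oquery_eq : S'.oquery = S.oquery
  ots_eq : S'.ots = S.ots
  announce_eq : S'.announce = S.announce
  ticket_eq : S'.ticket = S.ticket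
  proc_eq : S'.proc = S.proc
  old_cell : ∀ x < S.cellCount, S'.own x = S.own x ∧ S'.item x = S.item x ∧ S'.cts x = S.cts x ∧
    S'.nxt x = S.nxt x
  old_queue : ∀ q, (∀ v, q = .node v → v < S.nodeCount) → S'.hd q = S.hd q ∧ S'.tl q = S.tl q
  old_node : ∀ v < S.nodeCount, S'.sep v = S.sep v ∧ S'.initSz v = S.initSz v ∧
    S'.born v = S.born v ∧ S'.state v = S.state v ∧ S'.child v = S.child v ∧ S'.par v = S.par v ∧
    S'.dep v = S.dep v
  new_cell : ∀ x, S.cellCount ≤ x → x < S'.cellCount → S'.item x = .dummy ∧ S'.cts x = b ∧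
    S'.nxt x = none ∧ ∃ v, S.nodeCount ≤ v ∧ v < S'.nodeCount ∧ S'.own x = .node v ∧
      S'.hd (.node v) = x
  new_node : ∀ v, S.nodeCount ≤ v → v < S'.nodeCount →
    S.cellCount ≤ S'.hd (.node v) ∧ S'.hd (.node v) < S'.cellCount ∧
    S'.own (S'.hd (.node v)) = .node v ∧ S'.tl (.node v) = S'.hd (.node v) ∧
    S'.born v = b ∧ (S'.state v).tsMod = b ∧ (S'.state v).modCnt = 0 ∧ 2 ≤ S'.initSz v ∧
    S'.dep v < k + (S'.nodeCount - S.nodeCount) ∧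
    ∀ s, S'.rts (S'.child v s) = b ∧ ∀ c : ℕ, S'.child v s = .inner c →
      S.nodeCount ≤ c ∧ c < S'.nodeCount ∧ S'.par c = (v, s) ∧ S'.dep c = S'.dep v + 1
  root : S'.rts r = b ∧ ∀ c : ℕ, r = .inner c →
    S.nodeCount ≤ c ∧ c < S'.nodeCount ∧ S'.par c = tgt ∧ S'.dep c = k
  len : S'.nodeCount ≤ S.nodeCount + (len - 1)

theorem Grow.leaf {b r tgt k l} (h : ∀ c, r ≠ .inner c) (hr : r.ts = b) :
    Grow S S b r tgt k l where
  nodeCount_le := le_rfl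
  cellCount_le := le_rfl
  opCount_eq := rfl
  version_eq := rfl
  oquery_eq := rfl
  ots_eq := rfl
  announce_eq := rfl
  ticket_eq := rfl
  proc_eq := rfl
  old_cell _ _ := ⟨rfl, rfl, rfl, rfl⟩
  old_queue _ _ := ⟨rfl, rfl⟩
  old_node _ _ := ⟨rfl, rfl, rfl, rfl, rfl, rfl, rfl⟩
  new_cell _ h h' := absurd h' (not_lt.mpr h)
  new_node _ h h' := absurd h' (not_lt.mpr h)
  root := ⟨by cases r <;> simp_all [rts, Ref.ts], fun c hc => absurd hc (h c)⟩
  len := Nat.le_add_right _ _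

noncomputable def nodeSt (S : St κ σ ρ n) (sep : κ) (sz b : ℕ) (l r : Ref κ) (a : σ)
    (tgt : ℕ × Side) (k : ℕ) : St κ σ ρ n :=
  { S with
    nodeCount := S.nodeCount + 1
    cellCount := S.cellCount + 1
    own := Function.update S.own S.cellCount (.node S.nodeCount)
    item := Function.update S.item S.cellCount .dummy
    cts := Function.update S.cts S.cellCount b
    nxt := Function.update S.nxt S.cellCount none
    hd := Function.update S.hd (.node S.nodeCount) S.cellCount
    tl := Function.update S.tl (.node S.nodeCount) S.cellCount
    sep := Function.update S.sep S.nodeCount (some sep)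
    initSz := Function.update S.initSz S.nodeCount sz
    born := Function.update S.born S.nodeCount b
    state := Function.update S.state S.nodeCount ⟨a, 0, b⟩
    child := Function.update S.child S.nodeCount (fun s => match s with | .left => l | .right => r)
    par := Function.update S.par S.nodeCount tgt
    dep := Function.update S.dep S.nodeCount k }

theorem update_apply_fun {α β : Type*} (f : α → β) (h : ℕ → α) (i j : ℕ) (x : α) :
    f (Function.update h i x j) = Function.update (fun j => f (h j)) i (f x) j := by
  by_cases e : j = i <;> simp [Function.update, e]

theorem update_apply_id {α β : Type*} (f : α → β) (h : ℕ → α) (i j : ℕ) (x : α)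
    (hf : f x = f (h i)) : f (Function.update h i x j) = f (h j) := by
  by_cases e : j = i
  · subst e; simp [hf]
  · simp [Function.update, e]

theorem view_newNode (m : Mem κ σ ρ n) (g : Ghost n) (sep : κ) (sz b : ℕ) (l r : Ref κ) (a : σ)
    (tgt : ℕ × Side) (k : ℕ) :
    view (m.newNode sep sz b l r a)
      { g with
        own := Function.update g.own m.cellCount (.node m.nodeCount)
        par := Function.update g.par m.nodeCount tgt
        dep := Function.update g.dep m.nodeCount k } =
      (view m g).nodeSt sep sz b l r a tgt k := by
  apply St.ext <;> try rfl
  all_goals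
    funext z
    simp only [view, nodeSt, Mem.newNode, Mem.newCell, Mem.setCell, Mem.setNode]
  · exact update_apply_fun (fun x : Cell κ ρ => x.item) _ _ _ _
  · exact update_apply_fun (fun x : Cell κ ρ => x.ts) _ _ _ _
  · exact update_apply_fun (fun x : Cell κ ρ => x.next) _ _ _ _
  · cases z with
    | node v => by_cases e : v = m.nodeCount <;> simp [Mem.queue, Function.update, e]
    | _ => simp [Mem.queue]
  · cases z with
    | node v => by_cases e : v = m.nodeCount <;> simp [Mem.queue, Function.update, e]
    | _ => simp [Mem.queue]
  · exact update_apply_fun (fun x : Node κ σ => x.sep) _ _ _ _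
  · exact update_apply_fun (fun x : Node κ σ => x.initSz) _ _ _ _
  · exact update_apply_fun (fun x : Node κ σ => x.born) _ _ _ _
  · exact update_apply_fun (fun x : Node κ σ => x.state) _ _ _ _
  · by_cases e : z = m.nodeCount
    · subst e
      funext s
      cases s <;> simp [Node.child]
    · simp [Function.update, e]

theorem Grow.rts_eq {b r tgt k l} (G : Grow S S' b r tgt k l) {x : Ref κ}
    (h : ∀ c, x = .inner c → c < S.nodeCount) : S'.rts x = S.rts x := by
  cases x with
  | inner c => exact (G.old_node c (h c rfl)).2.2.1
  | _ => rfl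

/-- The left subtree is old memory while the right one is built, and both are when the root is
added. At most `len₁ - 1` and `len₂ - 1` nodes and the root make at most `len - 1`. -/
theorem Grow.node {S₁ S₂ : St κ σ ρ n} {b l r k len len₁ len₂ tgt sep sz a}
    (L : Grow S S₁ b l (S₂.nodeCount, .left) (k + 1) len₁)
    (R : Grow S₁ S₂ b r (S₂.nodeCount, .right) (k + 1) len₂)
    (hsz : 2 ≤ sz) (h1 : 1 ≤ len₁) (h2 : 1 ≤ len₂) (hl : len₁ + len₂ = len) :
    Grow S (S₂.nodeSt sep sz b l r a tgt k) b (.inner S₂.nodeCount) tgt k len := by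
  have hn1 := L.nodeCount_le
  have hn2 := R.nodeCount_le
  have hc1 := L.cellCount_le
  have hc2 := R.cellCount_le
  have lenL := L.len
  have lenR := R.len
  have ocell : ∀ x < S₂.cellCount, (S₂.nodeSt sep sz b l r a tgt k).own x = S₂.own x ∧
      (S₂.nodeSt sep sz b l r a tgt k).item x = S₂.item x ∧
      (S₂.nodeSt sep sz b l r a tgt k).cts x = S₂.cts x ∧
      (S₂.nodeSt sep sz b l r a tgt k).nxt x = S₂.nxt x := fun x hx => by
    simp [nodeSt, Function.update_of_ne hx.ne]
  have oq : ∀ q, (∀ v, q = .node v → v < S₂.nodeCount) →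
      (S₂.nodeSt sep sz b l r a tgt k).hd q = S₂.hd q ∧
      (S₂.nodeSt sep sz b l r a tgt k).tl q = S₂.tl q := fun q hq => by
    have : q ≠ .node S₂.nodeCount := fun h => lt_irrefl _ (hq _ h)
    simp [nodeSt, Function.update_of_ne this]
  have onode : ∀ v < S₂.nodeCount, (S₂.nodeSt sep sz b l r a tgt k).sep v = S₂.sep v ∧
      (S₂.nodeSt sep sz b l r a tgt k).initSz v = S₂.initSz v ∧
      (S₂.nodeSt sep sz b l r a tgt k).born v = S₂.born v ∧
      (S₂.nodeSt sep sz b l r a tgt k).state v = S₂.state v ∧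
      (S₂.nodeSt sep sz b l r a tgt k).child v = S₂.child v ∧
      (S₂.nodeSt sep sz b l r a tgt k).par v = S₂.par v ∧
      (S₂.nodeSt sep sz b l r a tgt k).dep v = S₂.dep v := fun v hv => by
    simp [nodeSt, Function.update_of_ne hv.ne]
  have hrts : ∀ x : Ref κ, (∀ c, x = .inner c → c < S₂.nodeCount) →
      (S₂.nodeSt sep sz b l r a tgt k).rts x = S₂.rts x := fun x h => by
    cases x with
    | inner c => exact (onode c (h c rfl)).2.2.1
    | _ => rfl
  have hNl : ∀ c : ℕ, l = .inner c → c < S₁.nodeCount := fun c hc => (L.root.2 c hc).2.1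
  have hNr : ∀ c : ℕ, r = .inner c → c < S₂.nodeCount := fun c hc => (R.root.2 c hc).2.1
  have hN : (S₂.nodeSt sep sz b l r a tgt k).nodeCount = S₂.nodeCount + 1 := rfl
  have hC : (S₂.nodeSt sep sz b l r a tgt k).cellCount = S₂.cellCount + 1 := rfl
  constructor
  case nodeCount_le => omega
  case cellCount_le => omega
  case opCount_eq => exact R.opCount_eq.trans L.opCount_eq
  case version_eq => exact R.version_eq.trans L.version_eq
  case oquery_eq => exact R.oquery_eq.trans L.oquery_eq
  case ots_eq => exact R.ots_eq.trans L.ots_eq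
  case announce_eq => exact R.announce_eq.trans L.announce_eq
  case ticket_eq => exact R.ticket_eq.trans L.ticket_eq
  case proc_eq => exact R.proc_eq.trans L.proc_eq
  case old_cell =>
    intro x hx
    obtain ⟨a1, a2, a3, a4⟩ := ocell x (by omega)
    obtain ⟨b1, b2, b3, b4⟩ := R.old_cell x (by omega)
    obtain ⟨c1, c2, c3, c4⟩ := L.old_cell x hx
    exact ⟨a1.trans (b1.trans c1), a2.trans (b2.trans c2), a3.trans (b3.trans c3),
      a4.trans (b4.trans c4)⟩
  case old_queue =>
    intro q hq
    obtain ⟨a1, a2⟩ := oq q (fun v hv => (hq v hv).trans_le (by omega))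
    obtain ⟨b1, b2⟩ := R.old_queue q (fun v hv => (hq v hv).trans_le (by omega))
    obtain ⟨c1, c2⟩ := L.old_queue q hq
    exact ⟨a1.trans (b1.trans c1), a2.trans (b2.trans c2)⟩
  case old_node =>
    intro v hv
    obtain ⟨a1, a2, a3, a4, a5, a6, a7⟩ := onode v (by omega)
    obtain ⟨b1, b2, b3, b4, b5, b6, b7⟩ := R.old_node v (by omega)
    obtain ⟨c1, c2, c3, c4, c5, c6, c7⟩ := L.old_node v hv
    exact ⟨a1.trans (b1.trans c1), a2.trans (b2.trans c2), a3.trans (b3.trans c3),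
      a4.trans (b4.trans c4), a5.trans (b5.trans c5), a6.trans (b6.trans c6),
      a7.trans (b7.trans c7)⟩
  case new_cell =>
    intro x hx hx'
    rcases lt_or_ge x S₂.cellCount with h | h
    · obtain ⟨a1, a2, a3, a4⟩ := ocell x h
      rw [a1, a2, a3, a4]
      rcases lt_or_ge x S₁.cellCount with h' | h'
      · obtain ⟨b1, b2, b3, b4⟩ := R.old_cell x h'
        rw [b1, b2, b3, b4]
        obtain ⟨c1, c2, c3, v, c4, c5, c6, c7⟩ := L.new_cell x hx h'
        refine ⟨c1, c2, c3, v, c4, by omega, c6, ?_⟩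
        rw [(oq _ fun w hw => by cases hw; omega).1,
          (R.old_queue _ fun w hw => by cases hw; omega).1, c7]
      · obtain ⟨c1, c2, c3, v, c4, c5, c6, c7⟩ := R.new_cell x h' h
        refine ⟨c1, c2, c3, v, by omega, by omega, c6, ?_⟩
        rw [(oq _ fun w hw => by cases hw; omega).1, c7]
    · have : x = S₂.cellCount := by omega
      subst this
      exact ⟨by simp [nodeSt], by simp [nodeSt], by simp [nodeSt], S₂.nodeCount, by omega, by omega,
        by simp [nodeSt], by simp [nodeSt]⟩
  case new_node =>
    intro v hv hv'
    rcases lt_or_ge v S₂.nodeCount with h | h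
    · obtain ⟨a1, a2, a3, a4, a5, a6, a7⟩ := onode v h
      obtain ⟨q1, q2⟩ := oq (.node v) (fun w hw => by cases hw; exact h)
      rw [a2, a3, a4, a5, a7, q1, q2]
      rcases lt_or_ge v S₁.nodeCount with h' | h'
      · obtain ⟨b1, b2, b3, b4, b5, b6, b7⟩ := R.old_node v h'
        obtain ⟨r1, r2⟩ := R.old_queue (.node v) (fun w hw => by cases hw; exact h')
        rw [b2, b3, b4, b5, b7, r1, r2]
        obtain ⟨c1, c2, c3, c4, c5, c6, c7, c8, c9, c10⟩ := L.new_node v hv h'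
        refine ⟨c1, by omega, ?_, c4, c5, c6, c7, c8, by omega, fun s => ?_⟩
        · rw [(ocell _ (by omega)).1, (R.old_cell _ c2).1, c3]
        · obtain ⟨d1, d2⟩ := c10 s
          have d3 : ∀ c : ℕ, S₁.child v s = .inner c → c < S₁.nodeCount := fun c hc => (d2 c hc).2.1
          refine ⟨?_, fun c hc => ?_⟩
          · rw [hrts _ (fun c hc => (d3 c hc).trans_le hn2), R.rts_eq d3, d1]
          · obtain ⟨e1, e2, e3, e4⟩ := d2 c hc
            obtain ⟨-, -, -, -, -, f6, f7⟩ := onode c (by omega)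
            obtain ⟨-, -, -, -, -, g6, g7⟩ := R.old_node c e2
            exact ⟨e1, by omega, by rw [f6, g6, e3], by rw [f7, g7, e4]⟩
      · obtain ⟨c1, c2, c3, c4, c5, c6, c7, c8, c9, c10⟩ := R.new_node v h' h
        refine ⟨by omega, by omega, ?_, c4, c5, c6, c7, c8, by omega, fun s => ?_⟩
        · rw [(ocell _ (by omega)).1, c3]
        · obtain ⟨d1, d2⟩ := c10 s
          have d3 : ∀ c : ℕ, S₂.child v s = .inner c → c < S₂.nodeCount := fun c hc => (d2 c hc).2.1
          refine ⟨?_, fun c hc => ?_⟩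
          · rw [hrts _ d3, d1]
          · obtain ⟨e1, e2, e3, e4⟩ := d2 c hc
            obtain ⟨-, -, -, -, -, f6, f7⟩ := onode c (by omega)
            exact ⟨by omega, by omega, by rw [f6, e3], by rw [f7, e4]⟩
    · have : v = S₂.nodeCount := by omega
      subst this
      have hd : (S₂.nodeSt sep sz b l r a tgt k).hd (.node S₂.nodeCount) = S₂.cellCount := by
        simp [nodeSt]
      have hdep : (S₂.nodeSt sep sz b l r a tgt k).dep S₂.nodeCount = k := by simp [nodeSt]
      rw [hd, hdep]
      refine ⟨by omega, by omega, by simp [nodeSt], by simp [nodeSt], by simp [nodeSt],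
        by simp [nodeSt], by simp [nodeSt], by simpa [nodeSt] using hsz, by omega, fun s => ?_⟩
      cases s with
      | left =>
        have : (S₂.nodeSt sep sz b l r a tgt k).child S₂.nodeCount .left = l := by simp [nodeSt]
        rw [this]
        refine ⟨?_, fun c hc => ?_⟩
        · rw [hrts _ (fun c hc => (hNl c hc).trans_le hn2), R.rts_eq hNl, L.root.1]
        · obtain ⟨e1, e2, e3, e4⟩ := L.root.2 c hc
          obtain ⟨-, -, -, -, -, f6, f7⟩ := onode c (by omega)
          obtain ⟨-, -, -, -, -, g6, g7⟩ := R.old_node c e2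
          exact ⟨e1, by omega, by rw [f6, g6, e3], by rw [f7, g7, e4]⟩
      | right =>
        have : (S₂.nodeSt sep sz b l r a tgt k).child S₂.nodeCount .right = r := by simp [nodeSt]
        rw [this]
        refine ⟨?_, fun c hc => ?_⟩
        · rw [hrts _ hNr, R.root.1]
        · obtain ⟨e1, e2, e3, e4⟩ := R.root.2 c hc
          obtain ⟨-, -, -, -, -, f6, f7⟩ := onode c (by omega)
          exact ⟨by omega, by omega, by rw [f6, e3], by rw [f7, e4]⟩
  case root =>
    refine ⟨by simp [rts, nodeSt], fun c hc => ?_⟩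
    cases hc
    exact ⟨by omega, by omega, by simp [nodeSt], by simp [nodeSt]⟩
  case len => omega

theorem grow_build (A : Spec κ σ ρ) (b : ℕ) (keys : List κ) :
    ∀ (m : Mem κ σ ρ n) (g : Ghost n) (tgt : ℕ × Side) (k : ℕ), ∃ g' : Ghost n,
      Grow (view m g) (view (build A b keys m).2 g') b (build A b keys m).1 tgt k keys.length := by
  induction hl : keys.length using Nat.strong_induction_on generalizing keys with
  | _ len ih =>
    intro m g tgt k
    match keys, hl with
    | [], _ => exact ⟨g, by rw [build]; exact Grow.leaf (fun c => by simp) rfl⟩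
    | [x], _ => exact ⟨g, by rw [build]; exact Grow.leaf (fun c => by simp) rfl⟩
    | x :: y :: l, hl =>
      rw [build]
      set keys := x :: y :: l with hkeys
      have h2 : 2 ≤ keys.length := by simp [hkeys]
      set h := keys.length / 2 with hh
      set L := build A b (keys.take h) m with hL
      set R := build A b (keys.drop h) L.2 with hR
      have e1 : (keys.take h).length = h := by rw [List.length_take]; omega
      have e2 : (keys.drop h).length = keys.length - h := by simp
      -- The common parent is allocated last. Its address can be recorded in advance, since the
      -- memory that is built does not depend on the history information.
      obtain ⟨g1, G1⟩ := ih h (by omega) (keys.take h) e1 m g (R.2.nodeCount, .left) (k + 1)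
      obtain ⟨g2, G2⟩ := ih (keys.length - h) (by omega) (keys.drop h) e2 L.2 g1
        (R.2.nodeCount, .right) (k + 1)
      refine ⟨{ g2 with
        own := Function.update g2.own R.2.cellCount (.node R.2.nodeCount)
        par := Function.update g2.par R.2.nodeCount tgt
        dep := Function.update g2.dep R.2.nodeCount k }, ?_⟩
      show Grow _ (view (R.2.newNode (keys.getD h x) keys.length b L.1 R.1 (A.ofKeys keys)) _) b
          (.inner R.2.nodeCount) tgt k len
      rw [view_newNode R.2 g2 _ _ _ _ _ _ tgt k]
      exact Grow.node (S₂ := view R.2 g2) G1 G2 h2 (by omega) (by omega) (by omega)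

def childSt (S : St κ σ ρ n) (v : ℕ) (s : Side) (r : Ref κ) : St κ σ ρ n :=
  { S with child := Function.update S.child v (Function.update (S.child v) s r) }

theorem Grow.queues {b r tgt k l} (Q : S.QInv) (G : Grow S S' b r tgt k l) : S'.QInv := by
  have hn := G.nodeCount_le
  have hc := G.cellCount_le
  have inQ : ∀ {x q}, S.InQ x q → S'.InQ x q := fun {x q} h =>
    ⟨h.1.trans_le hc, by rw [(G.old_cell x h.1).1, h.2]⟩
  have back : ∀ {x q}, S'.InQ x q → S.InQ x q ∨ (S.cellCount ≤ x ∧ ∃ v, q = .node v ∧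
      S.nodeCount ≤ v ∧ v < S'.nodeCount ∧ S'.hd (.node v) = x) := fun {x q} h => by
    rcases lt_or_ge x S.cellCount with h' | h'
    · exact .inl ⟨h', by rw [← (G.old_cell x h').1, h.2]⟩
    · obtain ⟨-, -, -, v, h1, h2, h3, h4⟩ := G.new_cell x h' h.1
      exact .inr ⟨h', v, by rw [← h.2, h3], h1, h2, h4⟩
  have vq : ∀ {q}, S'.VQ q → S.VQ q ∨ ∃ v, q = .node v ∧ S.nodeCount ≤ v ∧ v < S'.nodeCount := by
    intro q h
    cases q with
    | node v => exact (lt_or_ge v S.nodeCount).imp id fun h' => ⟨v, rfl, h', h⟩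
    | traverse o => exact .inl (show o < S.opCount from G.opCount_eq ▸ h)
    | processed o => exact .inl (show o < S.opCount from G.opCount_eq ▸ h)
  have vq' : ∀ {q}, S.VQ q → S'.VQ q := by
    intro q h
    cases q with
    | node v => exact lt_of_lt_of_le (b := S.nodeCount) h hn
    | traverse o => exact (G.opCount_eq.symm ▸ h : o < S'.opCount)
    | processed o => exact (G.opCount_eq.symm ▸ h : o < S'.opCount)
  have oq : ∀ {q}, S.VQ q → S'.hd q = S.hd q ∧ S'.tl q = S.tl q := fun {q} h =>
    G.old_queue q (by rintro v rfl; exact h)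
  constructor
  · intro q hq
    rcases vq hq with h | ⟨v, rfl, h1, h2⟩
    · rw [(oq h).1, (oq h).2]
      exact ⟨inQ (Q.ends q h).1, inQ (Q.ends q h).2⟩
    · obtain ⟨a1, a2, a3, a4, -⟩ := G.new_node v h1 h2
      rw [a4]
      exact ⟨⟨a2, a3⟩, ⟨a2, a3⟩⟩
  · intro x hx
    rcases back (x := x) ⟨hx, rfl⟩ with h | ⟨-, v, h, -, h2, -⟩
    · rw [← h.2]; exact vq' (Q.vq x h.1)
    · rw [h]; exact h2
  · intro x hx y hy
    rcases lt_or_ge x S.cellCount with h | h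
    · rw [(G.old_cell x h).2.2.2] at hy
      obtain ⟨h1, h2, h3⟩ := Q.next x h y hy
      rw [(G.old_cell x h).1]
      refine ⟨inQ h1, h2, fun z hz hlt => ?_⟩
      rcases back hz with h' | ⟨h', _⟩
      · exact h3 z h' hlt
      · exact h1.1.le.trans h'
    · rw [(G.new_cell x h hx).2.2.1] at hy
      cases hy
  · intro q x y hx hy hlt
    rcases back hx with h | ⟨h1, v, rfl, h2, h3, h4⟩
    · rw [(G.old_cell x h.1).2.2.2]
      rcases back hy with h' | ⟨_, v, rfl, h2, _⟩
      · exact Q.last q x y h h' hlt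
      · have := Q.vq x h.1
        rw [h.2] at this
        exact absurd this (not_lt.mpr h2)
    · rcases back hy with h | ⟨_, w, hw, _, _, h4'⟩
      · have := h.1
        omega
      · cases hw
        omega
  · intro q y hq hy
    rcases vq hq with h | ⟨v, rfl, h1, h2⟩
    · have ht := (Q.ends q h).2.1
      rw [(oq h).2, (G.old_cell _ ht).2.2.2] at hy
      rw [(G.old_cell _ (Q.next _ ht y hy).1.1).2.2.2]
      exact Q.lag q y h hy
    · obtain ⟨a1, a2, a3, a4, -⟩ := G.new_node v h1 h2
      rw [a4, (G.new_cell _ a1 a2).2.2.1] at hy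
      cases hy

/-- What justifies the replacement of the child of `v` at `s` by a new tree with `len` keys marked
with `b`. -/
def ReplaceOK (S : St κ σ ρ n) (A : Spec κ σ ρ) (v : ℕ) (s : Side) (b len : ℕ) : Prop :=
  (∃ d q, S.Reached v d ∧ (s, q) ∈ route d.query (S.sep v) ∧ (∀ c, S.child v s ≠ .inner c) ∧
    (S.child v s).ts < d.ts ∧ leafUpdate q (S.child v s) ≠ none ∧ b = d.ts ∧ len ≤ 2) ∨
  (∃ c d, S.child v s = .inner c ∧ S.Doomed A c d ∧ S.Clr c ∧ b + 1 = d.ts ∧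
    len ≤ (S.below c).card + 1)

theorem guar_replace (I : S.Inv A) {v s b r len} (hv : v < S.nodeCount)
    (h : S.ReplaceOK A v s b len) (G : Grow S S' b r (v, s) (S.dep v + 1) len) :
    Guar S (S'.childSt v s r) A := by
  have hn := G.nodeCount_le
  have hc := G.cellCount_le
  have hlen := G.len
  have back : ∀ {x q}, (S'.childSt v s r).InQ x q → S.InQ x q ∨ (S.cellCount ≤ x ∧ ∃ v, q = .node v ∧
      S.nodeCount ≤ v ∧ v < S'.nodeCount ∧ S'.hd (.node v) = x) := fun {x q} h => by
    rcases lt_or_ge x S.cellCount with h' | h'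
    · exact .inl ⟨h', by rw [← (G.old_cell x h').1]; exact h.2⟩
    · obtain ⟨-, -, -, v, h1, h2, h3, h4⟩ := G.new_cell x h' h.1
      exact .inr ⟨h', v, h.2.symm.trans h3, h1, h2, h4⟩
  have hq : ∀ {q}, S.VQ q → S'.hd q = S.hd q ∧ S'.tl q = S.tl q := fun {q} h =>
    G.old_queue q (by rintro v rfl; exact h)
  have hchild : (S'.childSt v s r).child v s = r := by simp [childSt]
  have hch : ∀ w t, ¬ (w = v ∧ t = s) → (S'.childSt v s r).child w t = S'.child w t := by
    intro w t hwt
    simp only [childSt]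
    by_cases e : w = v
    · subst e
      rw [Function.update_self, Function.update_of_ne (fun e => hwt ⟨rfl, e⟩)]
    · rw [Function.update_of_ne e]
  have hslot : ∀ w < S.nodeCount, ∀ t, (S'.childSt v s r).child w t ≠ S.child w t → w = v ∧ t = s := by
    intro w hw t hne
    by_contra hwt
    rw [hch w t hwt, (G.old_node w hw).2.2.2.2.1] at hne
    exact hne rfl
  have hSlot : Slot S (S'.childSt v s r) A v s := by
    constructor
    · rw [hchild]
      have hr : (S'.childSt v s r).rts r = b := G.root.1
      rw [hr]
      -- A tree with `len` keys has at most `len - 1` inner nodes: one when a leaf is replaced, and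
      -- not more than those below `c` in a rebuilding.
      rcases h with ⟨d, q, h1, h2, h3, h4, h5, h6, h7⟩ | ⟨c, d, h1, h2, h3, h4, h5⟩
      · exact .inl ⟨d, q, h1, h2, h3, h4, h5, h6, by show S'.nodeCount ≤ _; omega⟩
      · exact .inr ⟨c, d, h1, h2, h3, h4, by show S'.nodeCount ≤ _; omega⟩
    · rw [hchild]
      exact G.root.2
    · intro w hw hw'
      rw [hchild]
      obtain ⟨-, -, -, -, h5, -, -, -, h9, -⟩ := G.new_node w hw hw'
      exact ⟨h9, h5.trans G.root.1.symm⟩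
  constructor
  case nodeCount_le => exact hn
  case opCount_le => exact G.opCount_eq.ge
  case cellCount_le => exact hc
  case version_le => exact G.version_eq.ge
  case own_eq => exact fun x hx => (G.old_cell x hx).1
  case item_eq => exact fun x hx => (G.old_cell x hx).2.1
  case cts_eq => exact fun x hx => (G.old_cell x hx).2.2.1
  case nxt_eq => exact fun x hx y hy => ((G.old_cell x hx).2.2.2).trans hy
  case queues =>
    have Q := G.queues I.queues
    exact ⟨Q.ends, Q.vq, Q.next, Q.last, Q.lag⟩
  case sep_eq => exact fun w hw => (G.old_node w hw).1
  case initSz_eq => exact fun w hw => (G.old_node w hw).2.1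
  case born_eq => exact fun w hw => (G.old_node w hw).2.2.1
  case par_eq => exact fun w hw => (G.old_node w hw).2.2.2.2.2.1
  case dep_eq => exact fun w hw => (G.old_node w hw).2.2.2.2.2.2
  case oquery_eq => exact fun o _ => congrFun G.oquery_eq o
  case ots_eq => exact fun o _ t ht => (congrFun G.ots_eq o).trans ht
  case ticket_eq => exact fun t _ => congrFun G.ticket_eq t
  case proc_eq => exact fun o _ => congrFun G.proc_eq o
  case hd_le => exact fun w hw => (hq (q := .node w) hw).1.ge
  case hd_lt => exact fun w hw => (hq (q := .node w) hw).1.trans_lt (I.queues.ends (.node w) hw).1.1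
  case tl_le => exact fun q hq' => (hq hq').2.ge
  case hd_new =>
    intro w hw x _ h1 h2
    exact absurd (h2.trans (hq (q := .node w) hw).1.le) (not_le.mpr h1)
  case hd_trav =>
    intro o ho y w h1 h2 _
    rcases back h1 with h | ⟨_, _, h, _⟩
    · exact ⟨h, .inl (h2.trans (hq (q := .traverse o) ho).1.le)⟩
    · cases h
  case state => exact fun c hc => .inl (G.old_node c hc).2.2.2.1
  case slot =>
    intro w hw t
    by_cases e : (S'.childSt v s r).child w t = S.child w t
    · exact .inl e
    · obtain ⟨rfl, rfl⟩ := hslot w hw t e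
      exact .inr hSlot
  case slot_unique =>
    intro w hw t h1 w' hw' t' h2
    obtain ⟨rfl, rfl⟩ := hslot w hw t h1
    exact hslot w' hw' t' h2
  case slot_of_new =>
    intro _
    -- The pointer really changes: when a leaf or an empty node is replaced the mark grows, and in a
    -- rebuilding every new inner node has a fresh address.
    refine ⟨v, hv, s, fun e => ?_⟩
    rw [hchild] at e
    rcases h with ⟨d, q, -, -, h3, h4, -, h6, -⟩ | ⟨c, d, h1, -⟩
    · have := G.root.1
      rw [e] at this
      cases hcs : S.child v s with
      | inner c => exact h3 c hcs
      | empty t => rw [hcs] at h4 this; simp only [rts, Ref.ts] at h4 this; omega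
      | leaf k t => rw [hcs] at h4 this; simp only [rts, Ref.ts] at h4 this; omega
    · obtain ⟨h2, -⟩ := G.root.2 c (e.trans h1)
      exact absurd (I.child v hv s c h1).1 (not_lt.mpr h2)
  case cell_node =>
    intro x hx w hw h
    rcases back h with h' | ⟨_, _, h', h1, _⟩
    · exact absurd h'.1 (not_lt.mpr hx)
    · cases h'
      exact absurd hw (not_lt.mpr h1)
  case cell_trav =>
    intro x hx o ho h
    rcases back h with h' | ⟨_, _, h', _⟩
    · exact absurd h'.1 (not_lt.mpr hx)
    · cases h'
  case node_new =>
    intro w hw hw'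
    obtain ⟨a1, a2, a3, a4, a5, a6, a7, a8, a9, a10⟩ := G.new_node w hw hw'
    obtain ⟨c1, c2, c3, -⟩ := G.new_cell _ a1 a2
    refine ⟨⟨S'.hd (.node w), a1, ⟨a2, a3⟩, c2.trans a5.symm, c1, rfl, fun y hy => ?_⟩,
      a6.trans a5.symm, a7, a8, fun t => ?_⟩
    · rcases back hy with h' | ⟨_, u, h', _, _, h4⟩
      · have := I.queues.vq y h'.1
        rw [h'.2] at this
        exact absurd this (not_lt.mpr hw)
      · cases h'
        exact h4.symm
    · rw [hch w t (fun e => absurd hv (not_lt.mpr (e.1 ▸ hw)))]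
      exact ⟨(a10 t).1.trans a5.symm, (a10 t).2⟩
  case op_new =>
    intro o h1 h2
    exact absurd (G.opCount_eq ▸ h2 : o < S.opCount) (not_lt.mpr h1)
  case ots_new => exact fun o _ t ht => .inl ((congrFun G.ots_eq o).symm.trans ht)
  case ticket_new =>
    intro t h1 h2
    exact absurd (G.version_eq ▸ h2 : t < S.version) (not_lt.mpr h1)
  case announce_new => exact fun i => .inl (congrFun G.announce_eq i)

/-! The memory effects of the steps in terms of states. -/

section View

variable (m : Mem κ σ ρ n) (g : Ghost n)

theorem view_fetch (o : ℕ) : view { m with version := m.version + 1 }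
    { g with ticket := Function.update g.ticket m.version o } = (view m g).fetchSt o := rfl

theorem view_stamp (o t : ℕ) :
    view (m.setOp o { m.op o with ts := some t }) g = (view m g).stampSt o t := by
  apply St.ext <;> try rfl
  all_goals
    funext z
    simp only [view, stampSt, Mem.setOp, Mem.queue]
  · cases z <;> simp only
    · exact update_apply_id (fun x : OpRecord κ => x.traverse.head) _ _ _ _ rfl
    · exact update_apply_id (fun x : OpRecord κ => x.processed.head) _ _ _ _ rfl
  · cases z <;> simp only
    · exact update_apply_id (fun x : OpRecord κ => x.traverse.tail) _ _ _ _ rfl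
    · exact update_apply_id (fun x : OpRecord κ => x.processed.tail) _ _ _ _ rfl
  · exact update_apply_id (fun x : OpRecord κ => x.query) _ _ _ _ rfl
  · exact update_apply_fun (fun x : OpRecord κ => x.ts) _ _ _ _

theorem view_link (q : QRef) (x : Item κ ρ) (t y : ℕ) (hy : y < m.cellCount) :
    view ((m.newCell ⟨x, t, none⟩).setCell y
      { (m.newCell ⟨x, t, none⟩).cell y with next := some m.cellCount })
      { g with own := Function.update g.own m.cellCount q } = (view m g).linkSt q y x t := by
  apply St.ext <;> try rfl
  all_goals
    funext z
    simp only [view, linkSt, Mem.setCell, Mem.newCell]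
    by_cases h1 : z = y
    · subst h1
      simp [Function.update_of_ne (ne_of_lt hy)]
    · by_cases h2 : z = m.cellCount
      · subst h2
        simp [Function.update_of_ne h1]
      · simp [Function.update_of_ne h1, Function.update_of_ne h2]

theorem view_setQueue (q q' : QRef) (x : Queue) :
    (m.setQueue x q).queue q' = if q' = q then x else m.queue q' := by
  cases q <;> cases q' <;> simp [Mem.setQueue, Mem.queue, Mem.setNode, Mem.setOp, Function.update]
  all_goals split_ifs with h <;> simp_all

theorem setQueue_node {β : Type*} (f : Node κ σ → β) (q : QRef) (x : Queue)
    (hf : ∀ w, f { m.node w with queue := x } = f (m.node w)) (v : ℕ) :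
    f ((m.setQueue x q).node v) = f (m.node v) := by
  cases q with
  | node w => exact update_apply_id f _ _ _ _ (hf w)
  | _ => rfl

theorem setQueue_op {β : Type*} (f : OpRecord κ → β) (q : QRef) (x : Queue)
    (hf : ∀ w, f { m.op w with traverse := x } = f (m.op w))
    (hf' : ∀ w, f { m.op w with processed := x } = f (m.op w)) (v : ℕ) :
    f ((m.setQueue x q).op v) = f (m.op v) := by
  cases q with
  | node w => rfl
  | traverse w => exact update_apply_id f _ _ _ _ (hf w)
  | processed w => exact update_apply_id f _ _ _ _ (hf' w)

theorem view_queue_eq (q : QRef) (x : Queue) :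
    view (m.setQueue x q) g = { view m g with
      hd := Function.update (view m g).hd q x.head
      tl := Function.update (view m g).tl q x.tail } := by
  apply St.ext
  case hd =>
    funext q'
    simp only [view, view_setQueue, Function.update]
    split_ifs <;> simp_all
  case tl =>
    funext q'
    simp only [view, view_setQueue, Function.update]
    split_ifs <;> simp_all
  case sep => exact funext fun v => setQueue_node m (fun y : Node κ σ => y.sep) q x (fun _ => rfl) v
  case initSz => exact funext fun v => setQueue_node m (fun y : Node κ σ => y.initSz) q x (fun _ => rfl) v
  case born => exact funext fun v => setQueue_node m (fun y : Node κ σ => y.born) q x (fun _ => rfl) v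
  case state => exact funext fun v => setQueue_node m (fun y : Node κ σ => y.state) q x (fun _ => rfl) v
  case child => exact funext fun v => setQueue_node m (fun y : Node κ σ => y.child) q x (fun _ => by funext s; cases s <;> rfl) v
  case oquery => exact funext fun v => setQueue_op m (fun y : OpRecord κ => y.query) q x (fun _ => rfl) (fun _ => rfl) v
  case ots => exact funext fun v => setQueue_op m (fun y : OpRecord κ => y.ts) q x (fun _ => rfl) (fun _ => rfl) v
  all_goals cases q <;> rfl

theorem view_head (q : QRef) (y : ℕ) :
    view (m.setQueue { m.queue q with head := y } q) g = (view m g).headSt q y := by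
  rw [view_queue_eq]
  apply St.ext <;> try rfl
  funext q'
  by_cases h : q' = q
  · subst h; simp [view, headSt]
  · simp [view, headSt, Function.update_of_ne h]

theorem view_tail (q : QRef) (y : ℕ) :
    view (m.setQueue { m.queue q with tail := y } q) g = (view m g).tailSt q y := by
  rw [view_queue_eq]
  apply St.ext <;> try rfl
  funext q'
  by_cases h : q' = q
  · subst h; simp [view, tailSt]
  · simp [view, tailSt, Function.update_of_ne h]

theorem view_setNode_queue (v : ℕ) (x : Node κ σ) (h : x.queue = (m.node v).queue) (q : QRef) :
    (m.setNode v x).queue q = m.queue q := by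
  cases q with
  | node w => exact update_apply_id (fun y : Node κ σ => y.queue) _ _ _ _ h
  | _ => rfl

theorem view_state (c : ℕ) (st : State σ) :
    view (m.setNode c { m.node c with state := st }) g = (view m g).stateSt c st := by
  apply St.ext <;> try rfl
  all_goals funext z
  · exact congrArg Queue.head (view_setNode_queue m c { m.node c with state := st } rfl z)
  · exact congrArg Queue.tail (view_setNode_queue m c { m.node c with state := st } rfl z)
  · exact update_apply_id (fun x : Node κ σ => x.sep) _ _ _ _ rfl
  · exact update_apply_id (fun x : Node κ σ => x.initSz) _ _ _ _ rfl
  · exact update_apply_id (fun x : Node κ σ => x.born) _ _ _ _ rfl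
  · exact update_apply_fun (fun x : Node κ σ => x.state) _ _ _ _
  · exact update_apply_id (fun x : Node κ σ => x.child) _ _ _ _ (by funext s; cases s <;> rfl)

theorem view_child (v : ℕ) (s : Side) (r : Ref κ) :
    view (m.setNode v ((m.node v).setChild r s)) g = (view m g).childSt v s r := by
  apply St.ext <;> try rfl
  all_goals funext z
  · exact congrArg Queue.head (view_setNode_queue m v _ (by cases s <;> rfl) z)
  · exact congrArg Queue.tail (view_setNode_queue m v _ (by cases s <;> rfl) z)
  · exact update_apply_id (fun x : Node κ σ => x.sep) _ _ _ _ (by cases s <;> rfl)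
  · exact update_apply_id (fun x : Node κ σ => x.initSz) _ _ _ _ (by cases s <;> rfl)
  · exact update_apply_id (fun x : Node κ σ => x.born) _ _ _ _ (by cases s <;> rfl)
  · exact update_apply_id (fun x : Node κ σ => x.state) _ _ _ _ (by cases s <;> rfl)
  · refine (update_apply_fun (fun x : Node κ σ => x.child) _ _ _ _).trans ?_
    have : ((m.node v).setChild r s).child = Function.update (m.node v).child s r := by
      funext t
      cases s <;> cases t <;> rfl
    simp only [this]
    rfl

theorem view_announce (p : Fin n) (q : Query κ) :
    view (announceOp m p q)
      { g with
        own := Function.update (Function.update (Function.update g.own m.cellCount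
          (.traverse m.opCount)) (m.cellCount + 1) (.traverse m.opCount)) (m.cellCount + 2)
          (.processed m.opCount)
        proc := Function.update g.proc m.opCount p } = (view m g).announceSt p q := by
  apply St.ext <;> try rfl
  all_goals
    funext z
    simp only [view, announceSt, announceOp, Mem.newCell, Mem.setCell, Mem.setOp]
  · by_cases h2 : z = m.cellCount + 2
    · subst h2; simp
    · by_cases h1 : z = m.cellCount + 1
      · subst h1; simp [Function.update]
      · by_cases h0 : z = m.cellCount
        · subst h0
          have h3 : ¬ m.cellCount = m.cellCount + 1 + 1 := h2
          simp [Function.update, h3]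
        · simp [Function.update, *]
  · by_cases h2 : z = m.cellCount + 2
    · subst h2; simp
    · by_cases h1 : z = m.cellCount + 1
      · subst h1; simp [Function.update]
      · by_cases h0 : z = m.cellCount
        · subst h0
          have h3 : ¬ m.cellCount = m.cellCount + 1 + 1 := h2
          simp [Function.update, h3]
        · simp [Function.update, *]
  · by_cases h2 : z = m.cellCount + 2
    · subst h2; simp
    · by_cases h1 : z = m.cellCount + 1
      · subst h1; simp [Function.update]
      · by_cases h0 : z = m.cellCount
        · subst h0
          have h3 : ¬ m.cellCount = m.cellCount + 1 + 1 := h2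
          simp [Function.update, h3]
        · simp [Function.update, *]
  · cases z with
    | node v => simp [Mem.queue]
    | traverse o => by_cases h : o = m.opCount <;> simp [Mem.queue, Function.update, h]
    | processed o => by_cases h : o = m.opCount <;> simp [Mem.queue, Function.update, h]
  · cases z with
    | node v => simp [Mem.queue]
    | traverse o => by_cases h : o = m.opCount <;> simp [Mem.queue, Function.update, h]
    | processed o => by_cases h : o = m.opCount <;> simp [Mem.queue, Function.update, h]
  · exact update_apply_fun (fun x : OpRecord κ => x.query) _ _ _ _
  · exact update_apply_fun (fun x : OpRecord κ => x.ts) _ _ _ _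

end View

end St

end WaitFreeTree

/-! Assertions for the frames of a process. -/

namespace WaitFreeTree

set_option linter.unusedSectionVars false

/-! A logic for stacks of frames: the top frame runs now, every other one as soon as the one above it
is finished.  The numbers bound the costs. -/

section Logic

variable {X F : Type*} (R : X → X → Prop) (Pre : X → F → ℕ → Prop) (Post : X → F → Prop)

def Runs (P : X → Prop) : List F → X → ℕ → Prop
  | [], x, _ => P x
  | f :: r, x, m => ∃ a b, a + b ≤ m ∧ Pre x f a ∧ ∀ y, R x y → Post y f → Runs P r y b

variable {R Pre Post} {x y : X} {P Q : X → Prop} {L r : List F} {a b : ℕ}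

theorem Runs.le (hab : a ≤ b) (h : Runs R Pre Post P L x a) : Runs R Pre Post P L x b := by
  cases L with
  | nil => exact h
  | cons f r =>
    obtain ⟨c, d, h1, h2, h3⟩ := h
    exact ⟨c, d, h1.trans hab, h2, h3⟩

theorem Runs.append (hr : ∀ x, R x x) (ht : ∀ x y z, R x y → R y z → R x z)
    (h : Runs R Pre Post Q L x a) (h' : ∀ y, R x y → Q y → Runs R Pre Post P r y b) :
    Runs R Pre Post P (L ++ r) x (a + b) := by
  induction L generalizing x a with
  | nil => exact (h' x (hr x) h).le (Nat.le_add_left _ _)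
  | cons f L ih =>
    obtain ⟨c, d, h1, h2, h3⟩ := h
    exact ⟨c, d + b, by omega, h2, fun y hy hq => ih (h3 y hy hq)
      fun z hz hqz => h' z (ht _ _ _ hy hz) hqz⟩

end Logic

variable {κ σ ρ : Type*} {n : ℕ} [LinearOrder κ]

namespace St

variable {S S' : St κ σ ρ n} {A : Spec κ σ ρ}

section Assertions

variable (S : St κ σ ρ n) (A : Spec κ σ ρ) (p : Fin n)

def Tick (t o : ℕ) : Prop := 1 ≤ t ∧ t < S.version ∧ S.ticket t = o

def Idle : Prop := ∀ o, S.announce p = some o → S.Finished o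

def Stamped (o : ℕ) : Prop := ∀ o' ≤ o, S.ots o' ≠ none

def Known (l : List (Desc κ)) : Prop := ∀ d ∈ l, d.op < S.opCount ∧ S.ots d.op = some d.ts

/-- All operations announced before `o` or with a timestamp fetched before `t` are in the root queue
or going to be found. -/
def Cov (o t : ℕ) (todo : List (Fin n)) (e : Option ℕ) (saved : List (Desc κ)) : Prop :=
  ∀ o' < S.opCount, (o' ≤ o ∨ ∃ t' < t, 1 ≤ t' ∧ S.ticket t' = o') →
    (∃ t', S.ots o' = some t' ∧ (t' < t → S.Ins 0 t' ∨ ∃ d ∈ saved, d.ts = t')) ∨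
      (∃ i ∈ todo, S.announce i = some o') ∨ e = some o'

def Scan (o t : ℕ) (todo : List (Fin n)) (e : Option ℕ) (saved : List (Desc κ)) : Prop :=
  o < S.opCount ∧ S.ots o = some t ∧ S.Known saved ∧ (∀ d ∈ saved, d.ts < t) ∧
    S.Cov o t todo e saved ∧ ∀ o' ∈ e, o' < S.opCount

def Pushable (x : Item κ ρ) (t : ℕ) (g : Bool) : QRef → Prop
  | .node v => ∃ d, x = .desc d ∧ t = d.ts ∧ g = true ∧ S.Admits A v d
  | .traverse o => g = false ∧ ∃ c d, x = .node c ∧ S.TravAdmits A o c d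
  | .processed o => g = false ∧ o < S.opCount

/-- The tail cell that has been read by a process about to insert into a queue. -/
def AtTail (q : QRef) (t : ℕ) (g : Bool) (y : ℕ) : Prop :=
  S.InQ y q ∧ y ≤ S.tl q ∧ (g = true → S.cts y < t)

def Ready (v : ℕ) (d : Desc κ) : Prop := S.Reached v d ∧ S.AllDone v d

def Exec (d : Desc κ) (v : ℕ) (todo : List (Side × Query κ)) (rebuilt : Bool) : Prop :=
  S.Reached v d ∧ (∀ e ∈ todo, e ∈ route d.query (S.sep v)) ∧
    (∀ e ∈ route d.query (S.sep v), e ∈ todo ∨ S.SideDone v e.1 e.2 d.ts) ∧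
    (rebuilt = true → ∀ e ∈ todo.head?, d.ts ≤ S.rts (S.child v e.1) + 1)

def Frozen (X : ℕ) (u : ℕ) : Prop := S.Frz A X u ∧ S.NoPend u

/-- An external tree with `s` inner nodes has at most `s + 1` leaves, so this bounds the number of
keys still to be collected. -/
noncomputable def weight (l : List (Ref κ)) : ℕ := (l.map (fun r => S.size r + 1)).sum

/-- The last clause compares the keys, collected or still to come, with the inner nodes of the
subtree. It is the reason why a rebuilding does not create more nodes than it discards. -/
def Gather (t v : ℕ) (s : Side) (c : ℕ) (todo : List (Ref κ)) (k : ℕ) : Prop :=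
  (∃ d, S.Doomed A c d ∧ d.ts = t + 1) ∧ S.Clr c ∧ v < S.nodeCount ∧ S.par c = (v, s) ∧
    (S.child v s = .inner c ∨ t ≤ S.rts (S.child v s)) ∧
    (∀ u, .inner u ∈ todo → S.Below c u) ∧ k + S.weight todo ≤ S.size (.inner c : Ref κ) + 1

def MainAt (o t : ℕ) : Prop :=
  S.announce p = some o ∧ o < S.opCount ∧ S.ots o = some t ∧ S.Ins 0 t ∧ S.Stamped o

def Treated (o t h : ℕ) : Prop :=
  S.InQ h (.traverse o) ∧ ∀ y v, S.InQ y (.traverse o) → y ≤ h → S.item y = .node v →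
    S.Ins v t ∧ S.Passed v t

/-- All these assertions have to survive the steps of other processes. Hence they speak of what only
grows, or leave an alternative for the case that another helper was faster, as in `modify` and
`replace`. -/
def Pre : Frame κ σ ρ n → Prop
  | .fetch o => S.announce p = some o ∧ o < S.opCount
  | .stamp o t => S.announce p = some o ∧ o < S.opCount ∧ S.Tick t o
  | .stamped o => S.announce p = some o ∧ o < S.opCount ∧ S.ots o ≠ none
  | .scan o t todo saved => S.Scan o t todo none saved
  | .scanTs o t o' todo saved => S.Scan o t todo (some o') saved
  | .scanFetch o t o' todo saved => S.Scan o t todo (some o') saved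
  | .scanStamp o t o' t' todo saved => S.Scan o t todo (some o') saved ∧ S.Tick t' o'
  | .enqueue l => l.Pairwise (fun a b => a.ts ≤ b.ts) ∧ S.Known l ∧
      ∀ t', 1 ≤ t' → (∃ d ∈ l, t' < d.ts) →
        ∃ t'', S.ots (S.ticket t') = some t'' ∧ (t'' = t' → S.Ins 0 t' ∨ ∃ d ∈ l, d.ts = t')
  | .push q x t g => S.Pushable A x t g q
  | .pushNext q x t g y => S.Pushable A x t g q ∧ S.AtTail q t g y
  | .pushLink q x t g y => S.Pushable A x t g q ∧ S.AtTail q t g y ∧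
      (g = true → ∀ z, S.InQ z q → y < z → t ≤ S.cts z)
  | .pushSwing q y new => S.InQ y q ∧ y ≤ S.tl q ∧ S.nxt y = some new
  | .pop t v => ∃ d, d.ts = t ∧ S.Ready v d
  | .popNext t v h => (∃ d, d.ts = t ∧ S.Ready v d) ∧ S.InQ h (.node v) ∧ h ≤ S.hd (.node v) ∧
      ∀ x, S.InQ x (.node v) → S.cts x < t → x ≤ h
  | .popSwing v h new => (∃ d, S.item new = .desc d ∧ S.Ready v d) ∧ S.InQ h (.node v) ∧
      h ≤ S.hd (.node v) ∧ S.nxt h = some new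
  | .untilTs _ v => v < S.nodeCount
  | .untilNext _ v h => S.InQ h (.node v) ∧ h ≤ S.hd (.node v)
  | .exec d v todo _ r => S.Exec d v todo r
  | .execState d v s q todo _ r c => S.Exec d v ((s, q) :: todo) false ∧ c < S.nodeCount ∧ c ≠ 0 ∧
      S.par c = (v, s) ∧ (q.isWhole = false → S.Seen A c d) ∧ (r = true → d.ts ≤ S.born c + 1) ∧
      (S.child v s = .inner c ∨ d.ts ≤ S.rts (S.child v s) + 1)
  | .modify d c st => (∃ d', S.Accepted A c d' ∧ d'.ts = d.ts) ∧ S.InTrav d.op c ∧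
      (st = S.state c ∨ d.ts ≤ (S.state c).tsMod)
  | .replace v s old t keys => v < S.nodeCount ∧
      (S.rts old < t ∧ ∀ c, old = .inner c → c < S.nodeCount) ∧
      ((S.child v s = old ∧ S.ReplaceOK A v s t keys.length) ∨ t ≤ S.rts (S.child v s))
  | .drain t todo => ∀ u ∈ todo, S.Frz A (t + 1) u
  | .drainLeft t u todo => S.Frozen A (t + 1) u ∧ ∀ u ∈ todo, S.Frz A (t + 1) u
  | .drainRight t u l todo => S.Frozen A (t + 1) u ∧ l = S.child u .left ∧
      ∀ u ∈ todo, S.Frz A (t + 1) u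
  | .gather t v s c todo keys => S.Gather A t v s c todo keys.length
  | .gatherLeft t v s c u todo keys => S.Gather A t v s c (.inner u :: todo) keys.length
  | .gatherRight t v s c u l todo keys => S.Gather A t v s c (.inner u :: todo) keys.length ∧
      l = S.child u .left
  | .main o t => S.MainAt p o t
  | .mainNext o t h => S.MainAt p o t ∧ S.Treated o t h
  | .mainPop o y => S.announce p = some o ∧ ∃ t, S.ots o = some t ∧ S.Treated o t y
  | .result o => S.Idle p ∧ o < S.opCount
  | .resultNext c _ => S.Idle p ∧ ∃ o, S.InQ c (.processed o)

/-- The frames of the default case stand at the bottom of a stack, so their end is the end of the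
operation. -/
def Post : Frame κ σ ρ n → Prop
  | .scan o t _ _ => S.Ins 0 t ∧ S.Stamped o
  | .scanTs o t _ _ _ => S.Ins 0 t ∧ S.Stamped o
  | .scanFetch o t _ _ _ => S.Ins 0 t ∧ S.Stamped o
  | .scanStamp o t _ _ _ _ => S.Ins 0 t ∧ S.Stamped o
  | .enqueue l => ∀ d ∈ l, S.Ins 0 d.ts
  | .push q x t g => if g then ∃ y, S.InQ y q ∧ t ≤ S.cts y else ∃ y, S.InQ y q ∧ S.item y = x
  | .pushNext q x t g _ => if g then ∃ y, S.InQ y q ∧ t ≤ S.cts y else ∃ y, S.InQ y q ∧ S.item y = x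
  | .pushLink q x t g _ => if g then ∃ y, S.InQ y q ∧ t ≤ S.cts y else ∃ y, S.InQ y q ∧ S.item y = x
  | .pushSwing q _ new => new ≤ S.tl q
  | .pop t v => S.Passed v t
  | .popNext t v _ => S.Passed v t
  | .popSwing v _ new => new ≤ S.hd (.node v)
  | .untilTs t v => S.Passed v t
  | .untilNext t v _ => S.Passed v t
  | .exec d v _ _ _ => S.Passed v d.ts
  | .execState d v _ _ _ _ _ _ => S.Passed v d.ts
  | .modify d c _ => d.ts ≤ (S.state c).tsMod ∧ S.InTrav d.op c
  | .replace v s _ t _ => t ≤ S.rts (S.child v s)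
  | .drain _ todo => ∀ u ∈ todo, S.Clr u
  | .drainLeft _ u todo => S.Clr u ∧ ∀ u ∈ todo, S.Clr u
  | .drainRight _ u _ todo => S.Clr u ∧ ∀ u ∈ todo, S.Clr u
  | .gather t v s _ _ _ => t ≤ S.rts (S.child v s)
  | .gatherLeft t v s _ _ _ _ => t ≤ S.rts (S.child v s)
  | .gatherRight t v s _ _ _ _ _ => t ≤ S.rts (S.child v s)
  | .mainPop o y => S.hd (.traverse o) = y
  | _ => S.Idle p

end Assertions

/-! Stability of the assertions. -/

namespace Guar

variable {p : Fin n} (I : S.Inv A) (G : Guar S S' A)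
include I G

theorem idle (ha : S'.announce p = S.announce p) (h : S.Idle p) : S'.Idle p := fun o ho =>
  G.finished I (I.ann p o (ha ▸ ho)).1 (h o (ha ▸ ho))

theorem stamped {o} (ho : o < S.opCount) (h : S.Stamped o) : S'.Stamped o := fun o' ho' => by
  obtain ⟨t, ht⟩ := Option.ne_none_iff_exists'.mp (h o' ho')
  rw [G.ots_eq o' (ho'.trans_lt ho) t ht]
  simp

theorem tick {t o} (h : S.Tick t o) : S'.Tick t o :=
  ⟨h.1, h.2.1.trans_le G.version_le, (G.ticket_eq t h.2.1).trans h.2.2⟩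

theorem known {l} (h : S.Known l) : S'.Known l := fun d hd =>
  ⟨(h d hd).1.trans_le G.opCount_le, G.ots_eq _ (h d hd).1 _ (h d hd).2⟩

/-- An operation that is overwritten in the array is finished and thus in the root queue. Operations
announced later do not fall under `Cov`, as they are younger than `o` and get their tickets after
`t` was drawn. -/
theorem scan {o t todo e saved} (h : S.Scan o t todo e saved) : S'.Scan o t todo e saved := by
  obtain ⟨h1, h2, h3, h4, h5, h6⟩ := h
  refine ⟨h1.trans_le G.opCount_le, G.ots_eq o h1 t h2, G.known I h3, h4, fun o' ho' hor => ?_,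
    fun o' ho' => (h6 o' ho').trans_le G.opCount_le⟩
  have hv := (I.stamp o h1 t h2).2.1
  have hold : o' < S.opCount ∧ (o' ≤ o ∨ ∃ t' < t, 1 ≤ t' ∧ S.ticket t' = o') := by
    rcases hor with h | ⟨t', ht, h1', h⟩
    · exact ⟨h.trans_lt h1, .inl h⟩
    · have ht' : t' < S.version := ht.trans hv
      rw [G.ticket_eq t' ht'] at h
      exact ⟨h ▸ I.ticketLt t' h1' ht', .inr ⟨t', ht, h1', h⟩⟩
  rcases h5 o' hold.1 hold.2 with ⟨t', ht', h⟩ | ⟨i, hi, h⟩ | h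
  · exact .inl ⟨t', G.ots_eq o' hold.1 t' ht', fun hlt => (h hlt).imp G.ins id⟩
  · rcases G.announce_new i with h' | ⟨h', _⟩
    · exact .inr (.inl ⟨i, hi, h'.trans h⟩)
    · obtain ⟨t', ht', hi', _⟩ := h' o' h
      exact .inl ⟨t', G.ots_eq o' hold.1 t' ht', fun _ => .inl (G.ins hi')⟩
  · exact .inr (.inr h)

theorem pushable {x t g q} (h : S.Pushable A x t g q) : S'.Pushable A x t g q := by
  cases q with
  | node v =>
    obtain ⟨d, h1, h2, h3, h4⟩ := h
    exact ⟨d, h1, h2, h3, G.admits I h4⟩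
  | traverse o =>
    obtain ⟨h1, c, d, h2, h3⟩ := h
    exact ⟨h1, c, d, h2, G.travAdmits I h3⟩
  | processed o => exact ⟨h.1, h.2.trans_le G.opCount_le⟩

theorem tl_le' {x q} (h : S.InQ x q) : S.tl q ≤ S'.tl q :=
  G.tl_le q (h.2 ▸ I.queues.vq x h.1)

theorem hd_le' {x v} (h : S.InQ x (.node v)) : S.hd (.node v) ≤ S'.hd (.node v) :=
  G.hd_le v (I.node_lt h)

theorem atTail {q t g y} (h : S.AtTail q t g y) : S'.AtTail q t g y :=
  ⟨G.inQ h.1, h.2.1.trans (G.tl_le' I h.1), fun hg => (G.cts_eq y h.1.1).symm ▸ h.2.2 hg⟩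

theorem ready {v d} (h : S.Ready v d) : S'.Ready v d :=
  ⟨G.reached I h.1, G.allDone I h.1 h.2⟩

theorem exec {d v todo r} (h : S.Exec d v todo r) : S'.Exec d v todo r := by
  obtain ⟨h1, h2, h3, h4⟩ := h
  have hv := h1.lt I
  rw [Exec, G.sep_eq v hv]
  exact ⟨G.reached I h1, h2, fun e he => (h3 e he).imp id (G.sideDone I h1 he),
    fun hr e he => (h4 hr e he).trans (Nat.add_le_add_right (G.rts_le I hv) 1)⟩

theorem frozen {X u} (h : S.Frozen A X u) : S'.Frozen A X u :=
  ⟨G.frz I h.1, G.frz_noPend I h.1 h.2⟩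

theorem child_or {v s c d t} (hp : S.par c = (v, s)) (hv : v < S.nodeCount) (hd : S.Doomed A c d)
    (ht : d.ts = t + 1) (h : S.child v s = .inner c ∨ t ≤ S.rts (S.child v s)) :
    S'.child v s = .inner c ∨ t ≤ S'.rts (S'.child v s) := by
  rcases h with h | h
  · by_cases hne : S'.child v s = S.child v s
    · exact .inl (hne.trans h)
    · right
      obtain ⟨q, hq⟩ := id hd.1
      have hr : S.Reached v d := by simpa only [hp] using hq.2.2.1
      rcases G.slot_ge I hr hne with h' | ⟨_, _, _, h'⟩ <;> omega
  · exact .inr (h.trans (G.rts_le I hv))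

theorem size_below {X c u} (hf : S.Frz A X c) (hc : S.Clr c) (hb : S.Below c u) :
    S'.size (.inner u : Ref κ) = S.size (.inner u : Ref κ) :=
  congrArg Finset.card (G.below_eq I (Inv.frz_below hf hc hb) (Inv.clr_below hc hb))

theorem gather {t v s c todo k} (h : S.Gather A t v s c todo k) :
    S'.Gather A t v s c todo k := by
  obtain ⟨⟨d, hd, ht⟩, h2, h3, hp, h4, h5, h6⟩ := h
  have hf : S.Frz A (t + 1) c := .base c d hd ht
  refine ⟨⟨d, G.doomed I hd, ht⟩, G.clr I hf h2, h3.trans_le G.nodeCount_le,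
    (G.par_eq c (I.frz_cells hf).2).trans hp,
    G.child_or I hp h3 hd ht h4, fun u hu => (G.below_clr I hf h2).mpr (h5 u hu), ?_⟩
  rw [G.size_below I hf h2 .refl]
  convert h6 using 2
  refine congrArg List.sum (List.map_congr_left fun r hr => ?_)
  cases r with
  | inner u => rw [G.size_below I hf h2 (h5 u hr)]
  | _ => rfl

theorem mainAt {o t} (ha : S'.announce p = S.announce p) (h : S.MainAt p o t) : S'.MainAt p o t :=
  ⟨ha.trans h.1, h.2.1.trans_le G.opCount_le, G.ots_eq o h.2.1 t h.2.2.1, G.ins h.2.2.2.1,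
    G.stamped I h.2.1 h.2.2.2.2⟩

theorem treated {o t h} (ht : S.Treated o t h) : S'.Treated o t h := by
  refine ⟨G.inQ ht.1, fun y v hy hyh hi => ?_⟩
  have hyc : y < S.cellCount := hyh.trans_lt ht.1.1
  rw [G.item_eq y hyc] at hi
  obtain ⟨h1, h2⟩ := ht.2 y v (G.inQ_old hy hyc) hyh hi
  exact ⟨G.ins h1, G.passed I h1 h2⟩

theorem replaceOK {v s t l} (hv : v < S.nodeCount) (h : S.ReplaceOK A v s t l) :
    (S'.child v s = S.child v s ∧ S'.ReplaceOK A v s t l) ∨ t ≤ S'.rts (S'.child v s) := by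
  by_cases hne : S'.child v s = S.child v s
  · refine .inl ⟨hne, ?_⟩
    rw [ReplaceOK, hne]
    rcases h with ⟨d, q, h1, h2, h3, h4, h5, h6, h7⟩ | ⟨c, d, h1, h2, h3, h4, h5⟩
    · exact .inl ⟨d, q, G.reached I h1, by rwa [G.sep_eq v hv], h3, h4, h5, h6, h7⟩
    · refine .inr ⟨c, d, h1, G.doomed I h2, G.clr I (.base c d h2 rfl) h3, h4, ?_⟩
      rwa [G.below_eq I (.base c d h2 rfl) h3]
  · right
    rcases h with ⟨d, q, h1, h2, h3, h4, h5, h6, h7⟩ | ⟨c, d, h1, h2, h3, h4, h5⟩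
    · rcases G.slot_ge I h1 hne with h | ⟨c, hc, _⟩
      · omega
      · exact absurd hc (h3 c)
    · obtain ⟨q, hq⟩ := id h2.1
      have hr : S.Reached v d := by
        simpa only [(I.child v hv s c h1).2.2.1] using hq.2.2.1
      rcases G.slot_ge I hr hne with h' | ⟨_, _, _, h'⟩ <;> omega

theorem pre (ha : S'.announce p = S.announce p) {f : Frame κ σ ρ n} (h : S.Pre A p f) :
    S'.Pre A p f := by
  cases f with
  | fetch o => exact ⟨ha.trans h.1, h.2.trans_le G.opCount_le⟩
  | stamp o t => exact ⟨ha.trans h.1, h.2.1.trans_le G.opCount_le, G.tick I h.2.2⟩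
  | stamped o =>
    obtain ⟨t, ht⟩ := Option.ne_none_iff_exists'.mp h.2.2
    exact ⟨ha.trans h.1, h.2.1.trans_le G.opCount_le, by rw [G.ots_eq o h.2.1 t ht]; simp⟩
  | scan o t todo saved => exact G.scan I h
  | scanTs o t o' todo saved => exact G.scan I h
  | scanFetch o t o' todo saved => exact G.scan I h
  | scanStamp o t o' t' todo saved => exact ⟨G.scan I h.1, G.tick I h.2⟩
  | enqueue l =>
    obtain ⟨h1, h2, h3⟩ := h
    refine ⟨h1, G.known I h2, fun t' ht' hd => ?_⟩
    obtain ⟨d, hd1, hd2⟩ := id hd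
    have hv : t' < S.version := hd2.trans (I.stamp _ (h2 d hd1).1 _ (h2 d hd1).2).2.1
    obtain ⟨t'', h4, h5⟩ := h3 t' ht' hd
    rw [G.ticket_eq t' hv]
    exact ⟨t'', G.ots_eq _ (I.ticketLt t' ht' hv) _ h4, fun he => (h5 he).imp G.ins id⟩
  | push q x t g => exact G.pushable I h
  | pushNext q x t g y => exact ⟨G.pushable I h.1, G.atTail I h.2⟩
  | pushLink q x t g y =>
    refine ⟨G.pushable I h.1, G.atTail I h.2.1, fun hg z hz hyz => ?_⟩
    by_cases hzc : z < S.cellCount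
    · rw [G.cts_eq z hzc]
      exact h.2.2 hg z (G.inQ_old hz hzc) hyz
    · cases q with
      | node v =>
        obtain ⟨d, h1, h2, _, h4⟩ := h.1
        obtain ⟨d', h5, h6, h7, h8, h9⟩ := G.cell_node z (not_lt.mp hzc) v h4.1 hz
        rw [h6, h2]
        -- Were the new cell earlier than `t`, its timestamp would be in the queue already, because
        -- the later operation is admitted. So whoever is faster at this cell has a timestamp of at
        -- least `t`.
        by_contra hlt
        exact Inv.not_ins_of_all_lt h8 (I.pred_of_admits h4 h7 (not_le.mp hlt))
      | _ => rw [h.1.1] at hg; cases hg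
  | pushSwing q y new =>
    exact ⟨G.inQ h.1, h.2.1.trans (G.tl_le' I h.1), G.nxt_eq y h.1.1 _ h.2.2⟩
  | pop t v =>
    obtain ⟨d, h1, h2⟩ := h
    exact ⟨d, h1, G.ready I h2⟩
  | popNext t v hh =>
    obtain ⟨⟨d, h1, h2⟩, h3, h4, h5⟩ := h
    refine ⟨⟨d, h1, G.ready I h2⟩, G.inQ h3, h4.trans (G.hd_le' I h3), fun x hx hlt => ?_⟩
    rcases G.cell_cases hx with ⟨_, hx', hc, _⟩ | ⟨_, _, d', _, hc, _, hall, _⟩ | ⟨hv, _⟩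
    · exact h5 x hx' (hc ▸ hlt)
    · obtain ⟨y, hy, _, hyt⟩ := h2.1.1
      have := hall y hy
      omega
    · exact absurd (h2.1.lt I) (not_lt.mpr hv)
  | popSwing v hh new =>
    obtain ⟨⟨d, h1, h2⟩, h3, h4, h5⟩ := h
    have hn := (I.queues.next hh h3.1 new h5).1.1
    exact ⟨⟨d, (G.item_eq new hn).trans h1, G.ready I h2⟩, G.inQ h3, h4.trans (G.hd_le' I h3),
      G.nxt_eq hh h3.1 _ h5⟩
  | untilTs t v => exact lt_of_lt_of_le (b := S.nodeCount) h G.nodeCount_le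
  | untilNext t v hh => exact ⟨G.inQ h.1, h.2.trans (G.hd_le' I h.1)⟩
  | exec d v todo views r => exact G.exec I h
  | execState d v s q todo views r c =>
    obtain ⟨h1, h2, h3, h4, h5, h6, h7⟩ := h
    refine ⟨G.exec I h1, h2.trans_le G.nodeCount_le, h3, (G.par_eq c h2).trans h4,
      fun hq => G.seen I (h5 hq), fun hr => (G.born_eq c h2).symm ▸ h6 hr, ?_⟩
    have hv := h1.1.lt I
    rcases h7 with h7 | h7
    · by_cases hne : S'.child v s = S.child v s
      · exact .inl (hne.trans h7)
      · rcases G.slot_ge I h1.1 hne with h | ⟨_, _, _, h⟩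
        · exact .inr (h.trans (Nat.le_succ _))
        · exact .inr h.ge
    · exact .inr (h7.trans (Nat.add_le_add_right (G.rts_le I hv) 1))
  | modify d c st =>
    obtain ⟨⟨d', h1, h2⟩, h3, h4⟩ := h
    obtain ⟨q, hq⟩ := id h1.1
    refine ⟨⟨d', G.accepted I h1, h2⟩, G.inTrav h3, ?_⟩
    rcases h4 with h4 | h4
    · rcases G.tsMod_ge I hq h1.2.1 with h5 | h5
      · exact .inl (h4.trans h5.symm)
      · exact .inr (h2 ▸ h5)
    · exact .inr (h4.trans (G.tsMod_le hq.1))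
  | replace v s old t keys =>
    refine ⟨h.1.trans_le G.nodeCount_le, ⟨?_, fun c hc => (h.2.1.2 c hc).trans_le G.nodeCount_le⟩, ?_⟩
    · cases old with
      | inner c =>
        have : S.rts (.inner c : Ref κ) < t := h.2.1.1
        rwa [show S'.rts (.inner c : Ref κ) = S.rts (.inner c : Ref κ) from
          G.born_eq c (h.2.1.2 c rfl)]
      | _ => exact h.2.1.1
    rcases h.2.2 with ⟨h1, h2⟩ | h1
    · exact (G.replaceOK I h.1 h2).imp (fun h3 => ⟨h3.1.trans h1, h3.2⟩) id
    · exact .inr (h1.trans (G.rts_le I h.1))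
  | drain t todo => exact fun u hu => G.frz I (h u hu)
  | drainLeft t u todo => exact ⟨G.frozen I h.1, fun u hu => G.frz I (h.2 u hu)⟩
  | drainRight t u l todo =>
    exact ⟨G.frozen I h.1, h.2.1.trans (G.frz_child I h.1.1 h.1.2 _).symm,
      fun u hu => G.frz I (h.2.2 u hu)⟩
  | gather t v s c todo keys => exact G.gather I h
  | gatherLeft t v s c u todo keys => exact G.gather I h
  | gatherRight t v s c u l todo keys =>
    refine ⟨G.gather I h.1, h.2.trans ?_⟩
    obtain ⟨⟨d, hd, ht⟩, h2, _, _, _, h5, _⟩ := h.1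
    have hf : S.Frz A (t + 1) c := .base c d hd ht
    have hb := h5 u (by simp)
    cases Inv.clr_below h2 hb with
    | mk _ hp _ => exact (G.frz_child I (Inv.frz_below hf h2 hb) hp _).symm
  | main o t => exact G.mainAt I ha h
  | mainNext o t hh => exact ⟨G.mainAt I ha h.1, G.treated I h.2⟩
  | mainPop o y =>
    obtain ⟨h1, t, h2, h3⟩ := h
    exact ⟨ha.trans h1, t, G.ots_eq o (I.trav_lt h3.1) t h2, G.treated I h3⟩
  | result o => exact ⟨G.idle I ha h.1, h.2.trans_le G.opCount_le⟩
  | resultNext c parts =>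
    obtain ⟨h1, o, h2⟩ := h
    exact ⟨G.idle I ha h1, o, G.inQ h2⟩

end Guar

end St

end WaitFreeTree

/-! Ranges of keys, and the future of a process. -/

namespace WaitFreeTree

set_option linter.unusedSectionVars false

variable {κ σ ρ : Type*} {n : ℕ} [LinearOrder κ]

namespace St

variable {S S' S'' : St κ σ ρ n} {A : Spec κ σ ρ}

/-! Facts about the tree. -/

theorem Below.trans {u v w} (h : S.Below u v) (h' : S.Below v w) : S.Below u w := by
  induction h' with
  | refl => exact h
  | child x y s _ hc ih => exact .child x y s ih hc

noncomputable def belowRef (S : St κ σ ρ n) : Ref κ → Finset ℕ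
  | .inner c => S.below c
  | _ => ∅

theorem size_eq (S : St κ σ ρ n) (r : Ref κ) : S.size r = (S.belowRef r).card := by
  cases r <;> simp [size, belowRef]

namespace Inv

variable (I : S.Inv A)
include I

theorem below_dep {u v} (hu : u < S.nodeCount) (h : S.Below u v) :
    v = u ∨ S.dep u < S.dep v := by
  induction h with
  | refl => exact .inl rfl
  | child v c s hv hc ih =>
    have := (I.child v (I.below_lt hu hv) s c hc).2.2.2
    rcases ih with rfl | ih <;> right <;> omega

/-- The recorded parent is unique, so the paths upwards from `w` coincide as long as both go on. -/
theorem below_comparable {a b w} (ha : a < S.nodeCount) (hb : b < S.nodeCount)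
    (h : S.Below a w) (h' : S.Below b w) : S.Below a b ∨ S.Below b a := by
  induction h with
  | refl => exact .inr h'
  | child v c s hv hc ih =>
    cases h' with
    | refl => exact .inl (.child v _ s hv hc)
    | child v' _ s' hv' hc' =>
      have h1 := (I.child v (I.below_lt ha hv) s _ hc).2.2.1
      rw [(I.child v' (I.below_lt hb hv') s' _ hc').2.2.1] at h1
      cases h1
      exact ih hv'

/-- The two subtrees are disjoint: a common node would make one child an ancestor of the other, both
have the same depth, so they would be one node recorded at two sides. -/
theorem size_children {u} (hu : u < S.nodeCount) :
    S.size (S.child u .left) + S.size (S.child u .right) + 1 ≤ S.size (.inner u : Ref κ) := by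
  classical
  let f : Side → Finset ℕ := fun s => S.belowRef (S.child u s)
  have hf : ∀ s, S.size (S.child u s) = (f s).card := fun s => S.size_eq _
  have hmem : ∀ s w, w ∈ f s → ∃ c, S.child u s = .inner c ∧ S.Below c w := fun s w hw => by
    simp only [f] at hw
    cases hc : S.child u s with
    | inner c =>
      rw [hc] at hw
      simp only [belowRef, below, Finset.mem_filter] at hw
      exact ⟨c, rfl, hw.2⟩
    | _ => rw [hc] at hw; simp [belowRef] at hw
  have hup : ∀ s w c, S.child u s = .inner c → S.Below c w → w ≠ u := by
    rintro s w c hc hb rfl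
    obtain ⟨h1, _, _, h4⟩ := I.child w hu s c hc
    rcases I.below_dep h1 hb with h | h
    · subst h; omega
    · omega
  have hd : Disjoint (f .left) (f .right) := by
    rw [Finset.disjoint_left]
    intro w h1 h2
    obtain ⟨a, ha, hwa⟩ := hmem _ _ h1
    obtain ⟨b, hb, hwb⟩ := hmem _ _ h2
    obtain ⟨a1, a2, a3, a4⟩ := I.child u hu _ a ha
    obtain ⟨b1, b2, b3, b4⟩ := I.child u hu _ b hb
    have key : ∀ x y : ℕ, x < S.nodeCount → S.dep x = S.dep u + 1 → S.dep y = S.dep u + 1 →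
        S.Below x y → y = x := fun x y hx h1 h2 h3 =>
      (I.below_dep hx h3).resolve_right (by omega)
    rcases I.below_comparable a1 b1 hwa hwb with h | h
    · have := key a b a1 a4 b4 h
      subst this
      rw [a3] at b3
      cases b3
    · have := key b a b1 b4 a4 h
      subst this
      rw [a3] at b3
      cases b3
  have hu' : u ∉ f .left ∪ f .right := by
    intro h
    rcases Finset.mem_union.mp h with h | h <;> obtain ⟨c, hc, hb⟩ := hmem _ _ h <;>
      exact hup _ _ c hc hb rfl
  rw [hf, hf, ← Finset.card_union_of_disjoint hd, ← Finset.card_insert_of_notMem hu']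
  refine Finset.card_le_card fun w hw => ?_
  simp only [below, Finset.mem_filter, Finset.mem_range]
  rcases Finset.mem_insert.mp hw with rfl | hw
  · exact ⟨hu, .refl⟩
  · have : ∃ s, w ∈ f s := (Finset.mem_union.mp hw).elim (fun h => ⟨_, h⟩) (fun h => ⟨_, h⟩)
    obtain ⟨s, hs⟩ := this
    obtain ⟨c, hc, hb⟩ := hmem s w hs
    have hlt := I.below_lt (I.child u hu s c hc).1 hb
    refine ⟨hlt, ?_⟩
    exact Below.trans (.child u c s .refl hc) hb

/-- A single modification does not exceed `K * initSz`, since `K ≥ 1/2` and a new node has at least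
two keys. Without this an operation could rebuild the same place again and again. -/
theorem fresh_not_rebuild (hK : 1 ≤ 2 * A.K) {c} {d : Desc κ} (hc : c < S.nodeCount) (h0 : c ≠ 0)
    (h : (S.state c).tsMod = S.born c) : mustRebuild A d (S.initSz c) (S.state c) = false := by
  obtain ⟨h1, h2⟩ := I.fresh c hc h0
  have h3 : d.query.weight ≤ 1 := by cases d.query <;> simp [Query.weight]
  simp only [mustRebuild, decide_eq_false_iff_not, not_lt, h2 h]
  have h4 : ((0 + d.query.weight : ℕ) : ℝ) ≤ 1 := by exact_mod_cast (by omega)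
  have h5 : (2 : ℝ) ≤ S.initSz c := by exact_mod_cast h1
  nlinarith

theorem passed_of_last {v h} (hq : S.InQ h (.node v)) (hh : h ≤ S.hd (.node v))
    (hn : S.nxt h = none) (t : ℕ) : S.Passed v t := fun x hx _ => by
  by_contra hlt
  exact I.queues.last _ h x hq hx (hh.trans_lt (not_le.mp hlt)) hn

theorem next_node {v h c} (hq : S.InQ h (.node v)) (hn : S.nxt h = some c) :
    S.InQ c (.node v) ∧ h < c ∧ (∀ x, S.InQ x (.node v) → S.cts x < S.cts c → x ≤ h) ∧
      ∃ d, S.item c = .desc d ∧ S.cts c = d.ts := by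
  obtain ⟨h1, h2, h3⟩ := I.queues.next h hq.1 c hn
  rw [hq.2] at h1 h3
  refine ⟨h1, h2, fun x hx hlt => ?_, ?_⟩
  · by_contra hx'
    have := h3 x hx (not_le.mp hx')
    exact absurd (I.lt_of_cts hx h1 hlt) (not_lt.mpr this)
  · rcases I.desc v c h1 with ⟨_, h4⟩ | ⟨d, h4, h5, _⟩
    · have := I.sorted v h c hq h1 h2
      have := I.bornLe v h hq
      omega
    · exact ⟨d, h4, h5⟩

end Inv

theorem leafUpdate_length {q : Query κ} {r : Ref κ} {keys} (h : leafUpdate q r = some keys) :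
    keys.length ≤ 2 := by
  unfold leafUpdate at h
  split at h
  · cases h; simp
  · split_ifs at h <;> cases h <;> simp
  · split_ifs at h; cases h; simp
  · cases h

/-! What is preserved in the course of time. -/

structure Ext (S S' : St κ σ ρ n) : Prop where
  nodeCount_le : S.nodeCount ≤ S'.nodeCount
  opCount_le : S.opCount ≤ S'.opCount
  cellCount_le : S.cellCount ≤ S'.cellCount
  own_eq : ∀ x < S.cellCount, S'.own x = S.own x
  item_eq : ∀ x < S.cellCount, S'.item x = S.item x
  cts_eq : ∀ x < S.cellCount, S'.cts x = S.cts x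
  nxt_eq : ∀ x < S.cellCount, ∀ y, S.nxt x = some y → S'.nxt x = some y
  sep_eq : ∀ v < S.nodeCount, S'.sep v = S.sep v
  born_eq : ∀ v < S.nodeCount, S'.born v = S.born v
  dep_eq : ∀ v < S.nodeCount, S'.dep v = S.dep v
  ots_eq : ∀ o < S.opCount, ∀ t, S.ots o = some t → S'.ots o = some t
  hd_le : ∀ v < S.nodeCount, S.hd (.node v) ≤ S'.hd (.node v)
  tl_le : ∀ q, S.VQ q → S.tl q ≤ S'.tl q

theorem Guar.ext (G : Guar S S' A) : Ext S S' :=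
  { G with }

theorem Ext.refl (S : St κ σ ρ n) : Ext S S :=
  ⟨le_rfl, le_rfl, le_rfl, fun _ _ => rfl, fun _ _ => rfl, fun _ _ => rfl, fun _ _ _ h => h,
    fun _ _ => rfl, fun _ _ => rfl, fun _ _ => rfl, fun _ _ _ h => h, fun _ _ => le_rfl,
    fun _ _ => le_rfl⟩

theorem Ext.inQ (E : Ext S S') {x q} (h : S.InQ x q) : S'.InQ x q :=
  ⟨h.1.trans_le E.cellCount_le, (E.own_eq x h.1).trans h.2⟩

theorem Ext.inQ_old (E : Ext S S') {x q} (h : S'.InQ x q) (hx : x < S.cellCount) : S.InQ x q :=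
  ⟨hx, (E.own_eq x hx).symm.trans h.2⟩

theorem Ext.vq (E : Ext S S') {q} (h : S.VQ q) : S'.VQ q := by
  cases q with
  | node v => exact lt_of_lt_of_le (b := S.nodeCount) h E.nodeCount_le
  | traverse o => exact lt_of_lt_of_le (b := S.opCount) h E.opCount_le
  | processed o => exact lt_of_lt_of_le (b := S.opCount) h E.opCount_le

theorem Ext.trans (E : Ext S S') (E' : Ext S' S'') : Ext S S'' where
  nodeCount_le := E.nodeCount_le.trans E'.nodeCount_le
  opCount_le := E.opCount_le.trans E'.opCount_le
  cellCount_le := E.cellCount_le.trans E'.cellCount_le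
  own_eq x hx := (E'.own_eq x (hx.trans_le E.cellCount_le)).trans (E.own_eq x hx)
  item_eq x hx := (E'.item_eq x (hx.trans_le E.cellCount_le)).trans (E.item_eq x hx)
  cts_eq x hx := (E'.cts_eq x (hx.trans_le E.cellCount_le)).trans (E.cts_eq x hx)
  nxt_eq x hx y h := E'.nxt_eq x (hx.trans_le E.cellCount_le) y (E.nxt_eq x hx y h)
  sep_eq v hv := (E'.sep_eq v (hv.trans_le E.nodeCount_le)).trans (E.sep_eq v hv)
  born_eq v hv := (E'.born_eq v (hv.trans_le E.nodeCount_le)).trans (E.born_eq v hv)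
  dep_eq v hv := (E'.dep_eq v (hv.trans_le E.nodeCount_le)).trans (E.dep_eq v hv)
  ots_eq o ho t h := E'.ots_eq o (ho.trans_le E.opCount_le) t (E.ots_eq o ho t h)
  hd_le v hv := (E.hd_le v hv).trans (E'.hd_le v (hv.trans_le E.nodeCount_le))
  tl_le q hq := (E.tl_le q hq).trans (E'.tl_le q (E.vq hq))

theorem Ext.ins (E : Ext S S') {v t} (h : S.Ins v t) : S'.Ins v t := by
  obtain ⟨x, hx, ht⟩ := h
  exact ⟨x, E.inQ hx, (E.cts_eq x hx.1).symm ▸ ht⟩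

/-- The future of a process as long as it does not start another operation. -/
def Fut (A : Spec κ σ ρ) (p : Fin n) : St κ σ ρ n → St κ σ ρ n → Prop :=
  Relation.ReflTransGen fun S S' => Guar S S' A ∧ S'.announce p = S.announce p

namespace Fut

variable {p : Fin n} (F : Fut A p S S')
include F

theorem announce : S'.announce p = S.announce p := by
  induction F with
  | refl => rfl
  | tail _ h ih => exact h.2.trans ih

theorem ext : Ext S S' := by
  induction F with
  | refl => exact Ext.refl _
  | tail _ h ih => exact ih.trans h.1.ext

theorem inv (I : S.Inv A) : S'.Inv A := by
  induction F with
  | refl => exact I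
  | tail _ h ih => exact h.1.inv ih

theorem ind (I : S.Inv A) {P : St κ σ ρ n → Prop}
    (hP : ∀ S S', S.Inv A → Guar S S' A → S'.announce p = S.announce p → P S → P S')
    (h : P S) : P S' := by
  induction F with
  | refl => exact h
  | tail hF hs ih => exact hP _ _ (Fut.inv hF I) hs.1 hs.2 ih

theorem pre (I : S.Inv A) {f : Frame κ σ ρ n} (h : S.Pre A p f) : S'.Pre A p f :=
  F.ind I (P := fun S => S.Pre A p f) (fun _ _ I G ha h => G.pre I ha h) h

end Fut

/-- A process with the given frames proceeds safely, and `Q` holds when they are finished. -/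
def Safe (A : Spec κ σ ρ) (p : Fin n) (S : St κ σ ρ n) (Q : St κ σ ρ n → Prop)
    (L : List (Frame κ σ ρ n)) : Prop :=
  Runs (Fut A p) (fun S f _ => S.Pre A p f) (fun S f => S.Post p f) Q L S 0

section Safe

variable {p : Fin n} {Q : St κ σ ρ n → Prop} {f₁ f₂ f₃ f₄ : Frame κ σ ρ n}

theorem safe_nil (h : Q S) : Safe A p S Q [] := h

theorem safe_one (h1 : S.Pre A p f₁) (h : ∀ S₁, Fut A p S S₁ → S₁.Post p f₁ → Q S₁) :
    Safe A p S Q [f₁] := ⟨0, 0, le_rfl, h1, h⟩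

theorem safe_two (h1 : S.Pre A p f₁) (h : ∀ S₁, Fut A p S S₁ → S₁.Post p f₁ → S₁.Pre A p f₂ ∧
      ∀ S₂, Fut A p S₁ S₂ → S₂.Post p f₂ → Q S₂) : Safe A p S Q [f₁, f₂] :=
  ⟨0, 0, le_rfl, h1, fun S₁ F hp => safe_one (h S₁ F hp).1 (h S₁ F hp).2⟩

theorem safe_three (h1 : S.Pre A p f₁) (h : ∀ S₁, Fut A p S S₁ → S₁.Post p f₁ → S₁.Pre A p f₂ ∧
      ∀ S₂, Fut A p S₁ S₂ → S₂.Post p f₂ → S₂.Pre A p f₃ ∧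
        ∀ S₃, Fut A p S₂ S₃ → S₃.Post p f₃ → Q S₃) : Safe A p S Q [f₁, f₂, f₃] :=
  ⟨0, 0, le_rfl, h1, fun S₁ F hp => safe_two (h S₁ F hp).1 (h S₁ F hp).2⟩

theorem safe_four (h1 : S.Pre A p f₁) (h : ∀ S₁, Fut A p S S₁ → S₁.Post p f₁ → S₁.Pre A p f₂ ∧
      ∀ S₂, Fut A p S₁ S₂ → S₂.Post p f₂ → S₂.Pre A p f₃ ∧
        ∀ S₃, Fut A p S₂ S₃ → S₃.Post p f₃ → S₃.Pre A p f₄ ∧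
          ∀ S₄, Fut A p S₃ S₄ → S₄.Post p f₄ → Q S₄) : Safe A p S Q [f₁, f₂, f₃, f₄] :=
  ⟨0, 0, le_rfl, h1, fun S₁ F hp => safe_three (h S₁ F hp).1 (h S₁ F hp).2⟩

end Safe

variable [DecidableEq σ]

/-- What has to be shown about one step of a process. -/
def StepOK (A : Spec κ σ ρ) (p : Fin n) (m : Mem κ σ ρ n) (g : Ghost n) (f : Frame κ σ ρ n) :
    Prop :=
  ∃ g', Guar (view m g) (view (step A p m f).1 g') A ∧ (step A p m f).1.announce = m.announce ∧
    (∀ o, ((step A p m f).1.queue (.traverse o)).head ≠ (m.queue (.traverse o)).head →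
      m.announce p = some o) ∧
    (∀ x q, m.cellCount ≤ x → (view (step A p m f).1 g').InQ x q → (∃ v, q = .node v) ∨
      (x = m.cellCount ∧ ∃ i t b y, f = .pushLink q i t b y)) ∧
    Safe A p (view (step A p m f).1 g') (fun S => S.Post p f) (step A p m f).2

variable {p : Fin n} {m : Mem κ σ ρ n} {g : Ghost n} {f : Frame κ σ ρ n} (I : (view m g).Inv A)

include I

/-! ### Steps that obtain timestamps and fill the root queue -/

theorem stepOK_silent {L} (h : step A p m f = (m, L))
    (hr : Safe A p (view m g) (fun S => S.Post p f) L) : StepOK A p m g f := by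
  rw [StepOK, h]
  exact ⟨g, Guar.refl I, rfl, fun _ h => absurd rfl h, fun _ _ h h' => absurd h'.1 (not_lt.mpr h), hr⟩

theorem stepOK_fetch {o} (h : (view m g).Pre A p (.fetch o)) : StepOK A p m g (.fetch o) := by
  have G := guar_fetch I h.2
  rw [← view_fetch] at G
  refine ⟨_, G, rfl, fun _ h => absurd rfl h, fun _ _ h h' => absurd h'.1 (not_lt.mpr h), safe_one ⟨h.1, h.2, I.versionPos, Nat.lt_succ_self _, ?_⟩
    fun _ _ h => h⟩
  exact Function.update_self _ _ _

theorem stepOK_stamp {o t} (h : (view m g).Pre A p (.stamp o t)) :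
    StepOK A p m g (.stamp o t) := by
  by_cases hn : (m.op o).ts = none
  · have G := guar_stamp I hn h.2.2
    rw [← view_stamp] at G
    have hs : step A p m (.stamp o t) = (m.setOp o { m.op o with ts := some t }, [.stamped o]) := by
      simp [step, hn]
    rw [StepOK, hs]
    refine ⟨g, G, rfl, fun o' h => absurd ?_ h, fun _ _ h h' => absurd h'.1 (not_lt.mpr h), safe_one ⟨h.1, h.2.1, ?_⟩ fun _ _ h => h⟩
    · exact update_apply_id (fun x : OpRecord κ => x.traverse.head) _ _ _ _ rfl
    · simp [view, Mem.setOp]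
  · exact stepOK_silent I (L := [.stamped o]) (by simp [step, hn])
      (safe_one ⟨h.1, h.2.1, hn⟩ fun _ _ h => h)

theorem stepOK_stamped {o} (h : (view m g).Pre A p (.stamped o)) :
    StepOK A p m g (.stamped o) := by
  obtain ⟨t, ht⟩ := Option.ne_none_iff_exists'.mp h.2.2
  refine stepOK_silent I (L := [.scan o t (List.finRange n) [], .main o t]) (by
    simp only [step]
    rw [show (m.op o).ts = some t from ht]) (safe_two ?_ fun S' F hp =>
      ⟨?_, fun _ _ h => h⟩)
  · refine ⟨h.2.1, ht, fun d hd => by simp at hd, fun d hd => by simp at hd, fun o' ho' _ => ?_,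
      fun o' ho' => by simp at ho'⟩
    -- When the scan begins, every operation is finished or stands in the array, and the whole array
    -- is still to be read.
    rcases I.fin o' ho' with ⟨t', h1, h2, _⟩ | ⟨i, hi⟩
    · exact .inl ⟨t', h1, fun _ => .inl h2⟩
    · exact .inr (.inl ⟨i, List.mem_finRange i, hi⟩)
  · exact ⟨F.announce.trans h.1, h.2.1.trans_le F.ext.opCount_le, F.ext.ots_eq o h.2.1 t ht, hp⟩

theorem stepOK_scan {o t todo saved} (h : (view m g).Pre A p (.scan o t todo saved)) :
    StepOK A p m g (.scan o t todo saved) := by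
  obtain ⟨h1, h2, h3, h4, h5, _⟩ := h
  cases todo with
  | nil =>
    refine stepOK_silent I (L := [.enqueue ((⟨o, t, (m.op o).query⟩ :: saved).insertionSort
      (fun a b => a.ts ≤ b.ts))]) rfl (safe_one ⟨?_, ?_, ?_⟩ ?_)
    · exact List.pairwise_insertionSort (fun a b : Desc κ => a.ts ≤ b.ts) _
    · intro d hd
      rw [List.mem_insertionSort] at hd
      rcases List.mem_cons.mp hd with rfl | hd
      · exact ⟨h1, h2⟩
      · exact h3 d hd
    -- The array has been read completely, so an operation with an earlier ticket is in the root
    -- queue or has been saved.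
    · rintro t' h1' ⟨d, hd, hlt⟩
      have hdt : d.ts ≤ t := by
        rw [List.mem_insertionSort] at hd
        rcases List.mem_cons.mp hd with rfl | hd
        · exact le_rfl
        · exact (h4 d hd).le
      have hv := (I.stamp o h1 t h2).2.1
      rcases h5 _ (I.ticketLt t' h1' (by omega)) (.inr ⟨t', by omega, h1', rfl⟩) with
        ⟨t'', h6, h7⟩ | ⟨i, hi, _⟩ | h
      · refine ⟨t'', h6, ?_⟩
        rintro rfl
        refine (h7 (by omega)).imp id ?_
        rintro ⟨d', hd', he⟩
        exact ⟨d', by rw [List.mem_insertionSort]; exact List.mem_cons_of_mem _ hd', he⟩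
      · simp at hi
      · cases h
    · intro S' F hp
      refine ⟨hp ⟨o, t, _⟩ (by rw [List.mem_insertionSort]; exact List.mem_cons_self), ?_⟩
      refine F.ind I (P := fun S => o < S.opCount ∧ S.Stamped o) (fun _ _ I G _ h =>
        ⟨h.1.trans_le G.opCount_le, G.stamped I h.1 h.2⟩) ⟨h1, fun o' ho' => ?_⟩ |>.2
      rcases h5 o' (ho'.trans_lt h1) (.inl ho') with ⟨t'', h6, _⟩ | ⟨i, hi, _⟩ | h
      · rw [h6]; simp
      · simp at hi
      · cases h
  | cons i todo =>
    cases ha : m.announce i with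
    | none =>
      refine stepOK_silent I (L := [.scan o t todo saved]) (by simp only [step]; rw [ha])
        (safe_one ⟨h1, h2, h3, h4, fun o' ho' hor => ?_, by simp⟩ fun _ _ h => h)
      rcases h5 o' ho' hor with h | ⟨j, hj, hj'⟩ | h
      · exact .inl h
      · rcases List.mem_cons.mp hj with rfl | hj
        · rw [show m.announce j = some o' from hj'] at ha; cases ha
        · exact .inr (.inl ⟨j, hj, hj'⟩)
      · cases h
    | some o₁ =>
      refine stepOK_silent I (L := [.scanTs o t o₁ todo saved]) (by simp only [step]; rw [ha])
        (safe_one ⟨h1, h2, h3, h4, fun o' ho' hor => ?_, fun o' ho' => ?_⟩ fun _ _ h => h)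
      · rcases h5 o' ho' hor with h | ⟨j, hj, hj'⟩ | h
        · exact .inl h
        · rcases List.mem_cons.mp hj with rfl | hj
          · rw [show m.announce j = some o' from hj'] at ha
            exact .inr (.inr ha.symm)
          · exact .inr (.inl ⟨j, hj, hj'⟩)
        · cases h
      · cases ho'
        exact (I.ann i o₁ ha).1

theorem stepOK_scanTs {o t o₁ todo saved} (h : (view m g).Pre A p (.scanTs o t o₁ todo saved)) :
    StepOK A p m g (.scanTs o t o₁ todo saved) := by
  cases ht : (m.op o₁).ts with
  | none =>
    exact stepOK_silent I (L := [.scanFetch o t o₁ todo saved]) (by simp only [step]; rw [ht])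
      (safe_one h fun _ _ h => h)
  | some t₁ =>
    obtain ⟨h1, h2, h3, h4, h5, h6⟩ := h
    refine stepOK_silent I (L := [.scan o t todo (if t₁ < t then ⟨o₁, t₁, (m.op o₁).query⟩ :: saved
      else saved)]) (by simp only [step]; rw [ht])
      (safe_one ⟨h1, h2, ?_, ?_, fun o' ho' hor => ?_, by simp⟩ fun _ _ h => h)
    · split_ifs with hlt
      · intro d hd
        rcases List.mem_cons.mp hd with rfl | hd
        · exact ⟨h6 _ rfl, ht⟩
        · exact h3 d hd
      · exact h3
    · split_ifs with hlt
      · intro d hd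
        rcases List.mem_cons.mp hd with rfl | hd
        · exact hlt
        · exact h4 d hd
      · exact h4
    · rcases h5 o' ho' hor with ⟨t', h7, h8⟩ | h | h
      · refine .inl ⟨t', h7, fun hlt => (h8 hlt).imp id ?_⟩
        rintro ⟨d, hd, he⟩
        refine ⟨d, ?_, he⟩
        split_ifs
        · exact List.mem_cons_of_mem _ hd
        · exact hd
      · exact .inr (.inl h)
      · cases h
        refine .inl ⟨t₁, ht, fun hlt => .inr ?_⟩
        rw [if_pos hlt]
        exact ⟨_, List.mem_cons_self, rfl⟩

theorem stepOK_scanFetch {o t o₁ todo saved}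
    (h : (view m g).Pre A p (.scanFetch o t o₁ todo saved)) :
    StepOK A p m g (.scanFetch o t o₁ todo saved) := by
  have ho : o₁ < m.opCount := h.2.2.2.2.2 o₁ rfl
  have G := guar_fetch I ho
  refine ⟨{ g with ticket := Function.update g.ticket m.version o₁ }, G, rfl, fun _ h => absurd rfl h,
    fun _ _ h h' => absurd h'.1 (not_lt.mpr h),
    safe_one ⟨G.scan I h, I.versionPos, Nat.lt_succ_self _, Function.update_self _ _ _⟩
      fun _ _ h => h⟩

theorem stepOK_scanStamp {o t o₁ t₁ todo saved}
    (h : (view m g).Pre A p (.scanStamp o t o₁ t₁ todo saved)) :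
    StepOK A p m g (.scanStamp o t o₁ t₁ todo saved) := by
  by_cases hn : (m.op o₁).ts = none
  · have G := guar_stamp I hn h.2
    rw [← view_stamp] at G
    have hs : step A p m (.scanStamp o t o₁ t₁ todo saved) =
        (m.setOp o₁ { m.op o₁ with ts := some t₁ }, [.scanTs o t o₁ todo saved]) := by
      simp [step, hn]
    rw [StepOK, hs]
    refine ⟨g, G, rfl, fun o' h => absurd ?_ h, fun _ _ h h' => absurd h'.1 (not_lt.mpr h), safe_one (G.scan I h.1) fun _ _ h => h⟩
    exact update_apply_id (fun x : OpRecord κ => x.traverse.head) _ _ _ _ rfl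
  · exact stepOK_silent I (L := [.scanTs o t o₁ todo saved]) (by simp [step, hn])
      (safe_one h.1 fun _ _ h => h)

theorem stepOK_enqueue {l} (h : (view m g).Pre A p (.enqueue l)) :
    StepOK A p m g (.enqueue l) := by
  cases l with
  | nil => exact stepOK_silent I rfl (safe_nil (fun d hd => by simp at hd))
  | cons d l =>
    obtain ⟨h1, h2, h3⟩ := id h
    rw [List.pairwise_cons] at h1
    obtain ⟨hd1, hd2⟩ := h2 d List.mem_cons_self
    refine stepOK_silent I (L := [.push (.node 0) (.desc d) d.ts true, .enqueue l]) rfl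
      (safe_two ?_ fun S' F hp => ⟨?_, fun S'' F' hp' e he => ?_⟩)
    -- The list is sorted and `d` is its first entry, so all earlier operations are in the root
    -- queue and not in the rest of the list.
    · refine ⟨d, rfl, rfl, rfl, I.nodePos, hd1, hd2, I.travRoot _ hd1, .inl ⟨rfl,
        (I.stamp _ hd1 _ hd2).2.1.le, fun t' h1' hlt => ?_⟩⟩
      obtain ⟨t'', h4, h5⟩ := h3 t' h1' ⟨d, List.mem_cons_self, hlt⟩
      refine ⟨t'', h4, fun he => (h5 he).resolve_right ?_⟩
      rintro ⟨d', hd', rfl⟩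
      rcases List.mem_cons.mp hd' with rfl | hd'
      · exact lt_irrefl _ hlt
      · exact absurd (h1.1 d' hd') (not_le.mpr hlt)
    · obtain ⟨h1', h2', h3'⟩ := F.pre I h
      refine ⟨(List.pairwise_cons.mp h1').2, fun e he => h2' e (List.mem_cons_of_mem _ he), ?_⟩
      rintro t' ht' ⟨e, he, hlt⟩
      obtain ⟨t'', h4, h5⟩ := h3' t' ht' ⟨e, List.mem_cons_of_mem _ he, hlt⟩
      refine ⟨t'', h4, fun heq => ?_⟩
      rcases h5 heq with h | ⟨e', he', rfl⟩
      · exact .inl h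
      · rcases List.mem_cons.mp he' with rfl | he'
        · exact .inl hp
        · exact .inr ⟨e', he', rfl⟩
    · rcases List.mem_cons.mp he with rfl | he
      · exact F'.ext.ins hp
      · exact hp' e he

end St

end WaitFreeTree

/-! The steps preserve the assertions: timestamps and queues. -/

namespace WaitFreeTree

set_option linter.unusedSectionVars false

variable {κ σ ρ : Type*} {n : ℕ} [LinearOrder κ]

namespace St

variable {S S' S'' : St κ σ ρ n} {A : Spec κ σ ρ} [DecidableEq σ]
  {p : Fin n} {m : Mem κ σ ρ n} {g : Ghost n} {f : Frame κ σ ρ n} (I : (view m g).Inv A)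

include I

omit [DecidableEq σ] in
theorem pushable_vq {q x t b} (h : (view m g).Pushable A x t b q) : (view m g).VQ q := by
  cases q with
  | node v => obtain ⟨_, _, _, _, h⟩ := h; exact h.1
  | traverse o => obtain ⟨_, _, _, _, h⟩ := h; exact h.1
  | processed o => exact h.2

theorem stepOK_push {q x t b} (h : (view m g).Pre A p (.push q x t b)) :
    StepOK A p m g (.push q x t b) := by
  have hq := pushable_vq I h
  have ht := (I.queues.ends q hq).2
  by_cases hc : b = true ∧ t ≤ (m.cell (m.queue q).tail).ts
  · refine stepOK_silent I (L := []) (by simp only [step]; rw [if_pos hc]) (safe_nil ?_)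
    simp only [Post, hc.1, if_true]
    exact ⟨_, ht, hc.2⟩
  · refine stepOK_silent I (L := [.pushNext q x t b (m.queue q).tail])
      (by simp only [step]; rw [if_neg hc]) (safe_one ⟨h, ht, le_rfl, fun hb => ?_⟩ fun _ _ h => h)
    exact not_le.mp fun hle => hc ⟨hb, hle⟩

theorem stepOK_pushNext {q x t b y} (h : (view m g).Pre A p (.pushNext q x t b y)) :
    StepOK A p m g (.pushNext q x t b y) := by
  cases hn : (m.cell y).next with
  | some new =>
    refine stepOK_silent I (L := [.pushSwing q y new, .push q x t b])
      (by simp only [step]; rw [hn]) (safe_two ⟨h.2.1, h.2.2.1, hn⟩ fun S' F _ => ⟨?_, fun _ _ h => h⟩)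
    exact F.pre I (f := .push q x t b) h.1
  | none =>
    refine stepOK_silent I (L := [.pushLink q x t b y])
      (by simp only [step]; rw [hn]) (safe_one ⟨h.1, h.2, fun _ z hz hlt => ?_⟩ fun _ _ h => h)
    exact absurd hn (I.queues.last q y z h.2.1 hz hlt)

/-- A guarded insertion may end after a failed CAS: `y` then has a successor, and by the
precondition that one has a timestamp of at least `t`. -/
theorem stepOK_pushLink {q x t b y} (h : (view m g).Pre A p (.pushLink q x t b y)) :
    StepOK A p m g (.pushLink q x t b y) := by
  obtain ⟨h1, ⟨h2, h3, h4⟩, h5⟩ := h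
  by_cases hn : (m.cell y).next = none
  · have hok : (view m g).LinkOK A x t q := by
      cases q with
      | node v =>
        obtain ⟨d, e1, e2, e3, e4⟩ := h1
        refine ⟨d, e1, e2, e4, fun z hz => ?_⟩
        have hzy : z ≤ y := by
          by_contra hlt
          exact I.queues.last _ y z h2 hz (not_le.mp hlt) hn
        exact (I.cts_le hz h2 hzy).trans_lt (e2 ▸ h4 e3)
      | traverse o => exact h1.2
      | processed o => trivial
    have G := guar_link I h2 hn h3 hok
    have hyc : y < m.cellCount := h2.1
    rw [← view_link m g q x t y hyc] at G
    have hs : step A p m (.pushLink q x t b y) = ((m.newCell ⟨x, t, none⟩).setCell y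
      { (m.newCell ⟨x, t, none⟩).cell y with next := some m.cellCount },
        [.pushSwing q y m.cellCount]) := by
      simp only [step]
      rw [if_pos hn]
    rw [StepOK, hs]
    have V := view_link m g q x t y hyc
    have hin : ((view m g).linkSt q y x t).InQ m.cellCount q := linkSt_inQ.mpr (.inr ⟨rfl, rfl⟩)
    refine ⟨_, G, rfl, fun _ h => absurd rfl h, fun z q' hz hzq => .inr ?_, safe_one ⟨G.inQ h2, h3, ?_⟩ fun S' F hp => ?_⟩
    · rw [V] at hzq
      rcases linkSt_inQ.mp hzq with h' | ⟨h', rfl⟩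
      · exact absurd h'.1 (not_lt.mpr hz)
      · exact ⟨h', _, _, _, _, rfl⟩
    · rw [V]
      exact Function.update_self _ _ _
    · rw [V] at F
      have hin' := F.ext.inQ hin
      cases b with
      | true =>
        simp only [Post, if_true]
        refine ⟨_, hin', ?_⟩
        rw [F.ext.cts_eq _ hin.1]
        exact (Function.update_self (β := fun _ => ℕ) _ _ _).ge
      | false =>
        simp only [Post]
        refine ⟨_, hin', ?_⟩
        rw [F.ext.item_eq _ hin.1]
        exact Function.update_self _ _ _
  · obtain ⟨z, hz⟩ := Option.ne_none_iff_exists'.mp hn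
    cases b with
    | true =>
      refine stepOK_silent I (L := []) (by simp [step, hn]) (safe_nil ?_)
      obtain ⟨h6, h7, _⟩ := I.queues.next y h2.1 z hz
      rw [h2.2] at h6
      simp only [Post, if_true]
      exact ⟨z, h6, h5 rfl z h6 h7⟩
    | false =>
      exact stepOK_silent I (L := [.push q x t false]) (by simp [step, hn])
        (safe_one h1 fun _ _ h => h)

/-- A tail register that no longer contains `y` has moved on, at least to the successor of `y`. -/
theorem stepOK_pushSwing {q y z} (h : (view m g).Pre A p (.pushSwing q y z)) :
    StepOK A p m g (.pushSwing q y z) := by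
  obtain ⟨h1, h2, h3⟩ := h
  have hq : (view m g).VQ q := h1.2 ▸ I.queues.vq y h1.1
  by_cases hc : (m.queue q).tail = y
  · have G := guar_tail I hq hc h3
    rw [← view_tail] at G
    have hs : step A p m (.pushSwing q y z) =
        (m.setQueue { m.queue q with tail := z } q, []) := by
      simp only [step]
      rw [if_pos hc]
    rw [StepOK, hs]
    refine ⟨g, G, by cases q <;> rfl, fun o h => absurd ?_ h, fun z q' hz hzq => absurd hzq.1 (not_lt.mpr (by cases q <;> exact hz)), safe_nil ?_⟩
    · show ((m.setQueue _ q).queue _).head = _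
      rw [view_setQueue]
      split_ifs with h
      · rw [h]
      · rfl
    · rw [view_tail]
      exact (Function.update_self (β := fun _ => ℕ) _ _ _).ge
  · refine stepOK_silent I (L := []) (by simp only [step]; rw [if_neg hc]) (safe_nil ?_)
    obtain ⟨_, _, h6⟩ := I.queues.next y h1.1 z h3
    rw [h1.2] at h6
    exact h6 _ (I.queues.ends q hq).2 (lt_of_le_of_ne h2 (Ne.symm hc))

theorem stepOK_pop {t v} (h : (view m g).Pre A p (.pop t v)) : StepOK A p m g (.pop t v) := by
  obtain ⟨d, h1, h2⟩ := h
  have hv := h2.1.lt I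
  refine stepOK_silent I (L := [.popNext t v (m.queue (.node v)).head]) rfl
    (safe_one ⟨⟨d, h1, h2⟩, (I.queues.ends (.node v) hv).1, le_rfl, ?_⟩ fun _ _ h => h)
  intro x hx hlt
  exact h2.1.2 x hx (h1 ▸ hlt)

theorem stepOK_popNext {t v y} (h : (view m g).Pre A p (.popNext t v y)) :
    StepOK A p m g (.popNext t v y) := by
  obtain ⟨⟨d, h1, h2⟩, h3, h4, h5⟩ := h
  cases hn : (m.cell y).next with
  | none =>
    exact stepOK_silent I (L := []) (by simp only [step]; rw [hn])
      (safe_nil (I.passed_of_last h3 h4 hn t))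
  | some z =>
    obtain ⟨h6, h7, h8, d', h9, h10⟩ := I.next_node h3 hn
    obtain ⟨x, hx, hxi, hxt⟩ := h2.1.1
    by_cases ht : (m.cell z).ts = t
    · have hzx : z = x := I.cell_unique h6 hx (by rw [hxt, h1]; exact ht)
      subst hzx
      refine stepOK_silent I (L := [.popSwing v y z])
        (by simp only [step]; rw [hn]; simp only; rw [if_pos ht])
        (safe_one ⟨⟨d, hxi, h2⟩, h3, h4, hn⟩ fun S' F hp w hw hwt => ?_)
      have I' := F.inv I
      have hz' := F.ext.inQ h6
      refine le_trans ?_ hp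
      by_contra hlt
      have h11 := I'.sorted v z w hz' hw (not_le.mp hlt)
      rw [F.ext.cts_eq z h6.1] at h11
      exact absurd (ht ▸ h11 : t < S'.cts w) (not_lt.mpr hwt)
    -- Cells earlier than `t` lie no further than `y`, so the successor of `y` is later than `t`,
    -- and nothing up to `t` is left.
    · refine stepOK_silent I (L := [])
        (by simp only [step]; rw [hn]; simp only; rw [if_neg ht])
        (safe_nil fun w hw hwt => le_trans ?_ h4)
      by_contra hlt
      obtain ⟨_, _, h11⟩ := I.queues.next y h3.1 z hn
      rw [h3.2] at h11
      have hzw := I.cts_le h6 hw (h11 w hw (not_le.mp hlt))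
      have : (view m g).cts z < t := lt_of_le_of_ne (hzw.trans hwt) ht
      exact absurd (h5 z h6 this) (not_le.mpr h7)

theorem stepOK_popSwing {v y z} (h : (view m g).Pre A p (.popSwing v y z)) :
    StepOK A p m g (.popSwing v y z) := by
  obtain ⟨⟨d, h1, h2⟩, h3, h4, h5⟩ := h
  by_cases hc : (m.queue (.node v)).head = y
  · have h5' : (view m g).nxt ((view m g).hd (.node v)) = some z := by
      rw [show (view m g).hd (.node v) = y from hc]
      exact h5
    have G := guar_pop I h5' h1 h2.1 h2.2
    rw [← view_head] at G
    have hs : step A p m (.popSwing v y z) =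
        (m.setQueue { m.queue (.node v) with head := z } (.node v), []) := by
      simp only [step]
      rw [if_pos hc]
    rw [StepOK, hs]
    refine ⟨g, G, rfl, fun o h => absurd rfl h, fun _ _ h h' => absurd h'.1 (not_lt.mpr h), safe_nil ?_⟩
    rw [view_head]
    exact (Function.update_self (β := fun _ => ℕ) _ _ _).ge
  · refine stepOK_silent I (L := []) (by simp only [step]; rw [if_neg hc]) (safe_nil ?_)
    obtain ⟨_, _, h6⟩ := I.queues.next y h3.1 z h5
    rw [h3.2] at h6
    exact h6 _ (I.queues.ends (.node v) (I.node_lt h3)).1 (lt_of_le_of_ne h4 (Ne.symm hc))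

/-! ### Steps of the helping loop and of the initiator's traversal -/

theorem stepOK_untilTs {t v} (h : (view m g).Pre A p (.untilTs t v)) :
    StepOK A p m g (.untilTs t v) :=
  stepOK_silent I (L := [.untilNext t v (m.queue (.node v)).head]) rfl
    (safe_one ⟨(I.queues.ends (.node v) h).1, le_rfl⟩ fun _ _ h => h)

theorem stepOK_untilNext {t v y} (h : (view m g).Pre A p (.untilNext t v y)) :
    StepOK A p m g (.untilNext t v y) := by
  obtain ⟨h3, h4⟩ := h
  cases hn : (m.cell y).next with
  | none =>
    exact stepOK_silent I (L := []) (by simp only [step]; rw [hn])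
      (safe_nil (I.passed_of_last h3 h4 hn t))
  | some z =>
    obtain ⟨h6, h7, h8, d, h9, h10⟩ := I.next_node h3 hn
    have h9' : (m.cell z).item = .desc d := h9
    have hv := I.node_lt h3
    by_cases ht : t < d.ts
    · refine stepOK_silent I (L := [])
        (by simp only [step]; rw [hn]; simp only; rw [h9']; simp only; rw [if_pos ht])
        (safe_nil fun w hw hwt => le_trans ?_ h4)
      exact h8 w hw (hwt.trans_lt (h10 ▸ ht))
    · refine stepOK_silent I
        (L := [.exec d v (route d.query (m.node v).sep) [] false, .untilTs t v])
        (by simp only [step]; rw [hn]; simp only; rw [h9']; simp only; rw [if_neg ht])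
        (safe_two ⟨⟨⟨z, h6, h9, h10⟩, fun x hx hlt => ?_⟩, fun e he => he, fun e he => .inl he,
          fun h => by cases h⟩ fun S' F hp => ⟨?_, fun _ _ h => h⟩)
      · exact (h8 x hx (h10 ▸ hlt)).trans h4
      · exact hv.trans_le F.ext.nodeCount_le

theorem stepOK_main {o t} (h : (view m g).Pre A p (.main o t)) : StepOK A p m g (.main o t) := by
  refine stepOK_silent I (L := [.mainNext o t (m.queue (.traverse o)).head]) rfl
    (safe_one ⟨h, (I.queues.ends (.traverse o) h.2.1).1, fun y v hy hle hi => ?_⟩ fun _ _ h => h)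
  obtain ⟨t', h1, h2⟩ := I.passed o y v hy hle hi
  rw [h.2.2.1] at h1
  cases h1
  exact h2

omit [DecidableEq σ] in
-- The parent precedes the child in `Traverse`. It has been treated, so the operation was popped
-- there and has therefore entered the accepted child.
theorem treated_next {o t y z v} (h : (view m g).MainAt p o t) (h' : (view m g).Treated o t y)
    (hn : (view m g).nxt y = some z) (hi : (view m g).item z = .node v) :
    v < (view m g).nodeCount ∧ (view m g).Ins v t := by
  obtain ⟨h1, h2, h3⟩ := I.queues.next y h'.1.1 z hn
  rw [h'.1.2] at h1 h3
  rcases I.trav o z h1 with h4 | h4 | ⟨c, d, h4, h5, h6, h7, y', h8, h9, h10⟩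
  · rw [hi] at h4; cases h4
  · rw [hi] at h4
    cases h4
    exact ⟨I.nodePos, h.2.2.2.1⟩
  · rw [hi] at h4
    cases h4
    rw [h.2.2.1] at h6
    have hdt : d.ts = t := (Option.some.inj h6).symm
    obtain ⟨⟨q, hq⟩, _, _, _⟩ := id h7
    refine ⟨hq.1, ?_⟩
    have hy' : y' ≤ y := by
      by_contra hlt
      exact absurd (h3 y' h9 (not_le.mp hlt)) (not_le.mpr h8)
    obtain ⟨x, hx, hxi, hxt⟩ := hq.2.2.1.1
    have := (h'.2 y' _ h9 hy' h10).2 x hx (by omega)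
    exact hdt ▸ I.accepted_ins h7 ⟨x, hx, hxi, this⟩

omit [DecidableEq σ] in
theorem treated_mainPop {o t y z} (h : (view m g).MainAt p o t) (h' : (view m g).Treated o t y)
    (hn : (view m g).nxt y = some z) (F : Fut A p (view m g) S')
    (hz : ∀ v, (view m g).item z = .node v → S'.Passed v t) : S'.Pre A p (.mainPop o z) := by
  obtain ⟨h1, h2, h3⟩ := I.queues.next y h'.1.1 z hn
  rw [h'.1.2] at h1 h3
  refine ⟨F.announce.trans h.1, t, F.ext.ots_eq o h.2.1 t h.2.2.1, F.ext.inQ h1,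
    fun y' v hy' hle hi => ?_⟩
  have hc : y' < (view m g).cellCount := hle.trans_lt h1.1
  have hy := F.ext.inQ_old hy' hc
  rcases lt_or_ge y y' with hlt | hge
  · have : y' = z := le_antisymm hle (h3 y' hy hlt)
    subst this
    rw [F.ext.item_eq _ hc] at hi
    exact ⟨F.ext.ins (treated_next I h h' hn hi).2, hz v hi⟩
  · have := F.ind I (P := fun S => S.Treated o t y) (fun _ _ I G _ h => G.treated I h) h'
    exact this.2 y' v hy' hge hi

theorem stepOK_mainNext {o t y} (h : (view m g).Pre A p (.mainNext o t y)) :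
    StepOK A p m g (.mainNext o t y) := by
  obtain ⟨h1, h2⟩ := h
  cases hn : (m.cell y).next with
  | none =>
    refine stepOK_silent I (L := [.result o]) (by simp only [step]; rw [hn])
      (safe_one ⟨fun o' ho' => ?_, h1.2.1⟩ fun _ _ h => h)
    rw [h1.1] at ho'
    cases ho'
    -- Each node whose queue contains the operation occurs in `Traverse`, all of which has been
    -- treated.
    refine ⟨t, h1.2.2.1, h1.2.2.2.1, h1.2.2.2.2, fun v x d hx hi hd => ?_⟩
    obtain ⟨e1, e2, e3, ⟨z, hz, hzi⟩, _⟩ := I.desc_cell hx hi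
    have hzy : z ≤ y := by
      by_contra hlt
      rw [hd] at hz
      exact I.queues.last _ y z h2.1 hz (not_le.mp hlt) hn
    rw [hd, h1.2.2.1] at e3
    have hdt : d.ts = t := (Option.some.inj e3).symm
    exact (h2.2 z v (hd ▸ hz) hzy hzi).2 x hx (by omega)
  | some z =>
    by_cases hi : ∃ v, (m.cell z).item = .node v
    · obtain ⟨v, hi⟩ := hi
      refine stepOK_silent I (L := [.untilTs t v, .mainPop o z, .main o t])
        (by simp only [step]; rw [hn]; simp only; rw [hi])
        (safe_three (treated_next I h1 h2 hn hi).1 fun S' F hp => ⟨treated_mainPop I h1 h2 hn F ?_,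
          fun S'' F' _ => ⟨?_, fun _ _ h => h⟩⟩)
      · intro w hw
        rw [show (view m g).item z = .node v from hi] at hw
        cases hw
        exact hp
      · exact Fut.pre (F.trans F') I (f := .main o t) h1
    · refine stepOK_silent I (L := [.mainPop o z, .main o t])
        (by
          simp only [step]; rw [hn]; simp only
          split
          · exact absurd ⟨_, by assumption⟩ hi
          · rfl)
        (safe_two (treated_mainPop I h1 h2 hn .refl fun v hv => absurd ⟨v, hv⟩ hi)
          fun S' F _ => ⟨?_, fun _ _ h => h⟩)
      exact F.pre I (f := .main o t) h1

theorem stepOK_mainPop {o y} (h : (view m g).Pre A p (.mainPop o y)) :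
    StepOK A p m g (.mainPop o y) := by
  obtain ⟨h1, t, h2, h3, h4⟩ := h
  have G := guar_popTrav I h3 h2 h4
  rw [← view_head] at G
  have hs : step A p m (.mainPop o y) =
      (m.setQueue { m.queue (.traverse o) with head := y } (.traverse o), []) := rfl
  rw [StepOK, hs]
  refine ⟨g, G, rfl, fun o' h' => ?_, fun _ _ h h' => absurd h'.1 (not_lt.mpr h), safe_nil ?_⟩
  · have : o' = o := by
      by_contra hne
      have key : ((m.setQueue { m.queue (.traverse o) with head := y } (.traverse o)).queue
          (.traverse o')).head = (m.queue (.traverse o')).head := by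
        rw [view_setQueue, if_neg (fun e => hne (QRef.traverse.inj e))]
      exact h' key
    subst this
    exact h1
  · show (view (m.setQueue _ _) g).hd _ = _
    rw [view_head]
    exact Function.update_self _ _ _

theorem stepOK_result {o} (h : (view m g).Pre A p (.result o)) : StepOK A p m g (.result o) :=
  stepOK_silent I (L := [.resultNext (m.queue (.processed o)).head []]) rfl
    (safe_one ⟨h.1, o, (I.queues.ends (.processed o) h.2).1⟩ fun _ _ h => h)

theorem stepOK_resultNext {c parts} (h : (view m g).Pre A p (.resultNext c parts)) :
    StepOK A p m g (.resultNext c parts) := by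
  obtain ⟨h1, o, h2⟩ := h
  cases hn : (m.cell c).next with
  | none =>
    have hs : step A p m (.resultNext c parts) =
        ({ m with ret := Function.update m.ret p parts }, []) := by
      simp only [step]; rw [hn]
    rw [StepOK, hs]
    exact ⟨g, Guar.refl I, rfl, fun _ h => absurd rfl h, fun _ _ h h' => absurd h'.1 (not_lt.mpr h), safe_nil h1⟩
  | some z =>
    obtain ⟨h3, _⟩ := I.queues.next c h2.1 z hn
    rw [h2.2] at h3
    by_cases hi : ∃ v r, (m.cell z).item = .part v r
    · obtain ⟨v, r, hi⟩ := hi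
      exact stepOK_silent I
        (L := [.resultNext z (if v ∈ parts.map Prod.fst then parts else parts ++ [(v, r)])])
        (by simp only [step]; rw [hn]; simp only; rw [hi]) (safe_one ⟨h1, o, h3⟩ fun _ _ h => h)
    · exact stepOK_silent I (L := [.resultNext z parts])
        (by
          simp only [step]; rw [hn]; simp only
          split
          · exact absurd ⟨_, _, by assumption⟩ hi
          · rfl) (safe_one ⟨h1, o, h3⟩ fun _ _ h => h)

end St

end WaitFreeTree

/-! The steps preserve the assertions: execution and rebuilding. -/

namespace WaitFreeTree

set_option linter.unusedSectionVars false

variable {κ σ ρ : Type*} {n : ℕ} [LinearOrder κ]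

namespace St

variable {S S' S'' : St κ σ ρ n} {A : Spec κ σ ρ} [DecidableEq σ]
  {p : Fin n} {m : Mem κ σ ρ n} {g : Ghost n} {f : Frame κ σ ρ n} (I : (view m g).Inv A)

include I

omit [DecidableEq σ] in
theorem exec_cons {d v s q todo r} (F : Fut A p (view m g) S')
    (h : (view m g).Exec d v ((s, q) :: todo) r) (hs : S'.SideDone v s q d.ts) :
    S'.Exec d v todo false := by
  obtain ⟨h1, h2, h3, _⟩ := F.ind I (P := fun S => S.Exec d v ((s, q) :: todo) r)
    (fun _ _ I G _ h => G.exec I h) h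
  refine ⟨h1, fun e he => h2 e (List.mem_cons_of_mem _ he), fun e he => ?_, fun h => by cases h⟩
  rcases h3 e he with h | h
  · rcases List.mem_cons.mp h with rfl | h
    · exact .inr hs
    · exact .inl h
  · exact .inr h

theorem stepOK_exec_nil {d v views r} (h : (view m g).Pre A p (.exec d v [] views r)) :
    StepOK A p m g (.exec d v [] views r) := by
  obtain ⟨h1, _, h3, _⟩ := h
  have hr : (view m g).Ready v d := ⟨h1, fun s q hq => (h3 _ hq).resolve_left (by simp)⟩
  refine stepOK_silent I (L := [.push (.processed d.op) (.part v (A.value d.query d.ts views)) 0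
    false, .pop d.ts v]) rfl (safe_two ⟨rfl, (I.reached_desc h1).1⟩ fun S' F _ => ⟨?_, fun _ _ h => h⟩)
  exact F.pre I (f := .pop d.ts v) ⟨d, rfl, hr⟩

omit [DecidableEq σ] in
theorem pre_replace {d v s q todo r keys old}
    (h : (view m g).Exec d v ((s, q) :: todo) r) (hc : (view m g).child v s = old)
    (hni : ∀ c, old ≠ .inner c) (hlt : old.ts < d.ts) (hk : leafUpdate q old = some keys) :
    (view m g).Pre A p (.replace v s old d.ts keys) := by
  subst hc
  refine ⟨h.1.lt I, ⟨Ref.ts_eq_rts (view m g) hni ▸ hlt, fun c hc => absurd hc (hni c)⟩, .inl ⟨rfl, .inl ⟨d, q, h.1, h.2.1 _ List.mem_cons_self, hni, hlt, ?_, rfl,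
    leafUpdate_length hk⟩⟩⟩
  rw [hk]
  simp

theorem stepOK_exec_leaf {d v s q todo views views' r old}
    (h : (view m g).Exec d v ((s, q) :: todo) r) (hc : (view m g).child v s = old)
    (hni : ∀ c, old ≠ .inner c)
    (hs : step A p m (.exec d v ((s, q) :: todo) views r) =
      (m, (if old.ts < d.ts then (leafUpdate q old).toList.map
        (fun keys => .replace v s old d.ts keys) else []) ++ [.exec d v todo views' false])) :
    StepOK A p m g (.exec d v ((s, q) :: todo) views r) := by
  have hv := h.1.lt I
  refine stepOK_silent I hs ?_
  have hsd : ¬ (old.ts < d.ts) ∨ leafUpdate q old = none → (view m g).SideDone v s q d.ts := by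
    intro ho
    subst hc
    exact ⟨fun c hc => absurd hc (hni c), fun _ => ho.imp not_lt.mp id⟩
  by_cases hlt : old.ts < d.ts
  · rw [if_pos hlt]
    cases hk : leafUpdate q old with
    | none =>
      exact safe_one (exec_cons I (show Fut A p (view m g) (view m g) from .refl) h (hsd (.inr hk))) fun _ _ h => h
    | some keys =>
      refine safe_two (pre_replace I h hc hni hlt hk) fun S' F hp => ⟨exec_cons I F h ?_, fun _ _ h => h⟩
      exact Guar.sideDone_of_le (F.inv I) (Guar.refl (F.inv I)) (hv.trans_le F.ext.nodeCount_le) hp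
  · rw [if_neg hlt]
    exact safe_one (exec_cons I (show Fut A p (view m g) (view m g) from .refl) h (hsd (.inl hlt))) fun _ _ h => h

theorem stepOK_exec {d v todo views r} (h : (view m g).Pre A p (.exec d v todo views r)) :
    StepOK A p m g (.exec d v todo views r) := by
  cases todo with
  | nil => exact stepOK_exec_nil I h
  | cons e todo =>
    obtain ⟨s, q⟩ := e
    have hv := h.1.lt I
    cases hc : (m.node v).child s with
    | empty t =>
      exact stepOK_exec_leaf I h hc (by simp) (views' := views ++ [.empty t])
        (by simp only [step]; rw [hc]; rfl)
    | leaf k t =>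
      exact stepOK_exec_leaf I h hc (by simp) (views' := views ++ [.leaf k t])
        (by simp only [step]; rw [hc]; rfl)
    | inner c =>
      have hc' : (view m g).child v s = .inner c := hc
      obtain ⟨h1, h2, h3, _⟩ := I.child v hv s c hc'
      refine stepOK_silent I (L := [.execState d v s q todo views r c])
        (by simp only [step]; rw [hc])
        (safe_one ⟨⟨h.1, h.2.1, h.2.2.1, fun h => by cases h⟩, h1, h2, h3, fun hq => ?_, fun hr => ?_,
          .inl hc'⟩
          fun _ _ h => h)
      · have hcb : (view m g).ComesBy c d q := by
          refine ⟨h1, h2, ?_, ?_, hq⟩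
          · simpa only [h3] using h.1
          · simpa only [h3] using h.2.1 _ List.mem_cons_self
        refine ⟨⟨q, hcb⟩, fun t' hlt hcm => ?_, .inl (.inl ?_)⟩
        · obtain ⟨d', q', hd', rfl⟩ := hcm
          obtain ⟨_, _, h4, h5, h6⟩ := id hd'
          rw [h3] at h4 h5
          exact (I.allDone_of_lt h.1 h4 hlt s q' h5).1 c hc' h6
        · simpa only [h3] using hc'
      · have := h.2.2.2 hr (s, q) rfl
        rw [hc'] at this
        exact this

omit [DecidableEq σ] I in
theorem whole_sideDone {S : St κ σ ρ n} {v s t} {q : Query κ} (hq : q.isWhole = true) :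
    S.SideDone v s q t := by
  refine ⟨fun _ _ h => (by rw [hq] at h; cases h), fun _ => .inr ?_⟩
  unfold Query.isWhole at hq
  split at hq
  · unfold leafUpdate
    split <;> first | rfl | simp_all
  · cases hq

theorem stepOK_execState (hK : 1 ≤ 2 * A.K) {d v s q todo views r c}
    (h : (view m g).Pre A p (.execState d v s q todo views r c)) :
    StepOK A p m g (.execState d v s q todo views r c) := by
  obtain ⟨h1, h2, h3, h4, h5, h6, h7⟩ := h
  have hv := h1.1.lt I
  cases hq : q.isWhole with
  | true =>
    exact stepOK_silent I (L := [.exec d v todo (views ++ [.whole (m.node c).state.aug]) false])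
      (by simp only [step]; rw [if_pos hq])
      (safe_one (exec_cons I (show Fut A p (view m g) (view m g) from .refl) h1 (whole_sideDone hq)) fun _ _ h => h)
  | false =>
    obtain ⟨⟨q', hq'⟩, h8, h9⟩ := h5 hq
    have hdr := I.reached_desc h1.1
    have ht1 := (I.stamp _ hdr.1 _ hdr.2.1).1
    by_cases hc : (m.node c).state.tsMod < d.ts ∧ r = false ∧
        mustRebuild A d (m.node c).initSz (m.node c).state = true
    · have hdoom : (view m g).Doomed A c d := ⟨⟨q', hq'⟩, h8, hc.1, hc.2.2⟩
      have hf : (view m g).Frz A (d.ts - 1 + 1) c := .base c d hdoom (by omega)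
      refine stepOK_silent I (L := [.drain (d.ts - 1) [c], .gather (d.ts - 1) v s c [.inner c] [],
           .exec d v ((s, q) :: todo) views true])
        (by simp only [step]; rw [if_neg (by simp [hq]), if_pos hc])
        (safe_three (fun u hu => ?_) fun S' F hp => ⟨?_, fun S'' F' hp' => ⟨?_, fun _ _ h => h⟩⟩)
      · rw [List.mem_singleton] at hu
        exact hu ▸ hf
      · obtain ⟨-, -, -, i4, -, -, i7⟩ := F.pre I
          (f := .execState d v s q todo views r c) ⟨h1, h2, h3, h4, h5, h6, h7⟩
        have hd' : S'.Doomed A c d := F.ind I (P := fun S => S.Doomed A c d)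
          (fun _ _ I G _ h => G.doomed I h) hdoom
        refine ⟨⟨d, hd', by omega⟩, hp c (by simp), hv.trans_le F.ext.nodeCount_le, i4,
          i7.imp id (fun h => by omega), fun u hu => ?_, ?_⟩
        · rw [List.mem_singleton] at hu
          cases hu
          exact .refl
        · simp [weight]
      · obtain ⟨j1, j2, j3, -⟩ := F'.pre (F.inv I) (F.pre I
          (f := .exec d v ((s, q) :: todo) views false) h1)
        refine ⟨j1, j2, j3, fun _ e he => ?_⟩
        cases he
        have : d.ts - 1 ≤ S''.rts (S''.child v s) := hp'
        show d.ts ≤ S''.rts (S''.child v s) + 1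
        omega
    · have hmr : d.ts ≤ ((view m g).state c).tsMod ∨
          mustRebuild A d ((view m g).initSz c) ((view m g).state c) = false := by
        rcases lt_or_ge ((view m g).state c).tsMod d.ts with hlt | hge
        · right
          cases hr : r with
          | false =>
            cases hm : mustRebuild A d ((view m g).initSz c) ((view m g).state c) with
            | false => rfl
            | true => exact absurd ⟨hlt, hr, hm⟩ hc
          | true =>
            -- The child read after a rebuilding was born at `d.ts - 1` or later. If `d` has not
            -- modified it, its state is still the initial one, and no second rebuilding is asked
            -- for.
            have h10 := h6 hr
            have h11 := I.born_tsMod h3 h2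
            exact I.fresh_not_rebuild hK h2 h3 (by omega)
        · exact .inl hge
      have hacc : (view m g).Accepted A c d := by
        refine ⟨⟨q', hq'⟩, h8, h9.resolve_right fun hdm => ?_, hmr⟩
        rcases hmr with h | h
        · exact absurd hdm.2.2.1 (not_lt.mpr h)
        · exact absurd (h.symm.trans hdm.2.2.2) (by simp)
      have hacc' : ∀ {S'}, Fut A p (view m g) S' → S'.Accepted A c d := fun F =>
        F.ind I (P := fun S => S.Accepted A c d) (fun _ _ I G _ h => G.accepted I h) hacc
      refine stepOK_silent I (L := [.push (.traverse d.op) (.node c) 0 false,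
          .modify { d with query := q } c (m.node c).state,
          .push (.node c) (.desc { d with query := q }) d.ts true,
          .exec d v todo (views ++ [.below (m.node c).born]) false])
        (by simp only [step]; rw [if_neg (by simp [hq]), if_neg hc])
        (safe_four ⟨rfl, c, d, rfl, hdr.1, rfl, hdr.2.1, hacc, ?_⟩
          fun S₁ F₁ hp₁ => ⟨⟨⟨d, hacc' F₁, rfl⟩, ?_, ?_⟩, fun S₂ F₂ hp₂ => ⟨?_, fun S₃ F₃ hp₃ =>
            ⟨exec_cons I (F₁.trans (F₂.trans F₃)) h1 ?_, fun _ _ h => h⟩⟩⟩)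
      · rw [h4]
        exact hdr.2.2.1
      · exact hp₁
      · refine F₁.ind I (P := fun S => S.Accepted A c d ∧
          ((m.node c).state = S.state c ∨ d.ts ≤ (S.state c).tsMod)) (fun S S' I G _ h => ?_)
          ⟨hacc, .inl rfl⟩ |>.2
        obtain ⟨ha, h⟩ := h
        refine ⟨G.accepted I ha, ?_⟩
        obtain ⟨q', hq'⟩ := id ha.1
        rcases h with h | h
        · rcases G.tsMod_ge I hq' ha.2.1 with h' | h'
          · exact .inl (h.trans h'.symm)
          · exact .inr h'
        · exact .inr (h.trans (G.tsMod_le hq'.1))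
      · have E := F₁.ext.trans F₂.ext
        refine ⟨_, rfl, rfl, rfl, h2.trans_le E.nodeCount_le, hdr.1.trans_le E.opCount_le,
          E.ots_eq _ hdr.1 _ hdr.2.1, hp₂.2, .inr ⟨h3, ⟨d, hacc' (F₁.trans F₂), rfl⟩, hp₂.1⟩⟩
      · have E := F₁.ext.trans (F₂.ext.trans F₃.ext)
        have F : Fut A p (view m g) S₃ := F₁.trans (F₂.trans F₃)
        have I₃ := F.inv I
        have hi : S₃.Ins c d.ts := hp₃
        obtain ⟨_, _, ha, _⟩ := hacc' F
        have hp4 : S₃.par c = (v, s) := (F.ind I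
          (P := fun S => c < S.nodeCount ∧ S.par c = (v, s))
          (fun _ _ I G _ h => ⟨h.1.trans_le G.nodeCount_le, (G.par_eq c h.1).trans h.2⟩) ⟨h2, h4⟩).2
        rw [Att, hp4] at ha
        -- Either `c` is still the child and contains the operation, or the pointer has received a
        -- mark of at least `d.ts`, which settles this side as well.
        rcases ha with ha | ha
        · refine ⟨fun c' hc' _ => ?_, fun h => absurd ha (h c)⟩
          simp only at ha
          rw [hc'] at ha
          cases ha
          exact hi
        · exact Guar.sideDone_of_le I₃ (Guar.refl I₃) (hv.trans_le E.nodeCount_le) ha.2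

theorem stepOK_modify {d c st} (h : (view m g).Pre A p (.modify d c st)) :
    StepOK A p m g (.modify d c st) := by
  obtain ⟨⟨d', h1, h2⟩, h3, h4⟩ := h
  by_cases hc : st.tsMod < d.ts ∧ (m.node c).state = st
  · have hlt : ((view m g).state c).tsMod < d'.ts := by
      show (m.node c).state.tsMod < d'.ts
      rw [h2, hc.2]
      exact hc.1
    have G := guar_state I h1 hlt (st := newState A d st) h2.symm
    rw [← view_state] at G
    have hs : step A p m (.modify d c st) =
        (m.setNode c { m.node c with state := newState A d st }, []) := by
      simp only [step]; rw [if_pos hc]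
    rw [StepOK, hs]
    refine ⟨g, G, rfl, fun _ h => absurd rfl h, fun _ _ h h' => absurd h'.1 (not_lt.mpr h), safe_nil ⟨?_, G.inTrav h3⟩⟩
    rw [view_state]
    show d.ts ≤ (Function.update (view m g).state c (newState A d st) c).tsMod
    rw [Function.update_self]
    exact le_rfl
  · refine stepOK_silent I (L := []) (by simp only [step]; rw [if_neg hc]) (safe_nil ⟨?_, h3⟩)
    rcases h4 with h4 | h4
    · exact not_lt.mp fun hlt => hc ⟨h4 ▸ hlt, h4.symm⟩
    · exact h4

/-- The mark of `old` is below `t` and marks do not decrease, so the CAS cannot succeed after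
another process has done the replacement; and if it fails, the mark is at least `t`. -/
theorem stepOK_replace {v s old t keys} (h : (view m g).Pre A p (.replace v s old t keys)) :
    StepOK A p m g (.replace v s old t keys) := by
  obtain ⟨hv, ho, h⟩ := h
  by_cases hc : (m.node v).child s = old
  · rcases h with ⟨_, h⟩ | h
    · obtain ⟨g', G⟩ := grow_build A t keys m g (v, s) ((view m g).dep v + 1)
      have Gu := guar_replace I hv h G
      rw [← view_child] at Gu
      have hs : step A p m (.replace v s old t keys) =
          ((build A t keys m).2.setNode v
            (((build A t keys m).2.node v).setChild (build A t keys m).1 s), []) := by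
        simp only [step]; rw [if_pos hc]
      rw [StepOK, hs]
      refine ⟨g', Gu, G.announce_eq, fun o h => absurd ?_ h, fun x q hx hxq => ?_, safe_nil ?_⟩
      · exact (G.old_queue (.traverse o) (fun _ h => by cases h)).1
      · obtain ⟨-, -, -, w, -, -, h3, -⟩ := G.new_cell x hx hxq.1
        exact .inl ⟨w, hxq.2.symm.trans h3⟩
      · show t ≤ _
        rw [view_child]
        have : ((view (build A t keys m).2 g').childSt v s (build A t keys m).1).child v s =
          (build A t keys m).1 := by simp [childSt]
        rw [this]
        exact G.root.1.ge
    · rw [show (view m g).child v s = old from hc] at h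
      exact absurd ho.1 (not_lt.mpr h)
  · refine stepOK_silent I (L := []) (by simp only [step]; rw [if_neg hc]) (safe_nil ?_)
    rcases h with ⟨h, _⟩ | h
    · exact absurd h hc
    · exact h

theorem stepOK_drain {t todo} (h : (view m g).Pre A p (.drain t todo)) :
    StepOK A p m g (.drain t todo) := by
  cases todo with
  | nil => exact stepOK_silent I (L := []) rfl (safe_nil fun u hu => by simp at hu)
  | cons u todo =>
    have hu : (view m g).Frz A (t + 1) u := h u (by simp)
    refine stepOK_silent I (L := [.untilTs t u, .drainLeft t u todo]) rfl
      (safe_two (I.frz_cells hu).2 fun S' F hp => ⟨⟨⟨?_, fun x hx => hp x hx ?_⟩, fun w hw => ?_⟩,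
        fun S'' F' hp' w hw => ?_⟩)
    · exact F.pre I (f := .drain t (u :: todo)) h u (by simp)
    -- All cells below the doomed node are earlier than `t + 1`, so execution up to `t` empties the
    -- queue.
    · have := ((F.inv I).frz_cells (F.pre I (f := .drain t (u :: todo)) h u (by simp))).1 x hx
      omega
    · exact F.pre I (f := .drain t (u :: todo)) h w (by simp [hw])
    · rcases List.mem_cons.mp hw with rfl | hw
      · exact hp'.1
      · exact hp'.2 w hw

theorem stepOK_drainLeft {t u todo} (h : (view m g).Pre A p (.drainLeft t u todo)) :
    StepOK A p m g (.drainLeft t u todo) :=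
  stepOK_silent I (L := [.drainRight t u (m.node u).left todo]) rfl
    (safe_one ⟨h.1, rfl, h.2⟩ fun _ _ h => h)

omit [DecidableEq σ] I in
theorem mem_nodes {r : Ref κ} {u} : u ∈ r.nodes ↔ r = .inner u := by
  cases r <;> simp [Ref.nodes, eq_comm]

theorem stepOK_drainRight {t u l todo} (h : (view m g).Pre A p (.drainRight t u l todo)) :
    StepOK A p m g (.drainRight t u l todo) := by
  obtain ⟨h1, h2, h3⟩ := id h
  refine stepOK_silent I (L := [.drain t (l.nodes ++ (m.node u).right.nodes ++ todo)]) rfl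
    (safe_one (fun w hw => ?_) fun S' F hp => ?_)
  · rcases List.mem_append.mp hw with hw | hw
    · rcases List.mem_append.mp hw with hw | hw
      · rw [mem_nodes] at hw
        exact .step u w .left h1.1 h1.2 (h2 ▸ hw)
      · rw [mem_nodes] at hw
        exact .step u w .right h1.1 h1.2 hw
    · exact h3 w hw
  · obtain ⟨i1, i2, i3⟩ := F.pre I h
    have i4 : S'.child u .right = (view m g).child u .right :=
      (F.ind I (P := fun S => S.Frozen A (t + 1) u ∧ S.child u .right = (view m g).child u .right)
        (fun _ _ I G _ h => ⟨G.frozen I h.1, (G.frz_child I h.1.1 h.1.2 _).trans h.2⟩) ⟨h1, rfl⟩).2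
    refine ⟨.mk u i1.2 fun s c hc => hp c ?_, fun w hw => hp w (by simp [hw])⟩
    cases s with
    | left =>
      rw [← i2] at hc
      simp [mem_nodes, hc]
    | right =>
      rw [i4] at hc
      have : (m.node u).right = .inner c := hc
      simp [mem_nodes, this]

theorem stepOK_gather (hK : 1 ≤ 2 * A.K) {t v s c todo keys} (h : (view m g).Pre A p (.gather t v s c todo keys)) :
    StepOK A p m g (.gather t v s c todo keys) := by
  obtain ⟨h1, h2, h3, h4, h5, h6, h7⟩ := id h
  match todo, h with
  | [], h =>
    refine stepOK_silent I (L := [.replace v s (.inner c) t keys]) rfl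
      (safe_one ⟨h3, ⟨?_, fun u hu => ?_⟩, h5.imp (fun hc => ⟨hc, .inr ?_⟩) id⟩ fun _ _ h => h)
    all_goals obtain ⟨d, hd, ht⟩ := h1
    all_goals obtain ⟨q, hq⟩ := id hd.1
    · show (view m g).born c < t
      -- A node born at `t` or later and unmodified by the operation `t + 1` would be fresh and not
      -- to be rebuilt. So the new mark is strictly larger than the old one.
      have h8 := I.born_tsMod hq.2.1 hq.1
      have h9 := hd.2.2.1
      by_contra hlt
      have := I.fresh_not_rebuild hK (d := d) hq.1 hq.2.1 (by omega)
      exact absurd (this.symm.trans hd.2.2.2) (by simp)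
    · cases hu
      exact hq.1
    refine ⟨c, d, hc, hd, h2, ht.symm, ?_⟩
    simpa [weight, size] using h7
  | .empty t' :: todo, h =>
    refine stepOK_silent I (L := [.gather t v s c todo keys]) rfl
      (safe_one ⟨h1, h2, h3, h4, h5, fun u hu => h6 u (by simp [hu]), ?_⟩ fun _ _ h => h)
    simp only [weight, List.map_cons, List.sum_cons] at h7 ⊢
    omega
  | .leaf k t' :: todo, h =>
    refine stepOK_silent I (L := [.gather t v s c todo (keys ++ [k])]) rfl
      (safe_one ⟨h1, h2, h3, h4, h5, fun u hu => h6 u (by simp [hu]), ?_⟩ fun _ _ h => h)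
    simp only [weight, List.map_cons, List.sum_cons, size, List.length_append,
      List.length_singleton] at h7 ⊢
    omega
  | .inner u :: todo, h =>
    exact stepOK_silent I (L := [.gatherLeft t v s c u todo keys]) rfl
      (safe_one h fun _ _ h => h)

theorem stepOK_gatherLeft {t v s c u todo keys}
    (h : (view m g).Pre A p (.gatherLeft t v s c u todo keys)) :
    StepOK A p m g (.gatherLeft t v s c u todo keys) :=
  stepOK_silent I (L := [.gatherRight t v s c u (m.node u).left todo keys]) rfl
    (safe_one ⟨h, rfl⟩ fun _ _ h => h)

theorem stepOK_gatherRight {t v s c u l todo keys}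
    (h : (view m g).Pre A p (.gatherRight t v s c u l todo keys)) :
    StepOK A p m g (.gatherRight t v s c u l todo keys) := by
  obtain ⟨⟨h1, h2, h3, h4, h5, h6, h7⟩, h8⟩ := h
  have hb := h6 u (by simp)
  obtain ⟨d, hd, _⟩ := id h1
  obtain ⟨q, hq⟩ := id hd.1
  refine stepOK_silent I (L := [.gather t v s c (l :: (m.node u).right :: todo) keys]) rfl
    (safe_one ⟨h1, h2, h3, h4, h5, fun w hw => ?_, ?_⟩ fun _ _ h => h)
  · rcases List.mem_cons.mp hw with hw | hw
    · exact .child u w .left hb (h8.symm.trans hw.symm)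
    · rcases List.mem_cons.mp hw with hw | hw
      · exact .child u w .right hb hw.symm
      · exact h6 w (by simp [hw])
  -- Replacing `u` by its two children does not increase the weight of the list.
  · have h9 := I.size_children (I.below_lt hq.1 hb)
    rw [← h8] at h9
    have h10 : (view m g).child u .right = (m.node u).right := rfl
    rw [h10] at h9
    simp only [weight, List.map_cons, List.sum_cons] at h7 ⊢
    omega

theorem stepOK (hK : 1 ≤ 2 * A.K) (h : (view m g).Pre A p f) : StepOK A p m g f := by
  cases f with
  | fetch => exact stepOK_fetch I h
  | stamp => exact stepOK_stamp I h
  | stamped => exact stepOK_stamped I h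
  | scan => exact stepOK_scan I h
  | scanTs => exact stepOK_scanTs I h
  | scanFetch => exact stepOK_scanFetch I h
  | scanStamp => exact stepOK_scanStamp I h
  | enqueue => exact stepOK_enqueue I h
  | push => exact stepOK_push I h
  | pushNext => exact stepOK_pushNext I h
  | pushLink => exact stepOK_pushLink I h
  | pushSwing => exact stepOK_pushSwing I h
  | pop => exact stepOK_pop I h
  | popNext => exact stepOK_popNext I h
  | popSwing => exact stepOK_popSwing I h
  | untilTs => exact stepOK_untilTs I h
  | untilNext => exact stepOK_untilNext I h
  | exec => exact stepOK_exec I h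
  | execState => exact stepOK_execState I hK h
  | modify => exact stepOK_modify I h
  | replace => exact stepOK_replace I h
  | drain => exact stepOK_drain I h
  | drainLeft => exact stepOK_drainLeft I h
  | drainRight => exact stepOK_drainRight I h
  | gather => exact stepOK_gather I hK h
  | gatherLeft => exact stepOK_gatherLeft I h
  | gatherRight => exact stepOK_gatherRight I h
  | main => exact stepOK_main I h
  | mainNext => exact stepOK_mainNext I h
  | mainPop => exact stepOK_mainPop I h
  | result => exact stepOK_result I h
  | resultNext => exact stepOK_resultNext I h

end St

end WaitFreeTree

/-! The result of a step. -/

namespace WaitFreeTree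

set_option linter.unusedSectionVars false

variable {κ σ ρ : Type*} {n : ℕ} [LinearOrder κ]

def Ghost.init (p : Fin n) : Ghost n where
  own _ := .node 0
  par _ := (0, .left)
  dep _ := 0
  ticket _ := 0
  proc _ := p

namespace St

theorem inv_init (A : Spec κ σ ρ) (p : Fin n) :
    (view (initMem A n) (Ghost.init p) : St κ σ ρ n).Inv A := by
  set S : St κ σ ρ n := view (initMem A n) (Ghost.init p) with hS
  have hq : ∀ {x : ℕ} {q}, S.InQ x q → x = 0 ∧ q = .node 0 := fun {x q} h =>
    ⟨Nat.lt_one_iff.mp h.1, h.2.symm⟩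
  have h0 : S.InQ 0 (.node 0) := ⟨Nat.one_pos, rfl⟩
  have hn : ∀ {v : ℕ}, v < S.nodeCount → v = 0 := fun h => Nat.lt_one_iff.mp h
  have ho : ∀ {o : ℕ}, ¬ o < S.opCount := fun h => Nat.not_lt_zero _ h
  have hc : ∀ v s c, S.child v s ≠ .inner c := fun v s c h => by cases s <;> cases h
  have hv : ∀ {q}, S.VQ q → q = .node 0 := fun {q} h => by
    cases q with
    | node v => rw [hn h]
    | traverse o => exact absurd h ho
    | processed o => exact absurd h ho
  have hv0 : ∀ {x v}, S.InQ x (.node v) → x = 0 ∧ v = 0 := fun {x v} h =>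
    ⟨(hq h).1, QRef.node.inj (hq h).2⟩
  exact
  { queues :=
    { ends := fun q h => by rw [hv h]; exact ⟨h0, h0⟩
      vq := fun x _ => Nat.one_pos
      next := fun x _ y h => by cases h
      last := fun q x y hx hy h => by rw [(hq hx).1, (hq hy).1] at h; exact absurd h (lt_irrefl _)
      lag := fun q y _ h => by cases h }
    sorted := fun v x y hx hy h => by
      rw [(hq hx).1, (hq hy).1] at h; exact absurd h (lt_irrefl _)
    bornCell := fun v h => by rw [hn h]; exact ⟨0, h0, rfl⟩
    bornLe := fun v x _ => le_rfl
    desc := fun v x _ => .inl ⟨rfl, rfl⟩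
    tsMod := fun v x h hx => absurd (hv0 hx).2 h
    trav := fun o y h => by cases (hq h).2
    travRoot := fun o h => absurd h ho
    passed := fun o y v h => by cases (hq h).2
    nodePos := Nat.one_pos
    fresh := fun v h h' => absurd (hn h) h'
    child := fun v _ s c h => absurd h (hc v s c)
    rtsIns := fun v h s => by
      rw [hn h]
      refine ⟨⟨0, h0, ?_⟩, ?_⟩ <;> cases s <;> exact le_rfl
    done := fun v x d _ _ h => by cases h
    tree := fun v x hx h => by
      rw [(hv0 hx).1] at h
      exact absurd h (Nat.not_lt_zero _)
    stamp := fun o h => absurd h ho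
    ticketLt := fun t h h' => absurd h' (not_lt.mpr h)
    ann := fun i o h => by cases h
    fin := fun o h => absurd h ho
    rel := fun o₁ o₂ _ h => absurd h ho
    depRoot := rfl
    versionPos := le_rfl }

/-- The frames that replace the top frame in one step. -/
def Next (S : St κ σ ρ n) : Frame κ σ ρ n → List (Frame κ σ ρ n) → Prop
  | .fetch o, L => ∃ t, L = [.stamp o t]
  | .stamp o _, L => L = [.stamped o]
  | .stamped o, L => (S.ots o = none ∧ L = [.fetch o]) ∨
      ∃ t, S.ots o = some t ∧ L = [.scan o t (List.finRange n) [], .main o t]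
  | .scan _ t [] saved, L => ∃ l : List (Desc κ), l.length = saved.length + 1 ∧
      (∀ d ∈ l, d.ts = t ∨ d ∈ saved) ∧ L = [.enqueue l]
  | .scan o t (_ :: todo) saved, L => L = [.scan o t todo saved] ∨
      ∃ o', L = [.scanTs o t o' todo saved]
  | .scanTs o t o' todo saved, L => (S.ots o' = none ∧ L = [.scanFetch o t o' todo saved]) ∨
      (S.ots o' ≠ none ∧ ∃ saved', L = [.scan o t todo saved'] ∧
        saved'.length ≤ saved.length + 1 ∧ ∀ d ∈ saved', d ∈ saved ∨ d.ts < t)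
  | .scanFetch o t o' todo saved, L => ∃ t', L = [.scanStamp o t o' t' todo saved]
  | .scanStamp o t o' _ todo saved, L => L = [.scanTs o t o' todo saved]
  | .enqueue [], L => L = []
  | .enqueue (d :: l), L => L = [.push (.node 0) (.desc d) d.ts true, .enqueue l]
  | .push q x t g, L => (g = true ∧ t ≤ S.cts (S.tl q) ∧ L = []) ∨
      ((g = true → S.cts (S.tl q) < t) ∧ L = [.pushNext q x t g (S.tl q)])
  | .pushNext q x t g y, L => (∃ z, S.nxt y = some z ∧ L = [.pushSwing q y z, .push q x t g]) ∨
      (S.nxt y = none ∧ L = [.pushLink q x t g y])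
  | .pushLink q x t g y, L => (S.nxt y = none ∧ L = [.pushSwing q y S.cellCount]) ∨
      (S.nxt y ≠ none ∧ L = if g then [] else [.push q x t g])
  | .pushSwing _ _ _, L => L = []
  | .pop t v, L => L = [.popNext t v (S.hd (.node v))]
  | .popNext t v h, L => (S.nxt h = none ∧ L = []) ∨ ∃ z, S.nxt h = some z ∧
      ((S.cts z = t ∧ L = [.popSwing v h z]) ∨ (S.cts z ≠ t ∧ L = []))
  | .popSwing _ _ _, L => L = []
  | .untilTs t v, L => L = [.untilNext t v (S.hd (.node v))]
  | .untilNext t v h, L => L = [] ∨ ∃ x d, S.nxt h = some x ∧ S.item x = .desc d ∧ d.ts ≤ t ∧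
      L = [.exec d v (route d.query (S.sep v)) [] false, .untilTs t v]
  | .exec d v [] _ _, L => ∃ i, L = [.push (.processed d.op) i 0 false, .pop d.ts v]
  | .exec d v ((s, q) :: todo) views r, L =>
      (∃ c, S.child v s = .inner c ∧ L = [.execState d v s q todo views r c]) ∨
      ∃ L₀ views', (L₀ = [] ∨ ∃ old keys, L₀ = [.replace v s old d.ts keys]) ∧
        L = L₀ ++ [.exec d v todo views' false]
  | .execState d v s q todo views r c, L => (∃ views', L = [.exec d v todo views' false]) ∨
      ((S.state c).tsMod < d.ts ∧ r = false ∧ L = [.drain (d.ts - 1) [c],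
        .gather (d.ts - 1) v s c [.inner c] [], .exec d v ((s, q) :: todo) views true]) ∨
      ∃ i d' d'' st views', L = [.push (.traverse d.op) i 0 false, .modify d' c st,
        .push (.node c) (.desc d'') d.ts true, .exec d v todo views' false]
  | .modify _ _ _, L => L = []
  | .replace _ _ _ _ _, L => L = []
  | .drain _ [], L => L = []
  | .drain t (u :: todo), L => L = [.untilTs t u, .drainLeft t u todo]
  | .drainLeft t u todo, L => L = [.drainRight t u (S.child u .left) todo]
  | .drainRight t u l todo, L => L = [.drain t (l.nodes ++ (S.child u .right).nodes ++ todo)]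
  | .gather t v s c [] keys, L => L = [.replace v s (.inner c) t keys]
  | .gather t v s c (.inner u :: todo) keys, L => L = [.gatherLeft t v s c u todo keys]
  | .gather t v s c (_ :: todo) _, L => ∃ keys', L = [.gather t v s c todo keys']
  | .gatherLeft t v s c u todo keys, L => L = [.gatherRight t v s c u (S.child u .left) todo keys]
  | .gatherRight t v s c u l todo keys, L =>
      L = [.gather t v s c (l :: S.child u .right :: todo) keys]
  | .main o t, L => L = [.mainNext o t (S.hd (.traverse o))]
  | .mainNext o t h, L => (S.nxt h = none ∧ L = [.result o]) ∨ ∃ z, S.nxt h = some z ∧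
      ((∃ v, L = [.untilTs t v, .mainPop o z, .main o t]) ∨ L = [.mainPop o z, .main o t])
  | .mainPop _ _, L => L = []
  | .result o, L => L = [.resultNext (S.hd (.processed o)) []]
  | .resultNext c _, L => (S.nxt c = none ∧ L = []) ∨
      ∃ z parts', S.nxt c = some z ∧ L = [.resultNext z parts']

theorem next_step [DecidableEq σ] (A : Spec κ σ ρ) (p : Fin n) (m : Mem κ σ ρ n) (g : Ghost n)
    (f : Frame κ σ ρ n) : Next (view m g) f (step A p m f).2 := by
  cases f with
  | fetch o => exact ⟨_, rfl⟩
  | stamp o t => exact rfl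
  | stamped o =>
    cases h : (m.op o).ts with
    | none => exact .inl ⟨h, by simp [step, h]⟩
    | some t => exact .inr ⟨t, h, by simp [step, h]⟩
  | scan o t todo saved =>
    cases todo with
    | nil =>
      refine ⟨_, ?_, fun d hd => ?_, rfl⟩
      · exact (List.length_insertionSort _ _).trans List.length_cons
      · rw [List.mem_insertionSort] at hd
        rcases List.mem_cons.mp hd with rfl | hd
        · exact .inl rfl
        · exact .inr hd
    | cons i todo =>
      cases h : m.announce i with
      | none => exact .inl (by simp [step, h])
      | some o' => exact .inr ⟨o', by simp [step, h]⟩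
  | scanTs o t o' todo saved =>
    cases h : (m.op o').ts with
    | none => exact .inl ⟨h, by simp [step, h]⟩
    | some t' =>
      refine .inr ⟨by rw [show (view m g).ots o' = some t' from h]; simp,
        _, by simp only [step, h]; rfl, ?_, ?_⟩
      · split_ifs <;> simp
      · intro d hd
        split_ifs at hd with hlt
        · rcases List.mem_cons.mp hd with rfl | hd
          · exact .inr hlt
          · exact .inl hd
        · exact .inl hd
  | scanFetch o t o' todo saved => exact ⟨_, rfl⟩
  | scanStamp o t o' t' todo saved => exact rfl
  | enqueue l => cases l <;> exact rfl
  | push q x t b =>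
    by_cases h : b = true ∧ t ≤ (m.cell (m.queue q).tail).ts
    · exact .inl ⟨h.1, h.2, by simp only [step]; rw [if_pos h]⟩
    · exact .inr ⟨fun hb => not_le.mp fun hle => h ⟨hb, hle⟩,
        by simp only [step]; rw [if_neg h]; rfl⟩
  | pushNext q x t b y =>
    cases h : (m.cell y).next with
    | none => exact .inr ⟨h, by simp only [step, h]⟩
    | some z => exact .inl ⟨z, h, by simp only [step, h]⟩
  | pushLink q x t b y =>
    by_cases h : (m.cell y).next = none
    · exact .inl ⟨h, by simp only [step]; rw [if_pos h]; rfl⟩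
    · exact .inr ⟨h, by simp only [step]; rw [if_neg h]⟩
  | pushSwing q y z => exact rfl
  | pop t v => exact rfl
  | popNext t v y =>
    cases h : (m.cell y).next with
    | none => exact .inl ⟨h, by simp only [step, h]⟩
    | some z =>
      refine .inr ⟨z, h, ?_⟩
      by_cases ht : (m.cell z).ts = t
      · exact .inl ⟨ht, by simp only [step, h]; rw [if_pos ht]⟩
      · exact .inr ⟨ht, by simp only [step, h]; rw [if_neg ht]⟩
  | popSwing v y z => exact rfl
  | untilTs t v => exact rfl
  | untilNext t v y =>
    cases h : (m.cell y).next with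
    | none => exact .inl (by simp only [step, h])
    | some x =>
      cases hi : (m.cell x).item with
      | desc d =>
        by_cases ht : t < d.ts
        · exact .inl (by simp only [step, h, hi]; rw [if_pos ht])
        · exact .inr ⟨x, d, h, hi, not_lt.mp ht, by
            simp only [step, h, hi]; rw [if_neg ht]; rfl⟩
      | _ => exact .inl (by simp only [step, h, hi])
  | exec d v todo views r =>
    cases todo with
    | nil => exact ⟨_, rfl⟩
    | cons e todo =>
      obtain ⟨s, q⟩ := e
      cases h : (m.node v).child s with
      | inner c => exact .inl ⟨c, h, by simp only [step]; rw [h]⟩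
      | empty t =>
        refine .inr ⟨_, _, ?_, by simp only [step]; rw [h]⟩
        split_ifs
        · cases leafUpdate q (.empty t : Ref κ) with
          | none => exact .inl rfl
          | some keys => exact .inr ⟨_, _, rfl⟩
        · exact .inl rfl
      | leaf k t =>
        refine .inr ⟨_, _, ?_, by simp only [step]; rw [h]⟩
        split_ifs
        · cases leafUpdate q (.leaf k t : Ref κ) with
          | none => exact .inl rfl
          | some keys => exact .inr ⟨_, _, rfl⟩
        · exact .inl rfl
  | execState d v s q todo views r c =>
    by_cases h1 : q.isWhole = true
    · exact .inl ⟨_, by simp only [step]; rw [if_pos h1]⟩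
    · by_cases h2 : (m.node c).state.tsMod < d.ts ∧ r = false ∧
        mustRebuild A d (m.node c).initSz (m.node c).state = true
      · exact .inr (.inl ⟨h2.1, h2.2.1, by simp only [step]; rw [if_neg h1, if_pos h2]⟩)
      · exact .inr (.inr ⟨_, _, _, _, _, by simp only [step]; rw [if_neg h1, if_neg h2]⟩)
  | modify => exact rfl
  | replace => exact rfl
  | drain t todo => cases todo <;> exact rfl
  | drainLeft => exact rfl
  | drainRight => exact rfl
  | gather t v s c todo keys =>
    match todo with
    | [] => exact rfl
    | .inner u :: todo => exact rfl
    | .empty t' :: todo => exact ⟨_, rfl⟩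
    | .leaf k t' :: todo => exact ⟨_, rfl⟩
  | gatherLeft => exact rfl
  | gatherRight => exact rfl
  | main => exact rfl
  | mainNext o t y =>
    cases h : (m.cell y).next with
    | none => exact .inl ⟨h, by simp only [step, h]⟩
    | some z =>
      refine .inr ⟨z, h, ?_⟩
      cases hi : (m.cell z).item with
      | node v => exact .inl ⟨v, by simp only [step, h, hi]⟩
      | _ => exact .inr (by simp only [step, h, hi])
  | mainPop => exact rfl
  | result => exact rfl
  | resultNext y parts =>
    cases h : (m.cell y).next with
    | none => exact .inl ⟨h, by simp only [step, h]⟩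
    | some z =>
      cases hi : (m.cell z).item with
      | part v r => exact .inr ⟨z, _, h, by simp only [step, h, hi]; rfl⟩
      | _ => exact .inr ⟨z, _, h, by simp only [step, h, hi]; rfl⟩

end St

end WaitFreeTree

/-! The invariant holds in every execution. -/

namespace WaitFreeTree

set_option linter.unusedSectionVars false

variable {κ σ ρ : Type*} {n : ℕ} [LinearOrder κ]

/-- All operations that the frame may start to execute have timestamps below `b`. -/
def Frame.Lim (b : ℕ) : Frame κ σ ρ n → Prop
  | .untilTs t _ => t < b
  | .untilNext t _ _ => t < b
  | .drain t _ => t < b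
  | .drainLeft t _ _ => t < b
  | .drainRight t _ _ _ => t < b
  | .exec d _ _ _ _ => d.ts < b
  | .execState d _ _ _ _ _ _ _ => d.ts < b
  | .fetch _ => False
  | .stamp _ _ => False
  | .stamped _ => False
  | .main _ _ => False
  | .mainNext _ _ _ => False
  | _ => True

/-- The first frame may occur above the second one. -/
def Frame.Above (f : Frame κ σ ρ n) : Frame κ σ ρ n → Prop
  | .exec d _ _ _ _ => f.Lim d.ts
  | .pop t _ => f.Lim t
  | .push _ _ _ false => ∃ q y z, f = .pushSwing q y z
  | .execState _ _ _ _ _ _ _ _ => False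
  | .untilNext _ _ _ => False
  | .popNext _ _ _ => False
  | .popSwing _ _ _ => False
  | .pushNext _ _ _ _ _ => False
  | .pushLink _ _ _ _ _ => False
  | _ => True

/-- A node has two sides, one of which is in work in `execState`. -/
def Frame.Small : Frame κ σ ρ n → Prop
  | .exec _ _ todo _ _ => todo.length ≤ 2
  | .execState _ _ _ _ todo _ _ _ => todo.length ≤ 1
  | _ => True

/-- Executions nested in one stack have strictly decreasing timestamps towards the top, so no
timestamp is executed twice in it. -/
def StackOK (L : List (Frame κ σ ρ n)) : Prop := (∀ f ∈ L, f.Small) ∧ L.Pairwise Frame.Above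

theorem route_length (Q : Query κ) (r : Option κ) : (route Q r).length ≤ 2 := by
  unfold route
  split
  · simp
  · split
    · simp
    · simp
    · simp
    · split_ifs <;> simp

namespace St

variable {S : St κ σ ρ n} {A : Spec κ σ ρ} {p : Fin n} {f : Frame κ σ ρ n}
  {L r : List (Frame κ σ ρ n)}

/-- Draining a subtree for `d` goes up to `d.ts - 1`, and a helping loop starts no operation beyond
its own timestamp; so a bound is inherited by everything that is called. -/
theorem next_lim (hN : S.Next f L) {b} (h : f.Lim b) : ∀ a ∈ L, a.Lim b := by
  cases f with
  | fetch => exact h.elim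
  | stamp => exact h.elim
  | stamped => exact h.elim
  | main => exact h.elim
  | mainNext => exact h.elim
  | scan o t todo saved =>
    cases todo with
    | nil => obtain ⟨l, -, -, rfl⟩ := hN; simp [Frame.Lim]
    | cons i todo => rcases hN with rfl | ⟨o', rfl⟩ <;> simp [Frame.Lim]
  | scanTs => rcases hN with ⟨-, rfl⟩ | ⟨-, _, rfl, -⟩ <;> simp [Frame.Lim]
  | scanFetch => obtain ⟨_, rfl⟩ := hN; simp [Frame.Lim]
  | scanStamp => cases hN; simp [Frame.Lim]
  | enqueue l => cases l <;> cases hN <;> simp [Frame.Lim]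
  | push => rcases hN with ⟨-, -, rfl⟩ | ⟨-, rfl⟩ <;> simp [Frame.Lim]
  | pushNext => rcases hN with ⟨z, -, rfl⟩ | ⟨-, rfl⟩ <;> simp [Frame.Lim]
  | pushLink q x t g y =>
    rcases hN with ⟨-, rfl⟩ | ⟨-, rfl⟩
    · simp [Frame.Lim]
    · cases g <;> simp [Frame.Lim]
  | pushSwing => cases hN; simp
  | pop => cases hN; simp [Frame.Lim]
  | popNext => rcases hN with ⟨-, rfl⟩ | ⟨z, -, ⟨-, rfl⟩ | ⟨-, rfl⟩⟩ <;> simp [Frame.Lim]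
  | popSwing => cases hN; simp
  | untilTs => cases hN; simpa [Frame.Lim] using h
  | untilNext t v y =>
    rcases hN with rfl | ⟨x, d, -, -, hd, rfl⟩
    · simp
    · have : t < b := h
      simp only [List.mem_cons, List.not_mem_nil, or_false, forall_eq_or_imp, forall_eq, Frame.Lim]
      omega
  | exec d v todo views r =>
    have h' : d.ts < b := h
    cases todo with
    | nil => obtain ⟨i, rfl⟩ := hN; simp [Frame.Lim]
    | cons e todo =>
      rcases hN with ⟨c, -, rfl⟩ | ⟨L₀, views', rfl | ⟨old, keys, rfl⟩, rfl⟩ <;>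
        simpa [Frame.Lim] using h'
  | execState d =>
    have h' : d.ts < b := h
    rcases hN with ⟨_, rfl⟩ | ⟨-, -, rfl⟩ | ⟨_, _, _, _, _, rfl⟩
    · simp [Frame.Lim, h']
    · simp only [List.mem_cons, List.not_mem_nil, or_false, forall_eq_or_imp, forall_eq, Frame.Lim, true_and]
      omega
    · simpa [Frame.Lim] using h'
  | modify => cases hN; simp
  | replace => cases hN; simp
  | drain t todo =>
    cases todo
    · cases hN; simp
    · cases hN; simpa [Frame.Lim] using h
  | drainLeft => cases hN; simpa [Frame.Lim] using h
  | drainRight => cases hN; simpa [Frame.Lim] using h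
  | gather t v s c todo keys =>
    match todo, hN with
    | [], hN => cases hN; simp [Frame.Lim]
    | .inner u :: todo, hN => cases hN; simp [Frame.Lim]
    | .empty t' :: todo, hN => obtain ⟨_, rfl⟩ := hN; simp [Frame.Lim]
    | .leaf k t' :: todo, hN => obtain ⟨_, rfl⟩ := hN; simp [Frame.Lim]
  | gatherLeft => cases hN; simp [Frame.Lim]
  | gatherRight => cases hN; simp [Frame.Lim]
  | mainPop => cases hN; simp
  | result => cases hN; simp [Frame.Lim]
  | resultNext => rcases hN with ⟨-, rfl⟩ | ⟨_, _, -, rfl⟩ <;> simp [Frame.Lim]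

theorem stackOK_next (I : S.Inv A) (hp : S.Pre A p f) (hs : f.Small) (hN : S.Next f L) :
    StackOK L := by
  cases f with
  | fetch => obtain ⟨_, rfl⟩ := hN; simp [StackOK, Frame.Small]
  | stamp => cases hN; simp [StackOK, Frame.Small]
  | stamped => rcases hN with ⟨-, rfl⟩ | ⟨_, -, rfl⟩ <;> simp [StackOK, Frame.Small, Frame.Above]
  | main => cases hN; simp [StackOK, Frame.Small]
  | mainNext =>
    rcases hN with ⟨-, rfl⟩ | ⟨_, -, ⟨_, rfl⟩ | rfl⟩ <;> simp [StackOK, Frame.Small, Frame.Above]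
  | scan o t todo saved =>
    cases todo with
    | nil => obtain ⟨l, -, -, rfl⟩ := hN; simp [StackOK, Frame.Small]
    | cons i todo => rcases hN with rfl | ⟨o', rfl⟩ <;> simp [StackOK, Frame.Small]
  | scanTs => rcases hN with ⟨-, rfl⟩ | ⟨-, _, rfl, -⟩ <;> simp [StackOK, Frame.Small]
  | scanFetch => obtain ⟨_, rfl⟩ := hN; simp [StackOK, Frame.Small]
  | scanStamp => cases hN; simp [StackOK, Frame.Small]
  | enqueue l => cases l <;> cases hN <;> simp [StackOK, Frame.Small, Frame.Above]
  | push => rcases hN with ⟨-, -, rfl⟩ | ⟨-, rfl⟩ <;> simp [StackOK, Frame.Small]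
  | pushNext q x t g y =>
    rcases hN with ⟨z, -, rfl⟩ | ⟨-, rfl⟩
    · cases g <;> simp [StackOK, Frame.Small, Frame.Above]
    · simp [StackOK, Frame.Small]
  | pushLink q x t g y =>
    rcases hN with ⟨-, rfl⟩ | ⟨-, rfl⟩
    · simp [StackOK, Frame.Small]
    · cases g <;> simp [StackOK, Frame.Small]
  | pushSwing => cases hN; simp [StackOK]
  | pop => cases hN; simp [StackOK, Frame.Small]
  | popNext => rcases hN with ⟨-, rfl⟩ | ⟨z, -, ⟨-, rfl⟩ | ⟨-, rfl⟩⟩ <;> simp [StackOK, Frame.Small]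
  | popSwing => cases hN; simp [StackOK]
  | untilTs => cases hN; simp [StackOK, Frame.Small]
  | untilNext t v y =>
    rcases hN with rfl | ⟨x, d, -, -, hd, rfl⟩
    · simp [StackOK]
    · simp [StackOK, Frame.Small, Frame.Above, route_length]
  | exec d v todo views r =>
    cases todo with
    | nil => obtain ⟨i, rfl⟩ := hN; simp [StackOK, Frame.Small, Frame.Above, Frame.Lim]
    | cons e todo =>
      have h' : (e :: todo).length ≤ 2 := hs
      rw [List.length_cons] at h'
      rcases hN with ⟨c, -, rfl⟩ | ⟨L₀, views', rfl | ⟨old, keys, rfl⟩, rfl⟩ <;>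
        simp [StackOK, Frame.Small, Frame.Above, Frame.Lim] <;> omega
  | execState d v s q todo views r c =>
    have h' : todo.length ≤ 1 := hs
    have h1 : 1 ≤ d.ts := by
      have := I.reached_desc hp.1.1
      exact (I.stamp _ this.1 _ this.2.1).1
    rcases hN with ⟨_, rfl⟩ | ⟨-, -, rfl⟩ | ⟨_, _, _, _, _, rfl⟩ <;>
      simp [StackOK, Frame.Small, Frame.Above, Frame.Lim] <;> omega
  | modify => cases hN; simp [StackOK]
  | replace => cases hN; simp [StackOK]
  | drain t todo => cases todo <;> cases hN <;> simp [StackOK, Frame.Small, Frame.Above]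
  | drainLeft => cases hN; simp [StackOK, Frame.Small]
  | drainRight => cases hN; simp [StackOK, Frame.Small]
  | gather t v s c todo keys =>
    match todo, hN with
    | [], hN => cases hN; simp [StackOK, Frame.Small]
    | .inner u :: todo, hN => cases hN; simp [StackOK, Frame.Small]
    | .empty t' :: todo, hN => obtain ⟨_, rfl⟩ := hN; simp [StackOK, Frame.Small]
    | .leaf k t' :: todo, hN => obtain ⟨_, rfl⟩ := hN; simp [StackOK, Frame.Small]
  | gatherLeft => cases hN; simp [StackOK, Frame.Small]
  | gatherRight => cases hN; simp [StackOK, Frame.Small]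
  | mainPop => cases hN; simp [StackOK]
  | result => cases hN; simp [StackOK, Frame.Small]
  | resultNext => rcases hN with ⟨-, rfl⟩ | ⟨_, _, -, rfl⟩ <;> simp [StackOK, Frame.Small]

theorem stackOK_step (I : S.Inv A) (hp : S.Pre A p f) (h : StackOK (f :: r)) (hN : S.Next f L) :
    StackOK (L ++ r) := by
  obtain ⟨h1, h2⟩ := h
  obtain ⟨h3, h4⟩ := List.pairwise_cons.mp h2
  obtain ⟨h5, h6⟩ := stackOK_next I hp (h1 f List.mem_cons_self) hN
  refine ⟨fun a ha => (List.mem_append.mp ha).elim (h5 a)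
    fun h => h1 a (List.mem_cons_of_mem _ h), List.pairwise_append.mpr ⟨h6, h4, fun a ha b hb => ?_⟩⟩
  have hab := h3 b hb
  cases b with
  | exec d => exact next_lim hN (b := d.ts) hab a ha
  | pop t v => exact next_lim hN (b := t) hab a ha
  | push q x t g =>
    cases g with
    | true => trivial
    | false =>
      obtain ⟨q, y, z, rfl⟩ := hab
      cases hN
      cases ha
  | execState => exact hab.elim
  | untilNext => exact hab.elim
  | popNext => exact hab.elim
  | popSwing => exact hab.elim
  | pushNext => exact hab.elim
  | pushLink => exact hab.elim
  | _ => trivial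

/-- One step of the process `p` whose stack is given. -/
def Turn (A : Spec κ σ ρ) (p : Fin n) (S S' : St κ σ ρ n) (L L' : List (Frame κ σ ρ n)) : Prop :=
  (∃ Q, L = [] ∧ L' = [.fetch S.opCount] ∧ S' = S.announceSt p Q) ∨
    ∃ f r L₁, L = f :: r ∧ L' = L₁ ++ r ∧ S.Next f L₁ ∧ S'.announce = S.announce ∧
      (∀ x q, S.cellCount ≤ x → S'.InQ x q → (∃ v, q = .node v) ∨
        (x = S.cellCount ∧ ∃ i t b y, f = .pushLink q i t b y ∧ S.nxt y = none)) ∧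
      (∀ o t o' t' todo saved, f = .scanStamp o t o' t' todo saved → S'.ots o' ≠ none) ∧
      Safe A p S' (fun S => S.Post p f) L₁

/-- The history of the shared memory in an execution. -/
structure History (A : Spec κ σ ρ) (T : ℕ) (stack : ℕ → Fin n → List (Frame κ σ ρ n))
    (sched : ℕ → Fin n) (S : ℕ → St κ σ ρ n) : Prop where
  inv : ∀ t ≤ T, (S t).Inv A
  safe : ∀ t ≤ T, ∀ q, Safe A q (S t) (fun S => S.Idle q) (stack t q)
  stackOK : ∀ t ≤ T, ∀ q, StackOK (stack t q)
  guar : ∀ t < T, Guar (S t) (S (t + 1)) A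
  turn : ∀ t < T, Turn A (sched t) (S t) (S (t + 1)) (stack t (sched t)) (stack (t + 1) (sched t))
  other : ∀ t < T, ∀ q ≠ sched t, stack (t + 1) q = stack t q ∧
    (S (t + 1)).announce q = (S t).announce q ∧
    ∀ o, (S t).announce q = some o → (S (t + 1)).hd (.traverse o) = (S t).hd (.traverse o)

end St

/-- Dependent choice, by which the history information is extended step by step. -/
theorem exists_sequence {α : Type*} (P : ℕ → α → Prop) (R : ℕ → α → α → Prop)
    (h0 : ∃ a, P 0 a) (h : ∀ t a, P t a → ∃ b, P (t + 1) b ∧ R t a b) :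
    ∃ f : ℕ → α, ∀ t, P t (f t) ∧ R t (f t) (f (t + 1)) := by
  choose F hF using h
  obtain ⟨a, ha⟩ := h0
  let s : (t : ℕ) → {a // P t a} := fun t =>
    Nat.rec ⟨a, ha⟩ (fun t b => ⟨F t b.1 b.2, (hF t b.1 b.2).1⟩) t
  exact ⟨fun t => (s t).1, fun t => ⟨(s t).2, (hF t (s t).1 (s t).2).2⟩⟩

namespace St

variable {S : St κ σ ρ n} {A : Spec κ σ ρ}

theorem Safe.mono {p : Fin n} {S' : St κ σ ρ n} {Q L} (F : Fut A p S S') (I : S.Inv A)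
    (h : Safe A p S Q L) (hQ : ∀ S₁ S₂, Fut A p S S₁ → Fut A p S₁ S₂ → Q S₁ → Q S₂) :
    Safe A p S' Q L := by
  cases L with
  | nil => exact hQ _ _ .refl F h
  | cons f r =>
    obtain ⟨a, b, hab, h1, h2⟩ := h
    exact ⟨a, b, hab, F.pre I h1, fun y hy hp => h2 y (F.trans hy) hp⟩

theorem Fut.idle {p : Fin n} {S' : St κ σ ρ n} (F : Fut A p S S') (I : S.Inv A) (h : S.Idle p) :
    S'.Idle p :=
  F.ind I (P := fun S => S.Idle p) (fun _ _ I G ha h => G.idle I ha h) h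

variable [DecidableEq σ]

theorem ots_scanStamp (p : Fin n) (m : Mem κ σ ρ n) (o t o' t' : ℕ) (todo saved) :
    ((step A p m (.scanStamp o t o' t' todo saved)).1.op o').ts ≠ none := by
  by_cases h : (m.op o').ts = none <;> simp [step, h, Mem.setOp]

theorem cellCount_pushLink (p : Fin n) (m : Mem κ σ ρ n) (q) (x : Item κ ρ) (t b) (y : ℕ)
    (h : (m.cell y).next ≠ none) : (step A p m (.pushLink q x t b y)).1.cellCount = m.cellCount := by
  simp [step, h]

/-- The process that takes the step replaces its top frame by frames that establish the same
postcondition, which is where `Runs.append` enters. All others keep their assertions, because these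
survive every step that obeys `Guar`. -/
theorem exists_history {T : ℕ} {c : ℕ → Config κ σ ρ n} {sched : ℕ → Fin n} (hK : 1 ≤ 2 * A.K)
    (h : IsExecution A T c sched) :
    ∃ g : ℕ → Ghost n, History A T (fun t => (c t).stack) sched fun t => view (c t).mem (g t) := by
  obtain ⟨h0, hstep⟩ := h
  obtain ⟨g, hg⟩ := exists_sequence
    (fun t (g : Ghost n) => t ≤ T → (view (c t).mem g).Inv A ∧
      (∀ q, Safe A q (view (c t).mem g) (fun S => S.Idle q) ((c t).stack q)) ∧
      ∀ q, StackOK ((c t).stack q))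
    (fun t g g' => t < T → Guar (view (c t).mem g) (view (c (t + 1)).mem g') A ∧
      Turn A (sched t) (view (c t).mem g) (view (c (t + 1)).mem g') ((c t).stack (sched t))
        ((c (t + 1)).stack (sched t)) ∧
      ∀ q ≠ sched t, (c (t + 1)).stack q = (c t).stack q ∧
        (c (t + 1)).mem.announce q = (c t).mem.announce q ∧
        ∀ o, (c t).mem.announce q = some o →
          ((c (t + 1)).mem.queue (.traverse o)).head = ((c t).mem.queue (.traverse o)).head)
    ⟨Ghost.init (sched 0), fun _ => by
      rw [h0]
      refine ⟨inv_init A _, ?_, ?_⟩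
      · exact fun q => safe_nil fun o ho => by cases ho
      · exact fun q => ⟨fun f hf => (List.not_mem_nil hf).elim, List.Pairwise.nil⟩⟩
    (fun t g hP => by
      rcases lt_or_ge t T with ht | ht
      swap
      · exact ⟨g, fun h => absurd h (by omega), fun h => absurd h (by omega)⟩
      obtain ⟨I, hs, hok⟩ := hP ht.le
      -- what holds for the processes that do not take the step
      have key : ∀ g', Guar (view (c t).mem g) (view (c (t + 1)).mem g') A →
          (∀ q ≠ sched t, (c (t + 1)).stack q = (c t).stack q ∧
            (c (t + 1)).mem.announce q = (c t).mem.announce q) →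
          Safe A (sched t) (view (c (t + 1)).mem g') (fun S => S.Idle (sched t))
            ((c (t + 1)).stack (sched t)) →
          StackOK ((c (t + 1)).stack (sched t)) →
          (view (c (t + 1)).mem g').Inv A ∧
            (∀ q, Safe A q (view (c (t + 1)).mem g') (fun S => S.Idle q) ((c (t + 1)).stack q)) ∧
            ∀ q, StackOK ((c (t + 1)).stack q) := by
        intro g' G ho hsf hst
        refine ⟨G.inv I, fun q => ?_, fun q => ?_⟩
        · by_cases hq : q = sched t
          · exact hq ▸ hsf
          · obtain ⟨h1, h2⟩ := ho q hq
            rw [h1]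
            exact (hs q).mono (.single ⟨G, h2⟩) I fun _ _ F F' hi => F'.idle (F.inv I) hi
        · by_cases hq : q = sched t
          · exact hq ▸ hst
          · rw [(ho q hq).1]
            exact hok q
      generalize hc' : c (t + 1) = c' at *
      have hst := hstep t ht
      rw [hc'] at hst
      have hidle := hs (sched t)
      have hsok := hok (sched t)
      cases hst with
      | invoke a hi =>
        rw [show (c t).stack (sched t) = [] from hi] at hidle
        have G := guar_announce (Q := a.query) I hidle
        have hv := view_announce (g := g) (c t).mem (sched t) a.query
        rw [← hv] at G
        have hne : ∀ q ≠ sched t, (announceOp (c t).mem (sched t) a.query).announce q =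
            (c t).mem.announce q := fun q hq => by
          exact Function.update_of_ne hq _ _
        refine ⟨_, fun _ => key _ G (fun q hq => ⟨Function.update_of_ne hq _ _, hne q hq⟩) ?_ ?_,
          fun _ => ⟨G, .inl ⟨a.query, hi, Function.update_self _ _ _, hv⟩,
            fun q hq => ⟨Function.update_of_ne hq _ _, hne q hq, fun o ho => ?_⟩⟩⟩
        · show Safe A (sched t) _ _ (Function.update (c t).stack (sched t) _ (sched t))
          rw [Function.update_self]
          refine safe_one ⟨?_, Nat.lt_succ_self _⟩ fun _ _ h => h
          exact Function.update_self _ _ _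
        · show StackOK (Function.update (c t).stack (sched t) _ (sched t))
          rw [Function.update_self]
          simp [StackOK, Frame.Small]
        · have h1 := (I.ann q o ho).1
          have h2 := (announceSt_hd (S := view (c t).mem g) (p := sched t) (Q := a.query)
            (q := .traverse o) h1).1
          rw [← hv] at h2
          exact h2
      | run f r hi =>
        rw [hi] at hidle hsok
        obtain ⟨_, b, hb, hpre, hcont⟩ := hidle
        obtain ⟨g', G, ha, hh, hn, hsf⟩ := stepOK I hK hpre
        have hN := next_step (sched t) (c t).mem g f (A := A)
        have hn' : ∀ x q, (view (c t).mem g).cellCount ≤ x →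
            (view (step A (sched t) (c t).mem f).1 g').InQ x q → (∃ v, q = .node v) ∨
            (x = (view (c t).mem g).cellCount ∧ ∃ i t' b y, f = .pushLink q i t' b y ∧
              (view (c t).mem g).nxt y = none) := by
          intro x q hx hq
          refine (hn x q hx hq).imp_right fun ⟨h1, i, t', b', y, h2⟩ => ⟨h1, i, t', b', y, h2, ?_⟩
          by_contra hne
          subst h2
          have h3 := cellCount_pushLink (A := A) (sched t) (c t).mem q i t' b' y hne
          exact absurd (hq.1.trans_eq h3) (not_lt.mpr hx)
        have hs' : ∀ o t₁ o' t' todo saved, f = .scanStamp o t₁ o' t' todo saved →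
            (view (step A (sched t) (c t).mem f).1 g').ots o' ≠ none := by
          rintro o t₁ o' t' todo saved rfl
          exact ots_scanStamp (sched t) (c t).mem o t₁ o' t' todo saved
        refine ⟨g', fun _ => key _ G (fun q hq => ⟨Function.update_of_ne hq _ _,
            congrFun ha q⟩) ?_ ?_,
          fun _ => ⟨G, .inr ⟨f, r, _, hi, Function.update_self _ _ _, hN, ha, hn', hs', hsf⟩,
            fun q hq => ⟨Function.update_of_ne hq _ _, congrFun ha q, fun o ho => ?_⟩⟩⟩
        · show Safe A (sched t) _ _ (Function.update (c t).stack (sched t) _ (sched t))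
          rw [Function.update_self]
          have := Runs.append (b := 0) (r := r) (P := fun S => St.Idle S (sched t))
            (fun _ => .refl) (fun _ _ _ => Relation.ReflTransGen.trans) hsf
            fun y F hp => (hcont y (.head ⟨G, congrFun ha _⟩ F) hp).le (by omega)
          exact this
        · show StackOK (Function.update (c t).stack (sched t) _ (sched t))
          rw [Function.update_self]
          exact stackOK_step I hpre hsok hN
        -- The head of a `Traverse` list is moved only by the owner of the operation.
        · by_contra hne
          have h1 := hh o hne
          have h2 := (I.ann _ o h1).2
          have h3 := (I.ann _ o ho).2
          exact hq (h3.symm.trans h2))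
  exact ⟨g, fun t ht => ((hg t).1 ht).1, fun t ht => ((hg t).1 ht).2.1,
    fun t ht => ((hg t).1 ht).2.2, fun t ht => ((hg t).2 ht).1, fun t ht => ((hg t).2 ht).2.1,
    fun t ht => ((hg t).2 ht).2.2⟩

end St

end WaitFreeTree

/-! The length of an operations queue. -/

namespace WaitFreeTree

set_option linter.unusedSectionVars false

variable {κ σ ρ : Type*} {n : ℕ} [LinearOrder κ]

namespace St

variable {S : St κ σ ρ n} {A : Spec κ σ ρ} (I : S.Inv A)
include I

theorem Inv.pending_desc {v x} (hx : S.InQ x (.node v)) (h : S.hd (.node v) < x) :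
    ∃ d, S.item x = .desc d ∧ S.cts x = d.ts ∧ d.op < S.opCount ∧ S.ots d.op = some d.ts ∧
      S.InTrav d.op v ∧ (v ≠ 0 → S.Comes v d.ts) := by
  rcases I.desc v x hx with ⟨_, h2⟩ | h1
  · have h3 := (I.queues.ends (.node v) (I.node_lt hx)).1
    have h4 := I.sorted v _ x h3 hx h
    have h5 := I.bornLe v _ h3
    omega
  · exact h1

/-- A finished operation has no pending descriptor, and an unfinished one still stands in the array.
-/
theorem Inv.pending_announced {v x} (hx : S.InQ x (.node v)) (h : S.hd (.node v) < x) :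
    ∃ i o, S.announce i = some o ∧ S.ots o = some (S.cts x) := by
  obtain ⟨d, h1, h2, h3, h4, -⟩ := I.pending_desc hx h
  rcases I.fin d.op h3 with ⟨_, _, _, _, h5⟩ | ⟨i, hi⟩
  · exact absurd (h5 v x d hx h1 rfl) (not_le.mpr h)
  · exact ⟨i, d.op, hi, h2 ▸ h4⟩

theorem Inv.follow_chain {v h} {l : List ℕ} (hq : S.InQ h (.node v))
    (hl : List.IsChain (fun x y => S.nxt x = some y) (h :: l)) :
    (∀ x ∈ l, S.InQ x (.node v) ∧ h < x) ∧ l.Nodup := by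
  induction l generalizing h with
  | nil => exact ⟨fun x hx => (List.not_mem_nil hx).elim, List.nodup_nil⟩
  | cons y l ih =>
    obtain ⟨h1, h2⟩ := List.isChain_cons_cons.mp hl
    obtain ⟨h3, h4, -⟩ := I.queues.next h hq.1 y h1
    rw [hq.2] at h3
    obtain ⟨h5, h6⟩ := ih h3 h2
    refine ⟨fun x hx => ?_, List.nodup_cons.mpr ⟨fun hy => lt_irrefl y (h5 y hy).2, h6⟩⟩
    rcases List.mem_cons.mp hx with rfl | hx
    · exact ⟨h3, h4⟩
    · exact ⟨(h5 x hx).1, h4.trans (h5 x hx).2⟩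

/-- Pending cells of one queue have different timestamps, so they belong to different operations,
which stand in different cells of the array. -/
theorem Inv.queue_length {v} {l : List ℕ} (hv : v < S.nodeCount)
    (hl : List.IsChain (fun x y => S.nxt x = some y) (S.hd (.node v) :: l)) : l.length ≤ n := by
  obtain ⟨h1, h2⟩ := I.follow_chain (I.queues.ends (.node v) hv).1 hl
  have h3 : ∀ x : l.toFinset, ∃ i o, S.announce i = some o ∧ S.ots o = some (S.cts x) := fun x => by
    obtain ⟨h4, h5⟩ := h1 x (List.mem_toFinset.mp x.2)
    exact I.pending_announced h4 h5
  choose f o hf ho using h3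
  have hinj : Function.Injective f := fun x y hxy => by
    have h6 := hf y
    rw [← hxy, hf x] at h6
    have h7 := ho y
    rw [← Option.some.inj h6, ho x] at h7
    exact Subtype.ext (I.cell_unique (h1 x (List.mem_toFinset.mp x.2)).1
      (h1 y (List.mem_toFinset.mp y.2)).1 (Option.some.inj h7))
  have := Fintype.card_le_of_injective f hinj
  rwa [Fintype.card_coe, Fintype.card_fin, List.toFinset_card_of_nodup h2] at this

end St

theorem Follow.isChain {m : Mem κ σ ρ n} {c : CellId} {l : List CellId} (h : Follow m c l) :
    List.IsChain (fun x y => (m.cell x).next = some y) (c :: l) := by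
  induction l generalizing c with
  | nil => simp
  | cons y l ih => exact List.isChain_cons_cons.mpr ⟨h.1, ih h.2⟩

end WaitFreeTree

/-! The growth of the tree. -/

namespace WaitFreeTree

set_option linter.unusedSectionVars false

variable {κ σ ρ : Type*} {n : ℕ} [LinearOrder κ]

/-! The size of the tree.  `B` contains the timestamps up to `τ` with which child pointers can still
be marked. -/

section Weight

variable (τ : ℕ) (B : Finset ℕ)

/-- The base 4 leaves room for three slots with a later mark, and one part to spare. Slots marked
beyond `τ` are ignored. -/
def rtsWeight (r : ℕ) : ℕ := if r ≤ τ then 4 ^ (B.filter (r < ·)).card else 0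

variable {τ B}

theorem rtsWeight_anti {r b : ℕ} (h : r ≤ b) : rtsWeight τ B b ≤ rtsWeight τ B r := by
  unfold rtsWeight
  split_ifs with h1 h2
  · refine Nat.pow_le_pow_right (by omega) (Finset.card_le_card fun x hx => ?_)
    rw [Finset.mem_filter] at hx ⊢
    exact ⟨hx.1, by omega⟩
  · omega
  · exact Nat.zero_le _
  · exact le_rfl

/-- For the mark `r` the value `b` was still to come, for the mark `b` it is not. -/
theorem rtsWeight_lt {r b : ℕ} (h : r < b) (hb : b ≤ τ → b ∈ B) :
    4 * rtsWeight τ B b ≤ rtsWeight τ B r := by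
  by_cases h1 : b ≤ τ
  · rw [rtsWeight, rtsWeight, if_pos h1, if_pos (by omega), ← pow_succ']
    refine Nat.pow_le_pow_right (by omega) (Finset.card_lt_card ?_)
    refine ⟨fun x hx => ?_, fun hs => ?_⟩
    · rw [Finset.mem_filter] at hx ⊢
      exact ⟨hx.1, by omega⟩
    · have := hs (Finset.mem_filter.mpr ⟨hb h1, h⟩)
      rw [Finset.mem_filter] at this
      omega
  · rw [rtsWeight, if_neg h1]
    exact Nat.zero_le _

theorem rtsWeight_pos {r : ℕ} (h : r ≤ τ) : 1 ≤ rtsWeight τ B r := by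
  rw [rtsWeight, if_pos h]
  exact Nat.one_le_pow _ _ (by omega)

theorem rtsWeight_le (r : ℕ) : rtsWeight τ B r ≤ 4 ^ B.card := by
  unfold rtsWeight
  split_ifs
  · exact Nat.pow_le_pow_right (by omega) (Finset.card_filter_le _ _)
  · exact Nat.zero_le _

end Weight

namespace St

variable {S S' : St κ σ ρ n} {A : Spec κ σ ρ}

section

variable (S) (τ : ℕ) (B : Finset ℕ)

def slotWeight (v : ℕ) : ℕ :=
  rtsWeight τ B (S.rts (S.child v .left)) + rtsWeight τ B (S.rts (S.child v .right))

noncomputable def treeWeight : ℕ := ∑ v ∈ S.below 0, S.slotWeight τ B v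

end

variable {τ : ℕ} {B : Finset ℕ}

theorem treeWeight_le : S.treeWeight τ B ≤ (S.below 0).card * (2 * 4 ^ B.card) := by
  refine Finset.sum_le_card_nsmul _ _ _ fun v _ => ?_
  have h1 := rtsWeight_le (τ := τ) (B := B) (S.rts (S.child v .left))
  have h2 := rtsWeight_le (τ := τ) (B := B) (S.rts (S.child v .right))
  unfold slotWeight
  omega

theorem mem_below {u w} : w ∈ S.below u ↔ w < S.nodeCount ∧ S.Below u w := by
  simp [below]

theorem below_last {u w} (h : S.Below u w) : w = u ∨ ∃ v s, S.Below u v ∧ S.child v s = .inner w := by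
  cases h with
  | refl => exact .inl rfl
  | child v c s hv hc => exact .inr ⟨v, s, hv, hc⟩

/-- The operation that changes a child pointer is pending. -/
theorem Slot.pending (I : S.Inv A) {v s} (hv : v < S.nodeCount) (h : Slot S S' A v s) :
    ∃ x, S.InQ x (.node v) ∧ S.hd (.node v) < x ∧
      (S'.rts (S'.child v s) = S.cts x ∨ S'.rts (S'.child v s) + 1 = S.cts x) := by
  rcases h.cause with ⟨d, q, h1, h2, h3, h4, h5, h6, _⟩ | ⟨c, d, h1, h2, _, h4, _⟩
  · obtain ⟨⟨x, hx, hi, ht⟩, _⟩ := id h1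
    refine ⟨x, hx, ?_, .inl (ht ▸ h6)⟩
    by_contra hle
    rcases (I.done v x d hx (not_lt.mp hle) hi s q h2).2 h3 with h | h
    · exact absurd h4 (not_lt.mpr h)
    · exact h5 h
  · obtain ⟨q, hq⟩ := id h2.1
    have hp := (I.child v hv s c h1).2.2.1
    obtain ⟨_, _, h6, h7, h8⟩ := id hq
    rw [hp] at h6 h7
    obtain ⟨⟨x, hx, hi, ht⟩, _⟩ := id h6
    refine ⟨x, hx, ?_, .inr (ht ▸ h4)⟩
    by_contra hle
    exact I.doomed_not_ins h2 le_rfl ((I.done v x d hx (not_lt.mp hle) hi s q h7).1 c h1 h8)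

/-- In a rebuilding by `d`, equality would mean that the old child was born at `d.ts - 1` and is
unmodified; such a node is not rebuilt, by `fresh_not_rebuild`. -/
theorem Slot.rts_lt (I : S.Inv A) (hK : 1 ≤ 2 * A.K) {v s} (h : Slot S S' A v s) :
    S.rts (S.child v s) < S'.rts (S'.child v s) := by
  rcases h.cause with ⟨d, q, h1, h2, h3, h4, h5, h6, _⟩ | ⟨c, d, h1, h2, _, h4, _⟩
  · rw [← Ref.ts_eq_rts S h3, h6]
    exact h4
  · obtain ⟨q, hq⟩ := id h2.1
    rw [h1]
    show S.born c < _
    have h8 := I.born_tsMod hq.2.1 hq.1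
    have h9 := h2.2.2.1
    by_contra hlt
    have := I.fresh_not_rebuild hK (d := d) hq.1 hq.2.1 (by omega)
    exact absurd (this.symm.trans h2.2.2.2) (by simp)

theorem treeWeight_congr (I : S.Inv A) (G : Guar S S' A)
    (h : ∀ v < S.nodeCount, ∀ s, S'.child v s = S.child v s) :
    S'.treeWeight τ B = S.treeWeight τ B := by
  have hc : ∀ v, S'.Below 0 v ↔ S.Below 0 v := fun v => by
    constructor
    · intro hb
      induction hb with
      | refl => exact .refl
      | child u w s _ hc ih =>
        rw [h u (I.below_lt I.nodePos ih)] at hc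
        exact .child u w s ih hc
    · intro hb
      induction hb with
      | refl => exact .refl
      | child u w s hb hc ih =>
        rw [← h u (I.below_lt I.nodePos hb)] at hc
        exact .child u w s ih hc
  have hb : S'.below 0 = S.below 0 := by
    ext v
    simp only [mem_below, hc]
    exact ⟨fun h => ⟨I.below_lt I.nodePos h.2, h.2⟩, fun h => ⟨h.1.trans_le G.nodeCount_le, h.2⟩⟩
  rw [treeWeight, treeWeight, hb]
  refine Finset.sum_congr rfl fun v hv => ?_
  have hv' : v < S.nodeCount := (mem_below.mp hv).1
  rw [slotWeight, slotWeight, h v hv', h v hv', G.rts_eq I hv', G.rts_eq I hv']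

open Classical in
/-- The nodes that a change of the child pointer of `v` at `s` cuts off. -/
noncomputable def cut (S : St κ σ ρ n) (v : ℕ) (s : Side) : Finset ℕ :=
  match S.child v s with
  | .inner c => S.below c
  | _ => ∅

theorem mem_cut {v s w} (h : w ∈ S.cut v s) : ∃ c, S.child v s = .inner c ∧ S.Below c w := by
  unfold cut at h
  split at h
  · next c hc => exact ⟨c, hc, (mem_below.mp h).2⟩
  · cases h

theorem Inv.cut_subset (I : S.Inv A) {v s} (hv : S.Below 0 v) : S.cut v s ⊆ S.below 0 := by
  intro w hw
  obtain ⟨c, hc, hb⟩ := mem_cut hw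
  have := Below.trans (.child v c s hv hc) hb
  exact mem_below.mpr ⟨(I.below_lt I.nodePos this), this⟩

theorem Inv.not_mem_cut (I : S.Inv A) {v s u} (hv : v < S.nodeCount) (hu : S.dep u ≤ S.dep v) :
    u ∉ S.cut v s := by
  intro h
  obtain ⟨c, hc, hb⟩ := mem_cut h
  obtain ⟨h1, _, _, h4⟩ := I.child v hv s c hc
  rcases I.below_dep h1 hb with rfl | h <;> omega

/-- No unchanged edge leads from outside into the part cut off, because recorded parents are unique.
-/
theorem Guar.below_of_slot (I : S.Inv A) (G : Guar S S' A) {v s} (hv : v < S.nodeCount)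
    (hs : Slot S S' A v s) (hne : S'.child v s ≠ S.child v s) {u} (hb : S'.Below 0 u) :
    u ∈ S.below 0 \ S.cut v s ∨ (S.nodeCount ≤ u ∧ u < S'.nodeCount) := by
  induction hb with
  | refl =>
    refine .inl (Finset.mem_sdiff.mpr ⟨mem_below.mpr ⟨I.nodePos, .refl⟩,
      I.not_mem_cut hv ?_⟩)
    rw [I.depRoot]
    exact Nat.zero_le _
  | child u w r _ hc ih =>
    rcases ih with ih | ⟨h1, h2⟩
    · obtain ⟨h1, h2⟩ := Finset.mem_sdiff.mp ih
      obtain ⟨h3, h4⟩ := mem_below.mp h1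
      by_cases hch : S'.child u r = S.child u r
      · rw [hch] at hc
        have h5 := Below.child u w r h4 hc
        refine .inl (Finset.mem_sdiff.mpr ⟨mem_below.mpr ⟨(I.below_lt I.nodePos h5), h5⟩, fun hcut => ?_⟩)
        obtain ⟨c, hcc, hcb⟩ := mem_cut hcut
        have hpw := (I.child u h3 r w hc).2.2.1
        have hcl := I.child v hv s c hcc
        rcases below_last hcb with rfl | ⟨u', r', hb', hc'⟩
        · have h6 := hpw.symm.trans hcl.2.2.1
          cases h6
          exact hne hch
        · have h6 := (I.child u' (I.below_lt hcl.1 hb') r' w hc').2.2.1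
          have h7 := hpw.symm.trans h6
          cases h7
          refine h2 ?_
          unfold cut
          rw [hcc]
          exact mem_below.mpr ⟨h3, hb'⟩
      · obtain ⟨rfl, rfl⟩ := G.slot_unique v hv s hne u h3 r hch
        have := hs.inner w hc
        exact .inr ⟨this.1, this.2.1⟩
    · have := (G.node_new u h1 h2).2.2.2.2 r
      have := this.2 w hc
      exact .inr ⟨this.1, this.2.1⟩

/-- A rebuilding discards at least as many nodes as it creates, and the marks in the frozen subtree
do not exceed the new one. -/
theorem Slot.cut_weight (I : S.Inv A) {v s} (hs : Slot S S' A v s) :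
    (S'.nodeCount - S.nodeCount) * (2 * rtsWeight τ B (S'.rts (S'.child v s))) ≤
        ∑ u ∈ S.cut v s, S.slotWeight τ B u ∨
      (S'.nodeCount - S.nodeCount ≤ 1) := by
  rcases hs.cause with ⟨d, q, h1, h2, h3, h4, h5, h6, h7⟩ | ⟨c, d, h1, h2, h3, h4, h5⟩
  · exact .inr (by omega)
  · left
    have hcut : S.cut v s = S.below c := by rw [cut, h1]
    rw [hcut]
    refine (Nat.mul_le_mul_right _ (by omega : _ ≤ (S.below c).card)).trans ?_
    refine Finset.card_nsmul_le_sum _ _ _ fun u hu => ?_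
    obtain ⟨hu1, hu2⟩ := mem_below.mp hu
    have hf := Inv.frz_below (.base c d h2 rfl) h3 hu2
    have key : ∀ r, S.rts (S.child u r) ≤ S'.rts (S'.child v s) := fun r => by
      obtain ⟨x, hx, hxt⟩ := (I.rtsIns u hu1 r).1
      have := (I.frz_cells hf).1 x hx
      omega
    have h8 := rtsWeight_anti (τ := τ) (B := B) (key .left)
    have h9 := rtsWeight_anti (τ := τ) (B := B) (key .right)
    unfold slotWeight
    omega

theorem slotWeight_update (I : S.Inv A) (G : Guar S S' A) {v s} (hv : v < S.nodeCount)
    (hne : S'.child v s ≠ S.child v s) :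
    S'.slotWeight τ B v + rtsWeight τ B (S.rts (S.child v s)) =
      S.slotWeight τ B v + rtsWeight τ B (S'.rts (S'.child v s)) := by
  have key : ∀ r, r ≠ s → S'.rts (S'.child v r) = S.rts (S.child v r) := fun r hr => by
    by_cases h : S'.child v r = S.child v r
    · rw [h, G.rts_eq I hv]
    · exact absurd (G.slot_unique v hv s hne v hv r h).2 hr
  unfold slotWeight
  cases s with
  | left => rw [key .right (by simp)]; omega
  | right => rw [key .left (by simp)]; omega

/-- A change of a child pointer in the tree decreases the weight. -/
theorem treeWeight_step (hK : 1 ≤ 2 * A.K) (I : S.Inv A) (G : Guar S S' A)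
    (hB : ∀ v x t, S.InQ x (.node v) → S.hd (.node v) < x → (t = S.cts x ∨ t + 1 = S.cts x) →
      t ≤ τ → t ∈ B) :
    S'.treeWeight τ B ≤ S.treeWeight τ B ∧ ∀ w, S.nodeCount ≤ w → w < S'.nodeCount →
      S'.born w ≤ τ → S'.treeWeight τ B + 1 ≤ S.treeWeight τ B ∧
        S'.nodeCount - S.nodeCount ≤ S.treeWeight τ B := by
  by_cases hall : ∀ v < S.nodeCount, ∀ s, S'.child v s = S.child v s
  · refine ⟨(treeWeight_congr I G hall).le, fun w h1 h2 => ?_⟩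
    obtain ⟨v, hv, s, hne⟩ := G.slot_of_new (by omega)
    exact absurd (hall v hv s) hne
  · push Not at hall
    obtain ⟨v, hv, s, hne⟩ := hall
    have hs := (G.slot v hv s).resolve_left hne
    obtain ⟨x, hx, hxh, hxt⟩ := hs.pending I hv
    have htree := I.tree v x hx hxh
    have hlt := hs.rts_lt I hK
    have h4 := rtsWeight_lt (B := B) hlt (hB v x _ hx hxh hxt)
    have hcw := hs.cut_weight I (τ := τ) (B := B)
    have hpos := rtsWeight_pos (τ := τ) (B := B) (r := S'.rts (S'.child v s))
    set β := rtsWeight τ B (S'.rts (S'.child v s)) with hβ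
    set N := Finset.Ico S.nodeCount S'.nodeCount with hN
    set K := S.below 0 \ S.cut v s with hKdef
    have hvK : v ∈ K := Finset.mem_sdiff.mpr ⟨mem_below.mpr ⟨hv, htree⟩, I.not_mem_cut hv le_rfl⟩
    have hKlt : ∀ u ∈ K, u < S.nodeCount := fun u hu =>
      (mem_below.mp (Finset.mem_sdiff.mp hu).1).1
    have hsub : S'.below 0 ⊆ K ∪ N := fun u hu => by
      rcases G.below_of_slot I hv hs hne (mem_below.mp hu).2 with h | h
      · exact Finset.mem_union_left _ h
      · exact Finset.mem_union_right _ (Finset.mem_Ico.mpr h)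
    have hdisj : Disjoint K N := Finset.disjoint_left.mpr fun u hu hu' =>
      absurd (hKlt u hu) (not_lt.mpr (Finset.mem_Ico.mp hu').1)
    have h1 : S'.treeWeight τ B ≤ ∑ u ∈ K, S'.slotWeight τ B u + ∑ u ∈ N, S'.slotWeight τ B u := by
      rw [← Finset.sum_union hdisj]
      exact Finset.sum_le_sum_of_subset hsub
    have h2 : ∑ u ∈ N, S'.slotWeight τ B u = (S'.nodeCount - S.nodeCount) * (2 * β) := by
      rw [Finset.sum_congr rfl (g := fun _ => 2 * β) fun u hu => ?_]
      · rw [Finset.sum_const, hN, Nat.card_Ico, smul_eq_mul]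
      · obtain ⟨h1, h2⟩ := Finset.mem_Ico.mp hu
        have h3 := (G.node_new u h1 h2).2.2.2.2
        have h5 := (hs.depth u h1 h2).2
        rw [slotWeight, (h3 .left).1, (h3 .right).1, h5]
        omega
    have h3 : ∑ u ∈ K, S'.slotWeight τ B u + rtsWeight τ B (S.rts (S.child v s)) =
        ∑ u ∈ K, S.slotWeight τ B u + β := by
      rw [← Finset.add_sum_erase K _ hvK, ← Finset.add_sum_erase K (fun u => S.slotWeight τ B u) hvK]
      have h5 := slotWeight_update I G hv hne (τ := τ) (B := B)
      have h6 : ∑ u ∈ K.erase v, S'.slotWeight τ B u = ∑ u ∈ K.erase v, S.slotWeight τ B u := by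
        refine Finset.sum_congr rfl fun u hu => ?_
        obtain ⟨hu1, hu2⟩ := Finset.mem_erase.mp hu
        have hu3 := hKlt u hu2
        have key : ∀ r, S'.child u r = S.child u r := fun r => by
          by_contra h
          exact hu1 (G.slot_unique v hv s hne u hu3 r h).1
        rw [slotWeight, slotWeight, key, key, G.rts_eq I hu3, G.rts_eq I hu3]
      omega
    have h5 : S.treeWeight τ B = ∑ u ∈ K, S.slotWeight τ B u + ∑ u ∈ S.cut v s, S.slotWeight τ B u :=
      (Finset.sum_sdiff (I.cut_subset htree)).symm
    -- The changed slot falls from at least `4 * β` to `β`. The replacement of a leaf adds at most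
    -- one node, of weight `2 * β`; in a rebuilding the discarded nodes outweigh the new ones.
    have h6 : S'.treeWeight τ B + β ≤ S.treeWeight τ B := by
      rcases hcw with hcw | hcw
      · omega
      · have : (S'.nodeCount - S.nodeCount) * (2 * β) ≤ 2 * β := by
          calc _ ≤ 1 * (2 * β) := Nat.mul_le_mul_right _ hcw
            _ = _ := one_mul _
        omega
    refine ⟨by omega, fun w hw1 hw2 hw3 => ?_⟩
    rw [(hs.depth w hw1 hw2).2] at hw3
    have hp := hpos hw3
    refine ⟨by omega, ?_⟩
    rcases hcw with hcw | hcw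
    · have : (S'.nodeCount - S.nodeCount) * 1 ≤ (S'.nodeCount - S.nodeCount) * (2 * β) :=
        Nat.mul_le_mul_left _ (by omega)
      omega
    · omega

end St

end WaitFreeTree

/-! The nodes and operations that occur while an operation is executed. -/

namespace WaitFreeTree

set_option linter.unusedSectionVars false

variable {κ σ ρ : Type*} {n : ℕ} [LinearOrder κ]

theorem exists_jump {f : ℕ → ℕ} {a b x : ℕ} (hab : a ≤ b) (ha : f a ≤ x) (hb : x < f b) :
    ∃ k, a ≤ k ∧ k < b ∧ f k ≤ x ∧ x < f (k + 1) := by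
  induction b, hab using Nat.le_induction with
  | base => omega
  | succ b hab ih =>
    rcases lt_or_ge x (f b) with h | h
    · obtain ⟨k, h1, h2, h3⟩ := ih h
      exact ⟨k, h1, by omega, h3⟩
    · exact ⟨b, hab, by omega, h, hb⟩

namespace St

variable {A : Spec κ σ ρ} {T : ℕ} {stack : ℕ → Fin n → List (Frame κ σ ρ n)} {sched : ℕ → Fin n}
  {S : ℕ → St κ σ ρ n}

namespace History

variable (H : History A T stack sched S)
include H

theorem ind {P : St κ σ ρ n → Prop} {i j : ℕ} (hij : i ≤ j) (hj : j ≤ T)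
    (hP : ∀ S S', S.Inv A → Guar S S' A → P S → P S') (h : P (S i)) : P (S j) := by
  induction j, hij using Nat.le_induction with
  | base => exact h
  | succ j hij ih => exact hP _ _ (H.inv j (by omega)) (H.guar j (by omega)) (ih (by omega))

theorem ext {i j : ℕ} (hij : i ≤ j) (hj : j ≤ T) : Ext (S i) (S j) :=
  H.ind hij hj (fun _ _ _ G h => h.trans G.ext) (Ext.refl _)

theorem proc_eq {i j o : ℕ} (hij : i ≤ j) (hj : j ≤ T) (ho : o < (S i).opCount) :
    (S j).proc o = (S i).proc o :=
  (H.ind (P := fun S' => o < S'.opCount ∧ S'.proc o = (S i).proc o) hij hj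
    (fun _ _ _ G h => ⟨h.1.trans_le G.opCount_le, (G.proc_eq o h.1).trans h.2⟩) ⟨ho, rfl⟩).2

theorem finished {i j o : ℕ} (hij : i ≤ j) (hj : j ≤ T) (ho : o < (S i).opCount)
    (h : (S i).Finished o) : (S j).Finished o :=
  (H.ind (P := fun S' => o < S'.opCount ∧ S'.Finished o) hij hj
    (fun _ _ I G h => ⟨h.1.trans_le G.opCount_le, G.finished I h.1 h.2⟩) ⟨ho, h⟩).2

/-- Cells that are added to an operations queue are the last ones when they are added. -/
theorem cell_added {i : ℕ} (hi : i ≤ T) {x v : ℕ} (hx : (S i).cellCount ≤ x)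
    (hq : (S T).InQ x (.node v)) {d} (hd : (S T).item x = .desc d) :
    ∃ k, i ≤ k ∧ k < T ∧ v < (S k).nodeCount ∧ (S (k + 1)).InQ x (.node v) ∧
      (S (k + 1)).item x = .desc d ∧ (S (k + 1)).hd (.node v) < x := by
  obtain ⟨k, h1, h2, h3, h4⟩ := exists_jump (f := fun k => (S k).cellCount) hi hx hq.1
  have E := H.ext (show k + 1 ≤ T by omega) le_rfl
  have hq' := E.inQ_old hq h4
  rw [E.item_eq x h4] at hd
  have G := H.guar k h2
  refine ⟨k, h1, h2, ?_, hq', hd, ?_⟩ <;>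
    rcases G.cell_cases hq' with ⟨_, h5, _⟩ | ⟨h5, _⟩ | ⟨_, _, _, h5, _⟩
  · exact absurd h5.1 (not_lt.mpr h3)
  · exact h5
  · rw [hd] at h5; cases h5
  · exact absurd h5.1 (not_lt.mpr h3)
  · exact (G.hd_lt v h5).trans_le h3
  · rw [hd] at h5; cases h5

end History

/-! A period in which a process `p` executes one operation.  Here `X` is the state at its beginning
and `Z` the one at its end; `τ` is the timestamp of the operation. -/

section

variable (X Z : St κ σ ρ n) (τ : ℕ)

/-- The operation may be executed in the period. -/
def Relevant (o : ℕ) : Prop :=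
  o < Z.opCount ∧ ((∃ i, X.announce i = some o) ∨ X.opCount ≤ o) ∧ ∀ t, Z.ots o = some t → t ≤ τ

open Classical in
noncomputable def relTs : Finset ℕ :=
  (Finset.range (τ + 1)).filter fun t => ∃ o, Relevant X Z τ o ∧ Z.ots o = some t

/-- The cell is pending at some moment of the period. -/
def Live (x : ℕ) : Prop :=
  x < Z.cellCount ∧ Z.cts x ≤ τ ∧ ∃ v d, Z.own x = .node v ∧ Z.item x = .desc d ∧
    (x < X.cellCount → X.hd (.node v) < x)

/-- The node is in the tree at the beginning, or it is put into the tree by an operation with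
timestamp at most `τ`. -/
def Window (v : ℕ) : Prop :=
  (v < X.nodeCount ∧ X.Below 0 v) ∨ (X.nodeCount ≤ v ∧ v < Z.nodeCount ∧ Z.born v ≤ τ)

open Classical in
noncomputable def window : Finset ℕ := (Finset.range Z.nodeCount).filter (Window X Z τ)

open Classical in
noncomputable def live : Finset ℕ := (Finset.range Z.cellCount).filter (Live X Z τ)

/-- The timestamps with which child pointers can be marked. -/
noncomputable def markTs : Finset ℕ :=
  insert τ (relTs X Z τ ∪ (relTs X Z τ).image (· - 1))

/-- The nodes that have been created by operations with timestamps up to `τ`. -/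
def freshNodes : Finset ℕ :=
  (Finset.Ico X.nodeCount Z.nodeCount).filter fun v => Z.born v ≤ τ

end

/-- The base of the square bounds the initial weight: two slots for each node, each of weight at
most `4 ^ (4 * n + 1)`. It is squared because it bounds both the number of decreases and the number
of nodes added in one of them. -/
def sizeBound (n N : ℕ) : ℕ := N + (N * (2 * 4 ^ (4 * n + 1))) ^ 2

/-- The timestamp that the operation started at time `t₀` has at time `T`. -/
def deadline (S : ℕ → St κ σ ρ n) (T t₀ : ℕ) : ℕ := ((S T).ots (S t₀).opCount).getD 0

/-- The process `p` starts an operation at time `t₀` and executes it up to time `T`. -/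
structure Period (A : Spec κ σ ρ) (T : ℕ) (stack : ℕ → Fin n → List (Frame κ σ ρ n))
    (sched : ℕ → Fin n) (S : ℕ → St κ σ ρ n) (t₀ : ℕ) : Prop where
  hist : History A T stack sched S
  lt : t₀ < T
  idle : stack t₀ (sched t₀) = []
  busy : ∀ t, t₀ < t → t ≤ T → stack t (sched t₀) ≠ []

namespace Period

variable {t₀ : ℕ} (P : Period A T stack sched S t₀)
include P

theorem start : ∃ Q, stack (t₀ + 1) (sched t₀) = [.fetch (S t₀).opCount] ∧
    S (t₀ + 1) = (S t₀).announceSt (sched t₀) Q := by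
  rcases P.hist.turn t₀ P.lt with ⟨Q, -, h1, h2⟩ | ⟨f, r, _, h, _⟩
  · exact ⟨Q, h1, h2⟩
  · rw [P.idle] at h
    cases h

local notation "τ" => deadline S T t₀
local notation "X" => S (t₀ + 1)
local notation "Z" => S T

theorem le : t₀ + 1 ≤ T := P.lt

theorem invX : (X).Inv A := P.hist.inv _ P.le
theorem invZ : (Z).Inv A := P.hist.inv _ le_rfl

theorem opCount : (X).opCount = (S t₀).opCount + 1 := by
  obtain ⟨Q, _, h⟩ := P.start
  rw [h]
  rfl

/-- Apart from the operation announced at the beginning, a process contributes only the first one it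
starts in the period. When it starts another, `Inv.rel` says that the operation of the period, which
is older than that first one, is stamped already; so the next one gets a timestamp beyond `τ`. -/
theorem relTs_card : (relTs X Z τ).card ≤ 2 * n := by
  have hE := P.hist.ext P.le le_rfl
  have hf : ∀ t ∈ relTs X Z τ, ∃ o, Relevant X Z τ o ∧ (Z).ots o = some t ∧ (Z).ticket t = o := by
    intro t ht
    simp only [relTs, Finset.mem_filter] at ht
    obtain ⟨_, o, ho, hot⟩ := ht
    exact ⟨o, ho, hot, (P.invZ.stamp o ho.1 t hot).2.2⟩
  classical
  have hcard : (Finset.univ : Finset (Fin n × Bool)).card = 2 * n := by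
    simp [mul_comm]
  rw [← hcard]
  refine Finset.card_le_card_of_injOn
    (fun t => ((Z).proc ((Z).ticket t), decide ((X).opCount ≤ (Z).ticket t)))
    (fun _ _ => Finset.mem_univ _) ?_
  -- two operations of a process that both start in the period
  have key : ∀ o o' t t', Relevant X Z τ o → Relevant X Z τ o' → (X).opCount ≤ o → o < o' →
      (Z).proc o = (Z).proc o' → (Z).ots o = some t → (Z).ots o' = some t' → False := by
    intro o o' t t' _ h2 h3 h4 h5 _ h7
    rw [P.opCount] at h3
    obtain ⟨s, h8, h9⟩ := P.invZ.rel o o' h4 h2.1 h5 (S t₀).opCount (by omega)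
    obtain ⟨h10, h11, h12⟩ := P.invZ.stamp o' h2.1 t' h7
    have h13 := h9 t' h10 h11 h12
    have h14 := h2.2.2 t' h7
    rw [deadline, h8] at h14
    exact absurd h14 (not_le.mpr h13)
  intro t ht t' ht' he
  obtain ⟨o, ho, hot, hto⟩ := hf t ht
  obtain ⟨o', ho', hot', hto'⟩ := hf t' ht'
  simp only [Prod.mk.injEq, hto, hto', decide_eq_decide] at he
  have hoo : o = o' := by
    by_cases hc : (X).opCount ≤ o
    · have hc' := he.2.mp hc
      by_contra hne
      rcases lt_or_gt_of_ne hne with h | h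
      · exact key o o' t t' ho ho' hc h he.1 hot hot'
      · exact key o' o t' t ho' ho hc' h he.1.symm hot' hot
    · have hc' : ¬ (X).opCount ≤ o' := fun h => hc (he.2.mpr h)
      obtain ⟨i, hi⟩ := ho.2.1.resolve_right hc
      obtain ⟨i', hi'⟩ := ho'.2.1.resolve_right hc'
      have h1 := P.invX.ann i o hi
      have h2 := P.invX.ann i' o' hi'
      have h3 := he.1
      rw [P.hist.proc_eq P.le le_rfl h1.1, P.hist.proc_eq P.le le_rfl h2.1, h1.2, h2.2] at h3
      rw [h3, hi'] at hi
      exact (Option.some.inj hi).symm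
  rw [hoo, hot'] at hot
  exact (Option.some.inj hot).symm

/-- An operation finished at the beginning has no pending cell then, and being finished is
permanent, so it gets none later. -/
theorem relevant_of_live {x d} (hx : Live X Z τ x) (hd : (Z).item x = .desc d) :
    Relevant X Z τ d.op ∧ (Z).ots d.op = some ((Z).cts x) ∧ (Z).cts x = d.ts := by
  obtain ⟨h1, h2, v, d', h3, h4, h5⟩ := hx
  obtain ⟨h6, h7, h8, -⟩ := P.invZ.desc_cell ⟨h1, h3⟩ hd
  refine ⟨⟨h7, ?_, fun t ht => ?_⟩, by rw [h8, h6], h6⟩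
  · by_contra hne
    push Not at hne
    have hfin := (P.invX.fin d.op hne.2).resolve_right fun ⟨i, hi⟩ => hne.1 i hi
    have hE := P.hist.ext P.le le_rfl
    rcases lt_or_ge x (X).cellCount with hc | hc
    · obtain ⟨_, _, _, _, h9⟩ := hfin
      rw [hE.item_eq x hc] at hd
      exact absurd (h9 v x d (hE.inQ_old ⟨h1, h3⟩ hc) hd rfl) (not_le.mpr (h5 hc))
    · obtain ⟨k, h9, h10, _, h11, h12, h13⟩ := P.hist.cell_added P.le hc ⟨h1, h3⟩ hd
      obtain ⟨_, _, _, _, h14⟩ := P.hist.finished (show t₀ + 1 ≤ k + 1 by omega) (by omega) hne.2 hfin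
      exact absurd (h14 v x d h11 h12 rfl) (not_le.mpr h13)
  · rw [h8] at ht
    cases ht
    omega

theorem cts_mem_relTs {x} (hx : Live X Z τ x) : (Z).cts x ∈ relTs X Z τ := by
  obtain ⟨h1, h2, v, d, h3, h4, h5⟩ := id hx
  have := P.relevant_of_live hx h4
  simp only [relTs, Finset.mem_filter, Finset.mem_range]
  exact ⟨by omega, d.op, this.1, this.2.1⟩

theorem live_of_pending {j x v} (h1 : t₀ + 1 ≤ j) (h2 : j ≤ T) (hx : (S j).InQ x (.node v))
    (h : (S j).hd (.node v) < x) (ht : (S j).cts x ≤ τ) : Live X Z τ x := by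
  have E := P.hist.ext h2 le_rfl
  have E' := P.hist.ext h1 h2
  obtain ⟨d, hd, -⟩ := (P.hist.inv j h2).pending_desc hx h
  refine ⟨hx.1.trans_le E.cellCount_le, by rwa [E.cts_eq x hx.1], v, d, (E.inQ hx).2,
    by rw [E.item_eq x hx.1, hd], fun hc => lt_of_le_of_lt ?_ h⟩
  exact E'.hd_le v (P.invX.node_lt (E'.inQ_old hx hc))

/-- The tree stays within the nodes that are in it at the beginning and the new ones. -/
theorem tree_child {j} (h1 : t₀ + 1 ≤ j) (h2 : j ≤ T) : ∀ v < (S j).nodeCount,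
    (v < (X).nodeCount → (X).Below 0 v) → ∀ s c, (S j).child v s = .inner c →
      c < (X).nodeCount → (X).Below 0 c := by
  induction j, h1 using Nat.le_induction with
  | base => exact fun v hv hb s c hc _ => .child v c s (hb hv) hc
  | succ j h1 ih =>
    intro v hv hb s c hc hcx
    have G := P.hist.guar j (by omega)
    have hX := (P.hist.ext h1 (show j ≤ T by omega)).nodeCount_le
    by_cases hvj : v < (S j).nodeCount
    · rcases G.slot v hvj s with h | h
      · exact ih (by omega) v hvj hb s c (h ▸ hc) hcx
      · exact absurd hcx (not_lt.mpr (hX.trans (h.inner c hc).1))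
    · have := ((G.node_new v (not_lt.mp hvj) hv).2.2.2.2 s).2 c hc
      exact absurd hcx (not_lt.mpr (hX.trans this.1))

theorem below_old {j v} (h1 : t₀ + 1 ≤ j) (h2 : j ≤ T) (hb : (S j).Below 0 v)
    (hv : v < (X).nodeCount) : (X).Below 0 v := by
  suffices v < (S j).nodeCount ∧ (v < (X).nodeCount → (X).Below 0 v) from this.2 hv
  clear hv
  induction hb with
  | refl => exact ⟨(P.hist.inv j h2).nodePos, fun _ => .refl⟩
  | child u w s _ hc ih =>
    exact ⟨((P.hist.inv j h2).child u ih.1 s w hc).1, P.tree_child h1 h2 u ih.1 ih.2 s w hc⟩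

/-- A pending cell lies in a node of the tree at that moment, and an old node that is outside the
tree does not come back into it. -/
theorem window_of_live {x v} (hx : Live X Z τ x) (hv : (Z).own x = .node v) : Window X Z τ v := by
  obtain ⟨h1, h2, v', d, h3, h4, h5⟩ := hx
  rw [hv] at h3
  cases h3
  have hE := P.hist.ext P.le le_rfl
  by_cases hc : v < (X).nodeCount
  · refine .inl ⟨hc, ?_⟩
    rcases lt_or_ge x (X).cellCount with h | h
    · exact P.invX.tree v x (hE.inQ_old ⟨h1, hv⟩ h) (h5 h)
    · obtain ⟨k, h6, h7, _, h8, _, h9⟩ := P.hist.cell_added P.le h ⟨h1, hv⟩ h4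
      exact P.below_old (j := k + 1) (by omega) (by omega)
        ((P.hist.inv (k + 1) (by omega)).tree v x h8 h9) hc
  · exact .inr ⟨not_lt.mp hc, P.invZ.node_lt ⟨h1, hv⟩, (P.invZ.bornLe v x ⟨h1, hv⟩).trans h2⟩

theorem markTs_card : (markTs X Z τ).card ≤ 4 * n + 1 := by
  have h1 := P.relTs_card
  have h2 := Finset.card_insert_le τ (relTs X Z τ ∪ (relTs X Z τ).image (· - 1))
  have h3 := Finset.card_union_le (relTs X Z τ) ((relTs X Z τ).image (· - 1))
  have h4 := Finset.card_image_le (s := relTs X Z τ) (f := (· - 1))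
  unfold markTs
  omega

theorem mem_markTs {j} (h1 : t₀ + 1 ≤ j) (h2 : j ≤ T) {v x t} (hx : (S j).InQ x (.node v))
    (h : (S j).hd (.node v) < x) (ht : t = (S j).cts x ∨ t + 1 = (S j).cts x) (htt : t ≤ τ) :
    t ∈ markTs X Z τ := by
  have E := P.hist.ext h2 le_rfl
  have key : (S j).cts x ≤ τ → (S j).cts x ∈ relTs X Z τ := fun hle => by
    have := P.cts_mem_relTs (P.live_of_pending h1 h2 hx h hle)
    rwa [E.cts_eq x hx.1] at this
  unfold markTs
  rw [Finset.mem_insert, Finset.mem_union, Finset.mem_image]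
  rcases ht with rfl | ht
  · exact .inr (.inl (key htt))
  · rcases lt_or_ge τ ((S j).cts x) with hlt | hge
    -- The operation with timestamp `τ + 1` is not counted in `relTs`, but its rebuilding marks with
    -- `τ`.
    · exact .inl (by omega)
    · exact .inr (.inr ⟨_, key hge, by omega⟩)

/-- All nodes created in one step have the same birth, so either all of them count or none. -/
theorem freshNodes_step {j} (h1 : t₀ + 1 ≤ j) (h2 : j < T) :
    (freshNodes X (S (j + 1)) τ).card = (freshNodes X (S j) τ).card ∨
      (∃ w, (S j).nodeCount ≤ w ∧ w < (S (j + 1)).nodeCount ∧ (S (j + 1)).born w ≤ τ) ∧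
      (freshNodes X (S (j + 1)) τ).card =
        (freshNodes X (S j) τ).card + ((S (j + 1)).nodeCount - (S j).nodeCount) := by
  have G := P.hist.guar j h2
  have hX := (P.hist.ext h1 (show j ≤ T by omega)).nodeCount_le
  have h3 : freshNodes X (S (j + 1)) τ = freshNodes X (S j) τ ∪
      (Finset.Ico (S j).nodeCount (S (j + 1)).nodeCount).filter fun v => (S (j + 1)).born v ≤ τ := by
    ext v
    simp only [freshNodes, Finset.mem_filter, Finset.mem_union, Finset.mem_Ico]
    rcases lt_or_ge v (S j).nodeCount with h | h
    · have := G.nodeCount_le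
      rw [G.born_eq v h]
      constructor
      · rintro ⟨⟨a, _⟩, b⟩
        exact .inl ⟨⟨a, h⟩, b⟩
      · rintro (⟨⟨a, _⟩, b⟩ | ⟨⟨a, _⟩, _⟩)
        · exact ⟨⟨a, h.trans_le this⟩, b⟩
        · exact absurd h (not_lt.mpr a)
    · constructor
      · rintro ⟨⟨_, a⟩, b⟩
        exact .inr ⟨⟨h, a⟩, b⟩
      · rintro (⟨⟨_, a⟩, _⟩ | ⟨⟨_, a⟩, b⟩)
        · exact absurd a (not_lt.mpr h)
        · exact ⟨⟨hX.trans h, a⟩, b⟩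
  have h4 : Disjoint (freshNodes X (S j) τ)
      ((Finset.Ico (S j).nodeCount (S (j + 1)).nodeCount).filter
        fun v => (S (j + 1)).born v ≤ τ) := by
    rw [Finset.disjoint_left]
    intro v hv hv'
    simp only [freshNodes, Finset.mem_filter, Finset.mem_Ico] at hv hv'
    exact absurd hv.1.2 (not_lt.mpr hv'.1.1)
  by_cases hw : ∃ w, (S j).nodeCount ≤ w ∧ w < (S (j + 1)).nodeCount ∧ (S (j + 1)).born w ≤ τ
  · refine .inr ⟨hw, ?_⟩
    obtain ⟨w, hw1, hw2, hw3⟩ := hw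
    obtain ⟨v, hv, s, hne⟩ := G.slot_of_new (by omega)
    have hs := (G.slot v hv s).resolve_left hne
    rw [h3, Finset.card_union_of_disjoint h4, Finset.filter_true_of_mem, Nat.card_Ico]
    intro u hu
    rw [Finset.mem_Ico] at hu
    rw [(hs.depth u hu.1 hu.2).2, ← (hs.depth w hw1 hw2).2]
    exact hw3
  · left
    rw [h3, Finset.card_union_of_disjoint h4, Finset.filter_false_of_mem, Finset.card_empty, add_zero]
    intro u hu h
    rw [Finset.mem_Ico] at hu
    exact hw ⟨u, hu.1, hu.2, h⟩

/-- With `W₀` the initial weight, a step that creates nodes counted here lowers the weight by at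
least one and creates at most `W₀` of them; so the sum on the left never grows. -/
theorem freshNodes_card (hK : 1 ≤ 2 * A.K) {j} (h1 : t₀ + 1 ≤ j) (h2 : j ≤ T) :
    (S j).treeWeight τ (markTs X Z τ) ≤ (X).treeWeight τ (markTs X Z τ) ∧
    (freshNodes X (S j) τ).card +
        (X).treeWeight τ (markTs X Z τ) * (S j).treeWeight τ (markTs X Z τ) ≤
      (X).treeWeight τ (markTs X Z τ) ^ 2 := by
  induction j, h1 using Nat.le_induction with
  | base => simp [freshNodes, sq]
  | succ j h1 ih =>
    obtain ⟨h3, h4⟩ := ih (by omega)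
    obtain ⟨h5, h6⟩ := treeWeight_step hK (P.hist.inv j (by omega))
      (P.hist.guar j (by omega)) fun v x t hx h ht htt => P.mem_markTs h1 (by omega) hx h ht htt
    refine ⟨h5.trans h3, ?_⟩
    set W₀ := (X).treeWeight τ (markTs X Z τ)
    rcases P.freshNodes_step h1 (show j < T by omega) with h7 | ⟨⟨w, hw1, hw2, hw3⟩, h7⟩
    · rw [h7]
      exact (Nat.add_le_add_left (Nat.mul_le_mul_left _ h5) _).trans h4
    · obtain ⟨h8, h9⟩ := h6 w hw1 hw2 hw3
      have := Nat.mul_le_mul_left W₀ h8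
      rw [mul_add, mul_one] at this
      omega

omit P in
-- Every depth up to that of `v` occurs on the path from the root to `v`.
theorem _root_.WaitFreeTree.St.Inv.dep_lt {S : St κ σ ρ n} (I : S.Inv A) {v} (h : S.Below 0 v) :
    S.dep v < (S.below 0).card := by
  have : Finset.range (S.dep v + 1) ⊆ (S.below 0).image S.dep := by
    induction h with
    | refl =>
      intro i hi
      rw [I.depRoot, zero_add, Finset.range_one, Finset.mem_singleton] at hi
      exact Finset.mem_image.mpr ⟨0, mem_below.mpr ⟨I.nodePos, .refl⟩, by rw [hi, I.depRoot]⟩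
    | child u w s hb hc ih =>
      have h1 := I.child u (I.below_lt I.nodePos hb) s w hc
      intro i hi
      rw [Finset.mem_range, Nat.lt_succ_iff] at hi
      rcases hi.lt_or_eq with hi | rfl
      · exact ih (Finset.mem_range.mpr (by omega))
      · exact Finset.mem_image.mpr ⟨w, mem_below.mpr ⟨h1.1, .child u w s hb hc⟩, rfl⟩
  have := (Finset.card_le_card this).trans Finset.card_image_le
  rw [Finset.card_range] at this
  omega

/-- New nodes are hung below a node that is itself counted, its birth being less than the new mark.
Their depth exceeds that of this node by at most the number of nodes just created. -/
theorem dep_lt (hK : 1 ≤ 2 * A.K) {j} (h1 : t₀ + 1 ≤ j) (h2 : j ≤ T) {v}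
    (hv : v ∈ (X).below 0 ∪ freshNodes X (S j) τ) :
    (S j).dep v < ((X).below 0).card + (freshNodes X (S j) τ).card := by
  induction j, h1 using Nat.le_induction generalizing v with
  | base =>
    have : v ∈ (X).below 0 := by simpa [freshNodes] using hv
    exact (P.invX.dep_lt (mem_below.mp this).2).trans_le (Nat.le_add_right _ _)
  | succ j h1 ih =>
    have G := P.hist.guar j (by omega)
    have I := P.hist.inv j (by omega)
    have E := P.hist.ext h1 (show j ≤ T by omega)
    have hX := E.nodeCount_le
    have hstep := P.freshNodes_step h1 (show j < T by omega)
    by_cases hvj : v < (S j).nodeCount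
    · have hv' : v ∈ (X).below 0 ∪ freshNodes X (S j) τ := by
        rcases Finset.mem_union.mp hv with h | h
        · exact Finset.mem_union_left _ h
        · refine Finset.mem_union_right _ ?_
          simp only [freshNodes, Finset.mem_filter, Finset.mem_Ico] at h ⊢
          rw [G.born_eq v hvj] at h
          exact ⟨⟨h.1.1, hvj⟩, h.2⟩
      rw [G.dep_eq v hvj]
      refine (ih (by omega) hv').trans_le (Nat.add_le_add_left ?_ _)
      rcases hstep with h | ⟨_, h⟩ <;> omega
    · have hvf : (S (j + 1)).nodeCount > v ∧ (S (j + 1)).born v ≤ τ := by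
        rcases Finset.mem_union.mp hv with h | h
        · exact absurd ((mem_below.mp h).1.trans_le hX) hvj
        · simp only [freshNodes, Finset.mem_filter, Finset.mem_Ico] at h
          exact ⟨h.1.2, h.2⟩
      rw [not_lt] at hvj
      obtain ⟨u, hu, s, hne⟩ := G.slot_of_new (by omega)
      have hs := (G.slot u hu s).resolve_left hne
      obtain ⟨hd, hb⟩ := hs.depth v hvj hvf.1
      have hlt := hs.rts_lt I hK
      obtain ⟨x, hx, hxh, -⟩ := hs.pending I hu
      have hborn := (I.rtsIns u hu s).2
      have hu' : u ∈ (X).below 0 ∪ freshNodes X (S j) τ := by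
        by_cases h : u < (X).nodeCount
        · exact Finset.mem_union_left _ (mem_below.mpr ⟨h, P.below_old h1 (by omega)
            (I.tree u x hx hxh) h⟩)
        · refine Finset.mem_union_right _ ?_
          simp only [freshNodes, Finset.mem_filter, Finset.mem_Ico]
          exact ⟨⟨not_lt.mp h, hu⟩, by omega⟩
      have h3 := ih (by omega) hu'
      rcases hstep with h | ⟨_, h⟩
      · exfalso
        have h4 : freshNodes X (S j) τ ⊂ freshNodes X (S (j + 1)) τ := by
          refine Finset.ssubset_iff_of_subset (fun w hw => ?_) |>.mpr ⟨v, ?_, ?_⟩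
          · simp only [freshNodes, Finset.mem_filter, Finset.mem_Ico] at hw ⊢
            rw [G.born_eq w hw.1.2]
            exact ⟨⟨hw.1.1, hw.1.2.trans_le G.nodeCount_le⟩, hw.2⟩
          · simp only [freshNodes, Finset.mem_filter, Finset.mem_Ico]
            exact ⟨⟨hX.trans hvj, hvf.1⟩, hvf.2⟩
          · simp only [freshNodes, Finset.mem_filter, Finset.mem_Ico]
            exact fun hw => absurd hw.1.2 (not_lt.mpr hvj)
        exact absurd (Finset.card_lt_card h4) (by omega)
      · omega

theorem fresh_le (hK : 1 ≤ 2 * A.K) :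
    ((X).below 0).card + (freshNodes X Z τ).card ≤ sizeBound n ((X).below 0).card := by
  have h1 := (P.freshNodes_card hK P.le le_rfl).2
  have h2 : (X).treeWeight τ (markTs X Z τ) ≤ ((X).below 0).card * (2 * 4 ^ (4 * n + 1)) :=
    treeWeight_le.trans (Nat.mul_le_mul_left _ (Nat.mul_le_mul_left _
      (Nat.pow_le_pow_right (by omega) P.markTs_card)))
  have h3 := Nat.pow_le_pow_left h2 2
  unfold sizeBound
  omega

theorem window_subset : window X Z τ ⊆ (X).below 0 ∪ freshNodes X Z τ := by
  intro v hv
  simp only [window, Finset.mem_filter] at hv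
  rcases hv.2 with h | h
  · exact Finset.mem_union_left _ (mem_below.mpr h)
  · refine Finset.mem_union_right _ ?_
    simp only [freshNodes, Finset.mem_filter, Finset.mem_Ico]
    exact ⟨⟨h.1, h.2.1⟩, h.2.2⟩

theorem mem_window {v} : v ∈ window X Z τ ↔ Window X Z τ v := by
  simp only [window, Finset.mem_filter, Finset.mem_range, and_iff_right_iff_imp]
  rintro (h | h)
  · exact h.1.trans_le (P.hist.ext P.le le_rfl).nodeCount_le
  · exact h.2.1

theorem window_card (hK : 1 ≤ 2 * A.K) :
    (window X Z τ).card ≤ sizeBound n ((X).below 0).card :=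
  (Finset.card_le_card P.window_subset).trans ((Finset.card_union_le _ _).trans (P.fresh_le hK))

theorem window_dep (hK : 1 ≤ 2 * A.K) {v} (hv : Window X Z τ v) :
    (Z).dep v < sizeBound n ((X).below 0).card :=
  (P.dep_lt hK P.le le_rfl (P.window_subset (P.mem_window.mpr hv))).trans_le (P.fresh_le hK)

/-- A cell is determined by its queue and its timestamp. -/
theorem live_card (hK : 1 ≤ 2 * A.K) :
    (live X Z τ).card ≤ sizeBound n ((X).below 0).card * (2 * n) := by
  classical
  have h1 : (live X Z τ).card ≤ ((window X Z τ).image QRef.node ×ˢ relTs X Z τ).card := by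
    refine Finset.card_le_card_of_injOn (fun x => ((Z).own x, (Z).cts x)) ?_ ?_
    · intro x hx
      simp only [live, Finset.coe_filter, Set.mem_ofPred_eq] at hx
      obtain ⟨_, hx⟩ := hx
      obtain ⟨_, _, v, d, h3, _⟩ := id hx
      simp only [Finset.coe_product, Set.mem_prod, Finset.mem_coe, Finset.mem_image]
      exact ⟨⟨v, P.mem_window.mpr (P.window_of_live hx h3), h3.symm⟩, P.cts_mem_relTs hx⟩
    · intro x hx y hy he
      simp only [live, Finset.coe_filter, Set.mem_ofPred_eq] at hx hy
      obtain ⟨_, h2, _, v, d, h3, _⟩ := hx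
      obtain ⟨_, h4, _⟩ := hy
      simp only [Prod.mk.injEq] at he
      exact P.invZ.cell_unique ⟨h2, h3⟩ ⟨h4, he.1.symm.trans h3⟩ he.2
  refine h1.trans ?_
  rw [Finset.card_product]
  exact Nat.mul_le_mul (Finset.card_image_le.trans (P.window_card hK)) P.relTs_card

end Period

end St

end WaitFreeTree

/-! The cells whose treatment has begun. -/

namespace WaitFreeTree

set_option linter.unusedSectionVars false

variable {κ σ ρ : Type*} {n : ℕ} [LinearOrder κ]

namespace St

section

variable (Z : St κ σ ρ n)

/-- A process with this frame is executing the descriptor in the cell, or is about to do so. -/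
def _root_.WaitFreeTree.Frame.Act : Frame κ σ ρ n → ℕ → Prop
  | .untilNext t _ h, x => Z.nxt h = some x ∧ Z.cts x ≤ t
  | .exec d v _ _ _, x => Z.own x = .node v ∧ Z.cts x = d.ts
  | .execState d v _ _ _ _ _ _, x => Z.own x = .node v ∧ Z.cts x = d.ts
  | .pop t v, x => Z.own x = .node v ∧ Z.cts x = t
  | .popNext t v _, x => Z.own x = .node v ∧ Z.cts x = t
  | .popSwing _ _ new, x => x = new
  | _, _ => False

open Classical in
/-- `1` for a process that has read the head of a queue and may find the next cell in `K`. -/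
noncomputable def _root_.WaitFreeTree.Frame.reserve (K : Finset ℕ) : Frame κ σ ρ n → ℕ
  | .untilNext t _ h => if ∃ x ∈ K, Z.nxt h = some x ∧ Z.cts x ≤ t then 1 else 0
  | _ => 0

open Classical in
/-- The cells of `K` that a process with the given stack may still begin to treat. -/
noncomputable def inact (K : Finset ℕ) (S : St κ σ ρ n) (L : List (Frame κ σ ρ n)) : Finset ℕ :=
  K.filter fun x => (x < S.cellCount → S.hd (Z.own x) < x) ∧ ∀ f ∈ L, ¬ f.Act Z x

/-- The cells belong to operations queues. -/
def NodeCells (K : Finset ℕ) : Prop := ∀ x ∈ K, x < Z.cellCount ∧ ∃ v, Z.own x = .node v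

end

variable {S S' Z : St κ σ ρ n} {A : Spec κ σ ρ} {K : Finset ℕ} {L r : List (Frame κ σ ρ n)}

theorem mem_inact {x} : x ∈ inact Z K S L ↔
    x ∈ K ∧ (x < S.cellCount → S.hd (Z.own x) < x) ∧ ∀ f ∈ L, ¬ f.Act Z x := by
  simp [inact]

theorem pending_of_ext (I : S.Inv A) (E : Ext S S') (E' : Ext S' Z) (hK : NodeCells Z K) {x}
    (hx : x ∈ K) (h : x < S'.cellCount → S'.hd (Z.own x) < x) :
    x < S.cellCount → S.hd (Z.own x) < x := by
  intro hc
  obtain ⟨h1, v, h2⟩ := hK x hx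
  have h3 : S.InQ x (.node v) := (E.trans E').inQ_old ⟨h1, h2⟩ hc
  have h4 := h (hc.trans_le E.cellCount_le)
  rw [h2] at h4 ⊢
  exact (E.hd_le v (I.node_lt h3)).trans_lt h4

theorem inact_mono (I : S.Inv A) (E : Ext S S') (E' : Ext S' Z) (hK : NodeCells Z K) :
    inact Z K S' L ⊆ inact Z K S L := by
  intro x hx
  rw [mem_inact] at hx ⊢
  exact ⟨hx.1, pending_of_ext I E E' hK hx.1 hx.2.1, hx.2.2⟩

/-- Once an execution begins, its cell does not return to the set: during the treatment some frame
acts on it, and afterwards it has been popped. When a head is read, its eventual successor is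
reserved, for it may be linked after the reading; the reservation is given back if the frame ends
without executing anything. -/
theorem inact_run (I : S.Inv A) (IZ : Z.Inv A) (E : Ext S S') (E' : Ext S' Z)
    (hK : NodeCells Z K) {p : Fin n} {f : Frame κ σ ρ n} (hp : S.Pre A p f)
    (hs : StackOK (f :: r)) (hN : S.Next f L) (hsf : Safe A p S' (fun S => S.Post p f) L) :
    (inact Z K S' (L ++ r)).card + (L.map (Frame.reserve Z K)).sum ≤
      (inact Z K S (f :: r)).card + if L = [] then f.reserve Z K else 0 := by
  have E0 := E.trans E'
  have sub : (∀ x ∈ K, f.Act Z x → (x < S'.cellCount → S'.hd (Z.own x) < x) →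
      ∃ g ∈ L, g.Act Z x) → inact Z K S' (L ++ r) ⊆ inact Z K S (f :: r) := by
    intro h x hx
    rw [mem_inact] at hx ⊢
    refine ⟨hx.1, pending_of_ext I E E' hK hx.1 hx.2.1, fun g hg => ?_⟩
    rcases List.mem_cons.mp hg with rfl | hg
    · intro hact
      obtain ⟨g', h1, h2⟩ := h x hx.1 hact hx.2.1
      exact hx.2.2 g' (List.mem_append_left _ h1) h2
    · exact hx.2.2 g (List.mem_append_right _ hg)
  have fin : (∀ x ∈ K, f.Act Z x → (x < S'.cellCount → S'.hd (Z.own x) < x) →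
      ∃ g ∈ L, g.Act Z x) → (L.map (Frame.reserve Z K)).sum = 0 →
      (inact Z K S' (L ++ r)).card + (L.map (Frame.reserve Z K)).sum ≤
      (inact Z K S (f :: r)).card + if L = [] then f.reserve Z K else 0 := by
    intro h h0
    have := Finset.card_le_card (sub h)
    omega
  have own_eq : ∀ {x v}, S.InQ x (.node v) → Z.own x = .node v := fun h => (E0.inQ h).2
  cases f with
  | fetch => obtain ⟨_, rfl⟩ := hN; exact fin (fun _ _ h => h.elim) (by simp [Frame.reserve])
  | stamp => cases hN; exact fin (fun _ _ h => h.elim) (by simp [Frame.reserve])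
  | stamped =>
    rcases hN with ⟨-, rfl⟩ | ⟨_, -, rfl⟩ <;> exact fin (fun _ _ h => h.elim) (by simp [Frame.reserve])
  | main => cases hN; exact fin (fun _ _ h => h.elim) (by simp [Frame.reserve])
  | mainNext =>
    rcases hN with ⟨-, rfl⟩ | ⟨_, -, ⟨_, rfl⟩ | rfl⟩ <;>
      exact fin (fun _ _ h => h.elim) (by simp [Frame.reserve])
  | scan o t todo saved =>
    cases todo with
    | nil => obtain ⟨l, -, -, rfl⟩ := hN; exact fin (fun _ _ h => h.elim) (by simp [Frame.reserve])
    | cons i todo =>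
      rcases hN with rfl | ⟨o', rfl⟩ <;> exact fin (fun _ _ h => h.elim) (by simp [Frame.reserve])
  | scanTs =>
    rcases hN with ⟨-, rfl⟩ | ⟨-, _, rfl, -⟩ <;>
      exact fin (fun _ _ h => h.elim) (by simp [Frame.reserve])
  | scanFetch => obtain ⟨_, rfl⟩ := hN; exact fin (fun _ _ h => h.elim) (by simp [Frame.reserve])
  | scanStamp => cases hN; exact fin (fun _ _ h => h.elim) (by simp [Frame.reserve])
  | enqueue l =>
    cases l <;> cases hN <;> exact fin (fun _ _ h => h.elim) (by simp [Frame.reserve])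
  | push =>
    rcases hN with ⟨-, -, rfl⟩ | ⟨-, rfl⟩ <;> exact fin (fun _ _ h => h.elim) (by simp [Frame.reserve])
  | pushNext =>
    rcases hN with ⟨z, -, rfl⟩ | ⟨-, rfl⟩ <;> exact fin (fun _ _ h => h.elim) (by simp [Frame.reserve])
  | pushLink q x t g y =>
    rcases hN with ⟨-, rfl⟩ | ⟨-, rfl⟩
    · exact fin (fun _ _ h => h.elim) (by simp [Frame.reserve])
    · cases g <;> exact fin (fun _ _ h => h.elim) (by simp [Frame.reserve])
  | pushSwing => cases hN; exact fin (fun _ _ h => h.elim) (by simp)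
  | pop => cases hN; exact fin (fun x _ h _ => ⟨_, List.mem_cons_self, h⟩) (by simp [Frame.reserve])
  | popNext t v h =>
    obtain ⟨⟨d, hd, ⟨⟨z', hz1, -, hz2⟩, -⟩, -⟩, hq, -⟩ := hp
    rcases hN with hN | ⟨z, hz, hN⟩
    all_goals try rcases hN with ⟨ht, rfl⟩ | hN
    rotate_left
    · refine fin (fun x hx h _ => ⟨_, List.mem_cons_self, ?_⟩) (by simp [Frame.reserve])
      have h1 := I.queues.next _ hq.1 z hz
      rw [hq.2] at h1
      refine IZ.cell_unique ⟨(hK x hx).1, h.1⟩ (E0.inQ h1.1) ?_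
      rw [h.2, E0.cts_eq z h1.1.1, ht]
    all_goals
      obtain ⟨-, rfl⟩ := hN
      refine fin (fun x hx h hpend => ?_) (by simp)
      exfalso
      have h1 : x = z' := by
        refine IZ.cell_unique ⟨(hK x hx).1, h.1⟩ (E0.inQ hz1) ?_
        rw [h.2, E0.cts_eq _ hz1.1, hz2, hd]
      subst h1
      have h2 := E.inQ hz1
      -- The frame ends with the descriptor popped, so its cell is not pending any more.
      have h3 : S'.Passed v t := hsf
      have h4 := h3 x h2 (by rw [E.cts_eq _ hz1.1, hz2, hd])
      have h5 := hpend h2.1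
      rw [h.1] at h5
      exact absurd h5 (not_lt.mpr h4)
  | popSwing v h new =>
    cases hN
    refine fin (fun x hx hact hpend => ?_) (by simp)
    exfalso
    cases hact
    obtain ⟨-, hq, -, hn⟩ := hp
    have h1 := I.queues.next _ hq.1 _ hn
    rw [hq.2] at h1
    have h2 : new ≤ S'.hd (.node v) := hsf
    have h3 := hpend (E.inQ h1.1).1
    rw [own_eq h1.1] at h3
    exact absurd h3 (not_lt.mpr h2)
  | untilTs t v =>
    cases hN
    have hv : v < S.nodeCount := hp
    have hh := (I.queues.ends (.node v) hv).1
    simp only [List.cons_ne_nil, if_false, List.map_cons, List.map_nil, List.sum_cons, List.sum_nil,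
      add_zero, Frame.reserve]
    have hsub : inact Z K S' ([.untilNext t v (S.hd (.node v))] ++ r) ⊆
        inact Z K S (.untilTs t v :: r) := by
      refine sub fun _ _ h => h.elim
    split_ifs with hex
    · obtain ⟨x, hx, hn, ht⟩ := hex
      refine Finset.card_lt_card ((Finset.ssubset_iff_of_subset hsub).mpr ⟨x, ?_, ?_⟩)
      · have h1 := IZ.queues.next _ (E0.inQ hh).1 x hn
        rw [own_eq hh] at h1
        rw [mem_inact]
        refine ⟨hx, fun _ => by rw [h1.1.2]; exact h1.2.1, fun g hg => ?_⟩
        rcases List.mem_cons.mp hg with rfl | hg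
        · exact id
        -- Executions further down in the stack have timestamps above `t`, so none of them concerns
        -- the reserved cell.
        have h2 := (List.pairwise_cons.mp hs.2).1 g hg
        intro hact
        cases g with
        | exec d =>
          have h3 : t < d.ts := h2
          have h4 := hact.2
          omega
        | pop t' =>
          have h3 : t < t' := h2
          have h4 := hact.2
          omega
        | execState => exact h2
        | untilNext => exact h2
        | popNext => exact h2
        | popSwing => exact h2
        | _ => exact hact
      · rw [mem_inact]
        exact fun h => h.2.2 _ List.mem_cons_self ⟨hn, ht⟩
    · exact Finset.card_le_card hsub
  | untilNext t v h =>
    rcases hN with rfl | ⟨x, d, hx, hd, hdt, rfl⟩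
    · simp only [List.map_nil, List.sum_nil, add_zero, if_true, List.nil_append, Frame.reserve]
      split_ifs with hex
      · obtain ⟨x, hxK, hn, ht⟩ := hex
        -- The reserved cell may become available again; the summand for an empty `L` accounts for
        -- it.
        have : inact Z K S' r ⊆ insert x (inact Z K S (.untilNext t v h :: r)) := by
          intro y hy
          rw [Finset.mem_insert]
          rw [mem_inact] at hy
          rcases eq_or_ne y x with h1 | h1
          · exact .inl h1
          right
          rw [mem_inact]
          refine ⟨hy.1, pending_of_ext I E E' hK hy.1 hy.2.1, fun g hg => ?_⟩
          rcases List.mem_cons.mp hg with rfl | hg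
          · rintro ⟨h2, -⟩
            rw [hn] at h2
            exact h1 (Option.some.inj h2).symm
          · exact hy.2.2 g hg
        exact (Finset.card_le_card this).trans (Finset.card_insert_le _ _)
      · refine Finset.card_le_card (sub fun x hx hact _ => absurd ?_ hex)
        exact ⟨x, hx, hact⟩
    · have h1 := I.queues.next _ hp.1.1 x hx
      rw [hp.1.2] at h1
      refine fin (fun y hy hact _ => ⟨_, List.mem_cons_self, ?_⟩) (by simp [Frame.reserve])
      have h2 := E0.nxt_eq h hp.1.1 x hx
      have h3 := hact.1
      rw [h2] at h3
      cases h3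
      exact ⟨own_eq h1.1, by rw [E0.cts_eq x h1.1.1, (I.desc_cell h1.1 hd).1]⟩
  | exec d v todo views b =>
    cases todo with
    | nil =>
      obtain ⟨i, rfl⟩ := hN
      exact fin (fun x _ h _ => ⟨.pop d.ts v, by simp, h⟩) (by simp [Frame.reserve])
    | cons e todo =>
      rcases hN with ⟨c, -, rfl⟩ | ⟨L₀, views', h0, rfl⟩
      · exact fin (fun x _ h _ => ⟨_, List.mem_cons_self, h⟩) (by simp [Frame.reserve])
      · refine fin (fun x _ h _ => ⟨.exec d v todo views' false, by simp, h⟩) ?_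
        rcases h0 with rfl | ⟨old, keys, rfl⟩ <;> simp [Frame.reserve]
  | execState d v s q todo views b c =>
    rcases hN with ⟨views', rfl⟩ | ⟨-, -, rfl⟩ | ⟨_, _, _, _, views', rfl⟩
    · exact fin (fun x _ h _ => ⟨_, List.mem_cons_self, h⟩) (by simp [Frame.reserve])
    · exact fin (fun x _ h _ => ⟨.exec d v ((s, q) :: todo) views true, by simp, h⟩)
        (by simp [Frame.reserve])
    · exact fin (fun x _ h _ => ⟨.exec d v todo views' false, by simp, h⟩) (by simp [Frame.reserve])
  | modify => cases hN; exact fin (fun _ _ h => h.elim) (by simp)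
  | replace => cases hN; exact fin (fun _ _ h => h.elim) (by simp)
  | drain t todo =>
    cases todo <;> cases hN <;> exact fin (fun _ _ h => h.elim) (by simp [Frame.reserve])
  | drainLeft => cases hN; exact fin (fun _ _ h => h.elim) (by simp [Frame.reserve])
  | drainRight => cases hN; exact fin (fun _ _ h => h.elim) (by simp [Frame.reserve])
  | gather t v s c todo keys =>
    match todo, hN with
    | [], hN => cases hN; exact fin (fun _ _ h => h.elim) (by simp [Frame.reserve])
    | .inner u :: todo, hN => cases hN; exact fin (fun _ _ h => h.elim) (by simp [Frame.reserve])
    | .empty t' :: todo, hN =>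
      obtain ⟨_, rfl⟩ := hN; exact fin (fun _ _ h => h.elim) (by simp [Frame.reserve])
    | .leaf k t' :: todo, hN =>
      obtain ⟨_, rfl⟩ := hN; exact fin (fun _ _ h => h.elim) (by simp [Frame.reserve])
  | gatherLeft => cases hN; exact fin (fun _ _ h => h.elim) (by simp [Frame.reserve])
  | gatherRight => cases hN; exact fin (fun _ _ h => h.elim) (by simp [Frame.reserve])
  | mainPop => cases hN; exact fin (fun _ _ h => h.elim) (by simp)
  | result => cases hN; exact fin (fun _ _ h => h.elim) (by simp [Frame.reserve])
  | resultNext =>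
    rcases hN with ⟨-, rfl⟩ | ⟨_, _, -, rfl⟩ <;>
      exact fin (fun _ _ h => h.elim) (by simp [Frame.reserve])

end St

end WaitFreeTree

/-! Contention on the record of an operation. -/

namespace WaitFreeTree

set_option linter.unusedSectionVars false

variable {κ σ ρ : Type*} {n : ℕ} [LinearOrder κ]

/-- The queue belongs to the record of the operation. -/
def QRef.OfOp (o : ℕ) (q : QRef) : Prop := q = .traverse o ∨ q = .processed o

theorem sum_le_of_pairwise {α : Type*} {c : α → ℕ} {M : ℕ} {L : List α} (h : ∀ f ∈ L, c f ≤ M)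
    (h' : L.Pairwise fun f g => c f = 0 ∨ c g = 0) : (L.map c).sum ≤ M := by
  induction L with
  | nil => exact Nat.zero_le _
  | cons f L ih =>
    obtain ⟨h1, h2⟩ := List.pairwise_cons.mp h'
    rw [List.map_cons, List.sum_cons]
    by_cases h0 : c f = 0
    · rw [h0, zero_add]
      exact ih (fun g hg => h g (List.mem_cons_of_mem _ hg)) h2
    · rw [List.sum_eq_zero]
      · exact h f List.mem_cons_self
      · intro x hx
        obtain ⟨g, hg, rfl⟩ := List.mem_map.mp hx
        exact (h1 g hg).resolve_left h0

namespace St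

section

variable (Z : St κ σ ρ n) (o : ℕ)

open Classical in
/-- The cells with descriptors of the operation. -/
noncomputable def opCells : Finset ℕ :=
  (Finset.range Z.cellCount).filter fun x =>
    ∃ v d, Z.own x = .node v ∧ Z.item x = .desc d ∧ Z.ots o = some (Z.cts x)

open Classical in
/-- The number of insertions into the queues of the operation in the execution of its descriptor
that has been begun. -/
noncomputable def execCap : Frame κ σ ρ n → ℕ
  | .untilNext t v h => 3 * (Frame.untilNext t v h : Frame κ σ ρ n).reserve Z (opCells Z o)
  | .exec d _ todo _ _ => if Z.ots o = some d.ts then todo.length + 1 else 0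
  | .execState d _ _ _ todo _ _ _ => if Z.ots o = some d.ts then todo.length + 2 else 0
  | _ => 0

open Classical in
/-- `1` for an insertion into one of the queues of the operation. -/
noncomputable def pushCap : Frame κ σ ρ n → ℕ
  | .push q _ _ g => if g = false ∧ q.OfOp o then 1 else 0
  | .pushNext q _ _ g _ => if g = false ∧ q.OfOp o then 1 else 0
  | .pushLink q _ _ g _ => if g = false ∧ q.OfOp o then 1 else 0
  | _ => 0

/-- A bound for the number of cells that a process with the given stack can add to the queues of the
operation. -/
noncomputable def pushPotential (S : St κ σ ρ n) (L : List (Frame κ σ ρ n)) : ℕ :=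
  3 * (inact Z (opCells Z o) S L).card + (L.map fun f => execCap Z o f + pushCap o f).sum

open Classical in
/-- The cells of the first `k` ones that belong to the record of the operation. -/
noncomputable def recordCells (k : ℕ) : Finset ℕ := (Finset.range k).filter fun x => (Z.own x).OfOp o

end

variable {S S' Z : St κ σ ρ n} {A : Spec κ σ ρ} {o : ℕ} {L r : List (Frame κ σ ρ n)}

theorem nodeCells_opCells : NodeCells Z (opCells Z o) := by
  intro x hx
  simp only [opCells, Finset.mem_filter, Finset.mem_range] at hx
  obtain ⟨h1, v, _, h2, _⟩ := hx
  exact ⟨h1, v, h2⟩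

/-- By the order of timestamps only one frame of the stack can stand for an execution of the
operation, with at most three insertions ahead: two children and the part of the answer. The fourth
is an insertion in progress, of which there is also only one. -/
theorem stack_cap (h : StackOK L) :
    (L.map fun f => execCap Z o f + pushCap o f).sum ≤ 4 := by
  rw [List.sum_map_add]
  refine Nat.add_le_add (b := 3) (d := 1) (sum_le_of_pairwise (fun f hf => ?_) (h.2.imp ?_))
    (sum_le_of_pairwise (fun f hf => ?_) (h.2.imp ?_))
  · have hs := h.1 f hf
    cases f with
    | untilNext => simp only [execCap, Frame.reserve]; split_ifs <;> omega
    | exec d v todo =>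
      have : todo.length ≤ 2 := hs
      simp only [execCap]; split_ifs <;> omega
    | execState d v s q todo =>
      have : todo.length ≤ 1 := hs
      simp only [execCap]; split_ifs <;> omega
    | _ => exact Nat.zero_le _
  · intro f g hfg
    cases g with
    | untilNext => exact hfg.elim
    | execState => exact hfg.elim
    | exec d v todo =>
      have hl : f.Lim d.ts := hfg
      by_cases hd : Z.ots o = some d.ts
      swap
      · right; simp [execCap, hd]
      left
      cases f with
      | untilNext t v h =>
        have hl : t < d.ts := hl
        simp only [execCap, Frame.reserve, Nat.mul_eq_zero, OfNat.ofNat_ne_zero, false_or]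
        rw [if_neg]
        rintro ⟨x, hx, -, h2⟩
        simp only [opCells, Finset.mem_filter] at hx
        obtain ⟨-, _, _, -, -, h1⟩ := hx
        rw [hd] at h1
        have := Option.some.inj h1
        omega
      | exec d' =>
        have hl : d'.ts < d.ts := hl
        simp only [execCap]
        rw [if_neg]
        rw [hd, Option.some.injEq]
        omega
      | execState d' =>
        have hl : d'.ts < d.ts := hl
        simp only [execCap]
        rw [if_neg]
        rw [hd, Option.some.injEq]
        omega
      | _ => rfl
    | _ => exact .inr rfl
  · cases f with
    | push => simp only [pushCap]; split_ifs <;> omega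
    | pushNext => simp only [pushCap]; split_ifs <;> omega
    | pushLink => simp only [pushCap]; split_ifs <;> omega
    | _ => exact Nat.zero_le _
  · intro f g hfg
    cases g with
    | push q x t b =>
      cases b with
      | true => right; simp [pushCap]
      | false =>
        obtain ⟨_, _, _, rfl⟩ := hfg
        exact .inl rfl
    | pushNext => exact hfg.elim
    | pushLink => exact hfg.elim
    | _ => exact .inr rfl

open Classical in
-- A cell of the operation that leaves `inact` releases three insertions, and each successful
-- linking uses up one.
theorem pushPotential_run (I : S.Inv A) (IZ : Z.Inv A) (E : Ext S S') (E' : Ext S' Z)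
    {p : Fin n} {f : Frame κ σ ρ n} (hp : S.Pre A p f) (hs : StackOK (f :: r)) (hN : S.Next f L)
    (hsf : Safe A p S' (fun S => S.Post p f) L) :
    pushPotential Z o S' (L ++ r) +
        (if ∃ q x t b y, f = .pushLink q x t b y ∧ q.OfOp o ∧ S.nxt y = none then 1 else 0) ≤
      pushPotential Z o S (f :: r) := by
  have h1 := inact_run I IZ E E' (nodeCells_opCells (o := o)) hp hs hN hsf
  have E0 := E.trans E'
  suffices key : (L.map fun f => execCap Z o f + pushCap o f).sum +
      (if ∃ q x t b y, f = .pushLink q x t b y ∧ q.OfOp o ∧ S.nxt y = none then 1 else 0) +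
      3 * (if L = [] then f.reserve Z (opCells Z o) else 0) ≤
      3 * (L.map (Frame.reserve Z (opCells Z o))).sum + (execCap Z o f + pushCap o f) by
    simp only [pushPotential, List.map_append, List.sum_append, List.map_cons, List.sum_cons] at *
    omega
  clear h1 hsf
  cases f with
  | fetch => obtain ⟨_, rfl⟩ := hN; simp [execCap, pushCap, Frame.reserve]
  | stamp => cases hN; simp [execCap, pushCap, Frame.reserve]
  | stamped => rcases hN with ⟨-, rfl⟩ | ⟨_, -, rfl⟩ <;> simp [execCap, pushCap, Frame.reserve]
  | main => cases hN; simp [execCap, pushCap, Frame.reserve]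
  | mainNext =>
    rcases hN with ⟨-, rfl⟩ | ⟨_, -, ⟨_, rfl⟩ | rfl⟩ <;> simp [execCap, pushCap, Frame.reserve]
  | scan o t todo saved =>
    cases todo with
    | nil => obtain ⟨l, -, -, rfl⟩ := hN; simp [execCap, pushCap, Frame.reserve]
    | cons i todo => rcases hN with rfl | ⟨o', rfl⟩ <;> simp [execCap, pushCap, Frame.reserve]
  | scanTs => rcases hN with ⟨-, rfl⟩ | ⟨-, _, rfl, -⟩ <;> simp [execCap, pushCap, Frame.reserve]
  | scanFetch => obtain ⟨_, rfl⟩ := hN; simp [execCap, pushCap, Frame.reserve]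
  | scanStamp => cases hN; simp [execCap, pushCap, Frame.reserve]
  | enqueue l => cases l <;> cases hN <;> simp [execCap, pushCap, Frame.reserve]
  | push => rcases hN with ⟨-, -, rfl⟩ | ⟨-, rfl⟩ <;> simp [execCap, pushCap, Frame.reserve]
  | pushNext =>
    rcases hN with ⟨z, -, rfl⟩ | ⟨-, rfl⟩ <;> simp [execCap, pushCap, Frame.reserve]
  | pushLink q x t g y =>
    rcases hN with ⟨hn, rfl⟩ | ⟨hn, rfl⟩
    · have hg : q.OfOp o → g = false := by
        rintro (rfl | rfl)
        · exact hp.1.1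
        · exact hp.1.1
      by_cases hq : q.OfOp o
      · simp [execCap, pushCap, Frame.reserve, hq, hg hq, hn]
      · simp [execCap, pushCap, Frame.reserve, hq]
    · cases g <;> simp [execCap, pushCap, Frame.reserve, hn]
  | pushSwing => cases hN; simp [Frame.reserve]
  | pop => cases hN; simp [execCap, pushCap, Frame.reserve]
  | popNext =>
    rcases hN with ⟨-, rfl⟩ | ⟨z, -, ⟨-, rfl⟩ | ⟨-, rfl⟩⟩ <;> simp [execCap, pushCap, Frame.reserve]
  | popSwing => cases hN; simp [Frame.reserve]
  | untilTs => cases hN; simp [execCap, pushCap]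
  | untilNext t v h =>
    rcases hN with rfl | ⟨x, d, hx, hd, hdt, rfl⟩
    · simp [execCap]
    · have h1 := I.queues.next _ hp.1.1 x hx
      rw [hp.1.2] at h1
      have h2 := route_length d.query (S.sep v)
      by_cases ho : Z.ots o = some d.ts
      · have h3 := I.desc_cell h1.1 hd
        have h4 : Z.cts x = d.ts := by rw [E0.cts_eq x h1.1.1, h3.1]
        have h5 : (Frame.untilNext t v h : Frame κ σ ρ n).reserve Z (opCells Z o) = 1 := by
          simp only [Frame.reserve]
          rw [if_pos]
          refine ⟨x, ?_, E0.nxt_eq h hp.1.1 x hx, by omega⟩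
          simp only [opCells, Finset.mem_filter, Finset.mem_range]
          exact ⟨(E0.inQ h1.1).1, v, d, (E0.inQ h1.1).2, by rw [E0.item_eq x h1.1.1, hd],
            by rw [h4, ho]⟩
        have h6 : ([.exec d v (route d.query (S.sep v)) [] false, .untilTs t v].map
            fun f : Frame κ σ ρ n => execCap Z o f + pushCap o f).sum ≤ 3 := by
          simp [execCap, pushCap, ho]
          omega
        have h7 : execCap Z o (.untilNext t v h : Frame κ σ ρ n) = 3 := by simp only [execCap, h5]
        rw [if_neg (by simp), if_neg (by simp), h7]
        omega
      · simp [execCap, pushCap, ho]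
  | exec d v todo views b =>
    have hd := I.reached_desc hp.1
    have hdo : d.op = o → Z.ots o = some d.ts := by
      rintro rfl
      exact E0.ots_eq _ hd.1 _ hd.2.1
    cases todo with
    | nil =>
      obtain ⟨i, rfl⟩ := hN
      by_cases ho : Z.ots o = some d.ts
      · simp [execCap, pushCap, Frame.reserve, ho]
        split_ifs <;> omega
      · have : d.op ≠ o := fun h => ho (hdo h)
        simp [execCap, pushCap, Frame.reserve, ho, QRef.OfOp, this]
    | cons e todo =>
      rcases hN with ⟨c, -, rfl⟩ | ⟨L₀, views', h0, rfl⟩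
      · simp [execCap, pushCap, Frame.reserve]
      · by_cases ho : Z.ots o = some d.ts <;>
          rcases h0 with rfl | ⟨old, keys, rfl⟩ <;> simp [execCap, pushCap, Frame.reserve, ho]
  | execState d v s q todo views b c =>
    have hd := I.reached_desc hp.1.1
    have hdo : d.op = o → Z.ots o = some d.ts := by
      rintro rfl
      exact E0.ots_eq _ hd.1 _ hd.2.1
    rcases hN with ⟨views', rfl⟩ | ⟨-, -, rfl⟩ | ⟨_, _, _, _, views', rfl⟩ <;>
      by_cases ho : Z.ots o = some d.ts
    · simp [execCap, pushCap, Frame.reserve, ho]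
    · simp [execCap, pushCap, Frame.reserve, ho]
    · simp [execCap, pushCap, Frame.reserve, ho]
    · simp [execCap, pushCap, Frame.reserve, ho]
    · simp [execCap, pushCap, Frame.reserve, ho]
      split_ifs <;> omega
    · have : d.op ≠ o := fun h => ho (hdo h)
      simp [execCap, pushCap, Frame.reserve, ho, QRef.OfOp, this]
  | modify => cases hN; simp [Frame.reserve]
  | replace => cases hN; simp [Frame.reserve]
  | drain t todo => cases todo <;> cases hN <;> simp [execCap, pushCap, Frame.reserve]
  | drainLeft => cases hN; simp [execCap, pushCap, Frame.reserve]
  | drainRight => cases hN; simp [execCap, pushCap, Frame.reserve]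
  | gather t v s c todo keys =>
    match todo, hN with
    | [], hN => cases hN; simp [execCap, pushCap, Frame.reserve]
    | .inner u :: todo, hN => cases hN; simp [execCap, pushCap, Frame.reserve]
    | .empty t' :: todo, hN => obtain ⟨_, rfl⟩ := hN; simp [execCap, pushCap, Frame.reserve]
    | .leaf k t' :: todo, hN => obtain ⟨_, rfl⟩ := hN; simp [execCap, pushCap, Frame.reserve]
  | gatherLeft => cases hN; simp [execCap, pushCap, Frame.reserve]
  | gatherRight => cases hN; simp [execCap, pushCap, Frame.reserve]
  | mainPop => cases hN; simp [Frame.reserve]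
  | result => cases hN; simp [execCap, pushCap, Frame.reserve]
  | resultNext => rcases hN with ⟨-, rfl⟩ | ⟨_, _, -, rfl⟩ <;> simp [execCap, pushCap, Frame.reserve]

namespace History

variable {T : ℕ} {stack : ℕ → Fin n → List (Frame κ σ ρ n)} {sched : ℕ → Fin n}
  {S : ℕ → St κ σ ρ n} (H : History A T stack sched S)
include H

theorem pre {j : ℕ} (hj : j ≤ T) {q f r} (h : stack j q = f :: r) : (S j).Pre A q f := by
  have := H.safe j hj q
  rw [h] at this
  obtain ⟨_, _, _, h1, _⟩ := this
  exact h1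

theorem pushPotential_env {j : ℕ} (hj : j < T) {q} (hq : q ≠ sched j) :
    pushPotential (S T) o (S (j + 1)) (stack (j + 1) q) ≤
      pushPotential (S T) o (S j) (stack j q) := by
  rw [(H.other j hj q hq).1]
  refine Nat.add_le_add_right (Nat.mul_le_mul_left _ (Finset.card_le_card ?_)) _
  exact inact_mono (H.inv j hj.le) (H.guar j hj).ext (H.ext hj le_rfl) nodeCells_opCells

/-- A new cell in the record is paid for by the potential of the process that links it, except for
the three cells with which the record is created. -/
theorem contention_step {j : ℕ} (hj : j < T) :
    pushPotential (S T) o (S (j + 1)) (stack (j + 1) (sched j)) +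
        (recordCells (S T) o (S (j + 1)).cellCount).card ≤
      pushPotential (S T) o (S j) (stack j (sched j)) +
        (recordCells (S T) o (S j).cellCount).card +
        if o = (S j).opCount ∧ o < (S (j + 1)).opCount then 3 else 0 := by
  classical
  have G := H.guar j hj
  have E' := H.ext (show j + 1 ≤ T from hj) le_rfl
  have old : ∀ {D : Finset ℕ}, (∀ x, (S j).cellCount ≤ x → x < (S (j + 1)).cellCount →
      ((S (j + 1)).own x).OfOp o → x ∈ D) →
      (recordCells (S T) o (S (j + 1)).cellCount).card ≤
        (recordCells (S T) o (S j).cellCount).card + D.card := by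
    intro D hD
    refine (Finset.card_le_card fun x hx => ?_).trans (Finset.card_union_le _ D)
    simp only [recordCells, Finset.mem_filter, Finset.mem_range, Finset.mem_union] at hx ⊢
    rcases lt_or_ge x (S j).cellCount with h | h
    · exact .inl ⟨h, hx.2⟩
    · refine .inr (hD x h hx.1 ?_)
      rw [← E'.own_eq x hx.1]
      exact hx.2
  rcases H.turn j hj with ⟨Q, h1, h2, h3⟩ | ⟨f, r, L, h1, h2, hN, -, hnew, -, hsf⟩
  · have h4 : pushPotential (S T) o (S (j + 1)) (stack (j + 1) (sched j)) ≤
        pushPotential (S T) o (S j) (stack j (sched j)) := by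
      have h5 := Finset.card_le_card (inact_mono (L := []) (H.inv j hj.le) G.ext E'
        (nodeCells_opCells (o := o)))
      have h6 : inact (S T) (opCells (S T) o) (S (j + 1)) [.fetch (S j).opCount] =
          inact (S T) (opCells (S T) o) (S (j + 1)) [] := by
        ext x
        simp [mem_inact, Frame.Act]
      rw [h1, h2]
      simp only [pushPotential, h6, execCap, pushCap, List.map_cons, List.map_nil, List.sum_cons,
        List.sum_nil]
      omega
    have h5 : ∀ x, (S j).cellCount ≤ x → x < (S (j + 1)).cellCount →
        ((S (j + 1)).own x).OfOp o → (o = (S j).opCount ∧ o < (S (j + 1)).opCount) ∧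
        x ∈ Finset.Ico (S j).cellCount ((S j).cellCount + 3) := by
      intro x hx hx' hq
      have h6 : (S (j + 1)).InQ x ((S (j + 1)).own x) := ⟨hx', rfl⟩
      rw [h3, announceSt_inQ, ← h3] at h6
      rw [Finset.mem_Ico]
      rcases h6 with h6 | ⟨h6, h7⟩ | ⟨h6, h7⟩
      · exact absurd h6.1 (not_lt.mpr hx)
      all_goals
        rw [h7] at hq
        rcases hq with hq | hq <;> cases hq
        exact ⟨⟨rfl, h3 ▸ Nat.lt_succ_self _⟩, hx, by omega⟩
    split_ifs with ho
    · have := old (D := Finset.Ico (S j).cellCount ((S j).cellCount + 3))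
        fun x hx hx' hq => (h5 x hx hx' hq).2
      rw [Nat.card_Ico] at this
      omega
    · have := old (D := ∅) fun x hx hx' hq => absurd (h5 x hx hx' hq).1 ho
      rw [Finset.card_empty] at this
      omega
  · have hst := H.stackOK j hj.le (sched j)
    rw [h1] at hst
    have h4 := pushPotential_run (o := o) (H.inv j hj.le) (H.inv T le_rfl) G.ext E'
      (H.pre hj.le h1) hst hN hsf
    rw [← h1, ← h2] at h4
    have h5 := old (D := if ∃ q x t b y, f = .pushLink q x t b y ∧ q.OfOp o ∧ (S j).nxt y = none
        then {(S j).cellCount} else ∅) fun x hx hx' hq => by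
      rcases hnew x _ hx ⟨hx', rfl⟩ with ⟨v, hv⟩ | ⟨rfl, i, t, b, y, h6, h7⟩
      · rw [hv] at hq
        rcases hq with hq | hq <;> cases hq
      · rw [if_pos ⟨_, i, t, b, y, h6, hq, h7⟩]
        exact Finset.mem_singleton_self _
    split_ifs at h4 h5 <;> simp at h5 <;> omega

/-- A bound for the number of cells that are added to the queues of an operation. -/
theorem contention {i j : ℕ} (hij : i ≤ j) (hj : j ≤ T) :
    (∑ q, pushPotential (S T) o (S j) (stack j q)) +
        (recordCells (S T) o (S j).cellCount).card ≤
      (∑ q, pushPotential (S T) o (S i) (stack i q)) +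
        (recordCells (S T) o (S i).cellCount).card +
        if (S i).opCount ≤ o ∧ o < (S j).opCount then 3 else 0 := by
  classical
  induction j, hij using Nat.le_induction with
  | base => exact Nat.le_add_right _ _
  | succ j hij ih =>
    have ih := ih (by omega)
    have h1 := H.contention_step (o := o) (show j < T by omega)
    have h2 : ∑ q ∈ Finset.univ.erase (sched j), pushPotential (S T) o (S (j + 1)) (stack (j + 1) q) ≤
        ∑ q ∈ Finset.univ.erase (sched j), pushPotential (S T) o (S j) (stack j q) :=
      Finset.sum_le_sum fun q hq => H.pushPotential_env (by omega) (Finset.ne_of_mem_erase hq)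
    rw [← Finset.add_sum_erase _ _ (Finset.mem_univ (sched j))] at ih ⊢
    have h3 := (H.guar j (by omega)).opCount_le
    have h4 := (H.ext hij (by omega)).opCount_le
    split_ifs at h1 ih ⊢ <;> omega

end History

end St

end WaitFreeTree

/-! The number of retries of an insertion. -/

namespace WaitFreeTree

set_option linter.unusedSectionVars false

variable {κ σ ρ : Type*} {n : ℕ} [LinearOrder κ]

namespace St

def liveBound (n N : ℕ) : ℕ := sizeBound n N * (2 * n)

/-- For each of the `n` processes, three insertions for every live cell and four for what is on its
stack already. -/
def recordBound (n N : ℕ) : ℕ := n * (3 * liveBound n N + 4)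

/-- Two for the tail cell and its successor, three for a record created in the period; then `2 * n`
timestamps in an operations queue, or the later growth of a record. -/
def tailBound (n N : ℕ) : ℕ := 5 + (2 * n + recordBound n N)

open Classical in
/-- The cells of the queue from `y` on, and with timestamps below `t` if the flag is set. -/
noncomputable def queueCells (Z : St κ σ ρ n) (q : QRef) (t : ℕ) (g : Bool) (y : ℕ) : Finset ℕ :=
  (Finset.range Z.cellCount).filter fun x => Z.own x = q ∧ y ≤ x ∧ (g = true → Z.cts x < t)

/-- The queue is one for which the number of insertions in the period is bounded. -/
def Bounded (X Z : St κ σ ρ n) (τ : ℕ) (t : ℕ) (g : Bool) : QRef → Prop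
  | .node _ => t ≤ τ ∧ g = true
  | .traverse o => Relevant X Z τ o
  | .processed o => Relevant X Z τ o

/-- By `lag` the successor of the tail cell is the last cell. -/
theorem Inv.after_tail {S : St κ σ ρ n} {A : Spec κ σ ρ} (I : S.Inv A) {q x} (hx : S.InQ x q)
    (h : S.tl q ≤ x) : x = S.tl q ∨ S.nxt (S.tl q) = some x := by
  have hq : S.VQ q := hx.2 ▸ I.queues.vq x hx.1
  have ht := (I.queues.ends q hq).2
  rcases h.eq_or_lt with h | h
  · exact .inl h.symm
  right
  obtain ⟨y, hy⟩ := Option.ne_none_iff_exists'.mp (I.queues.last q _ x ht hx h)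
  have h1 := I.queues.next _ ht.1 y hy
  rw [ht.2] at h1
  rcases (h1.2.2 x hx h).eq_or_lt with h2 | h2
  · rw [hy, h2]
  · exact absurd (I.queues.lag q y hq hy) (I.queues.last q y x h1.1 hx h2)

variable {A : Spec κ σ ρ} {T : ℕ} {stack : ℕ → Fin n → List (Frame κ σ ρ n)} {sched : ℕ → Fin n}
  {S : ℕ → St κ σ ρ n}

namespace Period

variable {t₀ : ℕ} (P : Period A T stack sched S t₀)
include P

local notation "τ" => deadline S T t₀
local notation "X" => S (t₀ + 1)
local notation "Z" => S T

theorem pushPotential_start (hK : 1 ≤ 2 * A.K) {o} (ho : Relevant X Z τ o) (q : Fin n) :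
    pushPotential Z o X (stack (t₀ + 1) q) ≤ 3 * liveBound n ((X).below 0).card + 4 := by
  refine Nat.add_le_add (Nat.mul_le_mul_left _ ((Finset.card_le_card fun x hx => ?_).trans
    (P.live_card hK))) (stack_cap (P.hist.stackOK _ P.le q))
  rw [mem_inact] at hx
  have h1 := hx.1
  simp only [opCells, Finset.mem_filter, Finset.mem_range] at h1
  obtain ⟨h2, v, d, h3, h4, h5⟩ := h1
  simp only [live, Finset.mem_filter, Finset.mem_range]
  exact ⟨h2, h2, ho.2.2 _ h5, v, d, h3, h4, fun hc => h3 ▸ hx.2.1 hc⟩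

theorem recordCells_card (hK : 1 ≤ 2 * A.K) {o} (ho : Relevant X Z τ o) :
    (recordCells Z o (Z).cellCount).card ≤ (recordCells Z o (X).cellCount).card +
      recordBound n ((X).below 0).card + if (X).opCount ≤ o then 3 else 0 := by
  have h1 := P.hist.contention (o := o) P.le le_rfl
  have h2 := Finset.sum_le_sum fun q (_ : q ∈ Finset.univ) => P.pushPotential_start hK ho q
  rw [Finset.sum_const, Finset.card_univ, Fintype.card_fin, smul_eq_mul] at h2
  have h3 : recordBound n ((X).below 0).card = n * (3 * liveBound n ((X).below 0).card + 4) := rfl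
  split_ifs at h1 ⊢ <;> omega

theorem relevant : Relevant X Z τ (S t₀).opCount := by
  obtain ⟨Q, _, h⟩ := P.start
  refine ⟨?_, .inl ⟨sched t₀, by rw [h]; exact Function.update_self _ _ _⟩, fun t ht => ?_⟩
  · have := (P.hist.ext P.le le_rfl).opCount_le
    rw [P.opCount] at this
    exact this
  · simp [deadline, ht]

theorem own_record (hK : 1 ≤ 2 * A.K) :
    (recordCells Z (S t₀).opCount (Z).cellCount).card ≤ recordBound n ((X).below 0).card + 3 := by
  have h1 := P.recordCells_card hK P.relevant
  rw [if_neg (by rw [P.opCount]; omega)] at h1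
  have h2 : recordCells Z (S t₀).opCount (X).cellCount ⊆
      Finset.Ico (S t₀).cellCount ((S t₀).cellCount + 3) := by
    intro x hx
    simp only [recordCells, Finset.mem_filter, Finset.mem_range] at hx
    obtain ⟨hx, hq⟩ := hx
    rw [(P.hist.ext P.le le_rfl).own_eq x hx] at hq
    have h3 : (X).InQ x ((X).own x) := ⟨hx, rfl⟩
    obtain ⟨Q, _, h⟩ := P.start
    rw [h, announceSt_inQ, ← h] at h3
    rw [Finset.mem_Ico]
    rcases h3 with h3 | ⟨h3, -⟩ | ⟨h3, -⟩
    · have h4 := (P.hist.inv t₀ P.lt.le).queues.vq x h3.1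
      rw [h3.2] at h4
      rcases hq with hq | hq <;> rw [hq] at h4 <;> exact absurd h4 (lt_irrefl _)
    all_goals omega
  have h3 := Finset.card_le_card h2
  rw [Nat.card_Ico] at h3
  omega

theorem live_of_late {j x v} (h1 : t₀ + 1 ≤ j) (h2 : j ≤ T) (hv : v < (S j).nodeCount)
    (hx : (Z).InQ x (.node v)) (hj : (S j).cellCount ≤ x) (ht : (Z).cts x ≤ τ) : Live X Z τ x := by
  have E := P.hist.ext h2 le_rfl
  have hd := E.inQ ((P.hist.inv j h2).queues.ends (.node v) hv).1
  have hlt : (S j).hd (.node v) < x :=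
    ((P.hist.inv j h2).queues.ends (.node v) hv).1.1.trans_le hj
  rcases P.invZ.desc v x hx with ⟨-, h3⟩ | ⟨d, h3, -⟩
  · have h4 := P.invZ.sorted v _ x hd hx hlt
    have h5 := P.invZ.bornLe v _ hd
    omega
  · exact ⟨hx.1, ht, v, d, hx.2, h3, fun h =>
      absurd h (not_lt.mpr ((P.hist.ext h1 h2).cellCount_le.trans hj))⟩

/-- Of the cells existing at time `j` at most two count. The later ones are live cells with
different relevant timestamps, or belong to a record whose growth is bounded. As the count refers to
the end of the period, it covers all retries to come. -/
theorem tail_bound (hK : 1 ≤ 2 * A.K) {j q t g} (h1 : t₀ + 1 ≤ j) (h2 : j ≤ T) (hq : (S j).VQ q)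
    (hb : Bounded X Z τ t g q) :
    (queueCells Z q t g ((S j).tl q)).card ≤ tailBound n ((X).below 0).card := by
  classical
  have E := P.hist.ext h2 le_rfl
  have E' := P.hist.ext h1 h2
  have I := P.hist.inv j h2
  have hsub : queueCells Z q t g ((S j).tl q) ⊆
      {(S j).tl q, ((S j).nxt ((S j).tl q)).getD 0} ∪
        (queueCells Z q t g 0).filter ((S j).cellCount ≤ ·) := by
    intro x hx
    simp only [queueCells, Finset.mem_filter, Finset.mem_range, Finset.mem_union,
      Finset.mem_insert, Finset.mem_singleton] at hx ⊢
    rcases lt_or_ge x (S j).cellCount with h | h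
    · left
      rcases I.after_tail (E.inQ_old ⟨hx.1, hx.2.1⟩ h) hx.2.2.1 with h3 | h3
      · exact .inl h3
      · exact .inr (by rw [h3]; rfl)
    · exact .inr ⟨⟨hx.1, hx.2.1, Nat.zero_le _, hx.2.2.2⟩, h⟩
  have hrec : ∀ o, Relevant X Z τ o → q.OfOp o →
      ((queueCells Z q t g 0).filter ((S j).cellCount ≤ ·)).card ≤
        recordBound n ((X).below 0).card + if (X).opCount ≤ o then 3 else 0 := by
    intro o ho hqo
    have h3 := P.recordCells_card hK ho
    have h4 : Disjoint ((queueCells Z q t g 0).filter ((S j).cellCount ≤ ·))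
        (recordCells Z o (X).cellCount) := by
      rw [Finset.disjoint_left]
      intro x hx hx'
      simp only [recordCells, Finset.mem_filter, Finset.mem_range] at hx hx'
      exact absurd hx'.1 (not_lt.mpr (E'.cellCount_le.trans hx.2))
    have h5 : (queueCells Z q t g 0).filter ((S j).cellCount ≤ ·) ∪
        recordCells Z o (X).cellCount ⊆ recordCells Z o (Z).cellCount := by
      intro x hx
      simp only [recordCells, queueCells, Finset.mem_filter, Finset.mem_range, Finset.mem_union] at hx ⊢
      rcases hx with hx | hx
      · exact ⟨hx.1.1, hx.1.2.1 ▸ hqo⟩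
      · exact ⟨hx.1.trans_le (P.hist.ext P.le le_rfl).cellCount_le, hx.2⟩
    have h6 := Finset.card_le_card h5
    rw [Finset.card_union_of_disjoint h4] at h6
    omega
  have hcard : ((queueCells Z q t g 0).filter ((S j).cellCount ≤ ·)).card ≤
      2 * n + recordBound n ((X).below 0).card + 3 := by
    cases q with
    | node v =>
      refine le_trans ?_ (P.relTs_card.trans (by omega))
      have hlive : ∀ x ∈ (queueCells Z (.node v) t g 0).filter ((S j).cellCount ≤ ·),
          (Z).InQ x (.node v) ∧ Live X Z τ x := by
        intro x hx
        simp only [queueCells, Finset.mem_filter, Finset.mem_range] at hx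
        have h3 := hx.1.2.2.2 hb.2
        have h4 := hb.1
        exact ⟨⟨hx.1.1, hx.1.2.1⟩, P.live_of_late h1 h2 hq ⟨hx.1.1, hx.1.2.1⟩ hx.2 (by omega)⟩
      refine Finset.card_le_card_of_injOn (Z).cts (fun x hx => ?_) fun x hx y hy h => ?_
      · exact P.cts_mem_relTs (hlive x hx).2
      · exact P.invZ.cell_unique (hlive x hx).1 (hlive y hy).1 h
    | traverse o =>
      have := hrec o hb (.inl rfl)
      split_ifs at this <;> omega
    | processed o =>
      have := hrec o hb (.inr rfl)
      split_ifs at this <;> omega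
  have h3 := (Finset.card_le_card hsub).trans (Finset.card_union_le _ _)
  have h4 := Finset.card_le_two (a := (S j).tl q) (b := ((S j).nxt ((S j).tl q)).getD 0)
  unfold tailBound
  omega

end Period

end St

end WaitFreeTree

/-! The costs of the frames. -/

namespace WaitFreeTree

set_option linter.unusedSectionVars false

variable {κ σ ρ : Type*} {n : ℕ} [LinearOrder κ]

namespace St

/-! A bound for the number of steps that a process needs for the frames of its stack.  Here `Z` is the
state at the end of the period, `K` a set of cells, `D` a bound for the depth of the nodes, `W` one
for the number of steps of an insertion, and `E` one for the number of cells of the own record. -/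

section

variable (Z : St κ σ ρ n) (K : Finset ℕ) (D W E : ℕ)

/-- The work for one child: two insertions, a modification and the reading of the state. If no
rebuilding has taken place, draining and gathering a subtree are added, each bounded by `7 ^ D` and
a constant. -/
def stageCost : Bool → ℕ
  | true => 2 * W + 2
  | false => 2 * 7 ^ D + 2 * W + 7

/-- The execution of an operation in a node. -/
def execCost : ℕ := 2 * (stageCost D W false + 1) + (W + 5) + 2

/-- The traversal of a subtree. -/
def refCost : Ref κ → ℕ
  | .inner u => 7 ^ (D - Z.dep u)
  | _ => 1

/-- The number of cells in the queue from `y` on. -/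
noncomputable def restCells (q : QRef) (y : ℕ) : ℕ := (queueCells Z q 0 false y).card

open Classical in
-- Each cell from `y` on pays for a round of the loop. The three additional steps are `pushNext`,
-- `pushLink` and `pushSwing` at a cell that has no successor.
noncomputable def pushCost (S : St κ σ ρ n) (q : QRef) (t : ℕ) (g : Bool) (y : ℕ) : ℕ :=
  8 * (queueCells Z q t g y).card + if S.nxt y = none then 3 else 0

/-- For each cell of the array, one step to read it, at most four to provide a timestamp, and `W +
1` for the insertion of the descriptor. -/
def scanCost (todo saved : ℕ) : ℕ := (W + 6) * todo + (W + 1) * (saved + 1) + 2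

open Classical in
/-- The number of steps for one frame. -/
noncomputable def cost (S : St κ σ ρ n) : Frame κ σ ρ n → ℕ
  | .fetch _ => scanCost W n 0 + 6 * E + 7
  | .stamp _ _ => scanCost W n 0 + 6 * E + 6
  | .stamped _ => scanCost W n 0 + 6 * E + 5
  | .scan _ _ todo saved => scanCost W todo.length saved.length
  | .scanTs _ _ o' todo saved =>
      (if S.ots o' = none then 4 else 1) + (W + 1) + scanCost W todo.length saved.length
  | .scanFetch _ _ _ todo saved => 3 + (W + 1) + scanCost W todo.length saved.length
  | .scanStamp _ _ _ _ todo saved => 2 + (W + 1) + scanCost W todo.length saved.length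
  | .enqueue l => (W + 1) * l.length + 1
  | .push q _ t g =>
      1 + if queueCells Z q t g (S.tl q) = ∅ then 0 else pushCost Z S q t g (S.tl q)
  | .pushNext q _ t g y => pushCost Z S q t g y
  | .pushLink q _ t g y => 8 * (queueCells Z q t g y).card + 2
  | .pushSwing _ _ _ => 1
  | .pop _ _ => 3
  | .popNext _ _ _ => 2
  | .popSwing _ _ _ => 1
  -- The executions in this loop are paid for by the cells treated, not by the frame.
  | .untilTs _ _ => 2
  | .untilNext t v h => 1 + execCost D W * (Frame.untilNext t v h : Frame κ σ ρ n).reserve Z K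
  | .exec _ _ [] _ _ => W + 5
  | .exec _ _ (_ :: todo) _ r =>
      1 + stageCost D W r + (stageCost D W false + 1) * todo.length + (W + 5)
  | .execState _ _ _ _ todo _ r _ =>
      stageCost D W r + (stageCost D W false + 1) * todo.length + (W + 5)
  | .modify _ _ _ => 1
  | .replace _ _ _ _ _ => 1
  | .drain _ todo => 1 + (todo.map fun u => 7 ^ (D - Z.dep u)).sum
  | .drainLeft _ u todo =>
      3 + 2 * 7 ^ (D - (Z.dep u + 1)) + (todo.map fun u => 7 ^ (D - Z.dep u)).sum
  | .drainRight _ u _ todo =>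
      2 + 2 * 7 ^ (D - (Z.dep u + 1)) + (todo.map fun u => 7 ^ (D - Z.dep u)).sum
  | .gather _ _ _ _ todo _ => 2 + (todo.map (refCost Z D)).sum
  | .gatherLeft _ _ _ _ u todo _ =>
      4 + 2 * 7 ^ (D - (Z.dep u + 1)) + (todo.map (refCost Z D)).sum
  | .gatherRight _ _ _ _ u _ todo _ =>
      3 + 2 * 7 ^ (D - (Z.dep u + 1)) + (todo.map (refCost Z D)).sum
  -- Five steps for each cell of `Traverse`: two to find it, two for the helping loop, one for the
  -- removal. The summand `E` is for the assembly of the answer.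
  | .main o _ => 4 + E + 5 * restCells Z (.traverse o) (S.hd (.traverse o) + 1)
  | .mainNext o _ h => 3 + E + 5 * restCells Z (.traverse o) (h + 1)
  | .mainPop _ _ => 1
  | .result _ => 2 + E
  | .resultNext c _ => 1 + restCells Z (Z.own c) (c + 1)

end

/-- In the period whose operation is `o₁` a process with this frame only treats nodes, operations
and queues for which there are bounds. -/
def Fits (X Z : St κ σ ρ n) (τ o₁ : ℕ) : Frame κ σ ρ n → Prop
  | .fetch o => o = o₁
  | .stamp o _ => o = o₁
  | .stamped o => o = o₁
  | .scan _ t _ _ => t ≤ τ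
  | .scanTs _ t _ _ _ => t ≤ τ
  | .scanFetch _ t _ _ _ => t ≤ τ
  | .scanStamp _ t _ _ _ _ => t ≤ τ
  | .enqueue l => ∀ d ∈ l, d.ts ≤ τ
  | .push q _ t g => Bounded X Z τ t g q
  | .pushNext q _ t g _ => Bounded X Z τ t g q
  | .pushLink q _ t g _ => Bounded X Z τ t g q
  | .untilTs t _ => t ≤ τ
  | .untilNext t v h => t ≤ τ ∧ (v < X.nodeCount → X.hd (.node v) ≤ h)
  | .exec d v _ _ _ => (v < X.nodeCount → X.Below 0 v) ∧ d.ts ≤ τ ∧ Relevant X Z τ d.op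
  | .execState d v _ _ _ _ _ c => (v < X.nodeCount → X.Below 0 v) ∧ d.ts ≤ τ ∧
      Relevant X Z τ d.op ∧ (c < X.nodeCount → X.Below 0 c)
  | .drain t todo => t ≤ τ ∧ ∀ u ∈ todo, u < X.nodeCount → X.Below 0 u
  | .drainLeft t u todo => t ≤ τ ∧ ∀ w ∈ u :: todo, w < X.nodeCount → X.Below 0 w
  | .drainRight t u _ todo => t ≤ τ ∧ ∀ w ∈ u :: todo, w < X.nodeCount → X.Below 0 w
  | .gather t _ _ c _ _ => t ≤ τ ∧ (c < X.nodeCount → X.Below 0 c)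
  | .gatherLeft t _ _ c _ _ _ => t ≤ τ ∧ (c < X.nodeCount → X.Below 0 c)
  | .gatherRight t _ _ c _ _ _ _ => t ≤ τ ∧ (c < X.nodeCount → X.Below 0 c)
  | .main o _ => o = o₁
  | .mainNext o _ _ => o = o₁
  | .result o => o = o₁
  | .resultNext c _ => Z.own c = .processed o₁
  | _ => True

/-- The times of the period. -/
abbrev Time (t₀ T : ℕ) : Type := {j : ℕ // t₀ + 1 ≤ j ∧ j ≤ T}

variable {A : Spec κ σ ρ} {T : ℕ} {stack : ℕ → Fin n → List (Frame κ σ ρ n)} {sched : ℕ → Fin n}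
  {S : ℕ → St κ σ ρ n} {t₀ : ℕ}

def stepBound (n N : ℕ) : ℕ := 8 * tailBound n N + 4

open Classical in
/-- The cells with descriptors that may be executed in the period. -/
noncomputable def periodCells (Z : St κ σ ρ n) (τ : ℕ) : Finset ℕ :=
  (Finset.range Z.cellCount).filter fun x =>
    Z.cts x ≤ τ ∧ ∃ v d, Z.own x = .node v ∧ Z.item x = .desc d

/-- The number of steps for one frame in the period. -/
noncomputable def periodCost (S : ℕ → St κ σ ρ n) (T t₀ j : ℕ) : Frame κ σ ρ n → ℕ :=
  let N := ((S (t₀ + 1)).below 0).card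
  cost (S T) (periodCells (S T) (deadline S T t₀)) (sizeBound n N) (stepBound n N)
    (recordBound n N + 3) (S j)

/-- The frame occurs in the period at time `j`, and it needs at most `a` steps. -/
def Charge (S : ℕ → St κ σ ρ n) (T t₀ j : ℕ) (f : Frame κ σ ρ n) (a : ℕ) : Prop :=
  Fits (S (t₀ + 1)) (S T) (deadline S T t₀) (S t₀).opCount f ∧ periodCost S T t₀ j f ≤ a

/-- The process of the period needs at most `m` steps for the frames, and `Q` holds then. -/
def Charged (p : Fin n) (S : ℕ → St κ σ ρ n) (T t₀ : ℕ) (Q : St κ σ ρ n → Prop)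
    (L : List (Frame κ σ ρ n)) (j : Time t₀ T) (m : ℕ) : Prop :=
  Runs (fun i j : Time t₀ T => i ≤ j) (fun j f a => Charge S T t₀ j.1 f a)
    (fun j f => (S j.1).Post p f) (fun j => Q (S j.1)) L j m

theorem queueCells_succ {Z : St κ σ ρ n} {q t g y y'} (hy : Z.InQ y q) (hg : g = true → Z.cts y < t)
    (h : y < y') : (queueCells Z q t g y').card + 1 ≤ (queueCells Z q t g y).card := by
  refine Finset.card_lt_card ((Finset.ssubset_iff_of_subset fun x hx => ?_).mpr ⟨y, ?_, ?_⟩)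
  · simp only [queueCells, Finset.mem_filter, Finset.mem_range] at hx ⊢
    exact ⟨hx.1, hx.2.1, h.le.trans hx.2.2.1, hx.2.2.2⟩
  · simp only [queueCells, Finset.mem_filter, Finset.mem_range]
    exact ⟨hy.1, hy.2, le_rfl, hg⟩
  · simp only [queueCells, Finset.mem_filter, Finset.mem_range]
    exact fun hx => absurd hx.2.2.1 (not_le.mpr h)

theorem restCells_succ {Z : St κ σ ρ n} {q y y'} (hy : Z.InQ y' q) (h : y < y') :
    restCells Z q (y' + 1) + 1 ≤ restCells Z q (y + 1) := by
  refine (queueCells_succ (t := 0) (g := false) hy (fun h => by cases h) (Nat.lt_succ_self _)).trans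
    (Finset.card_le_card fun x hx => ?_)
  simp only [queueCells, Finset.mem_filter, Finset.mem_range] at hx ⊢
  exact ⟨hx.1, hx.2.1, (Nat.succ_le_of_lt h).trans hx.2.2.1, hx.2.2.2⟩

theorem Pushable.vq {S : St κ σ ρ n} {x t g q} (h : S.Pushable A x t g q) : S.VQ q := by
  cases q with
  | node v => obtain ⟨d, _, _, _, h⟩ := h; exact h.1
  | traverse o => obtain ⟨_, c, d, _, h⟩ := h; exact h.1
  | processed o => exact h.2

/-- The steps for an insertion do not become more. -/
theorem cost_push_le {S S' Z : St κ σ ρ n} (I : S.Inv A) (IZ : Z.Inv A) (E : Ext S S')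
    (E' : Ext S' Z) {K D W B q x t g} (hp : S.Pushable A x t g q) :
    cost Z K D W B S' (.push q x t g) ≤ cost Z K D W B S (.push q x t g) := by
  have hq := hp.vq
  have ht := (I.queues.ends q hq).2
  simp only [cost]
  by_cases h0 : queueCells Z q t g (S'.tl q) = ∅
  · rw [if_pos h0]; omega
  rw [if_neg h0]
  have hne : ¬ queueCells Z q t g (S.tl q) = ∅ := by
    intro h
    refine h0 (Finset.eq_empty_of_forall_notMem fun y hy => ?_)
    have : y ∈ queueCells Z q t g (S.tl q) := by
      simp only [queueCells, Finset.mem_filter, Finset.mem_range] at hy ⊢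
      exact ⟨hy.1, hy.2.1, (E.tl_le q hq).trans hy.2.2.1, hy.2.2.2⟩
    rw [h] at this
    simp at this
  rw [if_neg hne]
  unfold pushCost
  rcases (E.tl_le q hq).eq_or_lt with h | h
  · rw [← h]
    have : S'.nxt (S.tl q) = none → S.nxt (S.tl q) = none := by
      intro h1
      by_contra h2
      obtain ⟨y, hy⟩ := Option.ne_none_iff_exists'.mp h2
      rw [E.nxt_eq _ ht.1 y hy] at h1
      cases h1
    split_ifs <;> first | omega | exact absurd (this ‹_›) ‹_›
  · have := queueCells_succ (Z := Z) (g := g) (t := t) ((E.trans E').inQ ht) (fun hg => ?_) h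
    · split_ifs <;> omega
    · obtain ⟨y, hy⟩ := Finset.nonempty_iff_ne_empty.mpr h0
      simp only [queueCells, Finset.mem_filter, Finset.mem_range] at hy
      have h3 := hy.2.2.2 hg
      cases q with
      | node v =>
        exact (IZ.sorted v _ y ((E.trans E').inQ ht) ⟨hy.1, hy.2.1⟩ (h.trans_le hy.2.2.1)).trans h3
      | traverse o => rw [hp.1] at hg; cases hg
      | processed o => rw [hp.1] at hg; cases hg

theorem pushCost_le {S S' Z : St κ σ ρ n} (E : Ext S S') {q t g y} (hy : S.InQ y q) :
    pushCost Z S' q t g y ≤ pushCost Z S q t g y := by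
  unfold pushCost
  have : S'.nxt y = none → S.nxt y = none := by
    intro h1
    by_contra h2
    obtain ⟨z, hz⟩ := Option.ne_none_iff_exists'.mp h2
    rw [E.nxt_eq _ hy.1 z hz] at h1
    cases h1
  split_ifs <;> first | omega | exact absurd (this ‹_›) ‹_›

/-- The steps for an insertion after the cell `y` has turned out not to be the last one. -/
theorem cost_push_of_lt {S Z : St κ σ ρ n} {K D W B q x t g y} (hy : Z.InQ y q)
    (hg : g = true → Z.cts y < t) (h : y < S.tl q) :
    cost Z K D W B S (.push q x t g : Frame κ σ ρ n) + 4 ≤ 8 * (queueCells Z q t g y).card := by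
  have := queueCells_succ hy hg h
  simp only [cost, pushCost]
  split_ifs <;> omega

namespace Period

variable (P : Period A T stack sched S t₀)
include P

local notation "τ" => deadline S T t₀
local notation "X" => S (t₀ + 1)
local notation "Z" => S T
local notation "p" => sched t₀

theorem announce_eq {i j : ℕ} (hi : t₀ + 1 ≤ i) (hij : i ≤ j) (hj : j ≤ T) :
    (S j).announce p = (S i).announce p := by
  induction j, hij using Nat.le_induction with
  | base => rfl
  | succ j hij ih =>
    rw [← ih (by omega)]
    by_cases hp : sched j = p
    · rcases P.hist.turn j (by omega) with ⟨_, h, _⟩ | ⟨_, _, _, _, _, _, h, _⟩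
      · rw [hp] at h
        exact absurd h (P.busy j (by omega) (by omega))
      · rw [h]
    · exact (P.hist.other j (by omega) p (Ne.symm hp)).2.1

theorem fut {i j : ℕ} (hi : t₀ + 1 ≤ i) (hij : i ≤ j) (hj : j ≤ T) : Fut A p (S i) (S j) := by
  induction j, hij using Nat.le_induction with
  | base => exact .refl
  | succ j hij ih =>
    exact (ih (by omega)).tail
      ⟨P.hist.guar j (by omega), P.announce_eq (by omega) (Nat.le_succ j) hj⟩

end Period

end St

end WaitFreeTree

/-! The costs of insertions and of the timestamps. -/

namespace WaitFreeTree

set_option linter.unusedSectionVars false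

variable {κ σ ρ : Type*} {n : ℕ} [LinearOrder κ]

namespace St

variable {A : Spec κ σ ρ} {T : ℕ} {stack : ℕ → Fin n → List (Frame κ σ ρ n)} {sched : ℕ → Fin n}
  {S : ℕ → St κ σ ρ n} {t₀ : ℕ}

/-- The step at time `j` that replaces the frame `f` by `L` is paid for by the cost of `f`. -/
def Proceeds (p : Fin n) (S : ℕ → St κ σ ρ n) (T t₀ j : ℕ) (f : Frame κ σ ρ n)
    (L : List (Frame κ σ ρ n)) : Prop :=
  ∀ (h1 : t₀ + 1 ≤ j) (h2 : j + 1 ≤ T), ∃ m,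
    Charged p S T t₀ (fun S => S.Post p f) L ⟨j + 1, h1.trans (Nat.le_succ j), h2⟩ m ∧
      m + 1 ≤ periodCost S T t₀ j f

namespace Period

variable (P : Period A T stack sched S t₀)
include P

local notation "τ" => deadline S T t₀
local notation "X" => S (t₀ + 1)
local notation "Z" => S T
local notation "p" => sched t₀

section Logic

variable {Q : St κ σ ρ n → Prop} {g : Frame κ σ ρ n} {r : List (Frame κ σ ρ n)} {i : Time t₀ T}
  {a b m : ℕ}

/-- The two logics are joined here: what holds when a frame starts is known from `Safe`, so only the
costs remain to be bounded. -/
theorem charged_cons (hs : Safe A p (S i.1) Q (g :: r))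
    (h1 : (S i.1).Pre A p g → Charge S T t₀ i.1 g a)
    (h2 : ∀ i' : Time t₀ T, i ≤ i' → (S i'.1).Post p g → Safe A p (S i'.1) Q r →
      Charged p S T t₀ Q r i' b) (hm : a + b ≤ m) : Charged p S T t₀ Q (g :: r) i m := by
  obtain ⟨_, c, hc, h3, h4⟩ := hs
  obtain rfl : c = 0 := by omega
  exact ⟨a, b, hm, h1 h3, fun i' hi hp => h2 i' hi hp (h4 _ (P.fut i.2.1 hi i'.2.2) hp)⟩

theorem charged_one (hs : Safe A p (S i.1) Q [g])
    (h1 : (S i.1).Pre A p g → Charge S T t₀ i.1 g m) : Charged p S T t₀ Q [g] i m :=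
  P.charged_cons (b := 0) hs h1 (fun _ _ _ hs => hs) le_rfl

theorem charged_two {g'} (hs : Safe A p (S i.1) Q [g, g'])
    (h1 : (S i.1).Pre A p g → Charge S T t₀ i.1 g a)
    (h2 : ∀ i' : Time t₀ T, i ≤ i' → (S i'.1).Post p g → (S i'.1).Pre A p g' →
      Charge S T t₀ i'.1 g' b) : Charged p S T t₀ Q [g, g'] i (a + b) :=
  P.charged_cons hs h1 (fun i' hi hp hs => P.charged_one hs (h2 i' hi hp)) le_rfl

theorem charged_three {g' g'' c} (hs : Safe A p (S i.1) Q [g, g', g''])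
    (h1 : (S i.1).Pre A p g → Charge S T t₀ i.1 g a)
    (h2 : ∀ i' : Time t₀ T, i ≤ i' → (S i'.1).Pre A p g' → Charge S T t₀ i'.1 g' b)
    (h3 : ∀ i' : Time t₀ T, i ≤ i' → (S i'.1).Post p g' → (S i'.1).Pre A p g'' →
      Charge S T t₀ i'.1 g'' c) : Charged p S T t₀ Q [g, g', g''] i (a + (b + c)) :=
  P.charged_cons hs h1 (fun i' hi _ hs => P.charged_two hs (h2 i' hi)
    fun i'' hi' => h3 i'' (le_trans hi hi')) le_rfl

theorem charged_four {g' g'' g''' c d} (hs : Safe A p (S i.1) Q [g, g', g'', g'''])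
    (h1 : (S i.1).Pre A p g → Charge S T t₀ i.1 g a)
    (h2 : ∀ i' : Time t₀ T, i ≤ i' → (S i'.1).Pre A p g' → Charge S T t₀ i'.1 g' b)
    (h3 : ∀ i' : Time t₀ T, i ≤ i' → (S i'.1).Pre A p g'' → Charge S T t₀ i'.1 g'' c)
    (h4 : ∀ i' : Time t₀ T, i ≤ i' → (S i'.1).Pre A p g''' → Charge S T t₀ i'.1 g''' d) :
    Charged p S T t₀ Q [g, g', g'', g'''] i (a + (b + (c + d))) :=
  P.charged_cons hs h1 (fun i' hi _ hs => P.charged_three hs (h2 i' hi)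
    (fun i'' hi' => h3 i'' (le_trans hi hi')) fun i'' hi' _ => h4 i'' (le_trans hi hi')) le_rfl

end Logic

theorem push_charge (hK : 1 ≤ 2 * A.K) {j q x t g} (h1 : t₀ + 1 ≤ j) (h2 : j ≤ T)
    (hp : (S j).Pre A p (.push q x t g)) (hb : Bounded X Z τ t g q) :
    Charge S T t₀ j (.push q x t g) (stepBound n ((X).below 0).card) := by
  refine ⟨hb, ?_⟩
  have := P.tail_bound hK h1 h2 (Pushable.vq hp) hb
  simp only [periodCost, cost, pushCost, stepBound]
  split_ifs <;> omega

theorem rest_le (hK : 1 ≤ 2 * A.K) {q y} (hq : q.OfOp (S t₀).opCount) :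
    restCells Z q y ≤ recordBound n ((X).below 0).card + 3 := by
  refine (Finset.card_le_card fun x hx => ?_).trans (P.own_record hK)
  simp only [queueCells, recordCells, Finset.mem_filter, Finset.mem_range] at hx ⊢
  exact ⟨hx.1, hx.2.1 ▸ hq⟩

theorem child_dep {j u s c} (h2 : j ≤ T) (hu : u < (S j).nodeCount)
    (hc : (S j).child u s = .inner c) : (Z).dep c = (Z).dep u + 1 := by
  have h := (P.hist.inv j h2).child u hu s c hc
  have E := P.hist.ext h2 le_rfl
  rw [E.dep_eq c h.1, E.dep_eq u hu, h.2.2.2]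

/-- The birth of a frozen node is a timestamp in its queue, hence at most `t`, and so the node lies
in the window. -/
theorem frz_dep (hK : 1 ≤ 2 * A.K) {j t u} (h2 : j ≤ T) (ht : t ≤ τ) (hf : (S j).Frz A (t + 1) u)
    (ho : u < (X).nodeCount → (X).Below 0 u) : (Z).dep u < sizeBound n ((X).below 0).card := by
  have I := P.hist.inv j h2
  have E := P.hist.ext h2 le_rfl
  obtain ⟨h3, h4⟩ := I.frz_cells hf
  refine P.window_dep hK ?_
  rcases lt_or_ge u (X).nodeCount with h | h
  · exact .inl ⟨h, ho h⟩
  · obtain ⟨x, hx, hb⟩ := I.bornCell u h4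
    have := h3 x hx
    refine .inr ⟨h, h4.trans_le E.nodeCount_le, ?_⟩
    rw [E.born_eq u h4]
    omega

theorem below_old_of {j u c} (h1 : t₀ + 1 ≤ j) (h2 : j ≤ T) (hb : (S j).Below c u)
    (hc : c < (S j).nodeCount) (ho : c < (X).nodeCount → (X).Below 0 c) :
    u < (S j).nodeCount ∧ (u < (X).nodeCount → (X).Below 0 u) := by
  induction hb with
  | refl => exact ⟨hc, ho⟩
  | child v w s _ hw ih =>
    exact ⟨((P.hist.inv j h2).child v ih.1 s w hw).1, P.tree_child h1 h2 v ih.1 ih.2 s w hw⟩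

variable {j : ℕ} {L : List (Frame κ σ ρ n)}

theorem proceeds_one {f g : Frame κ σ ρ n} {m : ℕ}
    (hs : Safe A p (S (j + 1)) (fun S => S.Post p f) [g])
    (h : (S (j + 1)).Pre A p g → Charge S T t₀ (j + 1) g m) (hm : m + 1 ≤ periodCost S T t₀ j f) :
    Proceeds p S T t₀ j f [g] :=
  fun _ _ => ⟨m, P.charged_one hs h, hm⟩

theorem proceeds_nil {f : Frame κ σ ρ n} (hs : Safe A p (S (j + 1)) (fun S => S.Post p f) [])
    (hm : 1 ≤ periodCost S T t₀ j f) : Proceeds p S T t₀ j f [] :=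
  fun _ _ => ⟨0, hs, by omega⟩

theorem proceeds_stamped (hK : 1 ≤ 2 * A.K) (hj : j < T) {o} (hp : (S j).Pre A p (.stamped o))
    (hf : o = (S t₀).opCount) (hN : (S j).Next (.stamped o) L)
    (hs : Safe A p (S (j + 1)) (fun S => S.Post p (.stamped o)) L) :
    Proceeds p S T t₀ j (.stamped o) L := by
  rcases hN with ⟨h, -⟩ | ⟨t, h, rfl⟩
  · exact absurd h hp.2.2
  intro h1 h2
  have ht : t ≤ τ := by
    have := (P.hist.ext hj.le le_rfl).ots_eq o hp.2.1 t h
    rw [hf] at this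
    simp [deadline, this]
  refine ⟨_, P.charged_two hs (fun _ => ⟨ht, le_rfl⟩) (fun i _ _ _ =>
    ⟨hf, show _ ≤ 4 + (recordBound n ((X).below 0).card + 3) +
      5 * (recordBound n ((X).below 0).card + 3) from Nat.add_le_add_left
        (Nat.mul_le_mul_left _ (P.rest_le hK (.inl (by rw [hf])))) _⟩), ?_⟩
  simp only [periodCost, cost, List.length_finRange, List.length_nil]
  omega

theorem proceeds_scan {o t todo saved} (hp : (S j).Pre A p (.scan o t todo saved))
    (hf : t ≤ τ) (hN : (S j).Next (.scan o t todo saved) L)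
    (hs : Safe A p (S (j + 1)) (fun S => S.Post p (.scan o t todo saved)) L) :
    Proceeds p S T t₀ j (.scan o t todo saved) L := by
  cases todo with
  | nil =>
    obtain ⟨l, h1, h2, rfl⟩ := hN
    refine P.proceeds_one hs (fun _ => ⟨fun d hd => ?_, le_rfl⟩) ?_
    · rcases h2 d hd with h3 | h3
      · omega
      · have := hp.2.2.2.1 d h3
        omega
    · simp [periodCost, cost, scanCost, h1]
  | cons i todo =>
    rcases hN with rfl | ⟨o', rfl⟩
    · refine P.proceeds_one hs (fun _ => ⟨hf, le_rfl⟩) ?_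
      simp only [periodCost, cost, scanCost, List.length_cons, mul_add]
      omega
    · refine P.proceeds_one hs (fun _ => ⟨hf, le_rfl⟩) ?_
      simp only [periodCost, cost, scanCost, List.length_cons, mul_add]
      split_ifs <;> omega

theorem proceeds_scanTs {o t o' todo saved} (hf : t ≤ τ)
    (hN : (S j).Next (.scanTs o t o' todo saved) L)
    (hs : Safe A p (S (j + 1)) (fun S => S.Post p (.scanTs o t o' todo saved)) L) :
    Proceeds p S T t₀ j (.scanTs o t o' todo saved) L := by
  rcases hN with ⟨h, rfl⟩ | ⟨h, saved', rfl, h1, -⟩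
  · refine P.proceeds_one hs (fun _ => ⟨hf, le_rfl⟩) ?_
    simp only [periodCost, cost, h, if_true]
    omega
  · refine P.proceeds_one hs (fun _ => ⟨hf, le_rfl⟩) ?_
    simp only [periodCost, cost, h, if_false, scanCost]
    have := Nat.mul_le_mul_left (stepBound n ((X).below 0).card + 1) (Nat.succ_le_succ h1)
    simp only [Nat.succ_eq_add_one, mul_add, mul_one] at this ⊢
    omega

theorem proceeds_enqueue (hK : 1 ≤ 2 * A.K) (h1 : t₀ + 1 ≤ j) (h2 : j < T) {l} (hf : ∀ d ∈ l, d.ts ≤ τ)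
    (hN : (S j).Next (.enqueue l) L)
    (hs : Safe A p (S (j + 1)) (fun S => S.Post p (.enqueue l)) L) :
    Proceeds p S T t₀ j (.enqueue l) L := by
  cases l with
  | nil =>
    cases hN
    exact P.proceeds_nil hs (by simp [periodCost, cost])
  | cons d l =>
    cases hN
    refine fun _ _ => ⟨_, P.charged_two (b := (stepBound n ((X).below 0).card + 1) * l.length + 1) hs
      (fun hp => P.push_charge hK (h1.trans (Nat.le_succ j)) h2 hp ⟨hf d List.mem_cons_self, rfl⟩) (fun i _ _ _ =>
        ⟨fun d hd => hf d (List.mem_cons_of_mem _ hd), le_rfl⟩), ?_⟩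
    simp only [periodCost, cost, List.length_cons, mul_add]
    omega

theorem proceeds_push (hj : j < T) {q x t g} (hp : (S j).Pre A p (.push q x t g))
    (hf : Bounded X Z τ t g q) (hN : (S j).Next (.push q x t g) L)
    (hs : Safe A p (S (j + 1)) (fun S => S.Post p (.push q x t g)) L) :
    Proceeds p S T t₀ j (.push q x t g) L := by
  have E := (P.hist.guar j hj).ext
  have E0 := P.hist.ext hj.le le_rfl
  rcases hN with ⟨-, -, rfl⟩ | ⟨hg, rfl⟩
  · exact P.proceeds_nil hs (by simp [periodCost, cost])
  · have ht := ((P.hist.inv j hj.le).queues.ends q (Pushable.vq hp)).2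
    refine P.proceeds_one (m := pushCost Z (S j) q t g ((S j).tl q)) hs
      (fun _ => ⟨hf, pushCost_le E ht⟩) ?_
    have hne : queueCells Z q t g ((S j).tl q) ≠ ∅ := by
      refine Finset.nonempty_iff_ne_empty.mp ⟨(S j).tl q, ?_⟩
      simp only [queueCells, Finset.mem_filter, Finset.mem_range]
      exact ⟨(E0.inQ ht).1, (E0.inQ ht).2, le_rfl, fun h => by rw [E0.cts_eq _ ht.1]; exact hg h⟩
    simp only [periodCost, cost, hne, if_false]
    omega

theorem proceeds_pushNext (hj : j < T) {q x t g y} (hp : (S j).Pre A p (.pushNext q x t g y))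
    (hf : Bounded X Z τ t g q) (hN : (S j).Next (.pushNext q x t g y) L)
    (hs : Safe A p (S (j + 1)) (fun S => S.Post p (.pushNext q x t g y)) L) :
    Proceeds p S T t₀ j (.pushNext q x t g y) L := by
  have E0 := P.hist.ext hj.le le_rfl
  obtain ⟨hp1, hy, -, hg⟩ := hp
  have hg' : g = true → (Z).cts y < t := fun h => by rw [E0.cts_eq _ hy.1]; exact hg h
  rcases hN with ⟨z, hz, rfl⟩ | ⟨hn, rfl⟩
  · have hz' := (P.hist.inv j hj.le).queues.next y hy.1 z hz
    have hpos : 1 ≤ (queueCells Z q t g y).card := by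
      refine Finset.card_pos.mpr ⟨y, ?_⟩
      simp only [queueCells, Finset.mem_filter, Finset.mem_range]
      exact ⟨(E0.inQ hy).1, (E0.inQ hy).2, le_rfl, hg'⟩
    refine fun _ _ => ⟨1 + (8 * (queueCells Z q t g y).card - 4), P.charged_two hs
      (fun _ => ⟨trivial, le_rfl⟩) (fun i _ hps hpre => ⟨hf, ?_⟩), ?_⟩
    · have h1 : z ≤ (S i.1).tl q := hps
      have h2 := cost_push_of_lt (S := S i.1) (x := x) (K := periodCells Z τ)
        (D := sizeBound n ((X).below 0).card) (W := stepBound n ((X).below 0).card)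
        (B := recordBound n ((X).below 0).card + 3) (E0.inQ hy) hg' (hz'.2.1.trans_le h1)
      simp only [periodCost]
      omega
    · simp only [periodCost, cost, pushCost]
      omega
  · refine P.proceeds_one hs (fun _ => ⟨hf, le_rfl⟩) ?_
    simp only [periodCost, cost, pushCost, hn, if_true]
    omega

theorem proceeds_pushLink (hj : j < T) {q x t g y} (hp : (S j).Pre A p (.pushLink q x t g y))
    (hf : Bounded X Z τ t g q) (hN : (S j).Next (.pushLink q x t g y) L)
    (hs : Safe A p (S (j + 1)) (fun S => S.Post p (.pushLink q x t g y)) L) :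
    Proceeds p S T t₀ j (.pushLink q x t g y) L := by
  have E := (P.hist.guar j hj).ext
  have E0 := P.hist.ext hj.le le_rfl
  obtain ⟨hp1, ⟨hy, hyt, hg⟩, -⟩ := hp
  have hg' : g = true → (Z).cts y < t := fun h => by rw [E0.cts_eq _ hy.1]; exact hg h
  rcases hN with ⟨-, rfl⟩ | ⟨hn, rfl⟩
  · exact P.proceeds_one hs (fun _ => ⟨trivial, le_rfl⟩) (by simp [periodCost, cost])
  cases g with
  | true => exact P.proceeds_nil hs (by simp [periodCost, cost])
  | false =>
    refine P.proceeds_one (m := 8 * (queueCells Z q t false y).card + 1) hs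
      (fun _ => ⟨hf, ?_⟩) (by simp [periodCost, cost])
    rcases (hyt.trans (E.tl_le q hp1.vq)).eq_or_lt with h | h
    · obtain ⟨z, hz⟩ := Option.ne_none_iff_exists'.mp hn
      have h1 := E.nxt_eq y hy.1 z hz
      simp only [periodCost, cost, pushCost, ← h, h1, reduceCtorEq, if_false]
      split_ifs <;> omega
    · have h2 := cost_push_of_lt (x := x) (K := periodCells Z τ)
        (D := sizeBound n ((X).below 0).card) (W := stepBound n ((X).below 0).card)
        (B := recordBound n ((X).below 0).card + 3) (E0.inQ hy) hg' h
      simp only [periodCost]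
      omega

end Period

end St

end WaitFreeTree

/-! The costs of the execution of operations. -/

namespace WaitFreeTree

set_option linter.unusedSectionVars false

variable {κ σ ρ : Type*} {n : ℕ} [LinearOrder κ]

namespace St

variable {A : Spec κ σ ρ} {T : ℕ} {stack : ℕ → Fin n → List (Frame κ σ ρ n)} {sched : ℕ → Fin n}
  {S : ℕ → St κ σ ρ n} {t₀ : ℕ}

theorem cost_exec {S Z : St κ σ ρ n} {K D W B d v todo views} :
    cost Z K D W B S (.exec d v todo views false : Frame κ σ ρ n) =
      (stageCost D W false + 1) * todo.length + (W + 5) := by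
  cases todo with
  | nil => simp [cost]
  | cons e todo => simp only [cost, List.length_cons]; ring

theorem refCost_le {Z : St κ σ ρ n} {D k : ℕ} {r : Ref κ} (h : ∀ c, r = .inner c → Z.dep c = k) :
    refCost Z D r ≤ 7 ^ (D - k) := by
  cases r with
  | inner c => rw [← h c rfl]; exact le_rfl
  | _ => exact Nat.one_le_pow _ _ (by norm_num)

theorem nodes_sum_le {Z : St κ σ ρ n} {D k : ℕ} {r : Ref κ} (h : ∀ c, r = .inner c → Z.dep c = k) :
    (r.nodes.map fun u => 7 ^ (D - Z.dep u)).sum ≤ 7 ^ (D - k) := by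
  cases r with
  | inner c => rw [← h c rfl]; simp [Ref.nodes]
  | _ => simp [Ref.nodes]

/-- The base 7 covers two subtrees and five steps at the node itself. -/
theorem pow_depth {D k : ℕ} (h : k < D) : 5 + 2 * 7 ^ (D - (k + 1)) ≤ 7 ^ (D - k) := by
  have h1 : D - k = D - (k + 1) + 1 := by omega
  have h2 : 1 ≤ 7 ^ (D - (k + 1)) := Nat.one_le_pow _ _ (by norm_num)
  rw [h1, pow_succ]
  omega

namespace Period

variable (P : Period A T stack sched S t₀)
include P

local notation "τ" => deadline S T t₀
local notation "X" => S (t₀ + 1)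
local notation "Z" => S T
local notation "p" => sched t₀

variable {j : ℕ} {L : List (Frame κ σ ρ n)}

theorem proceeds_exec (hK : 1 ≤ 2 * A.K) (h1 : t₀ + 1 ≤ j) (h2 : j < T) {d v todo views r}
    (hp : (S j).Pre A p (.exec d v todo views r))
    (hf : Fits X Z τ (S t₀).opCount (.exec d v todo views r : Frame κ σ ρ n))
    (hN : (S j).Next (.exec d v todo views r) L)
    (hs : Safe A p (S (j + 1)) (fun S => S.Post p (.exec d v todo views r)) L) :
    Proceeds p S T t₀ j (.exec d v todo views r) L := by
  cases todo with
  | nil =>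
    obtain ⟨i, rfl⟩ := hN
    refine fun _ _ => ⟨_, P.charged_two (b := 3) hs (fun hp => P.push_charge hK
      (h1.trans (Nat.le_succ j)) h2 hp hf.2.2) fun i _ _ _ => ⟨trivial, le_rfl⟩, ?_⟩
    simp only [periodCost, cost]
    omega
  | cons e todo =>
    rcases hN with ⟨c, hc, rfl⟩ | ⟨L₀, views', rfl | ⟨old, keys, rfl⟩, rfl⟩
    · refine P.proceeds_one hs (fun _ => ⟨⟨hf.1, hf.2.1, hf.2.2, ?_⟩, le_rfl⟩) ?_
      · exact P.tree_child h1 h2.le v (hp.1.lt (P.hist.inv j h2.le)) hf.1 e.1 c hc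
      · simp only [periodCost, cost]
        omega
    · refine P.proceeds_one hs (fun _ => ⟨hf, cost_exec.le⟩) ?_
      simp only [periodCost, cost]
      omega
    · refine fun _ _ => ⟨_, P.charged_two (a := 1) hs (fun _ => ⟨trivial, le_rfl⟩)
        fun i _ _ _ => ⟨hf, cost_exec.le⟩, ?_⟩
      simp only [periodCost, cost]
      cases r <;> simp only [stageCost] <;> omega

theorem proceeds_execState (hK : 1 ≤ 2 * A.K) (h1 : t₀ + 1 ≤ j) (h2 : j < T)
    {d v s q todo views r c}
    (hf : Fits X Z τ (S t₀).opCount (.execState d v s q todo views r c : Frame κ σ ρ n))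
    (hN : (S j).Next (.execState d v s q todo views r c) L)
    (hs : Safe A p (S (j + 1)) (fun S => S.Post p (.execState d v s q todo views r c)) L) :
    Proceeds p S T t₀ j (.execState d v s q todo views r c) L := by
  obtain ⟨hv, ht, hr, hc⟩ := hf
  rcases hN with ⟨views', rfl⟩ | ⟨-, rfl, rfl⟩ | ⟨i, d', d'', st, views', rfl⟩
  · refine P.proceeds_one hs (fun _ => ⟨⟨hv, ht, hr⟩, cost_exec.le⟩) ?_
    simp only [periodCost, cost]
    cases r <;> simp only [stageCost] <;> omega
  · have h3 : 7 ^ (sizeBound n ((X).below 0).card - (Z).dep c) ≤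
        7 ^ sizeBound n ((X).below 0).card := Nat.pow_le_pow_right (by norm_num) (Nat.sub_le _ _)
    refine fun _ _ => ⟨_, P.charged_three (a := 1 + 7 ^ sizeBound n ((X).below 0).card)
      (b := 2 + 7 ^ sizeBound n ((X).below 0).card)
      (c := 1 + (2 * stepBound n ((X).below 0).card + 2) +
        (stageCost (sizeBound n ((X).below 0).card) (stepBound n ((X).below 0).card) false + 1) *
          todo.length + (stepBound n ((X).below 0).card + 5)) hs
      (fun _ => ⟨⟨by omega, by simpa using hc⟩, ?_⟩) (fun _ _ _ => ⟨⟨by omega, hc⟩, ?_⟩)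
      fun _ _ _ _ => ⟨⟨hv, ht, hr⟩, le_rfl⟩, ?_⟩
    · simpa [periodCost, cost] using h3
    · simpa [periodCost, cost, refCost] using h3
    · simp only [periodCost, cost, stageCost]
      omega
  · refine fun _ _ => ⟨_, P.charged_four (b := 1) hs (fun hp => P.push_charge hK
      (h1.trans (Nat.le_succ j)) h2 hp hr) (fun _ _ _ => ⟨trivial, le_rfl⟩)
      (fun i _ hp => P.push_charge hK i.2.1 i.2.2 hp ⟨ht, rfl⟩)
      fun _ _ _ => ⟨⟨hv, ht, hr⟩, cost_exec.le⟩, ?_⟩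
    simp only [periodCost, cost]
    cases r <;> simp only [stageCost] <;> omega

theorem proceeds_drain (hK : 1 ≤ 2 * A.K) (h2 : j < T) {t todo}
    (hp : (S j).Pre A p (.drain t todo))
    (hf : Fits X Z τ (S t₀).opCount (.drain t todo : Frame κ σ ρ n))
    (hN : (S j).Next (.drain t todo) L)
    (hs : Safe A p (S (j + 1)) (fun S => S.Post p (.drain t todo)) L) :
    Proceeds p S T t₀ j (.drain t todo) L := by
  cases todo with
  | nil =>
    cases hN
    exact P.proceeds_nil hs (by simp [periodCost, cost])
  | cons u todo =>
    cases hN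
    have h3 := pow_depth (P.frz_dep hK h2.le hf.1 (hp u List.mem_cons_self) (hf.2 u List.mem_cons_self))
    refine fun _ _ => ⟨_, P.charged_two (a := 2)
      (b := 3 + 2 * 7 ^ (sizeBound n ((X).below 0).card - ((Z).dep u + 1)) +
        (todo.map fun u => 7 ^ (sizeBound n ((X).below 0).card - (Z).dep u)).sum)
      hs (fun _ => ⟨hf.1, le_rfl⟩)
      fun _ _ _ _ => ⟨hf, le_rfl⟩, ?_⟩
    simp only [periodCost, cost, List.map_cons, List.sum_cons]
    omega

theorem proceeds_drainRight (h1 : t₀ + 1 ≤ j) (h2 : j < T) {t u l todo}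
    (hp : (S j).Pre A p (.drainRight t u l todo))
    (hf : Fits X Z τ (S t₀).opCount (.drainRight t u l todo : Frame κ σ ρ n))
    (hN : (S j).Next (.drainRight t u l todo) L)
    (hs : Safe A p (S (j + 1)) (fun S => S.Post p (.drainRight t u l todo)) L) :
    Proceeds p S T t₀ j (.drainRight t u l todo) L := by
  cases hN
  obtain ⟨hp1, rfl, hp3⟩ := hp
  have hu := ((P.hist.inv j h2.le).frz_cells hp1.1).2
  refine P.proceeds_one hs (fun _ => ⟨⟨hf.1, fun w hw => ?_⟩, le_rfl⟩) ?_
  · have h3 := P.tree_child h1 h2.le u hu (hf.2 u List.mem_cons_self)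
    rcases List.mem_append.mp hw with hw | hw
    · rcases List.mem_append.mp hw with hw | hw
      · exact h3 .left w (mem_nodes.mp hw)
      · exact h3 .right w (mem_nodes.mp hw)
    · exact hf.2 w (List.mem_cons_of_mem _ hw)
  · have h3 : ∀ s, (((S j).child u s).nodes.map fun w =>
        7 ^ (sizeBound n ((X).below 0).card - (Z).dep w)).sum ≤
        7 ^ (sizeBound n ((X).below 0).card - ((Z).dep u + 1)) :=
      fun s => nodes_sum_le fun c hc => P.child_dep h2.le hu hc
    have h4 := h3 .left
    have h5 := h3 .right
    simp only [periodCost, cost, List.map_append, List.sum_append]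
    omega

/-- The nodes to be collected are below the root of the subtree to be rebuilt. -/
theorem gather_node (hK : 1 ≤ 2 * A.K) (h1 : t₀ + 1 ≤ j) (h2 : j < T) {t v s c u todo k}
    (hp : (S j).Gather A t v s c (.inner u :: todo) k) (ht : t ≤ τ)
    (hc : c < (X).nodeCount → (X).Below 0 c) :
    u < (S j).nodeCount ∧ (Z).dep u < sizeBound n ((X).below 0).card := by
  obtain ⟨⟨d, hd, hdt⟩, h3, -, -, -, h4, -⟩ := hp
  have hF : (S j).Frz A (t + 1) c := .base c d hd hdt
  have I := P.hist.inv j h2.le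
  have hb := h4 u List.mem_cons_self
  have h5 := P.below_old_of h1 h2.le hb (I.frz_cells hF).2 hc
  exact ⟨h5.1, P.frz_dep hK h2.le ht (Inv.frz_below hF h3 hb) h5.2⟩

theorem proceeds_gather (hK : 1 ≤ 2 * A.K) (h1 : t₀ + 1 ≤ j) (h2 : j < T) {t v s c todo keys}
    (hp : (S j).Pre A p (.gather t v s c todo keys))
    (hf : Fits X Z τ (S t₀).opCount (.gather t v s c todo keys : Frame κ σ ρ n))
    (hN : (S j).Next (.gather t v s c todo keys) L)
    (hs : Safe A p (S (j + 1)) (fun S => S.Post p (.gather t v s c todo keys)) L) :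
    Proceeds p S T t₀ j (.gather t v s c todo keys) L := by
  match todo, hp, hN with
  | [], hp, hN =>
    cases hN
    exact P.proceeds_one (m := 1) hs (fun _ => ⟨trivial, le_rfl⟩) (by simp [periodCost, cost])
  | .inner u :: todo, hp, hN =>
    cases hN
    have h3 := pow_depth (P.gather_node hK h1 h2 hp hf.1 hf.2).2
    refine P.proceeds_one hs (fun _ => ⟨hf, le_rfl⟩) ?_
    simp only [periodCost, cost, List.map_cons, List.sum_cons, refCost]
    omega
  | .empty t' :: todo, hp, hN =>
    obtain ⟨keys', rfl⟩ := hN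
    refine P.proceeds_one hs (fun _ => ⟨hf, le_rfl⟩) ?_
    simp only [periodCost, cost, List.map_cons, List.sum_cons, refCost]
    omega
  | .leaf k t' :: todo, hp, hN =>
    obtain ⟨keys', rfl⟩ := hN
    refine P.proceeds_one hs (fun _ => ⟨hf, le_rfl⟩) ?_
    simp only [periodCost, cost, List.map_cons, List.sum_cons, refCost]
    omega

theorem proceeds_gatherRight (hK : 1 ≤ 2 * A.K) (h1 : t₀ + 1 ≤ j) (h2 : j < T)
    {t v s c u l todo keys}
    (hp : (S j).Pre A p (.gatherRight t v s c u l todo keys))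
    (hf : Fits X Z τ (S t₀).opCount (.gatherRight t v s c u l todo keys : Frame κ σ ρ n))
    (hN : (S j).Next (.gatherRight t v s c u l todo keys) L)
    (hs : Safe A p (S (j + 1)) (fun S => S.Post p (.gatherRight t v s c u l todo keys)) L) :
    Proceeds p S T t₀ j (.gatherRight t v s c u l todo keys) L := by
  cases hN
  obtain ⟨hp1, rfl⟩ := hp
  have hu := (P.gather_node hK h1 h2 hp1 hf.1 hf.2).1
  have h3 : ∀ s, refCost Z (sizeBound n ((X).below 0).card) ((S j).child u s) ≤
      7 ^ (sizeBound n ((X).below 0).card - ((Z).dep u + 1)) :=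
    fun s => refCost_le fun c hc => P.child_dep h2.le hu hc
  have h4 := h3 .left
  have h5 := h3 .right
  refine P.proceeds_one hs (fun _ => ⟨hf, le_rfl⟩) ?_
  simp only [periodCost, cost, List.map_cons, List.sum_cons]
  omega

theorem proceeds_mainNext (h2 : j < T) {o t h} (hp : (S j).Pre A p (.mainNext o t h))
    (hf : o = (S t₀).opCount) (hN : (S j).Next (.mainNext o t h) L)
    (hs : Safe A p (S (j + 1)) (fun S => S.Post p (.mainNext o t h)) L) :
    Proceeds p S T t₀ j (.mainNext o t h) L := by
  have E0 := P.hist.ext h2.le le_rfl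
  rcases hN with ⟨-, rfl⟩ | ⟨z, hz, hN⟩
  · refine P.proceeds_one hs (fun _ => ⟨hf, le_rfl⟩) ?_
    simp only [periodCost, cost]
    omega
  have hh := hp.2.1
  have h3 := (P.hist.inv j h2.le).queues.next h hh.1 z hz
  rw [hh.2] at h3
  have h4 := restCells_succ (E0.inQ h3.1) h3.2.1
  have ht : t ≤ τ := by
    have := E0.ots_eq o hp.1.2.1 t hp.1.2.2.1
    rw [hf] at this
    simp [deadline, this]
  have h5 : ∀ i : Time t₀ T, (S i.1).Post p (.mainPop o z : Frame κ σ ρ n) →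
      Charge S T t₀ i.1 (.main o t : Frame κ σ ρ n) (4 + (recordBound n ((X).below 0).card + 3) +
        5 * restCells Z (.traverse o) (z + 1)) := by
    intro i hi
    have hi : (S i.1).hd (.traverse o) = z := hi
    exact ⟨hf, by simp only [periodCost, cost, hi]; exact le_rfl⟩
  rcases hN with ⟨v, rfl⟩ | rfl
  · refine fun _ _ => ⟨_, P.charged_three (a := 2) (b := 1) hs (fun _ => ⟨ht, le_rfl⟩)
      (fun _ _ _ => ⟨trivial, le_rfl⟩) fun i _ hi _ => h5 i hi, ?_⟩
    simp only [periodCost, cost]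
    omega
  · refine fun _ _ => ⟨_, P.charged_two (a := 1) hs (fun _ => ⟨trivial, le_rfl⟩)
      fun i _ hi _ => h5 i hi, ?_⟩
    simp only [periodCost, cost]
    omega

theorem proceeds_result (hK : 1 ≤ 2 * A.K) (h2 : j < T) {o} (hp : (S j).Pre A p (.result o))
    (hf : o = (S t₀).opCount) (hN : (S j).Next (.result o) L)
    (hs : Safe A p (S (j + 1)) (fun S => S.Post p (.result o)) L) :
    Proceeds p S T t₀ j (.result o) L := by
  cases hN
  have h3 := ((P.hist.inv j h2.le).queues.ends (.processed o) hp.2).1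
  have h4 := (P.hist.ext h2.le le_rfl).inQ h3
  refine P.proceeds_one hs (fun _ => ⟨by rw [← hf]; exact h4.2, le_rfl⟩) ?_
  simp only [periodCost, cost, h4.2]
  have := P.rest_le hK (q := .processed o) (y := (S j).hd (.processed o) + 1)
    (.inr (by rw [hf]))
  omega

theorem proceeds_resultNext (h2 : j < T) {c parts} (hp : (S j).Pre A p (.resultNext c parts))
    (hf : Fits X Z τ (S t₀).opCount (.resultNext c parts : Frame κ σ ρ n))
    (hN : (S j).Next (.resultNext c parts) L)
    (hs : Safe A p (S (j + 1)) (fun S => S.Post p (.resultNext c parts)) L) :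
    Proceeds p S T t₀ j (.resultNext c parts) L := by
  rcases hN with ⟨-, rfl⟩ | ⟨z, parts', hz, rfl⟩
  · exact P.proceeds_nil hs (by simp [periodCost, cost])
  · have E0 := P.hist.ext h2.le le_rfl
    obtain ⟨o, ho⟩ := hp.2
    have h3 := (P.hist.inv j h2.le).queues.next c ho.1 z hz
    rw [ho.2] at h3
    have h4 := restCells_succ (E0.inQ h3.1) h3.2.1
    have h5 : (Z).own z = (Z).own c := (E0.inQ h3.1).2.trans (E0.inQ ho).2.symm
    refine P.proceeds_one hs (fun _ => ⟨h5.trans hf, le_rfl⟩) ?_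
    simp only [periodCost, cost, h5]
    rw [(E0.inQ ho).2]
    omega

end Period

end St

end WaitFreeTree

/-! The bound for the number of steps. -/

namespace WaitFreeTree

set_option linter.unusedSectionVars false

variable {κ σ ρ : Type*} {n : ℕ} [LinearOrder κ]

namespace St

variable {A : Spec κ σ ρ} {T : ℕ} {stack : ℕ → Fin n → List (Frame κ σ ρ n)} {sched : ℕ → Fin n}
  {S : ℕ → St κ σ ρ n} {t₀ : ℕ}

theorem nodeCells_periodCells {Z : St κ σ ρ n} {t : ℕ} : NodeCells Z (periodCells Z t) := by
  intro x hx
  simp only [periodCells, Finset.mem_filter, Finset.mem_range] at hx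
  obtain ⟨h1, -, v, _, h2, _⟩ := hx
  exact ⟨h1, v, h2⟩

def execBound (n N : ℕ) : ℕ := execCost (sizeBound n N) (stepBound n N)

/-- A bound for the number of steps of an operation after the first one. -/
def operationBound (n N : ℕ) : ℕ :=
  scanCost (stepBound n N) n 0 + 6 * (recordBound n N + 3) + 7 + execBound n N * liveBound n N

namespace Period

variable (P : Period A T stack sched S t₀)
include P

local notation "τ" => deadline S T t₀
local notation "X" => S (t₀ + 1)
local notation "Z" => S T
local notation "p" => sched t₀

variable {j : ℕ} {L : List (Frame κ σ ρ n)} {f : Frame κ σ ρ n}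

/-- The step at time `j` that replaces the frame `f` by `L` is paid for by the cost of `f` and by
the cells that are begun to be treated. -/
theorem charged_step (hK : 1 ≤ 2 * A.K) (h1 : t₀ + 1 ≤ j) (h2 : j + 1 ≤ T) (hp : (S j).Pre A p f)
    (hf : Fits X Z τ (S t₀).opCount f) (hN : (S j).Next f L)
    (hst : ∀ o t o' t' todo saved, f = .scanStamp o t o' t' todo saved → (S (j + 1)).ots o' ≠ none)
    (hs : Safe A p (S (j + 1)) (fun S => S.Post p f) L) :
    ∃ m, Charged p S T t₀ (fun S => S.Post p f) L ⟨j + 1, h1.trans (Nat.le_succ j), h2⟩ m ∧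
      m + 1 + execBound n ((X).below 0).card *
          (if L = [] then f.reserve Z (periodCells Z τ) else 0) ≤
        periodCost S T t₀ j f + execBound n ((X).below 0).card *
          (L.map (Frame.reserve Z (periodCells Z τ))).sum := by
  have fin : f.reserve Z (periodCells Z τ) = 0 → Proceeds p S T t₀ j f L → ∃ m,
      Charged p S T t₀ (fun S => S.Post p f) L ⟨j + 1, h1.trans (Nat.le_succ j), h2⟩ m ∧
      m + 1 + execBound n ((X).below 0).card *
          (if L = [] then f.reserve Z (periodCells Z τ) else 0) ≤
        periodCost S T t₀ j f + execBound n ((X).below 0).card *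
          (L.map (Frame.reserve Z (periodCells Z τ))).sum := by
    intro h0 h
    obtain ⟨m, h3, h4⟩ := h h1 h2
    refine ⟨m, h3, ?_⟩
    rw [h0, ite_self, mul_zero, add_zero]
    exact h4.trans (Nat.le_add_right _ _)
  cases f with
  | fetch o =>
    obtain ⟨t, rfl⟩ := hN
    exact fin rfl (P.proceeds_one hs (fun _ => ⟨hf, le_rfl⟩) (by simp [periodCost, cost]))
  | stamp o t =>
    cases hN
    exact fin rfl (P.proceeds_one hs (fun _ => ⟨hf, le_rfl⟩) (by simp [periodCost, cost]))
  | stamped o => exact fin rfl (P.proceeds_stamped hK h2 hp hf hN hs)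
  | scan => exact fin rfl (P.proceeds_scan hp hf hN hs)
  | scanTs => exact fin rfl (P.proceeds_scanTs hf hN hs)
  | scanFetch o t o' todo saved =>
    obtain ⟨t', rfl⟩ := hN
    refine fin rfl (P.proceeds_one hs (fun _ => ⟨hf, le_rfl⟩) ?_)
    simp only [periodCost, cost]
    omega
  | scanStamp o t o' t' todo saved =>
    cases hN
    refine fin rfl (P.proceeds_one hs (fun _ => ⟨hf, le_rfl⟩) ?_)
    -- After the CAS the operation has a timestamp, whoever gave it, so the second reading succeeds.
    simp only [periodCost, cost, hst o t o' t' todo saved rfl, if_false]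
    omega
  | enqueue => exact fin rfl (P.proceeds_enqueue hK h1 h2 hf hN hs)
  | push => exact fin rfl (P.proceeds_push h2 hp hf hN hs)
  | pushNext => exact fin rfl (P.proceeds_pushNext h2 hp hf hN hs)
  | pushLink => exact fin rfl (P.proceeds_pushLink h2 hp hf hN hs)
  | pushSwing => cases hN; exact fin rfl (P.proceeds_nil hs (by simp [periodCost, cost]))
  | pop =>
    cases hN
    exact fin rfl (P.proceeds_one hs (fun _ => ⟨trivial, le_rfl⟩) (by simp [periodCost, cost]))
  | popNext =>
    rcases hN with ⟨-, rfl⟩ | ⟨z, -, ⟨-, rfl⟩ | ⟨-, rfl⟩⟩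
    · exact fin rfl (P.proceeds_nil hs (by simp [periodCost, cost]))
    · exact fin rfl (P.proceeds_one hs (fun _ => ⟨trivial, le_rfl⟩) (by simp [periodCost, cost]))
    · exact fin rfl (P.proceeds_nil hs (by simp [periodCost, cost]))
  | popSwing => cases hN; exact fin rfl (P.proceeds_nil hs (by simp [periodCost, cost]))
  | untilTs t v =>
    cases hN
    have hv : v < (S j).nodeCount := hp
    refine ⟨1 + execBound n ((X).below 0).card * (Frame.untilNext t v ((S j).hd (.node v)) :
      Frame κ σ ρ n).reserve Z (periodCells Z τ), P.charged_one hs fun _ => ⟨⟨hf, fun h => ?_⟩, le_rfl⟩, ?_⟩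
    · exact (P.hist.ext h1 (by omega)).hd_le v h
    · rw [if_neg (List.cons_ne_nil _ _)]
      simp only [periodCost, cost, List.map_cons, List.map_nil, List.sum_cons, List.sum_nil, add_zero,
        mul_zero]
      omega
  | untilNext t v h =>
    rcases hN with rfl | ⟨x, d, hx, hd, hdt, rfl⟩
    · refine ⟨0, hs, ?_⟩
      simp only [periodCost, cost, execBound, List.map_nil, List.sum_nil, if_true]
      omega
    · have E0 := P.hist.ext (show j ≤ T by omega) le_rfl
      have h3 := (P.hist.inv j (by omega)).queues.next _ hp.1.1 x hx
      rw [hp.1.2] at h3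
      have h4 := ((P.hist.inv j (by omega)).desc_cell h3.1 hd).1
      have h5 : (Z).cts x = d.ts := by rw [E0.cts_eq x h3.1.1, h4]
      have h6 : (Z).item x = .desc d := by rw [E0.item_eq x h3.1.1, hd]
      have hq := E0.inQ h3.1
      have ht : d.ts ≤ τ := hdt.trans hf.1
      -- The head was read within the period, so the cell behind it had not been popped when the
      -- period began.
      have hl : Live X Z τ x := ⟨hq.1, h5 ▸ ht, v, d, hq.2, h6, fun hc =>
        (hf.2 (P.invX.node_lt ((P.hist.ext P.le le_rfl).inQ_old hq hc))).trans_lt h3.2.1⟩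
      have hw := P.window_of_live hl hq.2
      have hold : v < (X).nodeCount → (X).Below 0 v := by
        rcases hw with hw | hw
        · exact fun _ => hw.2
        · exact fun h => absurd h (not_lt.mpr hw.1)
      have hr : (Frame.untilNext t v h : Frame κ σ ρ n).reserve Z (periodCells Z τ) = 1 := by
        simp only [Frame.reserve]
        rw [if_pos]
        refine ⟨x, ?_, E0.nxt_eq h hp.1.1 x hx, by omega⟩
        simp only [periodCells, Finset.mem_filter, Finset.mem_range]
        exact ⟨hq.1, by omega, v, d, hq.2, h6⟩
      -- The reservation of the cell is worth `execBound`, which pays for the execution and for the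
      -- next round of the loop.
      refine ⟨_, P.charged_two (b := 2) hs
        (fun _ => ⟨⟨hold, ht, (P.relevant_of_live hl h6).1⟩, cost_exec.le⟩)
        fun _ _ _ _ => ⟨hf.1, le_rfl⟩, ?_⟩
      rw [if_neg (List.cons_ne_nil _ _)]
      have h7 := Nat.mul_le_mul_left (stageCost (sizeBound n ((X).below 0).card)
        (stepBound n ((X).below 0).card) false + 1) (route_length d.query ((S j).sep v))
      simp only [periodCost, cost, hr, execCost]
      omega
  | exec => exact fin rfl (P.proceeds_exec hK h1 h2 hp hf hN hs)
  | execState => exact fin rfl (P.proceeds_execState hK h1 h2 hf hN hs)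
  | modify => cases hN; exact fin rfl (P.proceeds_nil hs (by simp [periodCost, cost]))
  | replace => cases hN; exact fin rfl (P.proceeds_nil hs (by simp [periodCost, cost]))
  | drain => exact fin rfl (P.proceeds_drain hK h2 hp hf hN hs)
  | drainLeft t u todo =>
    cases hN
    refine fin rfl (P.proceeds_one hs (fun _ => ⟨hf, le_rfl⟩) ?_)
    simp only [periodCost, cost]
    omega
  | drainRight => exact fin rfl (P.proceeds_drainRight h1 h2 hp hf hN hs)
  | gather => exact fin rfl (P.proceeds_gather hK h1 h2 hp hf hN hs)
  | gatherLeft =>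
    cases hN
    refine fin rfl (P.proceeds_one hs (fun _ => ⟨hf, le_rfl⟩) ?_)
    simp only [periodCost, cost]
    omega
  | gatherRight => exact fin rfl (P.proceeds_gatherRight hK h1 h2 hp hf hN hs)
  | main o t =>
    cases hN
    refine fin rfl (P.proceeds_one hs (fun _ => ⟨hf, le_rfl⟩) ?_)
    simp only [periodCost, cost]
    omega
  | mainNext => exact fin rfl (P.proceeds_mainNext h2 hp hf hN hs)
  | mainPop => cases hN; exact fin rfl (P.proceeds_nil hs (by simp [periodCost, cost]))
  | result => exact fin rfl (P.proceeds_result hK h2 hp hf hN hs)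
  | resultNext => exact fin rfl (P.proceeds_resultNext h2 hp hf hN hs)

/-- Other processes only advance tails, add successors and give timestamps, and they leave the head
of the own `Traverse` list alone; nothing of this makes a frame more expensive. -/
theorem cost_env (h2 : j + 1 ≤ T) (hj : p ≠ sched j) (hp : (S j).Pre A p f) :
    periodCost S T t₀ (j + 1) f ≤ periodCost S T t₀ j f := by
  have E := (P.hist.guar j h2).ext
  cases f with
  | push q x t g =>
    exact cost_push_le (K := periodCells Z τ) (D := sizeBound n ((X).below 0).card)
      (W := stepBound n ((X).below 0).card) (B := recordBound n ((X).below 0).card + 3) (P.hist.inv j (by omega)) P.invZ E (P.hist.ext h2 le_rfl) hp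
  | pushNext q x t g y => exact pushCost_le E hp.2.1
  | scanTs o t o' todo saved =>
    simp only [periodCost, cost]
    have : (S j).ots o' ≠ none → (S (j + 1)).ots o' ≠ none := by
      intro h
      obtain ⟨t', ht'⟩ := Option.ne_none_iff_exists'.mp h
      rw [E.ots_eq o' (hp.2.2.2.2.2 o' rfl) t' ht']
      exact Option.some_ne_none _
    split_ifs <;> first | omega | exact absurd ‹_› (this ‹_›)
  | main o t =>
    have := (P.hist.other j h2 p hj).2.2 o hp.1
    simp only [periodCost, cost, this]
    exact le_rfl
  | exec d v todo => cases todo <;> exact le_rfl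
  | _ => exact le_rfl

/-- The potential is the charge of the stack and `execBound` for each cell whose treatment may still
begin. Own steps lower it, foreign ones do not raise it. At the beginning the stack is a single
`fetch`, and the cells in question are live. -/
theorem steps_le (hK : 1 ≤ 2 * A.K) (h1 : t₀ + 1 ≤ j) (h2 : j ≤ T) :
    ∃ m, Charged p S T t₀ (fun _ => True) (stack j p) ⟨j, h1, h2⟩ m ∧
      m + execBound n ((X).below 0).card *
          (inact Z (periodCells Z τ) (S j) (stack j p)).card +
        ((Finset.Ico (t₀ + 1) j).filter fun t => sched t = p).card ≤
        operationBound n ((X).below 0).card := by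
  induction j, h1 using Nat.le_induction with
  | base =>
    obtain ⟨Q, hst, -⟩ := P.start
    rw [hst]
    refine ⟨_, ⟨_, 0, le_rfl, ⟨rfl, le_rfl⟩, fun _ _ _ => trivial⟩, ?_⟩
    rw [Finset.Ico_self, Finset.filter_empty, Finset.card_empty, add_zero]
    refine Nat.add_le_add le_rfl (Nat.mul_le_mul_left _ ((Finset.card_le_card fun x hx => ?_).trans
      (P.live_card hK)))
    rw [mem_inact] at hx
    have h3 := hx.1
    simp only [periodCells, Finset.mem_filter, Finset.mem_range] at h3
    obtain ⟨h4, h5, v, d, h6, h7⟩ := h3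
    simp only [live, Finset.mem_filter, Finset.mem_range]
    exact ⟨h4, h4, h5, v, d, h6, h7, fun hc => h6 ▸ hx.2.1 hc⟩
  | succ j h1 ih =>
    obtain ⟨m, hm, hle⟩ := ih (by omega)
    have G := P.hist.guar j h2
    have I := P.hist.inv j (by omega)
    have E' := P.hist.ext h2 le_rfl
    cases hst : stack j p with
    | nil => exact absurd hst (P.busy j (by omega) (by omega))
    | cons f r =>
      have hpre := P.hist.pre (by omega) hst
      rw [hst] at hm hle
      obtain ⟨a, b, hab, ⟨hfit, hcost⟩, hcont⟩ := hm
      rw [← Finset.insert_Ico_right_eq_Ico_add_one h1, Finset.filter_insert]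
      by_cases hj : sched j = p
      · rw [if_pos hj, Finset.card_insert_of_notMem (by simp)]
        rcases P.hist.turn j h2 with ⟨_, h3, _⟩ | ⟨f', r', L, h3, h4, hN, -, -, hts, hsf⟩
        · rw [hj, hst] at h3
          cases h3
        rw [hj, hst] at h3
        cases h3
        rw [hj] at h4 hsf
        have hok := P.hist.stackOK j (by omega) p
        rw [hst] at hok
        have h5 := inact_run I P.invZ G.ext E' (nodeCells_periodCells (t := τ)) hpre hok hN hsf
        obtain ⟨m', h6, h7⟩ := P.charged_step hK h1 h2 hpre hfit hN hts hsf
        have h8 := Nat.mul_le_mul_left (execBound n ((X).below 0).card) h5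
        rw [mul_add, mul_add] at h8
        rw [h4]
        replace hcost : periodCost S T t₀ j f ≤ a := hcost
        refine ⟨m' + b, ?_, by omega⟩
        exact Runs.append (fun _ => le_rfl) (fun _ _ _ => le_trans) h6 fun i hi hq =>
          hcont i (le_trans (show j ≤ j + 1 by omega) hi) hq
      · rw [if_neg hj]
        have h3 := Finset.card_le_card (inact_mono (L := f :: r) I G.ext E'
          (nodeCells_periodCells (t := τ)))
        have h4 := Nat.mul_le_mul_left (execBound n ((X).below 0).card) h3
        rw [(P.hist.other j h2 p (Ne.symm hj)).1, hst]
        refine ⟨m, ⟨a, b, hab, ⟨hfit, (P.cost_env h2 (Ne.symm hj) hpre).trans hcost⟩,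
          fun i hi hq => hcont i (le_trans (show j ≤ j + 1 by omega) hi) hq⟩, by omega⟩

theorem card_le (hK : 1 ≤ 2 * A.K) :
    ((Finset.Ico t₀ T).filter fun t => sched t = p).card ≤
      operationBound n ((X).below 0).card + 1 := by
  obtain ⟨m, -, h⟩ := P.steps_le hK P.le le_rfl
  rw [← Finset.insert_Ico_add_one_left_eq_Ico P.lt, Finset.filter_insert, if_pos rfl]
  have := Finset.card_insert_le t₀ ((Finset.Ico (t₀ + 1) T).filter fun t => sched t = p)
  omega

end Period

/-- The period is counted from the state after the announcement, whereas the bound refers to the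
tree before it. -/
theorem announceSt_below {S : St κ σ ρ n} {p Q} : (S.announceSt p Q).below 0 = S.below 0 := by
  ext v
  rw [mem_below, mem_below]
  refine and_congr Iff.rfl ⟨fun h => ?_, fun h => ?_⟩
  · induction h with
    | refl => exact .refl
    | child v c s _ hc ih => exact .child v c s ih hc
  · induction h with
    | refl => exact .refl
    | child v c s _ hc ih => exact .child v c s ih hc

theorem treeSize_eq (m : Mem κ σ ρ n) (g : Ghost n) : treeSize m = ((view m g).below 0).card := by
  unfold treeSize
  congr 1
  ext v
  rw [mem_below]
  simp only [Finset.mem_filter, Finset.mem_range]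
  refine and_congr Iff.rfl ⟨fun h => ?_, fun h => ?_⟩
  · induction h with
    | root => exact .refl
    | child v c s _ hc ih => exact .child v c s ih hc
  · induction h with
    | refl => exact .root
    | child v c s _ hc ih => exact .child v c s ih hc

end St

end WaitFreeTree

theorem theorem2 {κ σ ρ : Type*} [LinearOrder κ] [DecidableEq σ] (A : Spec κ σ ρ)
    (hK : 1 ≤ 2 * A.K) :
    (∃ B : ℕ → ℕ → ℕ, ∀ (n T : ℕ) (c : ℕ → Config κ σ ρ n) (sched : ℕ → Fin n),
      IsExecution A T c sched →
      ∀ t₀ < T, (c t₀).Idle (sched t₀) →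
        B n (treeSize (c t₀).mem) ≤
          ((Finset.Ico t₀ T).filter (fun t => sched t = sched t₀)).card →
        ∃ t, t₀ < t ∧ t ≤ T ∧ (c t).Idle (sched t₀)) ∧
    (∀ (n T : ℕ) (c : ℕ → Config κ σ ρ n) (sched : ℕ → Fin n),
      IsExecution A T c sched →
      ∀ t ≤ T, ∀ v < (c t).mem.nodeCount, ∀ l : List CellId,
        Follow (c t).mem ((c t).mem.node v).queue.head l → l.length ≤ n) := by
  refine ⟨⟨fun n N => St.operationBound n N + 2, fun n T c sched h t₀ ht hidle hB => ?_⟩,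
    fun n T c sched h t ht v hv l hl => ?_⟩
  · obtain ⟨g, H⟩ := St.exists_history hK h
    -- A process that does not become idle takes at most `operationBound + 1` steps, the invocation
    -- included; the bound is one more.
    by_contra! hne
    have P : St.Period A T (fun t => (c t).stack) sched (fun t => view (c t).mem (g t)) t₀ :=
      ⟨H, ht, hidle, hne⟩
    have h1 := P.card_le hK
    obtain ⟨Q, -, h2⟩ := P.start
    rw [h2, St.announceSt_below, ← St.treeSize_eq] at h1
    have h3 : St.operationBound n (treeSize (c t₀).mem) + 2 ≤ _ := hB
    omega
  · obtain ⟨g, H⟩ := St.exists_history hK h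
    exact (H.inv t ht).queue_length hv hl.isChain
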